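/- **Model.** Fix $I\ge1$. For each scaling parameter $n\ge 1$ consider a single-server queue with $I$ customer classes on a probability space $(\Omega^n,\mathcal F^n,\mathbb P^n)$ carrying $2I$ mutually independent Poisson processes: arrivals $A^n_i$ with rate $\lambda^n_i>0$ and potential services $S^n_i$ with rate $\mu^n_i>0$. Here $\lambda^n_i=\lambda_i n+\hat\lambda_i n^{1/2}+o(n^{1/2})$ and $\mu^n_i=\mu_i n+\hat\mu_i n^{1/2}+o(n^{1/2})$ with $\lambda_i,\mu_i>0$, $\hat\lambda_i,\hat\mu_i\in\mathbb R$ and $\sum_i\lambda_i/\mu_i=1$. If the server devotes the fraction $U^n_i(t)$ of its effort to class $i$, let $T^n_i(t)=\int_0^tU^n_i(s)\,ds$, $D^n_i(t)=S^n_i(T^n_i(t))$, let $X^n_i(t)=X^n_i(0)+A^n_i(t)-D^n_i(t)\ge0$ be the queue length, $\hat X^n_i=n^{-1/2}X^n_i$, and let $\mathcal F^n_t$ be generated by $A^n_i(s),D^n_i(s)$, $s\le t$, $i\le I$. The initial states are deterministic and $\hat X^n(0)$ converges as $n\to\infty$. An admissible control $U^n$ is $\mathcal F^n_t$-adapted,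 right-continuous with left limits, satisfies $U^n_i\ge0$, $\sum_iU^n_i\le1$, and $U^n_i(t)=0$ whenever $X^n_i(t)=0$. **Costs.** There are $\bar p\ge p\ge1$ and $c_0,c_2,c_3>0$, $c_1\in\mathbb R$ such that: $C_i:\mathbb R_+\to\mathbb R_+$ is strictly increasing, strictly convex, continuously differentiable, $C_i(0)=C_i'(0)=0$, $C_i(x)\le c_0(1+x^p)$; for $j\in\{A,S\}$, $g_{j,i}:\mathbb R\to\mathbb R$ is convex, nondecreasing, $|g_{j,i}(x)|\le c_3(1+|x|^{\bar p})$ for $x\in\mathbb R$, and $g_{j,i}(x)\ge c_1+c_2x^{\bar p}$ for $x\ge0$; $\varrho:\mathbb R_+\to\mathbb R_+$ is nonincreasing with $\int_0^\infty\varrho(t)t^{\bar p}dt<\infty$. **Control.** For each $n$, $U^n$ is the generalized $c\mu$ rule, preemptive or non-preemptive. Let $\mathcal X_i$ be the set of $x\in\mathbb R_+^I\setminus\{0\}$ for which $i$ is the smallest index maximizing $\mu_jC_j'(x_j)$ over $j$. The preemptive rule is $U^n_i(t)=1_{\{\hat X^n(t)\in\mathcal X_i\}}$. The non-preemptive rule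 sets $U^n_i(\tau)=1_{\{\hat X^n(\tau)\in\mathcal X_i\}}$ at time $0$, at each departure time and at each arrival to an empty system, keeps $U^n$ unchanged until the next departure, and idles while the system is empty. **Adversary.** An admissible measure $\mathbb Q^n$ is a probability measure such that, for every $t$, the density of $\mathbb Q^n$ with respect to $\mathbb P^n$ on $\mathcal F^n_t$ is $\prod_{i}\Lambda^n_{A,i}(t)\Lambda^n_{S,i}(t)$, where $$\log\Lambda^n_{A,i}(t)=\int_0^t\log\frac{\psi^n_{A,i}(s)}{\lambda^n_i}dA^n_i(s)-\int_0^t(\psi^n_{A,i}(s)-\lambda^n_i)ds,\qquad \log\Lambda^n_{S,i}(t)=\int_0^t\log\frac{\psi^n_{S,i}(s)}{\mu^n_i}dD^n_i(s)-\int_0^t(\psi^n_{S,i}(s)-\mu^n_i)dT^n_i(s),$$ for positive $\mathcal F^n_t$-predictable processes $\psi^n_{j,i}$ with $\int_0^t\psi^n_{j,i}(s)ds<\infty$ for all $t$, $\mathbb P^n$-a.s. The payoff is $$J^n(\mathbb Q^n)=\mathbb E^{\mathbb Q^n}\Big[\int_0^\infty\varrho(t)\sum_iC_i(\hat X^n_i(t))dt\Big]-\sum_{j\in\{A,S\}}\sum_{i}\mathbb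 E^{\mathbb Q^n}\Big[\int_0^\infty\varrho(t)g_{j,i}(\log\Lambda^n_{j,i}(t))dt\Big],$$ with value $-\infty$ if the total penalty is $+\infty$. **Notation.** $\hat\psi^n_{A,i}=(\lambda_in)^{-1/2}(\psi^n_{A,i}-\lambda^n_i)$, $\hat\psi^n_{S,i}=(\mu_in)^{-1/2}(\psi^n_{S,i}-\mu^n_i)$, and, with $h(y)=(1+y)\log(1+y)-y$, $f^n_{A,i}(x)=\lambda^n_i\,h\big(\tfrac{(\lambda_in)^{1/2}}{\lambda^n_i}x\big)$, $f^n_{S,i}(x)=\mu^n_i\,h\big(\tfrac{(\mu_in)^{1/2}}{\mu^n_i}x\big)$. **Proposition 4.2.** Let $v\in\mathbb R$ and let $(\mathbb Q^n)_{n\ge1}$ be a sequence of admissible measures (with controls $\psi^n_{j,i}$) such that $J^n(\mathbb Q^n)\ge v$ for every $n\ge1$. Then there is $M>0$ such that for every $n\ge1$ and every $i$, $$\mathbb E^{\mathbb Q^n}\Big[\int_0^\infty\varrho(t)\Big\{\Big|\int_0^t\hat\psi^n_{A,i}(s)ds\Big|^{\bar p}+\Big|\int_0^t\hat\psi^n_{S,i}(s)dT^n_i(s)\Big|^{\bar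 p}\Big\}dt\Big]\le M,$$ $$\mathbb E^{\mathbb Q^n}\Big[\int_0^\infty\varrho(t)\Big\{\Big(\int_0^tf^n_{A,i}(\hat\psi^n_{A,i}(s))ds\Big)^{\bar p}+\Big(\int_0^tf^n_{S,i}(\hat\psi^n_{S,i}(s))dT^n_i(s)\Big)^{\bar p}\Big\}dt\Big]\le M,$$ $$\mathbb E^{\mathbb Q^n}\Big[\int_0^\infty\varrho(t)(\hat X^n_i(t))^{\bar p}dt\Big]\le M.$$ (In particular this applies with $v=V-1$ for the value $V$ of the limiting stochastic differential game, which is the near-optimality condition.) -/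

import Mathlib

open MeasureTheory ProbabilityTheory Filter Topology
open scoped NNReal ENNReal

noncomputable section

namespace RobustQueue

/-- The two kinds of counting streams of a class: arrivals (`A`) and service completions (`S`). -/
inductive Kind
  | A
  | S

/-! ### Primitive data of the sequence of systems -/

/-- The deterministic data of a sequence of multiclass single-server queues with `I` classes. -/
structure Data (I : ℕ) where
  /-- first-order rates: `base A i = λ_i`, `base S i = μ_i` -/
  base : Kind → Fin I → ℝ
  /-- second-order rates: `second A i = \hat λ_i`, `second S i = \hat μ_i` -/
  second : Kind → Fin I → ℝ
  /-- rates of the `n`-th system: `rate n A i = λ^n_i`, `rate n S i = μ^n_i` -/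
  rate : ℕ → Kind → Fin I → ℝ≥0
  /-- the deterministic initial number of customers `X^n_i(0)` -/
  init : ℕ → Fin I → ℕ
  /-- the holding cost `C_i` of class `i`; only its values on `[0, ∞)` matter -/
  cost : Fin I → ℝ → ℝ
  /-- the divergence functions `g_{j,i}` -/
  g : Kind → Fin I → ℝ → ℝ
  /-- the discount function `ϱ` -/
  disc : ℝ≥0 → ℝ≥0

variable {I : ℕ}

/-- Lebesgue measure on the time axis `[0, ∞)`. -/
def leb : Measure ℝ≥0 := Measure.comap ((↑) : ℝ≥0 → ℝ) volume

/-- Heavy traffic: `λ^n_i = λ_i n + \hat λ_i √n + o(√n)`, `μ^n_i = μ_i n + \hat μ_i √n + o(√n)`,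
all rates are positive, `∑ λ_i / μ_i = 1`, and the scaled initial condition converges. -/
structure Data.CriticallyLoaded (D : Data I) : Prop where
  base_pos : ∀ j i, 0 < D.base j i
  rate_pos : ∀ n, 1 ≤ n → ∀ j i, 0 < D.rate n j i
  rate_expansion : ∀ j i,
    (fun n : ℕ => (D.rate n j i : ℝ) - D.base j i * n - D.second j i * √(n : ℝ))
      =o[atTop] fun n : ℕ => √(n : ℝ)
  load : ∑ i, D.base Kind.A i / D.base Kind.S i = 1
  init_tendsto : ∃ x₀ : Fin I → ℝ,
    Tendsto (fun (n : ℕ) (i : Fin I) => (D.init n i : ℝ) / √(n : ℝ)) atTop (𝓝 x₀)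

/-- Derivative of the holding cost `C_i` on `[0, ∞)` (one-sided at `0`). -/
def Data.cost' (D : Data I) (i : Fin I) (x : ℝ) : ℝ := derivWithin (D.cost i) (Set.Ici 0) x

/-- Regularity and growth of the costs, of the divergence functions and of the discount, with
exponents `1 ≤ p ≤ pbar`. -/
structure Data.Regular (D : Data I) (p pbar : ℝ) : Prop where
  one_le_p : 1 ≤ p
  p_le_pbar : p ≤ pbar
  cost_strictMono : ∀ i, StrictMonoOn (D.cost i) (Set.Ici 0)
  cost_strictConvex : ∀ i, StrictConvexOn ℝ (Set.Ici 0) (D.cost i)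
  cost_contDiff : ∀ i, ContDiffOn ℝ 1 (D.cost i) (Set.Ici 0)
  cost_zero : ∀ i, D.cost i 0 = 0
  cost'_zero : ∀ i, D.cost' i 0 = 0
  cost_growth : ∃ c₀ : ℝ, 0 < c₀ ∧ ∀ i, ∀ x : ℝ, 0 ≤ x → D.cost i x ≤ c₀ * (1 + x ^ p)
  g_convex : ∀ j i, ConvexOn ℝ Set.univ (D.g j i)
  g_mono : ∀ j i, Monotone (D.g j i)
  g_growth : ∃ c₁ c₂ c₃ : ℝ, 0 < c₂ ∧ 0 < c₃ ∧ ∀ j i,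
    (∀ x : ℝ, |D.g j i x| ≤ c₃ * (1 + |x| ^ pbar)) ∧
    (∀ x : ℝ, 0 ≤ x → c₁ + c₂ * x ^ pbar ≤ D.g j i x)
  disc_anti : Antitone D.disc
  disc_moment : ∫⁻ t : ℝ≥0, (D.disc t : ℝ≥0∞) * (t : ℝ≥0∞) ^ pbar ∂leb < ∞

/-! ### Poisson processes and the queueing dynamics -/

variable {Ω : Type*} [MeasurableSpace Ω]

/-- `N` is a Poisson process with rate `r` under `P`: a counting process with right-continuous
nondecreasing paths started at `0`, with independent, Poisson distributed increments. -/
structure IsPoissonProcess (N : ℝ≥0 → Ω → ℕ) (r : ℝ≥0) (P : Measure Ω) : Prop where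
  measurable : ∀ t, Measurable (N t)
  zero : ∀ ω, N 0 ω = 0
  mono : ∀ ω, Monotone fun t => N t ω
  rightCont : ∀ ω t, ContinuousWithinAt (fun s => N s ω) (Set.Ici t) t
  indep : HasIndepIncrements N P
  law : ∀ s t, s ≤ t → P.map (fun ω => N t ω - N s ω) = poissonMeasure (r * (t - s))

/-- The jump at time `t` of the path of a counting process (zero at `t = 0`). -/
def jump (N : ℝ≥0 → Ω → ℕ) (t : ℝ≥0) (ω : Ω) : ℝ :=
  (N t ω : ℝ) - Function.leftLim (fun s => (N s ω : ℝ)) t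

/-- The effort process integrated: `T(t) = ∫_0^t U(s) ds`. -/
def busyTime (U : ℝ≥0 → Ω → ℝ) (t : ℝ≥0) (ω : Ω) : ℝ≥0 :=
  (∫ s in Set.Iic t, U s ω ∂leb).toNNReal

/-- The `n`-th queueing system on a probability space `(Ω, P)`: independent Poisson arrival
processes `A_i` and potential service processes `S_i`, an effort process `U`, and the queue length
`X_i = X_i(0) + A_i - S_i(T_i)` (stated without subtraction), where `T_i = ∫_0^· U_i(s) ds`. -/
structure Queue (D : Data I) (n : ℕ) (P : Measure Ω) where
  /-- arrival processes `A^n_i` -/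
  A : Fin I → ℝ≥0 → Ω → ℕ
  /-- potential service processes `S^n_i` -/
  S : Fin I → ℝ≥0 → Ω → ℕ
  /-- effort processes `U^n_i` -/
  U : Fin I → ℝ≥0 → Ω → ℝ
  /-- queue lengths `X^n_i` -/
  X : Fin I → ℝ≥0 → Ω → ℕ
  poisson_A : ∀ i, IsPoissonProcess (A i) (D.rate n Kind.A i) P
  poisson_S : ∀ i, IsPoissonProcess (S i) (D.rate n Kind.S i) P
  indep : iIndepFun (fun (k : Kind × Fin I) (ω : Ω) (t : ℝ≥0) =>
    match k.1 with
    | Kind.A => A k.2 t ω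
    | Kind.S => S k.2 t ω) P
  /-- service completions are random variables -/
  measurable_completions : ∀ i t, Measurable fun ω => S i (busyTime (U i) t ω) ω
  balance : ∀ i t ω, X i t ω + S i (busyTime (U i) t ω) ω = D.init n i + A i t ω

namespace Queue

variable {D : Data I} {n : ℕ} {P : Measure Ω} (q : Queue D n P)

/-- The observed counting processes: arrivals `A_i` and service completions `S_i(T_i(·))`. -/
def count (j : Kind) (i : Fin I) (t : ℝ≥0) (ω : Ω) : ℕ :=
  match j with
  | Kind.A => q.A i t ω
  | Kind.S => q.S i (busyTime (q.U i) t ω) ω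

lemma measurable_count (j : Kind) (i : Fin I) (t : ℝ≥0) : Measurable (q.count j i t) := by
  cases j
  · exact (q.poisson_A i).measurable t
  · exact q.measurable_completions i t

/-- The density of the clock of a stream: arrivals run on the clock `dt`, service completions of
class `i` run on the clock `dT_i(t) = U_i(t) dt`. -/
def clock (j : Kind) (i : Fin I) (t : ℝ≥0) (ω : Ω) : ℝ :=
  match j with
  | Kind.A => 1
  | Kind.S => q.U i t ω

/-- The filtration `F^n_t` generated by arrivals and service completions up to time `t`. -/
def filtration : Filtration ℝ≥0 (inferInstance : MeasurableSpace Ω) where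
  seq t := ⨆ j : Kind, ⨆ i : Fin I, ⨆ s : ℝ≥0, ⨆ _ : s ≤ t,
    MeasurableSpace.comap (q.count j i s) ⊤
  mono' _ _ hst := iSup_mono fun _ => iSup_mono fun _ => iSup_mono fun _ =>
    iSup_mono' fun h => ⟨h.trans hst, le_rfl⟩
  le' _ := iSup_le fun j => iSup_le fun i => iSup_le fun s => iSup_le fun _ =>
    (q.measurable_count j i s).comap_le

/-- The diffusion-scaled queue length `\hat X^n_i = n^{-1/2} X^n_i`. -/
def scaledX (i : Fin I) (t : ℝ≥0) (ω : Ω) : ℝ := (q.X i t ω : ℝ) / √(n : ℝ)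

/-- Admissible controls: `U` takes values in the sub-simplex, has right-continuous paths with left
limits, is adapted to the observed filtration, and devotes no effort to empty classes. -/
structure Admissible : Prop where
  nonneg : ∀ i t ω, 0 ≤ q.U i t ω
  sum_le_one : ∀ t ω, ∑ i, q.U i t ω ≤ 1
  rightCont : ∀ i ω t, ContinuousWithinAt (fun s => q.U i s ω) (Set.Ici t) t
  leftLimit : ∀ i ω t, ∃ l : ℝ, Tendsto (fun s => q.U i s ω) (𝓝[<] t) (𝓝 l)
  adapted : ∀ i, Adapted q.filtration (q.U i)
  idle_on_empty : ∀ i t ω, q.X i t ω = 0 → q.U i t ω = 0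

end Queue

/-! ### The generalized cμ rule -/

/-- The region `𝒳_i`: nonzero states for which `i` is the smallest index maximizing
`μ_j C_j'(x_j)`. -/
def Data.region (D : Data I) (i : Fin I) : Set (Fin I → ℝ) :=
  {x | (∀ j, 0 ≤ x j) ∧ x ≠ 0 ∧
    (∀ j, D.base Kind.S j * D.cost' j (x j) ≤ D.base Kind.S i * D.cost' i (x i)) ∧
    ∀ j < i, D.base Kind.S j * D.cost' j (x j) < D.base Kind.S i * D.cost' i (x i)}

namespace Queue

variable {D : Data I} {n : ℕ} {P : Measure Ω} (q : Queue D n P)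

/-- The indicator of the event that the rule selects class `i` in the state at time `t`. -/
def selected (i : Fin I) (t : ℝ≥0) (ω : Ω) : ℝ :=
  (D.region i).indicator 1 fun j => q.scaledX j t ω

/-- The preemptive generalized cμ rule. -/
def IsPreemptive : Prop := ∀ i t ω, q.U i t ω = q.selected i t ω

/-- Times at which the non-preemptive server (re)selects a class: time `0`, the departure times,
and the times just before which the system was empty (in particular each arrival to an empty
system, which is served immediately). -/
def IsDecisionTime (ω : Ω) (t : ℝ≥0) : Prop :=
  t = 0 ∨ (∃ i, jump (q.count Kind.S i) t ω ≠ 0) ∨ ∀ᶠ s in 𝓝[<] t, ∀ i, q.X i s ω = 0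

/-- The non-preemptive generalized cμ rule: at time `t` the server is devoted to the class that was
selected at the last decision time. -/
def IsNonPreemptive : Prop :=
  ∀ t ω, ∃ s ≤ t, q.IsDecisionTime ω s ∧ (∀ r, s < r → r ≤ t → ¬ q.IsDecisionTime ω r) ∧
    ∀ i, q.U i t ω = q.selected i s ω

/-! ### The adversary -/

/-- Logarithm of the density process of one stream with intensity `ψ` (per unit of its clock)
against the reference rate `r`:
`∫_0^t log(ψ(s)/r) dN(s) - ∫_0^t (ψ(s) - r) dT(s)`.
The first integral is the (finite) sum over the jump times of the counting path. -/
def logDensity (j : Kind) (i : Fin I) (ψ : ℝ≥0 → Ω → ℝ) (t : ℝ≥0) (ω : Ω) : ℝ :=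
  (∑ᶠ s ∈ Set.Iic t, Real.log (ψ s ω / D.rate n j i) * jump (q.count j i) s ω) -
    ∫ s in Set.Iic t, (ψ s ω - D.rate n j i) * q.clock j i s ω ∂leb

/-- `Q` is an admissible measure for the maximizer with controls `ψ_{j,i}`: the `ψ_{j,i}` are
positive, predictable, locally integrable in time, and on each `F^n_t` the density of `Q` with
respect to `P` is the product over all streams of the exponential density processes. -/
structure IsMaximizer (ψ : Kind → Fin I → ℝ≥0 → Ω → ℝ) (Q : Measure Ω) : Prop where
  isProbability : IsProbabilityMeasure Q
  pos : ∀ j i t ω, 0 < ψ j i t ω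
  predictable : ∀ j i, IsStronglyPredictable q.filtration (ψ j i)
  integrable : ∀ j i, ∀ᵐ ω ∂P, ∀ t : ℝ≥0, IntegrableOn (fun s => ψ j i s ω) (Set.Iic t) leb
  density : ∀ t : ℝ≥0, ∀ B : Set Ω, MeasurableSet[q.filtration t] B →
    Q B = ∫⁻ ω in B, ENNReal.ofReal
      (∏ i, (Real.exp (q.logDensity Kind.A i (ψ Kind.A i) t ω) *
        Real.exp (q.logDensity Kind.S i (ψ Kind.S i) t ω))) ∂P

/-- The divergence `𝓛_{j,i} = E^Q ∫_0^∞ ϱ(t) g_{j,i}(log (dQ_{j,i}/dP_{j,i})(t)) dt`, as the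
extended real number "integral of the positive part minus integral of the negative part". -/
def divergence (j : Kind) (i : Fin I) (ψ : ℝ≥0 → Ω → ℝ) (Q : Measure Ω) : EReal :=
  ((∫⁻ ω, ∫⁻ t,
      (D.disc t : ℝ≥0∞) * ENNReal.ofReal (D.g j i (q.logDensity j i ψ t ω)) ∂leb ∂Q : ℝ≥0∞) : EReal) -
  ((∫⁻ ω, ∫⁻ t,
      (D.disc t : ℝ≥0∞) * ENNReal.ofReal (-D.g j i (q.logDensity j i ψ t ω)) ∂leb ∂Q : ℝ≥0∞) : EReal)

/-- The expected discounted holding cost `E^Q ∫_0^∞ ϱ(t) ∑_i C_i(\hat X^n_i(t)) dt`. -/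
def holdingCost (Q : Measure Ω) : ℝ≥0∞ :=
  ∫⁻ ω, ∫⁻ t, (D.disc t : ℝ≥0∞) * ENNReal.ofReal (∑ i, D.cost i (q.scaledX i t ω)) ∂leb ∂Q

/-- The payoff `J^n`: holding cost minus the sum of the divergences. In the extended reals
`⊤ - ⊤ = ⊥`, so a control with infinite penalty has payoff `-∞` for the maximizer. -/
def payoff (ψ : Kind → Fin I → ℝ≥0 → Ω → ℝ) (Q : Measure Ω) : EReal :=
  (q.holdingCost Q : EReal) -
    (∑ i, q.divergence Kind.A i (ψ Kind.A i) Q + ∑ i, q.divergence Kind.S i (ψ Kind.S i) Q)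

end Queue

/-! ### Scaled perturbations -/

/-- The scaled rate perturbation `\hat ψ = (b n)^{-1/2} (ψ - r)`, with `b = λ_i, r = λ^n_i` for
arrivals and `b = μ_i, r = μ^n_i` for services. -/
def Data.scaledPsi (D : Data I) (n : ℕ) (j : Kind) (i : Fin I) (ψ : ℝ≥0 → Ω → ℝ)
    (t : ℝ≥0) (ω : Ω) : ℝ :=
  (ψ t ω - D.rate n j i) / √(D.base j i * n)

/-- The relative-entropy rate
`f^n(x) = r [(1 + √(b n) x / r) log (1 + √(b n) x / r) - √(b n) x / r]`. -/
def Data.entropyRate (D : Data I) (n : ℕ) (j : Kind) (i : Fin I) (x : ℝ) : ℝ :=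
  D.rate n j i *
    ((1 + √(D.base j i * n) / D.rate n j i * x) *
        Real.log (1 + √(D.base j i * n) / D.rate n j i * x) -
      √(D.base j i * n) / D.rate n j i * x)

namespace Queue

variable {D : Data I} {n : ℕ} {P : Measure Ω} (q : Queue D n P)

/-- `∫_0^t \hat ψ_{j,i}(s) dT(s)`, where `dT = ds` for arrivals and `dT = dT_i` for services. -/
def integratedPsi (j : Kind) (i : Fin I) (ψ : ℝ≥0 → Ω → ℝ) (t : ℝ≥0) (ω : Ω) : ℝ :=
  ∫ s in Set.Iic t, D.scaledPsi n j i ψ s ω * q.clock j i s ω ∂leb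

/-- `∫_0^t f^n_{j,i}(\hat ψ_{j,i}(s)) dT(s)`, an integral of a nonnegative function. -/
def integratedEntropy (j : Kind) (i : Fin I) (ψ : ℝ≥0 → Ω → ℝ) (t : ℝ≥0) (ω : Ω) : ℝ≥0∞ :=
  ∫⁻ s in Set.Iic t,
    ENNReal.ofReal (D.entropyRate n j i (D.scaledPsi n j i ψ s ω) * q.clock j i s ω) ∂leb

end Queue

end RobustQueue

end

/-!
The three families of moments are all controlled by the moments of the positive parts `X⁺` of the
logarithmic densities of the individual streams of arrivals and services, and the payoff bounds the
latter: in the payoff the holding cost enters with a small multiple of these moments, the penalty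
with a fixed one.

**Martingales.** Both versions of the rule let the counts run as independent Poisson processes on
clocks whose speeds depend on the observed past only (`ModeDriven`). The clock readings at a fixed
time form a multi-parameter stopping time (`measurableSet_clock_le`), so that optional
stopping (`setLIntegral_multiWeight_stopped`) turns the exponential martingales of the Poisson
processes into exponential martingales of the observed filtration
(`expSystem_of_modeDriven`, `Queue.IsPreemptive.expSystem`, `Queue.IsNonPreemptive.expSystem`).
Every predictable process is a limit of elementary ones, and Fatou's lemma gives the exponential
supermartingale inequality for predictable integrands (`ExpSystem.lintegral_exp_le`).

**Entropy.** Let `Q` be an admissible measure and `X` the logarithmic density of a stream. By the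
supermartingale inequality, the reciprocal of the part of the density that is collected on a
predictable set has `Q`-mean at most one (`Tilted.lintegral_exp_neg_logExp_le`); in particular the
negative part of `X` has an exponential moment. Under `Q` the compensator of `X` is the integrated
entropy `A` of the stream. Collecting `X` only while `A` exceeds a level `a` yields
`E (A_t - a)⁺ ≤ E [1_{A_t > a} (X_t⁺ + ξ)]` with an error `ξ` that has an exponential moment
(`Tilted.exists_level_error`, for a truncation of `A`), and a weighted sum over the levels yields
`E A_t ^ p ≤ C (1 + E (X_t⁺) ^ p)` with a constant that depends on `p` only
(`exists_moment_const`, `Tilted.exists_entropy_const`).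

**Queue lengths.** Apply Doob's maximal inequality under the reference measure to the exponential
martingale of a single stream with the parameter `± a / √n`, and pass to `Q` at the cost of the
logarithmic density (`Tilted.exists_sup_error`). The supremum up to time `t` of the centered and
scaled counts is then at most `(2 / a) (∑ X_t⁺ + ξ) + C_a t`, where `ξ` has an exponential moment
(`Queue.exists_centered_bound`). The rule never idles in a nonempty system, and the system is
critically loaded; hence these suprema bound the workload and the scaled queue lengths
(`Queue.Admissible.workload_le`, `Queue.Admissible.scaledX_le`). Therefore the moments of the queue
lengths are at most those of `X⁺` with a factor of order `a ^ (-pbar)`, plus a constant that depends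
on `a` (`Queue.exists_scaledX_moment_const`).

**Payoff.** The holding cost grows at most like the power `pbar` of the queue lengths. A penalty is
at least `c₂ (X⁺) ^ pbar - |c₁|` up to its negative part, whose expectation is bounded since
`exp (-X)` has mean at most one. If `a` is large, half of the penalty absorbs the holding cost, and
the lower bound on the payoff bounds the discounted moments of `X⁺` uniformly in `n`
(`Queue.exists_logMoment_bound`). The bounds on the queue lengths and on the entropies follow. The
perturbations are handled by Fenchel's inequality, which bounds `|scaledPsi|` by a multiple of the
entropy rate plus a constant (`Queue.enorm_integratedPsi_le`).
-/

open MeasureTheory ProbabilityTheory Filter Topology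
open scoped NNReal ENNReal

noncomputable section

namespace RobustQueue

/-! ### Lebesgue measure on the half-line -/

lemma measurableEmbedding_coe_nnreal : MeasurableEmbedding ((↑) : ℝ≥0 → ℝ) :=
  NNReal.isClosedEmbedding_coe.measurableEmbedding

lemma leb_apply (s : Set ℝ≥0) : leb s = volume (((↑) : ℝ≥0 → ℝ) '' s) :=
  measurableEmbedding_coe_nnreal.comap_apply _ _

lemma leb_Iic (t : ℝ≥0) : leb (Set.Iic t) = t := by
  have : ((↑) : ℝ≥0 → ℝ) '' Set.Iic t = Set.Icc 0 (t : ℝ) := by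
    ext x
    simp only [Set.mem_image, Set.mem_Iic, Set.mem_Icc]
    constructor
    · rintro ⟨y, hy, rfl⟩
      exact ⟨y.2, by exact_mod_cast hy⟩
    · rintro ⟨h0, h1⟩
      exact ⟨⟨x, h0⟩, by exact_mod_cast h1, rfl⟩
  rw [leb_apply, this, Real.volume_Icc]
  simp

instance : NullSingletonClass leb where
  measure_singleton x := by rw [leb_apply]; simp

lemma leb_Ioc (s t : ℝ≥0) : leb (Set.Ioc s t) = (t - s : ℝ≥0) := by
  have : ((↑) : ℝ≥0 → ℝ) '' Set.Ioc s t = Set.Ioc (s : ℝ) (t : ℝ) := by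
    ext x
    simp only [Set.mem_image, Set.mem_Ioc]
    constructor
    · rintro ⟨y, ⟨hy, hy'⟩, rfl⟩
      exact ⟨by exact_mod_cast hy, by exact_mod_cast hy'⟩
    · rintro ⟨h0, h1⟩
      exact ⟨⟨x, s.2.trans h0.le⟩, ⟨by exact_mod_cast h0, by exact_mod_cast h1⟩, rfl⟩
  rw [leb_apply, this, Real.volume_Ioc, ENNReal.ofReal, ← NNReal.sub_def]

instance : IsLocallyFiniteMeasure leb where
  finiteAtNhds x := ⟨Set.Iic (x + 1), Iic_mem_nhds (by simp), by simp [leb_Iic]⟩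

instance : SigmaFinite leb := inferInstance

instance (t : ℝ≥0) : IsFiniteMeasure (leb.restrict (Set.Iic t)) :=
  ⟨by simp [leb_Iic]⟩

/-! ### Jumps of counting paths -/

/-- The path of a counting process: nondecreasing, right-continuous, with values in `ℕ`. -/
structure IsCountingPath (f : ℝ≥0 → ℕ) : Prop where
  mono : Monotone f
  rightCont : ∀ t, ContinuousWithinAt f (Set.Ici t) t

/-- The jump of a counting path at time `t` (zero at `t = 0`). -/
def pathJump (f : ℝ≥0 → ℕ) (t : ℝ≥0) : ℝ :=
  (f t : ℝ) - Function.leftLim (fun s => (f s : ℝ)) t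

lemma pathJump_zero (f : ℝ≥0 → ℕ) : pathJump f 0 = 0 := by
  simp [pathJump, Function.leftLim]

lemma nhdsLT_neBot {a b : ℝ≥0} (hab : a < b) : (𝓝[<] b).NeBot :=
  nhdsWithin_Iio_neBot' ⟨a, hab⟩ le_rfl

lemma leftLim_of_const {f : ℝ≥0 → ℝ} {c : ℝ} {a b : ℝ≥0} (hab : a < b)
    (h : ∀ s, a ≤ s → s < b → f s = c) : Function.leftLim f b = c := by
  have := nhdsLT_neBot hab
  apply leftLim_eq_of_tendsto
  refine tendsto_const_nhds.congr' ?_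
  filter_upwards [Ioo_mem_nhdsLT hab] with s hs
  exact (h s hs.1.le hs.2).symm

lemma pathJump_of_const {f : ℝ≥0 → ℕ} {a b : ℝ≥0} (hab : a < b)
    (h : ∀ s, a ≤ s → s < b → f s = f a) : pathJump f b = f b - f a := by
  rw [pathJump, leftLim_of_const hab (c := (f a : ℝ)) fun s h1 h2 => by rw [h s h1 h2]]

namespace IsCountingPath

variable {f : ℝ≥0 → ℕ} (hf : IsCountingPath f)
include hf

lemma exists_const (t : ℝ≥0) : ∃ u, t < u ∧ ∀ s, t ≤ s → s < u → f s = f t := by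
  have h1 : ∀ᶠ s in 𝓝[≥] t, f s = f t :=
    (hf.rightCont t).eventually (show ∀ᶠ k in 𝓝 (f t), k = f t by simp [nhds_discrete])
  obtain ⟨u, hu, hsub⟩ := (mem_nhdsGE_iff_exists_Ico_subset' (show t < t + 1 by simp)).1 h1
  exact ⟨u, hu, fun s h1 h2 => hsub ⟨h1, h2⟩⟩

/-- After any time before which the path moves there is a well-defined first jump. -/
lemma exists_first_jump {a b : ℝ≥0} (hab : a ≤ b) (h : f a ≠ f b) :
    ∃ s, a < s ∧ s ≤ b ∧ (∀ r, a ≤ r → r < s → f r = f a) ∧ f s ≠ f a := by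
  set S := {r | a ≤ r ∧ f r ≠ f a} with hS
  have hb : b ∈ S := ⟨hab, h.symm⟩
  have hbdd : BddBelow S := OrderBot.bddBelow _
  set s := sInf S with hs
  have has : a ≤ s := le_csInf ⟨b, hb⟩ fun r hr => hr.1
  have hbefore : ∀ r, a ≤ r → r < s → f r = f a := by
    intro r h1 h2
    by_contra h3
    exact absurd (csInf_le hbdd (show r ∈ S from ⟨h1, h3⟩)) (not_le.2 h2)
  have hsne : f s ≠ f a := by
    intro heq
    obtain ⟨u, hu, hcon⟩ := hf.exists_const s
    obtain ⟨r, hr, hru⟩ := exists_lt_of_csInf_lt ⟨b, hb⟩ hu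
    exact hr.2 ((hcon r (csInf_le hbdd hr) hru).trans heq)
  refine ⟨s, lt_of_le_of_ne has ?_, csInf_le hbdd hb, hbefore, hsne⟩
  rintro heq
  exact hsne (by rw [← heq])

lemma pathJump_eq_zero {a b s : ℝ≥0} (h : f a = f b) (h1 : a < s) (h2 : s ≤ b) :
    pathJump f s = 0 := by
  have key : ∀ r, a ≤ r → r ≤ b → f r = f a := fun r h3 h4 =>
    le_antisymm ((hf.mono h4).trans h.ge) (hf.mono h3)
  rw [pathJump_of_const h1 fun r h3 h4 => key r h3 (h4.le.trans h2), key s h1.le h2, sub_self]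

/-- On a bounded interval a counting path has finitely many jumps, and they add up to its
increment. -/
lemma finite_jumps_and_sum : ∀ (n : ℕ) (a b : ℝ≥0), a ≤ b → f b - f a ≤ n →
    ({s | s ∈ Set.Ioc a b ∧ pathJump f s ≠ 0}.Finite ∧
      ∑ᶠ s ∈ Set.Ioc a b, pathJump f s = (f b : ℝ) - f a) := by
  intro n
  induction n with
  | zero =>
    intro a b hab hn
    have h : f a = f b := le_antisymm (hf.mono hab) (by omega)
    have h0 : ∀ s ∈ Set.Ioc a b, pathJump f s = 0 := fun s hs => hf.pathJump_eq_zero h hs.1 hs.2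
    constructor
    · convert Set.finite_empty
      ext s
      simp only [Set.mem_ofPred_eq, Set.mem_empty_iff_false, iff_false, not_and, not_not]
      exact h0 s
    · rw [finsum_mem_congr rfl h0, h]; simp
  | succ n ih =>
    intro a b hab hn
    by_cases h : f a = f b
    · exact (ih a b hab (by omega))
    -- split the interval at the first jump; fewer jumps remain after it
    obtain ⟨s, has, hsb, hcon, hne⟩ := hf.exists_first_jump hab h
    have hlt : f a < f s := lt_of_le_of_ne (hf.mono has.le) hne.symm
    obtain ⟨hfin, hsum⟩ := ih s b hsb (by omega)
    have hz : ∀ r, a < r → r < s → pathJump f r = 0 := fun r h1 h2 =>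
      hf.pathJump_eq_zero (hcon r h1.le h2).symm h1 le_rfl
    have hset : {r | r ∈ Set.Ioc a b ∧ pathJump f r ≠ 0} ⊆
        insert s {r | r ∈ Set.Ioc s b ∧ pathJump f r ≠ 0} := by
      rintro r ⟨⟨h1, h2⟩, h3⟩
      rcases lt_trichotomy r s with h4 | h4 | h4
      · exact absurd (hz r h1 h4) h3
      · exact Or.inl h4
      · exact Or.inr ⟨⟨h4, h2⟩, h3⟩
    have hfin' := (hfin.insert s).subset hset
    refine ⟨hfin', ?_⟩
    have h1 : ∑ᶠ r ∈ Set.Ioc a b, pathJump f r =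
        ∑ᶠ r ∈ insert s (Set.Ioc s b), pathJump f r := by
      rw [← finsum_mem_inter_support (pathJump f) (Set.Ioc a b),
        ← finsum_mem_inter_support (pathJump f) (insert s (Set.Ioc s b))]
      have : Set.Ioc a b ∩ Function.support (pathJump f) =
          insert s (Set.Ioc s b) ∩ Function.support (pathJump f) := ?_
      · rw [this]
      ext r
      simp only [Set.mem_inter_iff, Set.mem_Ioc, Function.mem_support, Set.mem_insert_iff,
        and_congr_left_iff]
      intro h3
      constructor
      · rintro ⟨h1, h2⟩
        rcases lt_trichotomy r s with h4 | h4 | h4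
        · exact absurd (hz r h1 h4) h3
        · exact Or.inl h4
        · exact Or.inr ⟨h4, h2⟩
      · rintro (rfl | ⟨h1, h2⟩)
        · exact ⟨has, hsb⟩
        · exact ⟨has.trans h1, h2⟩
    rw [h1, finsum_mem_insert' _ (by simp) (by exact hfin), hsum,
      pathJump_of_const has fun r h1 h2 => hcon r h1 h2]
    ring

lemma finite_jumps (a b : ℝ≥0) : {s | s ∈ Set.Ioc a b ∧ pathJump f s ≠ 0}.Finite := by
  rcases le_total a b with hab | hab
  · exact (hf.finite_jumps_and_sum _ a b hab le_rfl).1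
  · simp [Set.Ioc_eq_empty_of_le hab]

lemma sum_jumps {a b : ℝ≥0} (hab : a ≤ b) :
    ∑ᶠ s ∈ Set.Ioc a b, pathJump f s = (f b : ℝ) - f a :=
  (hf.finite_jumps_and_sum _ a b hab le_rfl).2

end IsCountingPath

/-- The integral `∫_(a,b] g df` of a function against a counting path. -/
def jumpSum (f : ℝ≥0 → ℕ) (g : ℝ≥0 → ℝ) (a b : ℝ≥0) : ℝ :=
  ∑ᶠ s ∈ Set.Ioc a b, g s * pathJump f s

section jumpSum
variable {f : ℝ≥0 → ℕ} (hf : IsCountingPath f)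
include hf

/-- The jump times of a counting path in `(a, b]`. -/
def jumpTimes (a b : ℝ≥0) : Finset ℝ≥0 := (hf.finite_jumps a b).toFinset

lemma jumpSum_eq_sum (g : ℝ≥0 → ℝ) (a b : ℝ≥0) :
    jumpSum f g a b = ∑ s ∈ jumpTimes hf a b, g s * pathJump f s := by
  apply finsum_mem_eq_sum_of_inter_support_eq
  ext s
  simp only [jumpTimes, Set.mem_inter_iff, Function.mem_support, Set.Finite.coe_toFinset,
    Set.mem_ofPred_eq]
  constructor
  · rintro ⟨h1, h2⟩
    exact ⟨⟨h1, right_ne_zero_of_mul h2⟩, h2⟩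
  · rintro ⟨h1, h2⟩
    exact ⟨h1.1, h2⟩

lemma mem_jumpTimes {a b s : ℝ≥0} (h : s ∈ jumpTimes hf a b) : s ∈ Set.Ioc a b :=
  ((hf.finite_jumps a b).mem_toFinset.1 h).1

omit hf in
lemma finsum_Iic_eq_jumpSum (g : ℝ≥0 → ℝ) (t : ℝ≥0) :
    ∑ᶠ s ∈ Set.Iic t, g s * pathJump f s = jumpSum f g 0 t := by
  unfold jumpSum
  rw [← finsum_mem_inter_support _ (Set.Iic t), ← finsum_mem_inter_support _ (Set.Ioc 0 t)]
  have : Set.Iic t ∩ Function.support (fun s => g s * pathJump f s) =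
      Set.Ioc 0 t ∩ Function.support (fun s => g s * pathJump f s) := ?_
  · rw [this]
  ext s
  simp only [Set.mem_inter_iff, Set.mem_Iic, Function.mem_support, Set.mem_Ioc,
    and_congr_left_iff]
  intro h
  refine ⟨fun h1 => ⟨pos_iff_ne_zero.2 ?_, h1⟩, fun h1 => h1.2⟩
  rintro rfl
  exact h (by rw [pathJump_zero, mul_zero])

lemma jumpSum_add (g h : ℝ≥0 → ℝ) (a b : ℝ≥0) :
    jumpSum f (fun s => g s + h s) a b = jumpSum f g a b + jumpSum f h a b := by
  simp only [jumpSum_eq_sum hf, add_mul, Finset.sum_add_distrib]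

lemma jumpSum_const_mul (c : ℝ) (g : ℝ≥0 → ℝ) (a b : ℝ≥0) :
    jumpSum f (fun s => c * g s) a b = c * jumpSum f g a b := by
  simp only [jumpSum_eq_sum hf, mul_assoc, Finset.mul_sum]

lemma jumpSum_neg (g : ℝ≥0 → ℝ) (a b : ℝ≥0) :
    jumpSum f (fun s => - g s) a b = - jumpSum f g a b := by
  simp only [jumpSum_eq_sum hf, neg_mul, Finset.sum_neg_distrib]

omit hf in
lemma jumpSum_congr {g h : ℝ≥0 → ℝ} {a b : ℝ≥0} (hgh : ∀ s ∈ Set.Ioc a b, g s = h s) :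
    jumpSum f g a b = jumpSum f h a b :=
  finsum_mem_congr rfl fun s hs => by rw [hgh s hs]

lemma jumpSum_of_const {c : ℝ} {g : ℝ≥0 → ℝ} {a b : ℝ≥0} (hab : a ≤ b)
    (hg : ∀ s ∈ Set.Ioc a b, g s = c) : jumpSum f g a b = c * ((f b : ℝ) - f a) := by
  rw [jumpSum_congr hg, ← hf.sum_jumps hab]
  have := jumpSum_const_mul hf c (fun _ => 1) a b
  simp only [mul_one] at this
  rw [this]
  simp [jumpSum]

lemma jumpSum_add_adjacent (g : ℝ≥0 → ℝ) {a b c : ℝ≥0} (hab : a ≤ b) (hbc : b ≤ c) :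
    jumpSum f g a c = jumpSum f g a b + jumpSum f g b c := by
  unfold jumpSum
  rw [← Set.Ioc_union_Ioc_eq_Ioc hab hbc]
  apply finsum_mem_union'
  · exact Set.disjoint_left.2 fun s h1 h2 => absurd h1.2 (not_le.2 h2.1)
  · exact (hf.finite_jumps a b).subset fun s hs => ⟨hs.1, right_ne_zero_of_mul hs.2⟩
  · exact (hf.finite_jumps b c).subset fun s hs => ⟨hs.1, right_ne_zero_of_mul hs.2⟩

lemma tendsto_jumpSum {g : ℕ → ℝ≥0 → ℝ} {g' : ℝ≥0 → ℝ} {a b : ℝ≥0}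
    (h : ∀ s ∈ Set.Ioc a b, Tendsto (fun n => g n s) atTop (𝓝 (g' s))) :
    Tendsto (fun n => jumpSum f (g n) a b) atTop (𝓝 (jumpSum f g' a b)) := by
  simp only [jumpSum_eq_sum hf]
  exact tendsto_finsetSum _ fun s hs => (h s (mem_jumpTimes hf hs)).mul_const _

end jumpSum

/-! ### Exponential martingales of independent Poisson processes -/

/-- The exponential weight `exp (c k - (e^c - 1) r v)`; along a Poisson process of rate `r`, with
`k` its value at time `v`, this is a martingale. -/
def expWeight (c : ℝ) (r v : ℝ≥0) (k : ℕ) : ℝ≥0∞ :=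
  ENNReal.ofReal (Real.exp (c * k - (Real.exp c - 1) * (r * v)))

/-- The moment generating function of the Poisson law with mean `a`, as a normalization. -/
lemma lintegral_exp_poissonMeasure (c : ℝ) (a : ℝ≥0) :
    ∫⁻ k, ENNReal.ofReal (Real.exp (c * k - (Real.exp c - 1) * a)) ∂(poissonMeasure a) = 1 := by
  rw [poissonMeasure, lintegral_sum_measure]
  simp only [lintegral_smul_measure, lintegral_dirac, smul_eq_mul]
  have h : HasSum (fun k : ℕ => Real.exp (-a) * a ^ k / (k.factorial : ℝ) *
      Real.exp (c * k - (Real.exp c - 1) * a)) 1 := by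
    have h0 := hasSum_one_poissonMeasure (a * (Real.exp c).toNNReal)
    rw [NNReal.coe_mul, Real.coe_toNNReal _ (Real.exp_pos c).le] at h0
    refine h0.congr_fun fun k => ?_
    have h1 : Real.exp (c * k - (Real.exp c - 1) * a) =
        Real.exp c ^ k * Real.exp (-(a * Real.exp c)) * Real.exp a := by
      rw [← Real.exp_nat_mul, ← Real.exp_add, ← Real.exp_add]
      congr 1; ring
    have h2 : Real.exp (-(a : ℝ)) * Real.exp a = 1 := by rw [← Real.exp_add]; simp
    rw [h1, mul_pow]
    linear_combination (Real.exp (-(a * Real.exp c)) * (a ^ k * Real.exp c ^ k) / k.factorial) * h2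
  have e : ∀ k : ℕ, ENNReal.ofReal (Real.exp (-a) * a ^ k / (k.factorial : ℝ)) *
      ENNReal.ofReal (Real.exp (c * k - (Real.exp c - 1) * a)) =
      ENNReal.ofReal (Real.exp (-a) * a ^ k / (k.factorial : ℝ) *
        Real.exp (c * k - (Real.exp c - 1) * a)) := fun k =>
    (ENNReal.ofReal_mul (by positivity)).symm
  simp_rw [e]
  rw [← ENNReal.ofReal_tsum_of_nonneg (fun k => by positivity) h.summable, h.tsum_eq]
  simp

variable {Ω : Type*} [MeasurableSpace Ω] {P : Measure Ω}

namespace IsPoissonProcess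

variable {N : ℝ≥0 → Ω → ℕ} {r : ℝ≥0}

lemma isCountingPath (h : IsPoissonProcess N r P) (ω : Ω) : IsCountingPath fun t => N t ω :=
  ⟨h.mono ω, h.rightCont ω⟩

/-- The increment of a Poisson process after time `w` is independent of its path up to `w`. -/
lemma indepFun_past (h : IsPoissonProcess N r P) [IsProbabilityMeasure P] {w K : ℝ≥0} (hw : w ≤ K) :
    IndepFun (fun ω (u : Set.Iic w) => N u ω) (fun ω => N K ω - N w ω) P := by
  apply IndepFun.process_indepFun (X := fun (u : Set.Iic w) => N (u : ℝ≥0))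
    (fun u => h.measurable (u : ℝ≥0)) ((h.measurable K).sub (h.measurable w))
  intro S
  classical
  -- the increments over the grid made of `0`, the points of `S`, `w` and `K` are independent
  set S' : Finset ℝ≥0 := S.image Subtype.val with hS'
  have hle : ∀ u ∈ S', u ≤ w := by
    intro u hu
    obtain ⟨v, -, rfl⟩ := Finset.mem_image.1 hu
    exact v.2
  set m := S'.card with hm
  let τ : ℕ → ℝ≥0 := fun j =>
    if hj : j < m + 1 then
      (if h0 : j = 0 then 0 else S'.orderEmbOfFin hm.symm ⟨j - 1, by omega⟩)
    else if j = m + 1 then w else K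
  have hτ : Monotone τ := by
    apply monotone_nat_of_le_succ
    intro j
    by_cases h1 : j + 1 < m + 1
    · by_cases h0 : j = 0
      · simp [τ, h0]
      · have h2 : j < m + 1 := by omega
        simp only [τ, h1, h2, h0, dite_true, dite_false, Nat.add_eq_zero_iff, one_ne_zero, and_false]
        apply (S'.orderEmbOfFin hm.symm).monotone
        simp
    · by_cases h2 : j < m + 1
      · have : j = m := by omega
        subst this
        have h3 : τ (m + 1) = w := by simp [τ]
        rw [h3]
        by_cases h0 : m = 0
        · simp [τ, h0]
        · simp only [τ, h2, h0, dite_true, dite_false]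
          exact hle _ (S'.orderEmbOfFin_mem _ _)
      · have h3 : τ (j + 1) = K := by
          simp only [τ, h1, dite_false]
          rw [if_neg (by omega)]
        rw [h3]
        simp only [τ, h2, dite_false]
        split_ifs
        · exact hw
        · exact le_rfl
  have hind := h.indep.nat hτ
  have hmeas : ∀ j, Measurable fun ω => N (τ (j + 1)) ω - N (τ j) ω := fun j =>
    (h.measurable _).sub (h.measurable _)
  have h2 := hind.indepFun_finset (Finset.range (m + 1)) {m + 1} (by simp) hmeas
  have hpos : ∀ j, ∀ ω, N (τ j) ω = ∑ i ∈ Finset.range j, (N (τ (i + 1)) ω - N (τ i) ω) := by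
    intro j ω
    rw [Finset.sum_range_tsub (fun a b hab => h.mono ω (hτ hab))]
    have : τ 0 = 0 := by simp [τ]
    simp only [this, h.zero, Nat.sub_zero]
  have hex : ∀ u : S, ∃ j, j ≤ m ∧ τ j = u := by
    intro u
    have hu : (u : ℝ≥0) ∈ S' := Finset.mem_image.2 ⟨u, u.2, rfl⟩
    have := Finset.range_orderEmbOfFin S' hm.symm
    have hu' : (u : ℝ≥0) ∈ Set.range (S'.orderEmbOfFin hm.symm) := by rw [this]; exact hu
    obtain ⟨i, hi⟩ := hu'
    refine ⟨i + 1, i.2, ?_⟩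
    simp [τ, hi]
  choose jj hjm hjj using hex
  let φ : ((i : Finset.range (m + 1)) → ℕ) → (S → ℕ) := fun x u =>
    ∑ i ∈ (Finset.range (m + 1)).attach, if (i : ℕ) < jj u then x i else 0
  let φ' : ((i : ({m + 1} : Finset ℕ)) → ℕ) → ℕ := fun x => x ⟨m + 1, by simp⟩
  have hφ : Measurable φ := by
    refine measurable_pi_lambda _ fun u => Finset.measurable_fun_sum _ fun i _ => ?_
    split_ifs
    · exact measurable_pi_apply i
    · exact measurable_const
  have h3 := h2.comp hφ (measurable_pi_apply _ : Measurable φ')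
  convert h3 using 1
  · ext ω u
    simp only [Function.comp, φ]
    rw [Finset.sum_attach (Finset.range (m + 1))
      (fun i => if i < jj u then N (τ (i + 1)) ω - N (τ i) ω else 0), ← Finset.sum_filter, ← hjj u,
      hpos]
    congr 1
    ext i
    have := hjm u
    simp only [Finset.mem_range, Finset.mem_filter]
    omega
  · ext ω
    simp only [Function.comp]
    have e1 : τ (m + 1) = w := by simp [τ]
    have e2 : τ (m + 1 + 1) = K := by simp [τ]
    rw [e1, e2]
    rfl

/-- The σ-algebra generated by a process up to time `w`. -/
abbrev past (N : ℝ≥0 → Ω → ℕ) (w : ℝ≥0) : MeasurableSpace Ω :=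
  ⨆ u : ℝ≥0, ⨆ _ : u ≤ w, MeasurableSpace.comap (N u) ⊤

omit [MeasurableSpace Ω] in
lemma past_eq_comap (N : ℝ≥0 → Ω → ℕ) (w : ℝ≥0) :
    past N w = MeasurableSpace.comap (fun ω (u : Set.Iic w) => N u ω) MeasurableSpace.pi := by
  rw [MeasurableSpace.pi, MeasurableSpace.comap_iSup, past, iSup_subtype]
  simp only [MeasurableSpace.comap_comp]
  rfl

lemma past_le (h : ∀ t, Measurable (N t)) (w : ℝ≥0) : past N w ≤ ‹MeasurableSpace Ω› :=
  iSup_le fun u => iSup_le fun _ => (h u).comap_le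

omit [MeasurableSpace Ω] in
lemma measurable_past {u w : ℝ≥0} (h : u ≤ w) : Measurable[past N w] (N u) :=
  (comap_measurable (N u)).mono (le_iSup₂_of_le u h le_rfl) le_rfl

lemma measurable_expWeight (c : ℝ) (r v : ℝ≥0) : Measurable (expWeight c r v) :=
  measurable_of_countable _

lemma expWeight_split (c : ℝ) (r : ℝ≥0) {w K : ℝ≥0} (hw : w ≤ K) {k l : ℕ} (hk : k ≤ l) :
    expWeight c r K l = expWeight c r w k *
      ENNReal.ofReal (Real.exp (c * (l - k : ℕ) - (Real.exp c - 1) * (r * (K - w) : ℝ≥0))) := by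
  rw [expWeight, expWeight, ← ENNReal.ofReal_mul (Real.exp_pos _).le, ← Real.exp_add]
  congr 2
  rw [Nat.cast_sub hk, NNReal.coe_mul, NNReal.coe_sub hw]
  ring

/-- The martingale property of the exponential weight of a Poisson process. -/
lemma setLIntegral_expWeight (h : IsPoissonProcess N r P) [IsProbabilityMeasure P] (c : ℝ)
    {w K : ℝ≥0} (hw : w ≤ K) {B : Set Ω} (hB : MeasurableSet[past N w] B) :
    ∫⁻ ω in B, expWeight c r K (N K ω) ∂P = ∫⁻ ω in B, expWeight c r w (N w ω) ∂P := by
  have hB' : MeasurableSet B := past_le h.measurable w _ hB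
  rw [← lintegral_indicator hB', ← lintegral_indicator hB']
  set g : ℕ → ℝ≥0∞ := fun k =>
    ENNReal.ofReal (Real.exp (c * k - (Real.exp c - 1) * (r * (K - w) : ℝ≥0))) with hg
  have e1 : ∀ ω, B.indicator (fun ω => expWeight c r K (N K ω)) ω =
      B.indicator (fun ω => expWeight c r w (N w ω)) ω * g (N K ω - N w ω) := by
    intro ω
    by_cases hω : ω ∈ B
    · simp only [Set.indicator_of_mem hω]
      exact expWeight_split c r hw (h.mono ω hw)
    · simp [Set.indicator_of_notMem hω]
  simp_rw [e1]
  have hind := h.indepFun_past hw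
  rw [IndepFun_iff_Indep, ← past_eq_comap] at hind
  have hinc : Measurable fun ω => N K ω - N w ω := (h.measurable K).sub (h.measurable w)
  rw [lintegral_mul_eq_lintegral_mul_lintegral_of_independent_measurableSpace
    (past_le h.measurable w) hinc.comap_le hind]
  · have e2 : ∫⁻ ω, g (N K ω - N w ω) ∂P = 1 := by
      rw [← lintegral_map (f := g) (measurable_of_countable _) hinc, h.law w K hw]
      exact lintegral_exp_poissonMeasure c _
    rw [e2, mul_one]
  · exact ((measurable_expWeight c r w).comp (measurable_past le_rfl)).indicator hB
  · exact (measurable_of_countable g).comp (comap_measurable _)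

end IsPoissonProcess

section Family

variable {L : Type*} [Fintype L] {Y : L → ℝ≥0 → Ω → ℕ} {r : L → ℝ≥0}

/-- A finite family of independent Poisson processes. -/
structure IsPoissonFamily (Y : L → ℝ≥0 → Ω → ℕ) (r : L → ℝ≥0) (P : Measure Ω) : Prop where
  poisson : ∀ l, IsPoissonProcess (Y l) (r l) P
  indep : iIndepFun (fun l ω t => Y l t ω) P

open IsPoissonProcess

/-- The multi-parameter past `σ(Y_l(u) : u ≤ w_l, l ∈ L)`. -/
abbrev multiPast (Y : L → ℝ≥0 → Ω → ℕ) (w : L → ℝ≥0) : MeasurableSpace Ω :=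
  ⨆ l, past (Y l) (w l)

omit [Fintype L] in
lemma multiPast_le (h : IsPoissonFamily Y r P) (w : L → ℝ≥0) :
    multiPast Y w ≤ ‹MeasurableSpace Ω› :=
  iSup_le fun l => past_le (h.poisson l).measurable _

/-- The product of the exponential weights with parameters `c_l`, at the times `v_l`. -/
def multiWeight (Y : L → ℝ≥0 → Ω → ℕ) (r : L → ℝ≥0) (c : L → ℝ) (v : L → ℝ≥0) (ω : Ω) : ℝ≥0∞ :=
  ∏ l, expWeight (c l) (r l) (v l) (Y l (v l) ω)

lemma measurable_multiWeight (h : IsPoissonFamily Y r P) (c : L → ℝ) (v : L → ℝ≥0) :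
    Measurable (multiWeight Y r c v) :=
  Finset.measurable_fun_prod _ fun l _ =>
    (measurable_expWeight _ _ _).comp ((h.poisson l).measurable _)

omit [Fintype L] in
lemma lintegral_prod_of_past [IsProbabilityMeasure P] (h : IsPoissonFamily Y r P)
    (s : Finset L) (g : L → Ω → ℝ≥0∞) (K : L → ℝ≥0)
    (hg : ∀ l, Measurable[past (Y l) (K l)] (g l)) :
    ∫⁻ ω, ∏ l ∈ s, g l ω ∂P = ∏ l ∈ s, ∫⁻ ω, g l ω ∂P := by
  apply lintegral_prod_eq_prod_lintegral_of_indepFun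
  · rw [iIndepFun_iff_iIndep]
    refine iIndep_of_iIndep_of_le h.indep.iIndep fun l => ?_
    refine (hg l).comap_le.trans ?_
    refine iSup_le fun u => iSup_le fun _ => ?_
    rw [MeasurableSpace.pi, MeasurableSpace.comap_iSup]
    refine le_iSup_of_le u ?_
    rw [MeasurableSpace.comap_comp]
    exact le_rfl
  · exact fun l => (hg l).mono (past_le (h.poisson l).measurable _) le_rfl

/-- The multi-parameter martingale property of the product of the exponential weights. -/
lemma setLIntegral_multiWeight [IsProbabilityMeasure P] (h : IsPoissonFamily Y r P) (c : L → ℝ)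
    {w K : L → ℝ≥0} (hw : w ≤ K) {B : Set Ω} (hB : MeasurableSet[multiPast Y w] B) :
    ∫⁻ ω in B, multiWeight Y r c K ω ∂P = ∫⁻ ω in B, multiWeight Y r c w ω ∂P := by
  classical
  -- on an event `⋂ l ∈ t, f l` with `f l` in the past of `Y l`, independence factorizes the
  -- integral
  have hrect : ∀ (v : L → ℝ≥0), w ≤ v → ∀ (t : Finset L) (f : L → Set Ω),
      (∀ l ∈ t, MeasurableSet[past (Y l) (w l)] (f l)) →
      ∫⁻ ω in ⋂ l ∈ t, f l, multiWeight Y r c v ω ∂P =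
        ∏ l, ∫⁻ ω in (if l ∈ t then f l else Set.univ), expWeight (c l) (r l) (v l) (Y l (v l) ω) ∂P := by
    intro v hv t f hf
    set f' : L → Set Ω := fun l => if l ∈ t then f l else Set.univ with hf'
    have hf'm : ∀ l, MeasurableSet[past (Y l) (w l)] (f' l) := by
      intro l
      by_cases hl : l ∈ t
      · simp only [hf', hl, if_true]; exact hf l hl
      · simp only [hf', hl, if_false]; exact MeasurableSet.univ
    have hpm : ∀ l, past (Y l) (w l) ≤ past (Y l) (v l) := fun l =>
      iSup_mono fun u => iSup_mono' fun hu => ⟨hu.trans (hv l), le_rfl⟩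
    have hset : (⋂ l ∈ t, f l) = ⋂ l, f' l := by
      ext ω
      simp only [Set.mem_iInter, hf']
      refine forall_congr' fun l => ?_
      by_cases hl : l ∈ t <;> simp [hl]
    have hmeas : MeasurableSet (⋂ l, f' l) :=
      MeasurableSet.iInter fun l => past_le (h.poisson l).measurable _ _ (hf'm l)
    rw [hset, ← lintegral_indicator hmeas]
    have e1 : ∀ ω, (⋂ l, f' l).indicator (multiWeight Y r c v) ω =
        ∏ l, (f' l).indicator (fun ω => expWeight (c l) (r l) (v l) (Y l (v l) ω)) ω := by
      intro ω
      by_cases hω : ω ∈ ⋂ l, f' l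
      · rw [Set.indicator_of_mem hω]
        refine Finset.prod_congr rfl fun l _ => ?_
        rw [Set.indicator_of_mem (Set.mem_iInter.1 hω l)]
      · rw [Set.indicator_of_notMem hω]
        obtain ⟨l, hl⟩ : ∃ l, ω ∉ f' l := by simpa using hω
        exact (Finset.prod_eq_zero (Finset.mem_univ l) (Set.indicator_of_notMem hl _)).symm
    simp_rw [e1]
    rw [lintegral_prod_of_past h Finset.univ _ v]
    · refine Finset.prod_congr rfl fun l _ => ?_
      rw [lintegral_indicator (past_le (h.poisson l).measurable _ _ (hf'm l))]
    · exact fun l => ((measurable_expWeight _ _ _).comp (measurable_past le_rfl)).indicator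
        (hpm l _ (hf'm l))
  have hall : ∀ (t : Finset L) (f : L → Set Ω),
      (∀ l ∈ t, MeasurableSet[past (Y l) (w l)] (f l)) →
      ∫⁻ ω in ⋂ l ∈ t, f l, multiWeight Y r c K ω ∂P =
        ∫⁻ ω in ⋂ l ∈ t, f l, multiWeight Y r c w ω ∂P := by
    intro t f hf
    rw [hrect K hw t f hf, hrect w le_rfl t f hf]
    refine Finset.prod_congr rfl fun l _ => ?_
    apply (h.poisson l).setLIntegral_expWeight _ (hw l)
    by_cases hl : l ∈ t
    · simp only [hl, if_true]; exact hf l hl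
    · simp only [hl, if_false]; exact MeasurableSet.univ
  have hle := multiPast_le h w
  have huniv : ∫⁻ ω, multiWeight Y r c w ω ∂P = 1 := by
    have := lintegral_prod_of_past h Finset.univ
      (fun l ω => expWeight (c l) (r l) (w l) (Y l (w l) ω)) w
      (fun l => (measurable_expWeight _ _ _).comp (measurable_past le_rfl))
    unfold multiWeight
    rw [this]
    refine Finset.prod_eq_one fun l _ => ?_
    have h0 := (h.poisson l).setLIntegral_expWeight (c l) (w := 0) (K := w l) zero_le
      (B := Set.univ) MeasurableSet.univ
    simp only [Measure.restrict_univ] at h0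
    rw [h0]
    simp [expWeight, (h.poisson l).zero]
  -- both sides are measures on the past of `w`, and these events form a π-system generating it
  set μ₁ := (P.withDensity (multiWeight Y r c K)).trim hle with hμ₁
  set μ₂ := (P.withDensity (multiWeight Y r c w)).trim hle with hμ₂
  have hval₁ : ∀ s, MeasurableSet[multiPast Y w] s →
      μ₁ s = ∫⁻ ω in s, multiWeight Y r c K ω ∂P := fun s hs => by
    rw [hμ₁, trim_measurableSet_eq hle hs, withDensity_apply _ (hle _ hs)]
  have hval₂ : ∀ s, MeasurableSet[multiPast Y w] s →
      μ₂ s = ∫⁻ ω in s, multiWeight Y r c w ω ∂P := fun s hs => by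
    rw [hμ₂, trim_measurableSet_eq hle hs, withDensity_apply _ (hle _ hs)]
  have hu := hall ∅ (fun _ => Set.univ) (by simp)
  simp only [Finset.notMem_empty, Set.iInter_of_empty, Set.iInter_univ] at hu
  have huniv₁ : μ₁ Set.univ = 1 := by
    rw [hval₁ _ MeasurableSet.univ, hu, Measure.restrict_univ, huniv]
  have huniv₂ : μ₂ Set.univ = 1 := by
    rw [hval₂ _ MeasurableSet.univ, Measure.restrict_univ, huniv]
  have hfin : IsFiniteMeasure μ₁ := ⟨by rw [huniv₁]; exact ENNReal.one_lt_top⟩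
  have key : μ₁ = μ₂ := by
    refine ext_of_generate_finite
      (piiUnionInter (fun l => {s | MeasurableSet[past (Y l) (w l)] s}) Set.univ)
      ?_ ?_ ?_ (by rw [huniv₁, huniv₂])
    · have := generateFrom_piiUnionInter_measurableSet (fun l => past (Y l) (w l)) Set.univ
      simp only [Set.mem_univ, iSup_pos] at this
      exact this.symm
    · exact isPiSystem_piiUnionInter _ (fun l => @MeasurableSpace.isPiSystem_measurableSet _ (_)) _
    · rintro s ⟨t, -, f, hf, rfl⟩
      have hm : MeasurableSet[multiPast Y w] (⋂ l ∈ t, f l) :=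
        Finset.measurableSet_biInter _ fun l hl => le_iSup (fun l => past (Y l) (w l)) l _ (hf l hl)
      rw [hval₁ _ hm, hval₂ _ hm]
      exact hall t f hf
  rw [← hval₁ B hB, ← hval₂ B hB, key]

end Family

/-! ### Optional stopping for multi-parameter exponential martingales -/

section OptionalStopping

variable {Ω : Type*} [MeasurableSpace Ω] {P : Measure Ω}
variable {L : Type*} [Fintype L] {Y : L → ℝ≥0 → Ω → ℕ} {r : L → ℝ≥0}

omit [Fintype L] [MeasurableSpace Ω] in
lemma multiPast_mono (Y : L → ℝ≥0 → Ω → ℕ) {v w : L → ℝ≥0} (h : v ≤ w) :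
    multiPast Y v ≤ multiPast Y w :=
  iSup_mono fun l => iSup_mono fun _ => iSup_mono' fun hu => ⟨hu.trans (h l), le_rfl⟩

/-- The vector of the grid points `k_l / (m + 1)`. -/
def gridVec (m : ℕ) (k : L → ℕ) : L → ℝ≥0 := fun l => (k l : ℝ≥0) / (m + 1)

omit [Fintype L] in
lemma ceil_le_iff_le_gridVec {m : ℕ} {x : ℝ≥0} {k : ℕ} :
    ⌈((m : ℝ≥0) + 1) * x⌉₊ ≤ k ↔ x ≤ (k : ℝ≥0) / (m + 1) := by
  rw [Nat.ceil_le, le_div_iff₀ (by positivity), mul_comm]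

omit [MeasurableSpace Ω] in
/-- Discretizing a multi-parameter stopping time upwards to a grid gives a stopping time: the event
that the discretization takes the value `w` is determined by the past of `w`. -/
lemma measurableSet_ceil_eq {V : L → Ω → ℝ≥0} {B : Set Ω}
    (hB : ∀ w, MeasurableSet[multiPast Y w] (B ∩ {ω | ∀ l, V l ω ≤ w l})) (m : ℕ) (k : L → ℕ) :
    MeasurableSet[multiPast Y (gridVec m k)]
      (B ∩ {ω | ∀ l, ⌈((m : ℝ≥0) + 1) * V l ω⌉₊ = k l}) := by
  classical
  -- the rounded vector equals `k` if `V` is below the grid point of `k`, but not below a grid point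
  -- in which one coordinate of `k` is lowered by one
  have hset : B ∩ {ω | ∀ l, ⌈((m : ℝ≥0) + 1) * V l ω⌉₊ = k l} =
      (B ∩ {ω | ∀ l, V l ω ≤ gridVec m k l}) \
        ⋃ l : L, ⋃ _ : k l ≠ 0,
          (B ∩ {ω | ∀ l', V l' ω ≤ gridVec m (Function.update k l (k l - 1)) l'}) := by
    ext ω
    simp only [gridVec, ← ceil_le_iff_le_gridVec, Set.mem_inter_iff, Set.mem_ofPred_eq,
      Set.mem_sdiff, Set.mem_iUnion, not_exists, not_and]
    constructor
    · rintro ⟨h1, h2⟩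
      refine ⟨⟨h1, fun l => (h2 l).le⟩, fun l hl _ h4 => ?_⟩
      have h5 := h4 l
      rw [Function.update_self, h2 l] at h5
      omega
    · rintro ⟨⟨h1, h2⟩, h3⟩
      refine ⟨h1, fun l => le_antisymm (h2 l) ?_⟩
      by_contra hlt
      push Not at hlt
      refine h3 l (by omega) h1 fun l' => ?_
      by_cases hl : l' = l
      · subst hl; rw [Function.update_self]; omega
      · rw [Function.update_of_ne hl]; exact h2 l'
  rw [hset]
  refine (hB _).diff (MeasurableSet.iUnion fun l => MeasurableSet.iUnion fun hl => ?_)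
  refine multiPast_mono Y ?_ _ (hB _)
  intro l'
  simp only [gridVec]
  gcongr
  by_cases hl : l' = l
  · subst hl; rw [Function.update_self]; omega
  · rw [Function.update_of_ne hl]

omit [Fintype L] in
lemma gridVec_ceil_le {m : ℕ} {V : L → ℝ≥0} {K : ℝ≥0} (hV : ∀ l, V l ≤ K) (l : L) :
    gridVec m (fun l => ⌈((m : ℝ≥0) + 1) * V l⌉₊) l ≤ K + 1 := by
  simp only [gridVec]
  rw [div_le_iff₀ (by positivity)]
  refine (Nat.ceil_lt_add_one zero_le).le.trans ?_
  calc ((m : ℝ≥0) + 1) * V l + 1 ≤ ((m : ℝ≥0) + 1) * K + ((m : ℝ≥0) + 1) := by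
        gcongr
        · exact hV l
        · simp
    _ = _ := by ring

/-- Optional stopping at the discretized multi-parameter stopping time, by summation over its
values. -/
lemma lintegral_multiWeight_grid [IsProbabilityMeasure P] (h : IsPoissonFamily Y r P) (c : L → ℝ)
    {V : L → Ω → ℝ≥0} {K : ℝ≥0} (hVK : ∀ l ω, V l ω ≤ K) {B : Set Ω}
    (hB : ∀ w, MeasurableSet[multiPast Y w] (B ∩ {ω | ∀ l, V l ω ≤ w l})) (m : ℕ) :
    ∫⁻ ω in B, multiWeight Y r c (gridVec m fun l => ⌈((m : ℝ≥0) + 1) * V l ω⌉₊) ω ∂P =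
      ∫⁻ ω in B, multiWeight Y r c (fun _ => K + 1) ω ∂P := by
  set Bk : (L → ℕ) → Set Ω := fun k => B ∩ {ω | ∀ l, ⌈((m : ℝ≥0) + 1) * V l ω⌉₊ = k l} with hBk
  have hUnion : B = ⋃ k, Bk k := by
    ext ω
    simp only [hBk, Set.mem_iUnion, Set.mem_inter_iff, Set.mem_ofPred_eq, exists_and_left]
    exact ⟨fun h => ⟨h, fun l => _, fun l => rfl⟩, fun h => h.1⟩
  have hm : ∀ k, MeasurableSet (Bk k) := fun k =>
    multiPast_le h _ _ (measurableSet_ceil_eq hB m k)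
  have hdisj : Pairwise (Function.onFun Disjoint Bk) := by
    intro k k' hkk'
    refine Set.disjoint_left.2 fun ω h1 h2 => hkk' ?_
    ext l
    rw [← h1.2 l, ← h2.2 l]
  rw [hUnion, lintegral_iUnion hm hdisj, lintegral_iUnion hm hdisj]
  refine tsum_congr fun k => ?_
  rcases (Bk k).eq_empty_or_nonempty with he | ⟨ω₀, hω₀⟩
  · simp [he]
  have hle : gridVec m k ≤ fun _ => K + 1 := by
    have h1 : k = fun l => ⌈((m : ℝ≥0) + 1) * V l ω₀⌉₊ := (funext hω₀.2).symm
    rw [h1]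
    exact gridVec_ceil_le fun l => hVK l ω₀
  rw [setLIntegral_multiWeight h c hle (measurableSet_ceil_eq hB m k)]
  refine setLIntegral_congr_fun (hm k) fun ω hω => ?_
  have : (fun l => ⌈((m : ℝ≥0) + 1) * V l ω⌉₊) = k := funext hω.2
  simp only [this]

omit [Fintype L] in
lemma tendsto_gridVec (V : L → ℝ≥0) (l : L) :
    Tendsto (fun m : ℕ => gridVec m (fun l => ⌈((m : ℝ≥0) + 1) * V l⌉₊) l) atTop (𝓝[≥] (V l)) := by
  refine tendsto_nhdsWithin_iff.2 ⟨?_, Eventually.of_forall fun m => ?_⟩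
  · have h1 : Tendsto (fun m : ℕ => (V l : ℝ≥0) + 1 / ((m : ℝ≥0) + 1)) atTop (𝓝 (V l + 0)) :=
      tendsto_const_nhds.add tendsto_one_div_add_atTop_nhds_zero_nat
    rw [add_zero] at h1
    refine tendsto_of_tendsto_of_tendsto_of_le_of_le tendsto_const_nhds h1 (fun m => ?_) fun m => ?_
    · exact ceil_le_iff_le_gridVec.1 le_rfl
    · simp only [gridVec]
      have hne : (m : ℝ≥0) + 1 ≠ 0 := by positivity
      rw [div_le_iff₀ (by positivity), add_mul (V l), one_div_mul_cancel hne, mul_comm (V l)]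
      exact (Nat.ceil_lt_add_one zero_le).le
  · exact ceil_le_iff_le_gridVec.1 le_rfl

lemma continuous_expWeight (c : ℝ) (r : ℝ≥0) (k : ℕ) : Continuous fun v => expWeight c r v k := by
  unfold expWeight
  exact ENNReal.continuous_ofReal.comp (by fun_prop)

lemma tendsto_multiWeight_grid (h : IsPoissonFamily Y r P) (c : L → ℝ) (V : L → ℝ≥0) (ω : Ω) :
    Tendsto (fun m : ℕ => multiWeight Y r c (gridVec m fun l => ⌈((m : ℝ≥0) + 1) * V l⌉₊) ω) atTop
      (𝓝 (multiWeight Y r c V ω)) := by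
  refine ENNReal.tendsto_finsetProd_of_ne_top _ (fun l _ => ?_) fun l _ => ?_
  · have h1 := tendsto_gridVec V l
    have h2 : ∀ᶠ v in 𝓝[≥] (V l), Y l v ω = Y l (V l) ω :=
      ((h.poisson l).rightCont ω (V l)).eventually
        (show ∀ᶠ k in 𝓝 (Y l (V l) ω), k = Y l (V l) ω by simp [nhds_discrete])
    have h3 := ((continuous_expWeight (c l) (r l) (Y l (V l) ω)).tendsto (V l)).comp
      (tendsto_nhds_of_tendsto_nhdsWithin h1)
    refine h3.congr' ?_
    filter_upwards [h1.eventually h2] with m hm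
    simp only [Function.comp, hm]
  · exact ENNReal.ofReal_ne_top

lemma expWeight_le (c : ℝ) (r : ℝ≥0) {v K : ℝ≥0} (hv : v ≤ K) {k l : ℕ} (hk : k ≤ l) :
    expWeight c r v k ≤ ENNReal.ofReal (Real.exp ((Real.exp |c| - 1) * (r * K) + r * K)) *
      expWeight |c| r K l := by
  unfold expWeight
  rw [← ENNReal.ofReal_mul (Real.exp_pos _).le, ← Real.exp_add]
  refine ENNReal.ofReal_le_ofReal (Real.exp_le_exp.2 ?_)
  have h1 : c * k ≤ |c| * l := by
    calc c * k ≤ |c| * k := by gcongr; exact le_abs_self c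
      _ ≤ |c| * l := by gcongr
  have h2 : -(Real.exp c - 1) * (r * v) ≤ r * K := by
    have h3 : -(Real.exp c - 1) ≤ 1 := by linarith [Real.exp_pos c]
    calc -(Real.exp c - 1) * (r * v : ℝ) ≤ 1 * (r * v) := by gcongr
      _ ≤ r * K := by rw [one_mul]; gcongr
  linarith

lemma multiWeight_le (h : IsPoissonFamily Y r P) (c : L → ℝ) (v : L → ℝ≥0) (K : ℝ≥0)
    (hv : ∀ l, v l ≤ K) (ω : Ω) :
    multiWeight Y r c v ω ≤ (∏ l, ENNReal.ofReal (Real.exp ((Real.exp |c l| - 1) * (r l * K) +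
      r l * K))) * multiWeight Y r (fun l => |c l|) (fun _ => K) ω := by
  unfold multiWeight
  rw [← Finset.prod_mul_distrib]
  exact Finset.prod_le_prod' fun l _ => expWeight_le _ _ (hv l) ((h.poisson l).mono ω (hv l))

omit [Fintype L] in
lemma measurable_expWeight_comp (h : IsPoissonFamily Y r P) (l : L) (c : ℝ) (g : ℕ → ℝ≥0)
    {k : Ω → ℕ} (hk : Measurable k) :
    Measurable fun ω => expWeight c (r l) (g (k ω)) (Y l (g (k ω)) ω) := by
  have h2 : Measurable fun p : ℕ × Ω => expWeight c (r l) (g p.1) (Y l (g p.1) p.2) := by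
    apply measurable_from_prod_countable_right
    intro j
    exact (IsPoissonProcess.measurable_expWeight c (r l) (g j)).comp ((h.poisson l).measurable (g j))
  have h3 : Measurable fun ω => (k ω, ω) := hk.prodMk measurable_id'
  have h4 := h2.comp h3
  exact h4

lemma measurable_multiWeight_gridVec (h : IsPoissonFamily Y r P) (c : L → ℝ) (m : ℕ)
    {k : Ω → L → ℕ} (hk : Measurable k) :
    Measurable fun ω => multiWeight Y r c (gridVec m (k ω)) ω :=
  Finset.measurable_fun_prod _ fun l _ =>
    measurable_expWeight_comp h l (c l) (fun j => (j : ℝ≥0) / (m + 1))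
      ((measurable_pi_apply l).comp hk)

/-- Optional stopping for the product of the exponential weights at a bounded multi-parameter
stopping time `V`: the hypothesis says that `B` is in the past of `V`. -/
lemma setLIntegral_multiWeight_stopped [IsProbabilityMeasure P] (h : IsPoissonFamily Y r P)
    (c : L → ℝ) {V : L → Ω → ℝ≥0} (hV : ∀ l, Measurable (V l)) {K : ℝ≥0} (hVK : ∀ l ω, V l ω ≤ K)
    {B : Set Ω} (hB : ∀ w, MeasurableSet[multiPast Y w] (B ∩ {ω | ∀ l, V l ω ≤ w l})) :
    ∫⁻ ω in B, multiWeight Y r c (fun l => V l ω) ω ∂P =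
      ∫⁻ ω in B, multiWeight Y r c (fun _ => K + 1) ω ∂P := by
  -- the discretizations decrease to `V`, where the paths are right-continuous; they stay below
  -- `K + 1`, where the weight with the exponents `|c l|` is an integrable bound
  have hlim := tendsto_lintegral_of_dominated_convergence (μ := P.restrict B)
    (F := fun m ω => multiWeight Y r c (gridVec m fun l => ⌈((m : ℝ≥0) + 1) * V l ω⌉₊) ω)
    (f := fun ω => multiWeight Y r c (fun l => V l ω) ω)
    (fun ω => (∏ l, ENNReal.ofReal (Real.exp ((Real.exp |c l| - 1) * (r l * (K + 1 : ℝ≥0)) +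
      r l * (K + 1 : ℝ≥0)))) * multiWeight Y r (fun l => |c l|) (fun _ => K + 1) ω)
    (fun m => ?_) (fun m => ?_) ?_ ?_
  · simp only [lintegral_multiWeight_grid h c hVK hB] at hlim
    exact tendsto_nhds_unique hlim tendsto_const_nhds |>.symm ▸ rfl
  · have h1 : Measurable fun ω => fun l => ⌈((m : ℝ≥0) + 1) * V l ω⌉₊ :=
      measurable_pi_lambda _ fun l => Nat.measurable_ceil.comp ((hV l).const_mul _)
    exact measurable_multiWeight_gridVec h c m h1
  · refine Eventually.of_forall fun ω => ?_
    have h1 : ∀ l, gridVec m (fun l => ⌈((m : ℝ≥0) + 1) * V l ω⌉₊) l ≤ K + 1 :=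
      gridVec_ceil_le fun l => hVK l ω
    exact multiWeight_le h c _ (K + 1) h1 ω
  · refine ne_of_lt (lt_of_le_of_lt (setLIntegral_le_lintegral _ _) ?_)
    rw [lintegral_const_mul _ (measurable_multiWeight h _ _)]
    refine ENNReal.mul_lt_top (ENNReal.prod_lt_top fun l _ => ENNReal.ofReal_lt_top) ?_
    have := setLIntegral_multiWeight h (fun l => |c l|) (w := fun _ => 0) (K := fun _ => K + 1)
      (fun _ => zero_le) (B := Set.univ) MeasurableSet.univ
    simp only [Measure.restrict_univ] at this
    rw [this]
    simp [multiWeight, expWeight, (h.poisson _).zero]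
  · exact Eventually.of_forall fun ω => tendsto_multiWeight_grid h c _ ω

end OptionalStopping

/-! ### Right-continuous processes -/

section RightCont

variable {Ω : Type*} [MeasurableSpace Ω]

/-- A right-continuous process evaluated at a random time is measurable. -/
lemma measurable_eval_of_rightCont {β : Type*} [TopologicalSpace β] [MeasurableSpace β]
    [TopologicalSpace.PseudoMetrizableSpace β] [BorelSpace β] {f : ℝ≥0 → Ω → β}
    (hf : ∀ t, Measurable (f t))
    (hr : ∀ ω t, ContinuousWithinAt (fun s => f s ω) (Set.Ici t) t) {R : Ω → ℝ≥0}
    (hR : Measurable R) : Measurable fun ω => f (R ω) ω := by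
  have h2 : ∀ m : ℕ, Measurable fun p : ℕ × Ω => f ((p.1 : ℝ≥0) / (m + 1)) p.2 := fun m => by
    apply measurable_from_prod_countable_right
    intro j
    exact hf ((j : ℝ≥0) / (m + 1))
  refine measurable_of_tendsto_metrizable
    (f := fun (m : ℕ) ω => f ((⌈((m : ℝ≥0) + 1) * R ω⌉₊ : ℝ≥0) / (m + 1)) ω) (fun m => ?_) ?_
  · have h3 : Measurable fun ω => (⌈((m : ℝ≥0) + 1) * R ω⌉₊, ω) :=
      (Nat.measurable_ceil.comp (hR.const_mul _)).prodMk measurable_id'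
    have h4 := (h2 m).comp h3
    exact h4
  · refine tendsto_pi_nhds.2 fun ω => ?_
    exact (hr ω (R ω)).tendsto.comp (tendsto_gridVec (fun _ : Unit => R ω) ())

end RightCont

/-! ### Systems driven by countably many modes -/

namespace IsCountingPath

lemma comp_linear {f : ℝ≥0 → ℕ} (hf : IsCountingPath f) (a p : ℝ≥0) :
    IsCountingPath fun e => f (a + e * p) where
  mono := fun e e' h => hf.mono (by gcongr)
  rightCont := fun e => by
    refine (hf.rightCont (a + e * p)).comp (t := Set.Ici (a + e * p)) ?_ ?_
    · exact Continuous.continuousWithinAt (by fun_prop)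
    · intro e' he'
      simp only [Set.mem_Ici] at he' ⊢
      gcongr

lemma sum {L : Type*} [Fintype L] {f : L → ℝ≥0 → ℕ} (hf : ∀ l, IsCountingPath (f l)) :
    IsCountingPath fun t => ∑ l, f l t where
  mono := fun _ _ h => Finset.sum_le_sum fun l _ => (hf l).mono h
  rightCont := fun t => tendsto_finsetSum _ fun l _ => (hf l).rightCont t

lemma stopped {f : ℝ≥0 → ℕ} (hf : IsCountingPath f) (w : ℝ≥0) :
    IsCountingPath fun t => f (min t w) where
  mono := fun s t h => hf.mono (min_le_min_right w h)
  rightCont := fun t => by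
    refine (hf.rightCont (min t w)).comp (t := Set.Ici (min t w)) ?_ ?_
    · exact Continuous.continuousWithinAt (by fun_prop)
    · intro e' he'
      exact min_le_min_right w he'

end IsCountingPath

section Skeleton

variable {L : Type*} [Fintype L] {𝒵 : Type*}

lemma sum_eq_iff_of_mono {f : L → ℝ≥0 → ℕ} (hf : ∀ l, IsCountingPath (f l)) {s t : ℝ≥0}
    (h : s ≤ t) : ∑ l, f l t = ∑ l, f l s ↔ ∀ l, f l t = f l s := by
  rw [eq_comm, Finset.sum_eq_sum_iff_of_le fun l _ => (hf l).mono h]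
  simp [eq_comm]

/-- The elapsed times at which, moving on from the clock readings `v` with speeds `p`, some path
has jumped or one unit of time is over. -/
def hitSet (y : L → ℝ≥0 → ℕ) (v p : L → ℝ≥0) : Set ℝ≥0 :=
  {e | 1 ≤ e ∨ ∃ l, y l (v l + e * p l) ≠ y l (v l)}

/-- The first element of `hitSet`. -/
def hitTime (y : L → ℝ≥0 → ℕ) (v p : L → ℝ≥0) : ℝ≥0 := sInf (hitSet y v p)

lemma exists_hitSet_eq_Ici {y : L → ℝ≥0 → ℕ} (hy : ∀ l, IsCountingPath (y l)) (v p : L → ℝ≥0) :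
    ∃ s, 0 < s ∧ hitSet y v p = Set.Ici s := by
  set f : L → ℝ≥0 → ℕ := fun l e => y l (v l + e * p l) with hf
  have hfl : ∀ l, IsCountingPath (f l) := fun l => (hy l).comp_linear _ _
  have hmem : ∀ e, (∃ l, y l (v l + e * p l) ≠ y l (v l)) ↔ ∑ l, f l e ≠ ∑ l, f l 0 := by
    intro e
    rw [Ne, sum_eq_iff_of_mono hfl (zero_le (a := e))]
    simp [hf]
  have hF := IsCountingPath.sum hfl
  -- the hitting time is `1`, unless some path jumps before that
  by_cases h1 : ∑ l, f l 0 = ∑ l, f l 1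
  · refine ⟨1, one_pos, ?_⟩
    ext e
    simp only [hitSet, Set.mem_ofPred_eq, Set.mem_Ici, hmem]
    refine ⟨?_, Or.inl⟩
    rintro (h | h)
    · exact h
    · by_contra hlt
      push Not at hlt
      exact h (le_antisymm ((hF.mono hlt.le).trans h1.ge) (hF.mono zero_le))
  · obtain ⟨s, hs0, hs1, hcon, hne⟩ := hF.exists_first_jump (zero_le (a := 1)) h1
    refine ⟨s, hs0, ?_⟩
    ext e
    simp only [hitSet, Set.mem_ofPred_eq, Set.mem_Ici, hmem]
    constructor
    · rintro (h | h)
      · exact hs1.trans h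
      · by_contra hlt
        push Not at hlt
        exact h (hcon e zero_le hlt)
    · intro h
      right
      intro heq
      exact hne (le_antisymm ((hF.mono h).trans heq.le) (hF.mono zero_le))

lemma hitTime_le_iff {y : L → ℝ≥0 → ℕ} (hy : ∀ l, IsCountingPath (y l)) (v p : L → ℝ≥0) (e : ℝ≥0) :
    hitTime y v p ≤ e ↔ (1 ≤ e ∨ ∃ l, y l (v l + e * p l) ≠ y l (v l)) := by
  obtain ⟨s, -, h⟩ := exists_hitSet_eq_Ici hy v p
  rw [hitTime, h, csInf_Ici, ← Set.mem_Ici, ← h]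
  rfl

lemma hitTime_pos {y : L → ℝ≥0 → ℕ} (hy : ∀ l, IsCountingPath (y l)) (v p : L → ℝ≥0) :
    0 < hitTime y v p := by
  obtain ⟨s, hs, h⟩ := exists_hitSet_eq_Ici hy v p
  rwa [hitTime, h, csInf_Ici]

open Classical in
/-- The skeleton of a mode-driven system: the successive event times together with the clock
readings and the mode at these times. The mode `z` determines the speeds `φ z` of the clocks, and
`step z m` is the mode that follows `z` when the counts jump to `m`. -/
def skeleton (φ : 𝒵 → L → ℝ≥0) (step : 𝒵 → (L → ℕ) → 𝒵) (z₀ : 𝒵) (y : L → ℝ≥0 → ℕ) :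
    ℕ → ℝ≥0 × (L → ℝ≥0) × 𝒵
  | 0 => (0, fun _ => 0, z₀)
  | k + 1 =>
    let s := skeleton φ step z₀ y k
    let e := hitTime y s.2.1 (φ s.2.2)
    let v' : L → ℝ≥0 := fun l => s.2.1 l + e * φ s.2.2 l
    (s.1 + e, v', if ∃ l, y l (v' l) ≠ y l (s.2.1 l) then step s.2.2 (fun l => y l (v' l)) else s.2.2)

variable {φ : 𝒵 → L → ℝ≥0} {step : 𝒵 → (L → ℕ) → 𝒵} {z₀ : 𝒵}

/-- The event times of the skeleton exhaust the half-line if the paths are bounded: each step takes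
a unit of time or uses up a jump. -/
lemma exists_skeleton_time {y : L → ℝ≥0 → ℕ} (hy : ∀ l, IsCountingPath (y l)) {C : ℕ}
    (hC : ∀ v : L → ℝ≥0, ∑ l, y l (v l) ≤ C) (t : ℝ≥0) :
    ∃ k, (skeleton φ step z₀ y k).1 ≤ t ∧ t < (skeleton φ step z₀ y (k + 1)).1 := by
  -- elapsed time plus the number of jumps grows by at least one in each step
  have hgrow : ∀ k : ℕ, (k : ℝ≥0) ≤ (skeleton φ step z₀ y k).1 +
      (∑ l, y l ((skeleton φ step z₀ y k).2.1 l) : ℕ) := by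
    intro k
    induction k with
    | zero => simp
    | succ k ih =>
      set s := skeleton φ step z₀ y k with hs
      have h1 := (hitTime_le_iff hy s.2.1 (φ s.2.2) _).1 le_rfl
      set e := hitTime y s.2.1 (φ s.2.2) with he
      have e1 : (skeleton φ step z₀ y (k + 1)).1 = s.1 + e := rfl
      have e2 : (skeleton φ step z₀ y (k + 1)).2.1 = fun l => s.2.1 l + e * φ s.2.2 l := rfl
      rw [e1, e2]
      have hmono : ∑ l, y l (s.2.1 l) ≤ ∑ l, y l (s.2.1 l + e * φ s.2.2 l) :=
        Finset.sum_le_sum fun l _ => (hy l).mono le_self_add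
      push_cast
      rcases h1 with h1 | ⟨l, hl⟩
      · calc (k : ℝ≥0) + 1 ≤ (s.1 + (∑ l, y l (s.2.1 l) : ℕ)) + e := by gcongr
          _ = s.1 + e + (∑ l, y l (s.2.1 l) : ℕ) := by ring
          _ ≤ s.1 + e + (∑ l, y l (s.2.1 l + e * φ s.2.2 l) : ℕ) := by gcongr
          _ = _ := by push_cast; rfl
      · have hlt : ∑ l, y l (s.2.1 l) + 1 ≤ ∑ l, y l (s.2.1 l + e * φ s.2.2 l) := by
          refine Nat.succ_le_of_lt (Finset.sum_lt_sum (fun l _ => (hy l).mono le_self_add)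
            ⟨l, Finset.mem_univ l, lt_of_le_of_ne ((hy l).mono le_self_add) hl.symm⟩)
        calc (k : ℝ≥0) + 1 ≤ (s.1 + (∑ l, y l (s.2.1 l) : ℕ)) + 1 := by gcongr
          _ = s.1 + (∑ l, y l (s.2.1 l) + 1 : ℕ) := by push_cast; ring
          _ ≤ s.1 + (∑ l, y l (s.2.1 l + e * φ s.2.2 l) : ℕ) := by gcongr
          _ ≤ s.1 + e + (∑ l, y l (s.2.1 l + e * φ s.2.2 l) : ℕ) := by gcongr; exact le_self_add
          _ = _ := by push_cast; rfl
  have hex : ∃ k, t < (skeleton φ step z₀ y k).1 := by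
    obtain ⟨k, hk⟩ := exists_nat_gt (t + C)
    refine ⟨k, ?_⟩
    have h2 : (k : ℝ≥0) ≤ (skeleton φ step z₀ y k).1 + C :=
      (hgrow k).trans (by gcongr; exact hC _)
    exact lt_of_add_lt_add_right (hk.trans_le h2)
  classical
  have hn := Nat.find_spec hex
  obtain ⟨k, hk⟩ : ∃ k, Nat.find hex = k + 1 := by
    refine Nat.exists_eq_succ_of_ne_zero fun h0 => ?_
    rw [h0] at hn
    simp [skeleton] at hn
  refine ⟨k, not_lt.1 (Nat.find_min hex (by omega)), ?_⟩
  rw [← hk]; exact hn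

section Measurability

variable {Ω : Type*} [MeasurableSpace Ω] [MeasurableSpace 𝒵] [DiscreteMeasurableSpace 𝒵]
  [Countable 𝒵]

omit [Fintype L] in
lemma measurable_path_comp {y : Ω → L → ℝ≥0 → ℕ} (hy : ∀ ω l, IsCountingPath (y ω l))
    (hm : ∀ l t, Measurable fun ω => y ω l t) (l : L) {R : Ω → ℝ≥0} (hR : Measurable R) :
    Measurable fun ω => y ω l (R ω) :=
  measurable_eval_of_rightCont (f := fun t ω => y ω l t) (hm l) (fun ω t => (hy ω l).rightCont t) hR

omit [Fintype L] in
lemma measurable_speed {z : Ω → 𝒵} (hz : Measurable z) (l : L) : Measurable fun ω => φ (z ω) l :=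
  (measurable_of_countable fun z => φ z l).comp hz

/-- The skeleton depends measurably on the driving paths. -/
lemma measurable_skeleton {y : Ω → L → ℝ≥0 → ℕ} (hy : ∀ ω l, IsCountingPath (y ω l))
    (hm : ∀ l t, Measurable fun ω => y ω l t) (k : ℕ) :
    Measurable fun ω => skeleton φ step z₀ (y ω) k := by
  classical
  induction k with
  | zero => exact measurable_const
  | succ k ih =>
    have h1 : Measurable fun ω => (skeleton φ step z₀ (y ω) k).1 := ih.fst
    have h2 : ∀ l, Measurable fun ω => (skeleton φ step z₀ (y ω) k).2.1 l := fun l =>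
      (measurable_pi_apply l).comp ih.snd.fst
    have h3 : Measurable fun ω => (skeleton φ step z₀ (y ω) k).2.2 := ih.snd.snd
    have h3' := fun l => measurable_speed (φ := φ) h3 l
    have he : Measurable fun ω => hitTime (y ω) (skeleton φ step z₀ (y ω) k).2.1
        (φ (skeleton φ step z₀ (y ω) k).2.2) := by
      refine measurable_of_Iic fun e => ?_
      have hset : (fun ω => hitTime (y ω) (skeleton φ step z₀ (y ω) k).2.1
          (φ (skeleton φ step z₀ (y ω) k).2.2)) ⁻¹' Set.Iic e =
          {ω | 1 ≤ e} ∪ ⋃ l, {ω | y ω l ((skeleton φ step z₀ (y ω) k).2.1 l +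
            e * φ (skeleton φ step z₀ (y ω) k).2.2 l) = y ω l ((skeleton φ step z₀ (y ω) k).2.1 l)}ᶜ := by
        ext ω
        simp only [Set.mem_preimage, Set.mem_Iic, hitTime_le_iff (hy ω), Set.mem_union,
          Set.mem_ofPred_eq, Set.mem_iUnion, Set.mem_compl_iff]
      rw [hset]
      refine (MeasurableSet.const _).union (MeasurableSet.iUnion fun l => ?_)
      exact (measurableSet_eq_fun (measurable_path_comp hy hm l ((h2 l).add ((h3' l).const_mul e)))
        (measurable_path_comp hy hm l (h2 l))).compl
    have hv : ∀ l, Measurable fun ω => (skeleton φ step z₀ (y ω) k).2.1 l +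
        hitTime (y ω) (skeleton φ step z₀ (y ω) k).2.1 (φ (skeleton φ step z₀ (y ω) k).2.2) *
          φ (skeleton φ step z₀ (y ω) k).2.2 l := fun l => (h2 l).add (he.mul (h3' l))
    have hstep : Measurable fun p : 𝒵 × (L → ℕ) => step p.1 p.2 := measurable_of_countable _
    refine (h1.add he).prodMk ((measurable_pi_lambda _ hv).prodMk (Measurable.ite ?_ ?_ h3))
    · simp only [Set.ofPred_exists]
      refine MeasurableSet.iUnion fun l => ?_
      exact (measurableSet_eq_fun (measurable_path_comp hy hm l (hv l))
        (measurable_path_comp hy hm l (h2 l))).compl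
    · exact hstep.comp (h3.prodMk (measurable_pi_lambda _ fun l => measurable_path_comp hy hm l (hv l)))

end Measurability

end Skeleton

section ModeDriven

variable {L : Type*} [Fintype L] {𝒵 : Type*}

/-- A deterministic system of counting paths `y l` run on clocks `V l`: between the jumps of the
observed counts `y l (V l s)` the mode `Z` is constant and the clocks have the constant speeds
`φ (Z s)`; at a jump the new mode is a function of the old one and of the new counts. -/
structure ModeDriven (φ : 𝒵 → L → ℝ≥0) (step : 𝒵 → (L → ℕ) → 𝒵) (z₀ : 𝒵) (y : L → ℝ≥0 → ℕ)
    (V : L → ℝ≥0 → ℝ≥0) (Z : ℝ≥0 → 𝒵) : Prop where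
  path : ∀ l, IsCountingPath (y l)
  count : ∀ l, IsCountingPath fun s => y l (V l s)
  clock_zero : ∀ l, V l 0 = 0
  mode_zero : Z 0 = z₀
  clock_mono : ∀ l, Monotone (V l)
  clock_linear : ∀ a b, a ≤ b → (∀ s, a ≤ s → s < b → Z s = Z a) →
    ∀ l, V l b = V l a + (b - a) * φ (Z a) l
  mode_const : ∀ a b, a ≤ b → (∀ l, y l (V l b) = y l (V l a)) → Z b = Z a
  mode_jump : ∀ a b, a < b → (∀ s, a ≤ s → s < b → ∀ l, y l (V l s) = y l (V l a)) →
    (∃ l, y l (V l b) ≠ y l (V l a)) → Z b = step (Z a) fun l => y l (V l b)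

variable {φ : 𝒵 → L → ℝ≥0} {step : 𝒵 → (L → ℕ) → 𝒵} {z₀ : 𝒵}

namespace ModeDriven

variable {y : L → ℝ≥0 → ℕ} {V : L → ℝ≥0 → ℝ≥0} {Z : ℝ≥0 → 𝒵}

/-- As long as either the true clocks or the clocks extrapolated from time `J` stay below `w`, and
the paths stopped at `w` show no jump along the extrapolation, the extrapolation is exact. -/
lemma extrapolate (h : ModeDriven φ step z₀ y V Z) {w : L → ℝ≥0} {J t : ℝ≥0} (hJt : J ≤ t)
    (ht : t ≤ J + hitTime (fun l v => y l (min v (w l))) (fun l => V l J) (φ (Z J)))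
    (hw : (∀ l, V l t ≤ w l) ∨ ∀ l, V l J + (t - J) * φ (Z J) l ≤ w l) :
    (∀ s, J ≤ s → s < t → ∀ l, y l (V l s) = y l (V l J)) ∧
      ∀ l, V l t = V l J + (t - J) * φ (Z J) l := by
  have hcon : ∀ s, J ≤ s → s < t → ∀ l, y l (V l s) = y l (V l J) := by
    by_contra hne
    push Not at hne
    obtain ⟨s, hJs, hst, l₀, hl₀⟩ := hne
    have hsum := IsCountingPath.sum h.count
    -- up to the first observed jump the extrapolation is exact, so that this jump would be visible
    -- along the extrapolation, before the hitting time
    obtain ⟨s', hJs', hs's, hbefore, hjump⟩ := hsum.exists_first_jump hJs (fun heq => hl₀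
      ((sum_eq_iff_of_mono h.count hJs).1 heq.symm l₀))
    have hZ : ∀ r, J ≤ r → r < s' → Z r = Z J := fun r h1 h2 =>
      h.mode_const J r h1 ((sum_eq_iff_of_mono h.count h1).1 (hbefore r h1 h2))
    have hV := h.clock_linear J s' hJs'.le hZ
    have hs't : s' < t := hs's.trans_lt hst
    have hVw : ∀ l, V l s' ≤ w l := by
      intro l
      rcases hw with hw | hw
      · exact (h.clock_mono l hs't.le).trans (hw l)
      · rw [hV l]
        refine le_trans ?_ (hw l)
        gcongr
    have hVJw : ∀ l, V l J ≤ w l := fun l => (h.clock_mono l hJs'.le).trans (hVw l)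
    have hlt : s' - J < hitTime (fun l v => y l (min v (w l))) (fun l => V l J) (φ (Z J)) := by
      rw [tsub_lt_iff_left hJs'.le]
      exact hs't.trans_le ht
    have hnot := mt (hitTime_le_iff (fun l => (h.path l).stopped (w l)) (fun l => V l J) (φ (Z J))
      (s' - J)).2 (not_le.2 hlt)
    push Not at hnot
    refine hjump ((sum_eq_iff_of_mono h.count hJs'.le).2 fun l => ?_)
    have h3 := hnot.2 l
    rw [← hV l, min_eq_left (hVw l), min_eq_left (hVJw l)] at h3
    exact h3
  refine ⟨hcon, h.clock_linear J t hJt fun s h1 h2 => ?_⟩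
  exact h.mode_const J s h1 (hcon s h1 h2)

/-- The system agrees with the skeleton built from the paths stopped at `w`, up to the time at
which a clock passes `w` (according to either of the two). -/
lemma eq_skeleton (h : ModeDriven φ step z₀ y V Z) (w : L → ℝ≥0) (k : ℕ) :
    let S := skeleton φ step z₀ (fun l v => y l (min v (w l)))
    ((∀ l, V l (S k).1 ≤ w l) ∨ (∀ l, (S k).2.1 l ≤ w l)) →
      (∀ l, V l (S k).1 = (S k).2.1 l) ∧ Z (S k).1 = (S k).2.2 := by
  intro S
  induction k with
  | zero => exact fun _ => ⟨fun l => h.clock_zero l, h.mode_zero⟩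
  | succ k ih =>
    intro hw
    set e := hitTime (fun l v => y l (min v (w l))) (S k).2.1 (φ (S k).2.2) with he
    have e1 : (S (k + 1)).1 = (S k).1 + e := rfl
    have e2 : ∀ l, (S (k + 1)).2.1 l = (S k).2.1 l + e * φ (S k).2.2 l := fun l => rfl
    have hpos : 0 < e := hitTime_pos (fun l => (h.path l).stopped (w l)) _ _
    have hle : (S k).1 ≤ (S (k + 1)).1 := by rw [e1]; exact le_self_add
    obtain ⟨hv, hz⟩ := ih (by
      rcases hw with hw | hw
      · exact Or.inl fun l => (h.clock_mono l hle).trans (hw l)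
      · exact Or.inr fun l => le_trans (by rw [e2]; exact le_self_add) (hw l))
    have hv' : (S k).2.1 = fun l => V l (S k).1 := funext fun l => (hv l).symm
    have hsub : (S (k + 1)).1 - (S k).1 = e := by rw [e1, add_tsub_cancel_left]
    obtain ⟨hcon, hlin⟩ := h.extrapolate (w := w) (t := (S (k + 1)).1) hle
      (by rw [hz, ← hv']; exact e1.le)
      (by
        rw [hz, hsub]
        rcases hw with hw | hw
        · exact Or.inl hw
        · right; intro l; rw [hv l, ← e2]; exact hw l)
    have hV : ∀ l, V l (S (k + 1)).1 = (S (k + 1)).2.1 l := by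
      intro l; rw [hlin l, hz, hsub, e2, hv l]
    refine ⟨hV, ?_⟩
    have hw' : ∀ l, V l (S (k + 1)).1 ≤ w l := by
      rcases hw with hw | hw
      · exact hw
      · intro l; rw [hV l]; exact hw l
    have hw'' : ∀ l, V l (S k).1 ≤ w l := fun l => (h.clock_mono l hle).trans (hw' l)
    have hy1 : ∀ l, y l (min ((S k).2.1 l + e * φ (S k).2.2 l) (w l)) = y l (V l (S (k + 1)).1) := by
      intro l
      rw [← e2, ← hV l, min_eq_left (hw' l)]
    have hy0 : ∀ l, y l (min ((S k).2.1 l) (w l)) = y l (V l (S k).1) := by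
      intro l
      rw [← hv l, min_eq_left (hw'' l)]
    have hlt : (S k).1 < (S (k + 1)).1 := by rw [e1]; exact lt_add_of_pos_right _ hpos
    change Z (S (k + 1)).1 = if ∃ l, y l (min ((S k).2.1 l + e * φ (S k).2.2 l) (w l)) ≠
      y l (min ((S k).2.1 l) (w l)) then step (S k).2.2
        (fun l => y l (min ((S k).2.1 l + e * φ (S k).2.2 l) (w l))) else (S k).2.2
    simp only [hy1, hy0]
    split_ifs with hj
    · rw [h.mode_jump _ _ hlt hcon hj, hz]
    · push Not at hj
      rw [h.mode_const _ _ hle hj, hz]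

/-- The clocks between two event times of the skeleton. -/
lemma clock_eq_skeleton (h : ModeDriven φ step z₀ y V Z) (w : L → ℝ≥0) (k : ℕ) (t : ℝ≥0) :
    let S := skeleton φ step z₀ (fun l v => y l (min v (w l)))
    (S k).1 ≤ t → t < (S (k + 1)).1 →
    ((∀ l, V l t ≤ w l) ∨ (∀ l, (S k).2.1 l + (t - (S k).1) * φ (S k).2.2 l ≤ w l)) →
      ∀ l, V l t = (S k).2.1 l + (t - (S k).1) * φ (S k).2.2 l := by
  intro S h1 h2 hw
  obtain ⟨hv, hz⟩ := h.eq_skeleton w k (by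
    rcases hw with hw | hw
    · exact Or.inl fun l => (h.clock_mono l h1).trans (hw l)
    · exact Or.inr fun l => le_self_add.trans (hw l))
  have hv' : (S k).2.1 = fun l => V l (S k).1 := funext fun l => (hv l).symm
  have := (h.extrapolate (w := w) h1 (by rw [hz, ← hv']; exact h2.le)
    (by
      rw [hz]
      rcases hw with hw | hw
      · exact Or.inl hw
      · right; intro l; rw [hv l]; exact hw l)).2
  intro l
  rw [this l, hz, hv l]

end ModeDriven

section Stopping

variable {Ω : Type*} [MeasurableSpace 𝒵] [DiscreteMeasurableSpace 𝒵] [Countable 𝒵]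
variable {Y : L → ℝ≥0 → Ω → ℕ} {V : L → ℝ≥0 → Ω → ℝ≥0} {Z : ℝ≥0 → Ω → 𝒵}

omit [Fintype L] in
lemma measurable_multiPast (Y : L → ℝ≥0 → Ω → ℕ) (w : L → ℝ≥0) (l : L) (t : ℝ≥0) :
    Measurable[multiPast Y w] fun ω => Y l (min t (w l)) ω :=
  (IsPoissonProcess.measurable_past (min_le_right t (w l))).mono
    (le_iSup (fun l => IsPoissonProcess.past (Y l) (w l)) l) le_rfl

/-- The clock readings of a mode-driven system form a multi-parameter stopping time: whether all
clocks are still below `w`, and any event about the counts up to then, is decided by the driving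
paths up to `w`. -/
lemma measurableSet_clock_le
    (h : ∀ ω, ModeDriven φ step z₀ (fun l t => Y l t ω) (fun l t => V l t ω) fun t => Z t ω)
    (w : L → ℝ≥0) (t : ℝ≥0) :
    MeasurableSet[multiPast Y w] {ω | ∀ l, V l t ω ≤ w l} ∧
      ∀ s ≤ t, ∀ l j, MeasurableSet[multiPast Y w]
        ({ω | Y l (V l s ω) ω = j} ∩ {ω | ∀ l, V l t ω ≤ w l}) := by
  -- measurability refers to the past of `w` here; the skeleton of the paths stopped at `w` is
  -- determined by this past, and it agrees with the system as long as the clocks are below `w`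
  let : MeasurableSpace Ω := multiPast Y w
  set y : Ω → L → ℝ≥0 → ℕ := fun ω l v => Y l (min v (w l)) ω with hy
  have hyc : ∀ ω l, IsCountingPath (y ω l) := fun ω l => ((h ω).path l).stopped (w l)
  have hym : ∀ l v, Measurable fun ω => y ω l v := fun l v => measurable_multiPast Y w l v
  set S : ℕ → Ω → ℝ≥0 × (L → ℝ≥0) × 𝒵 := fun k ω => skeleton φ step z₀ (y ω) k with hS
  have hSm : ∀ k, Measurable (S k) := fun k => measurable_skeleton hyc hym k
  have hex : ∀ ω s, ∃ k, (S k ω).1 ≤ s ∧ s < (S (k + 1) ω).1 := fun ω s =>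
    exists_skeleton_time (hyc ω) (C := ∑ l, Y l (w l) ω)
      (fun v => Finset.sum_le_sum fun l _ => ((h ω).path l).mono (min_le_right _ _)) s
  have hclock : ∀ k s l, Measurable fun ω =>
      (S k ω).2.1 l + (s - (S k ω).1) * φ (S k ω).2.2 l := fun k s l =>
    ((measurable_pi_apply l).comp (hSm k).snd.fst).add
      ((measurable_const.sub (hSm k).fst).mul (measurable_speed (hSm k).snd.snd l))
  have hwin : ∀ k s, MeasurableSet {ω | (S k ω).1 ≤ s ∧ s < (S (k + 1) ω).1} := fun k s =>
    (measurableSet_le (hSm k).fst measurable_const).inter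
      (measurableSet_lt (f := fun _ => s) measurable_const (hSm (k + 1)).fst)
  have hE : {ω | ∀ l, V l t ω ≤ w l} = ⋃ k, ({ω | (S k ω).1 ≤ t ∧ t < (S (k + 1) ω).1} ∩
      ⋂ l, {ω | (S k ω).2.1 l + (t - (S k ω).1) * φ (S k ω).2.2 l ≤ w l}) := by
    ext ω
    simp only [Set.mem_ofPred_eq, Set.mem_iUnion, Set.mem_inter_iff, Set.mem_iInter]
    constructor
    · intro hw
      obtain ⟨k, h1, h2⟩ := hex ω t
      refine ⟨k, ⟨h1, h2⟩, fun l => ?_⟩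
      rw [← (h ω).clock_eq_skeleton w k t h1 h2 (Or.inl hw) l]
      exact hw l
    · rintro ⟨k, ⟨h1, h2⟩, hw⟩ l
      rw [(h ω).clock_eq_skeleton w k t h1 h2 (Or.inr hw) l]
      exact hw l
  have hEm : MeasurableSet {ω | ∀ l, V l t ω ≤ w l} := by
    rw [hE]
    exact MeasurableSet.iUnion fun k => (hwin k t).inter
      (MeasurableSet.iInter fun l => measurableSet_le (hclock k t l) measurable_const)
  refine ⟨hEm, fun s hst l j => ?_⟩
  have hset : {ω | Y l (V l s ω) ω = j} ∩ {ω | ∀ l, V l t ω ≤ w l} =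
      (⋃ k, ({ω | (S k ω).1 ≤ s ∧ s < (S (k + 1) ω).1} ∩
        {ω | y ω l ((S k ω).2.1 l + (s - (S k ω).1) * φ (S k ω).2.2 l) = j})) ∩
      {ω | ∀ l, V l t ω ≤ w l} := by
    ext ω
    simp only [Set.mem_ofPred_eq, Set.mem_iUnion, Set.mem_inter_iff, and_congr_left_iff]
    intro hw
    have hws : ∀ l, V l s ω ≤ w l := fun l => ((h ω).clock_mono l hst).trans (hw l)
    constructor
    · intro hj
      obtain ⟨k, h1, h2⟩ := hex ω s
      refine ⟨k, ⟨h1, h2⟩, ?_⟩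
      rw [← (h ω).clock_eq_skeleton w k s h1 h2 (Or.inl hws) l]
      simp only [hy]
      rw [min_eq_left (hws l)]
      exact hj
    · rintro ⟨k, ⟨h1, h2⟩, hj⟩
      rw [← (h ω).clock_eq_skeleton w k s h1 h2 (Or.inl hws) l] at hj
      simp only [hy] at hj
      rwa [min_eq_left (hws l)] at hj
  rw [hset]
  refine (MeasurableSet.iUnion fun k => (hwin k s).inter ?_).inter hEm
  exact measurable_path_comp hyc hym l (hclock k s l) (measurableSet_singleton j)

/-- The σ-algebra generated by the counts `Y l (V l s)`, `s ≤ t`. -/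
abbrev observed (Y : L → ℝ≥0 → Ω → ℕ) (V : L → ℝ≥0 → Ω → ℝ≥0) (t : ℝ≥0) : MeasurableSpace Ω :=
  ⨆ l, ⨆ s : ℝ≥0, ⨆ _ : s ≤ t, MeasurableSpace.comap (fun ω => Y l (V l s ω) ω) ⊤

/-- Events observed up to time `t` are in the past of the clock readings at time `t`. -/
lemma measurableSet_observed_inter_clock_le
    (h : ∀ ω, ModeDriven φ step z₀ (fun l t => Y l t ω) (fun l t => V l t ω) fun t => Z t ω)
    (w : L → ℝ≥0) {t : ℝ≥0} {B : Set Ω} (hB : MeasurableSet[observed Y V t] B) :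
    MeasurableSet[multiPast Y w] (B ∩ {ω | ∀ l, V l t ω ≤ w l}) := by
  obtain ⟨hE, hN⟩ := measurableSet_clock_le h w t
  set E := {ω | ∀ l, V l t ω ≤ w l} with hEdef
  -- the sets `B` with this property form a σ-algebra
  let m : MeasurableSpace Ω :=
    { MeasurableSet' := fun B => MeasurableSet[multiPast Y w] (B ∩ E)
      measurableSet_empty := by rw [Set.empty_inter]; exact @MeasurableSet.empty _ (multiPast Y w)
      measurableSet_compl := fun B hB => by
        have : Bᶜ ∩ E = E \ (B ∩ E) := by ext; simp; tauto
        rw [this]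
        exact @MeasurableSet.diff _ (multiPast Y w) _ _ hE hB
      measurableSet_iUnion := fun f hf => by
        rw [Set.iUnion_inter]
        exact @MeasurableSet.iUnion _ _ (multiPast Y w) _ _ hf }
  have hle : observed Y V t ≤ m := by
    refine iSup_le fun l => iSup_le fun s => iSup_le fun hs => ?_
    rintro _ ⟨A, -, rfl⟩
    change MeasurableSet[multiPast Y w] (_ ∩ E)
    have : ((fun ω => Y l (V l s ω) ω) ⁻¹' A) ∩ E = ⋃ j ∈ A, ({ω | Y l (V l s ω) ω = j} ∩ E) := by
      ext ω
      simp
    rw [this]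
    exact @MeasurableSet.biUnion _ _ (multiPast Y w) _ _ A.to_countable fun j _ => hN s hs l j
  exact hle B hB

end Stopping

end ModeDriven

/-! ### Predictable processes as limits of elementary ones -/

section PredLim

variable {Ω : Type*} {mΩ : MeasurableSpace Ω} {F : Filtration ℝ≥0 mΩ}

/-- Elementary predictable processes with partition points `G`: on an interval `(a, b]` without
partition point in its interior the process does not depend on time, takes finitely many values and
is determined by `F a`. -/
def IsElementary (F : Filtration ℝ≥0 mΩ) (G : Finset ℝ≥0) {E : Type*} (θ : ℝ≥0 → Ω → E) : Prop :=
  ∀ a b, a < b → (∀ g ∈ G, g ≤ a ∨ b ≤ g) →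
    (∀ s ∈ Set.Ioc a b, ∀ ω, θ s ω = θ b ω) ∧ (Set.range (θ b)).Finite ∧
      ∀ y, MeasurableSet[F a] {ω | θ b ω = y}

/-- The smallest class of processes that contains the elementary ones and is closed under pointwise
limits of sequences. -/
inductive PredLim (F : Filtration ℝ≥0 mΩ) {E : Type*} [TopologicalSpace E] :
    (ℝ≥0 → Ω → E) → Prop
  | elem (G : Finset ℝ≥0) (θ : ℝ≥0 → Ω → E) (h : IsElementary F G θ) : PredLim F θ
  | lim (θn : ℕ → ℝ≥0 → Ω → E) (θ : ℝ≥0 → Ω → E) (h : ∀ n, PredLim F (θn n))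
      (hlim : ∀ s ω, Tendsto (fun n => θn n s ω) atTop (𝓝 (θ s ω))) : PredLim F θ

namespace IsElementary

variable {E E' E'' : Type*} {G G' : Finset ℝ≥0}

lemma map₂ {θ : ℝ≥0 → Ω → E} {η : ℝ≥0 → Ω → E'} (hθ : IsElementary F G θ)
    (hη : IsElementary F G' η) (f : E → E' → E'') :
    IsElementary F (G ∪ G') fun s ω => f (θ s ω) (η s ω) := by
  intro a b hab hG
  obtain ⟨h1, h2, h3⟩ := hθ a b hab fun g hg => hG g (Finset.mem_union_left _ hg)
  obtain ⟨k1, k2, k3⟩ := hη a b hab fun g hg => hG g (Finset.mem_union_right _ hg)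
  refine ⟨fun s hs ω => by simp only [h1 s hs, k1 s hs], ?_, fun y => ?_⟩
  · refine ((h2.prod k2).image fun p => f p.1 p.2).subset ?_
    rintro _ ⟨ω, rfl⟩
    exact ⟨(θ b ω, η b ω), ⟨⟨ω, rfl⟩, ⟨ω, rfl⟩⟩, rfl⟩
  · have : {ω | f (θ b ω) (η b ω) = y} =
        ⋃ p ∈ (Set.range (θ b) ×ˢ Set.range (η b)) ∩ {p | f p.1 p.2 = y},
          ({ω | θ b ω = p.1} ∩ {ω | η b ω = p.2}) := by
      ext ω
      simp only [Set.mem_ofPred_eq, Set.mem_iUnion, Set.mem_inter_iff, Set.mem_prod]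
      constructor
      · intro h
        exact ⟨(θ b ω, η b ω), ⟨⟨⟨ω, rfl⟩, ⟨ω, rfl⟩⟩, h⟩, rfl, rfl⟩
      · rintro ⟨p, ⟨-, hp⟩, e1, e2⟩
        rw [e1, e2]; exact hp
    rw [this]
    exact ((h2.prod k2).inter_of_left _).measurableSet_biUnion fun p _ =>
      @MeasurableSet.inter _ (F a) _ _ (h3 p.1) (k3 p.2)

lemma map {θ : ℝ≥0 → Ω → E} (hθ : IsElementary F G θ) (f : E → E') :
    IsElementary F G fun s ω => f (θ s ω) := by
  have := hθ.map₂ hθ fun x _ => f x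
  rwa [Finset.union_self] at this

end IsElementary

lemma isElementary_const {E : Type*} (y : E) : IsElementary F ∅ fun (_ : ℝ≥0) (_ : Ω) => y := by
  intro a b _ _
  refine ⟨fun _ _ _ => rfl, ?_, fun y' => ?_⟩
  · exact (Set.finite_singleton y).subset (by rintro _ ⟨_, rfl⟩; rfl)
  · exact MeasurableSet.const _

lemma predLim_const {E : Type*} [TopologicalSpace E] (y : E) :
    PredLim F fun (_ : ℝ≥0) (_ : Ω) => y :=
  .elem ∅ _ (isElementary_const y)

namespace PredLim

variable {E E' E'' : Type*} [TopologicalSpace E] [TopologicalSpace E'] [TopologicalSpace E'']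

lemma map {θ : ℝ≥0 → Ω → E} (hθ : PredLim F θ) {f : E → E'} (hf : Continuous f) :
    PredLim F fun s ω => f (θ s ω) := by
  induction hθ with
  | elem G θ h => exact .elem G _ (h.map f)
  | lim θn θ _ hlim ih =>
    exact .lim _ _ ih fun s ω => (hf.tendsto _).comp (hlim s ω)

lemma map₂ {θ : ℝ≥0 → Ω → E} {η : ℝ≥0 → Ω → E'} (hθ : PredLim F θ) (hη : PredLim F η)
    {f : E → E' → E''} (hf : Continuous fun p : E × E' => f p.1 p.2) :
    PredLim F fun s ω => f (θ s ω) (η s ω) := by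
  induction hθ with
  | elem G θ h =>
    induction hη with
    | elem G' η h' => exact .elem (G ∪ G') _ (h.map₂ h' f)
    | lim ηn η _ hlim ih =>
      refine .lim _ _ ih fun s ω => ?_
      exact (hf.tendsto (θ s ω, η s ω)).comp (tendsto_const_nhds.prodMk_nhds (hlim s ω))
  | lim θn θ _ hlim ih =>
    refine .lim _ _ ih fun s ω => ?_
    exact (hf.tendsto (θ s ω, η s ω)).comp ((hlim s ω).prodMk_nhds tendsto_const_nhds)

/-- The indicators of predictable sets are limits of elementary processes. -/
lemma indicator {S : Set (ℝ≥0 × Ω)} (hS : MeasurableSet[F.predictable] S) :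
    PredLim F fun s ω => S.indicator (fun _ => (1 : ℝ)) (s, ω) := by
  classical
  -- the sets with this property form a σ-algebra that contains the generating rectangles
  let m : MeasurableSpace (ℝ≥0 × Ω) :=
    { MeasurableSet' := fun S => PredLim F fun s ω => S.indicator (fun _ => (1 : ℝ)) (s, ω)
      measurableSet_empty := by
        simp only [Set.indicator_empty]
        exact predLim_const 0
      measurableSet_compl := fun S hS => by
        have := hS.map (f := fun x : ℝ => 1 - x) (by fun_prop)
        convert this using 3 with s ω
        by_cases h : (s, ω) ∈ S <;> simp [h]
      measurableSet_iUnion := fun f hf => by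
        have hfin : ∀ n : ℕ, PredLim F fun s ω =>
            (⋃ i ∈ Finset.range n, f i).indicator (fun _ => (1 : ℝ)) (s, ω) := by
          intro n
          induction n with
          | zero =>
            simp only [Finset.range_zero, Finset.notMem_empty, Set.iUnion_of_empty,
              Set.iUnion_empty, Set.indicator_empty]
            exact predLim_const 0
          | succ n ih =>
            have := (hf n).map₂ ih (f := fun x y : ℝ => max x y) (by fun_prop)
            convert this using 3 with s ω
            rw [Finset.range_add_one, Finset.set_biUnion_insert]
            generalize (⋃ i ∈ Finset.range n, f i) = T
            by_cases h1 : (s, ω) ∈ f n <;> by_cases h2 : (s, ω) ∈ T <;>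
              simp [Set.indicator, h1, h2]
        refine .lim _ _ hfin fun s ω => ?_
        by_cases h : (s, ω) ∈ ⋃ i, f i
        · obtain ⟨i, hi⟩ := Set.mem_iUnion.1 h
          refine tendsto_const_nhds.congr' ?_
          filter_upwards [eventually_gt_atTop i] with n hn
          rw [Set.indicator_of_mem h, Set.indicator_of_mem]
          exact Set.mem_biUnion (Finset.mem_range.2 hn) hi
        · refine tendsto_const_nhds.congr fun n => ?_
          rw [Set.indicator_of_notMem h, Set.indicator_of_notMem]
          exact fun h' => h (Set.iUnion₂_subset_iUnion _ _ h') }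
  have hle : F.predictable ≤ m := by
    apply measurableSpace_le_predictable_of_measurableSet
    · intro A _
      refine .elem ∅ _ fun a b hab _ => ?_
      have h0 : ∀ s, a < s → ∀ ω : Ω,
          (({⊥} : Set ℝ≥0) ×ˢ A).indicator (fun _ => (1 : ℝ)) (s, ω) = 0 := fun s hs ω => by
        apply Set.indicator_of_notMem
        rintro ⟨h1, -⟩
        have h1' : s = ⊥ := h1
        rw [h1'] at hs
        exact absurd hs not_lt_bot
      simp only [h0 b hab]
      refine ⟨fun s hs ω => h0 s hs.1 ω, ?_, fun y => MeasurableSet.const _⟩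
      exact (Set.finite_singleton 0).subset (by rintro _ ⟨_, rfl⟩; rfl)
    · intro i A hA
      refine .elem {i} _ fun a b hab hG => ?_
      rcases hG i (Finset.mem_singleton_self i) with h | h
      · have h1 : ∀ s, a < s → ∀ ω : Ω, (Set.Ioi i ×ˢ A).indicator (fun _ => (1 : ℝ)) (s, ω) =
            A.indicator (fun _ => (1 : ℝ)) ω := fun s hs ω => by
          have : s ∈ Set.Ioi i := h.trans_lt hs
          by_cases hω : ω ∈ A
          · rw [Set.indicator_of_mem hω, Set.indicator_of_mem (Set.mk_mem_prod this hω)]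
          · rw [Set.indicator_of_notMem hω, Set.indicator_of_notMem fun h => hω h.2]
        simp only [h1 b hab]
        refine ⟨fun s hs ω => h1 s hs.1 ω, ?_, fun y => ?_⟩
        · refine (Set.toFinite {0, 1}).subset ?_
          rintro _ ⟨ω, rfl⟩
          by_cases hω : ω ∈ A <;> simp [hω]
        · have hm : Measurable[F a] (A.indicator fun _ => (1 : ℝ)) :=
            measurable_const.indicator (F.mono h _ hA)
          exact hm (measurableSet_singleton y)
      · have h0 : ∀ s, s ≤ b → ∀ ω : Ω, (Set.Ioi i ×ˢ A).indicator (fun _ => (1 : ℝ)) (s, ω) = 0 :=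
          fun s hs ω => Set.indicator_of_notMem (fun h' => absurd h'.1 (not_lt.2 (hs.trans h))) _
        simp only [h0 b le_rfl]
        refine ⟨fun s hs ω => h0 s hs.2 ω, ?_, fun y => MeasurableSet.const _⟩
        exact (Set.finite_singleton 0).subset (by rintro _ ⟨_, rfl⟩; rfl)
  exact hle S hS

lemma finsetSum {ι : Type*} (s : Finset ι) {θ : ι → ℝ≥0 → Ω → E} [AddCommMonoid E]
    [ContinuousAdd E] (h : ∀ i ∈ s, PredLim F (θ i)) :
    PredLim F fun t ω => ∑ i ∈ s, θ i t ω := by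
  classical
  induction s using Finset.induction_on with
  | empty => simpa using predLim_const 0
  | insert i s hi ih =>
    simp only [Finset.sum_insert hi]
    exact (h i (Finset.mem_insert_self i s)).map₂
      (ih fun j hj => h j (Finset.mem_insert_of_mem hj)) (f := fun x y => x + y) continuous_add

/-- Every real predictable process is a limit of elementary ones. -/
lemma of_predictable {θ : ℝ≥0 → Ω → ℝ}
    (hθ : Measurable[F.predictable] fun p : ℝ≥0 × Ω => θ p.1 p.2) : PredLim F θ := by
  have hs : StronglyMeasurable[F.predictable] fun p : ℝ≥0 × Ω => θ p.1 p.2 :=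
    @Measurable.stronglyMeasurable _ _ _ F.predictable _ _ _ _ _ hθ
  refine .lim (fun n s ω => hs.approx n (s, ω)) θ (fun n => ?_) fun s ω => hs.tendsto_approx (s, ω)
  have heq : (fun s ω => hs.approx n (s, ω)) = fun (s : ℝ≥0) (ω : Ω) =>
      ∑ y ∈ @SimpleFunc.range _ _ F.predictable (hs.approx n),
        y * (hs.approx n ⁻¹' {y}).indicator (fun _ => (1 : ℝ)) (s, ω) := by
    ext s ω
    rw [Finset.sum_eq_single (hs.approx n (s, ω))]
    · rw [Set.indicator_of_mem (by simp), mul_one]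
    · intro y _ hy
      rw [Set.indicator_of_notMem (by simpa using hy.symm), mul_zero]
    · intro h
      exact absurd (@SimpleFunc.mem_range_self _ _ F.predictable (hs.approx n) (s, ω)) h
  rw [heq]
  refine finsetSum _ fun y _ => ?_
  exact (indicator (@SimpleFunc.measurableSet_fiber _ _ F.predictable (hs.approx n) y)).map
    (f := fun x => y * x) (by fun_prop)

lemma pi {L : Type*} [Fintype L] {θ : L → ℝ≥0 → Ω → ℝ} (h : ∀ l, PredLim F (θ l)) :
    PredLim F fun s ω l => θ l s ω := by
  classical
  have : (fun s ω l => θ l s ω) =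
      fun s ω => ∑ l, (fun l' => if l' = l then θ l s ω else 0 : L → ℝ) := by
    ext s ω l
    simp
  rw [this]
  refine finsetSum _ fun l _ =>
    (h l).map (f := fun x : ℝ => (fun l' => if l' = l then x else 0 : L → ℝ)) ?_
  refine continuous_pi fun l' => ?_
  split_ifs
  · exact continuous_id
  · exact continuous_const

end PredLim

/-- A property of time intervals that holds between neighbouring partition points and is compatible
with concatenation holds for all intervals. -/
lemma interval_induction {p : ℝ≥0 → ℝ≥0 → Prop} (G : Finset ℝ≥0)
    (base : ∀ a b, a < b → (∀ g ∈ G, g ≤ a ∨ b ≤ g) → p a b)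
    (step : ∀ a g b, a < g → g < b → p a g → p g b → p a b) (a b : ℝ≥0) (hab : a < b) : p a b := by
  classical
  induction hn : (G.filter fun g => a < g ∧ g < b).card using Nat.strong_induction_on
    generalizing a b with
  | _ n ih =>
    by_cases h : ∀ g ∈ G, g ≤ a ∨ b ≤ g
    · exact base a b hab h
    push Not at h
    obtain ⟨g, hg, hag, hgb⟩ := h
    refine step a g b hag hgb (ih _ ?_ a g hag rfl) (ih _ ?_ g b hgb rfl)
    · rw [← hn]
      refine Finset.card_lt_card ((Finset.ssubset_iff_of_subset ?_).2
        ⟨g, Finset.mem_filter.2 ⟨hg, hag, hgb⟩, by simp⟩)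
      intro x hx
      obtain ⟨h1, h2, h3⟩ := Finset.mem_filter.1 hx
      exact Finset.mem_filter.2 ⟨h1, h2, h3.trans hgb⟩
    · rw [← hn]
      refine Finset.card_lt_card ((Finset.ssubset_iff_of_subset ?_).2
        ⟨g, Finset.mem_filter.2 ⟨hg, hag, hgb⟩, by simp⟩)
      intro x hx
      obtain ⟨h1, h2, h3⟩ := Finset.mem_filter.1 hx
      exact Finset.mem_filter.2 ⟨h1, hag.trans h2, h3⟩

end PredLim

/-! ### Exponential supermartingales of predictable integrands -/

section Joint

variable {Ω : Type*} {mΩ : MeasurableSpace Ω} {F : Filtration ℝ≥0 mΩ}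

lemma measurable_indicator_Ioc {g : Ω → ℝ} (hg : Measurable g) (a b : ℝ≥0) :
    Measurable fun p : ℝ≥0 × Ω => (Set.Ioc a b).indicator (fun _ => g p.2) p.1 := by
  have : (fun p : ℝ≥0 × Ω => (Set.Ioc a b).indicator (fun _ => g p.2) p.1) =
      (Set.Ioc a b ×ˢ Set.univ).indicator fun p => g p.2 := by
    ext p
    by_cases h : p.1 ∈ Set.Ioc a b
    · rw [Set.indicator_of_mem h, Set.indicator_of_mem (Set.mk_mem_prod h (Set.mem_univ _))]
    · rw [Set.indicator_of_notMem h, Set.indicator_of_notMem fun h' => h h'.1]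
  rw [this]
  exact (hg.comp measurable_snd).indicator (measurableSet_Ioc.prod .univ)

lemma measurable_comp_mul {f g : Ω → ℝ} {φ : ℝ → ℝ} (hφ : Measurable φ) (hf : Measurable f)
    (hg : Measurable g) : Measurable fun ω => φ (f ω) * g ω :=
  (hφ.comp hf).mul hg

lemma measurable_add_real {f g : Ω → ℝ} (hf : Measurable f) (hg : Measurable g) :
    Measurable fun ω => f ω + g ω :=
  hf.add hg

lemma measurable_setIntegral_prod {f : ℝ≥0 × Ω → ℝ} (hf : Measurable f) (s : Set ℝ≥0) :
    Measurable fun ω => ∫ t in s, f (t, ω) ∂leb :=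
  (hf.stronglyMeasurable.integral_prod_left' (μ := leb.restrict s)).measurable

lemma measurable_stopped_of_rightCont {u : ℝ≥0 → Ω → ℝ} {b : ℝ≥0}
    (hu : ∀ t ≤ b, Measurable (u t))
    (hr : ∀ ω t, ContinuousWithinAt (fun s => u s ω) (Set.Ici t) t) :
    Measurable fun p : ℝ≥0 × Ω => u (min p.1 b) p.2 := by
  have := measurable_eval_of_rightCont (Ω := ℝ≥0 × Ω) (f := fun t p => u (min t b) p.2)
    (fun t => (hu _ (min_le_right _ _)).comp measurable_snd) (fun p t => ?_)
    (R := fun p => p.1) measurable_fst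
  · exact this
  · have h1 : ContinuousWithinAt (fun s : ℝ≥0 => min s b) (Set.Ici t) t := by fun_prop
    exact ContinuousWithinAt.comp (f := fun s : ℝ≥0 => min s b) (g := fun s => u s p.2)
      (t := Set.Ici (min t b)) (hr p.2 (min t b)) h1 fun s hs => min_le_min_right b hs

lemma IsElementary.measurable {G : Finset ℝ≥0} {θ : ℝ≥0 → Ω → ℝ} (h : IsElementary F G θ)
    {a b : ℝ≥0} (hab : a < b) (hG : ∀ g ∈ G, g ≤ a ∨ b ≤ g) : Measurable[F a] (θ b) := by
  obtain ⟨-, h2, h3⟩ := h a b hab hG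
  intro s _
  have : θ b ⁻¹' s = ⋃ y ∈ Set.range (θ b) ∩ s, {ω | θ b ω = y} := by
    ext ω
    simp
  rw [this]
  exact (h2.inter_of_left s).measurableSet_biUnion fun y _ => h3 y

/-- On every interval `(a, b]`, a limit of elementary processes is jointly measurable in time and
in the information available at time `b`. -/
lemma PredLim.measurable_indicator {θ : ℝ≥0 → Ω → ℝ} (hθ : PredLim F θ) {a b : ℝ≥0} (hab : a < b) :
    @Measurable (ℝ≥0 × Ω) ℝ (@Prod.instMeasurableSpace _ _ _ (F b)) _
      fun p => (Set.Ioc a b).indicator (fun s => θ s p.2) p.1 := by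
  induction hθ with
  | elem G θ h =>
    refine interval_induction G (p := fun a b =>
      @Measurable (ℝ≥0 × Ω) ℝ (@Prod.instMeasurableSpace _ _ _ (F b)) _
        fun p => (Set.Ioc a b).indicator (fun s => θ s p.2) p.1) ?_ ?_ a b hab
    · intro a b hab hG
      have h1 := (h a b hab hG).1
      have h2 : Measurable[F b] (θ b) := (h.measurable hab hG).mono (F.mono hab.le) le_rfl
      have h3 := @measurable_indicator_Ioc Ω (F b) _ h2 a b
      convert h3 using 2 with p
      by_cases hp : p.1 ∈ Set.Ioc a b
      · rw [Set.indicator_of_mem hp, Set.indicator_of_mem hp, h1 _ hp]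
      · rw [Set.indicator_of_notMem hp, Set.indicator_of_notMem hp]
    · intro a g b hag hgb h1 h2
      have h1' := h1.mono (sup_le_sup le_rfl (MeasurableSpace.comap_mono (F.mono hgb.le))) le_rfl
      have h3 := @measurable_add_real _ (@Prod.instMeasurableSpace _ _ _ (F b)) _ _ h1' h2
      convert h3 using 2 with p
      rw [← Set.Ioc_union_Ioc_eq_Ioc hag.le hgb.le, Set.indicator_union_of_disjoint]
      rw [Set.disjoint_left]
      exact fun s hs hs' => absurd hs'.1 (not_lt.2 hs.2)
  | lim θn θ _ hlim ih =>
    refine @measurable_of_tendsto_metrizable _ _ (@Prod.instMeasurableSpace _ _ _ (F b)) _ _ _ _ _ _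
      ih ?_
    rw [tendsto_pi_nhds]
    rintro ⟨s, ω⟩
    by_cases hs : s ∈ Set.Ioc a b
    · simp only [Set.indicator_of_mem hs]
      exact hlim s ω
    · simp only [Set.indicator_of_notMem hs]
      exact tendsto_const_nhds

lemma lintegral_le_of_tendsto {μ : Measure Ω} {f : ℕ → Ω → ℝ≥0∞} {g : Ω → ℝ≥0∞} {C : ℝ≥0∞}
    (hf : ∀ n, Measurable (f n)) (hlim : ∀ᵐ ω ∂μ, Tendsto (fun n => f n ω) atTop (𝓝 (g ω)))
    (hC : ∀ n, ∫⁻ ω, f n ω ∂μ ≤ C) : ∫⁻ ω, g ω ∂μ ≤ C := by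
  calc ∫⁻ ω, g ω ∂μ = ∫⁻ ω, liminf (fun n => f n ω) atTop ∂μ :=
        lintegral_congr_ae (hlim.mono fun ω h => h.liminf_eq.symm)
    _ ≤ liminf (fun n => ∫⁻ ω, f n ω ∂μ) atTop := lintegral_liminf_le hf
    _ ≤ C := liminf_le_of_le (by isBoundedDefault) fun b hb => by
        obtain ⟨n, hn⟩ := hb.exists
        exact hn.trans (hC n)

end Joint

section ExpSystem

variable {Ω : Type*} {mΩ : MeasurableSpace Ω} {L : Type*} [Fintype L]

/-- The logarithm of the exponential process over `(a, b]` with integrands `η · · l`: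
`∑ l, (∫ η dN l - r l ∫ (exp η - 1) u l ds)`. -/
def expo (N : L → ℝ≥0 → Ω → ℕ) (u : L → ℝ≥0 → Ω → ℝ) (r : L → ℝ≥0) (η : ℝ≥0 → Ω → L → ℝ)
    (a b : ℝ≥0) (ω : Ω) : ℝ :=
  ∑ l, (jumpSum (fun s => N l s ω) (fun s => η s ω l) a b -
    r l * ∫ s in Set.Ioc a b, (Real.exp (η s ω l) - 1) * u l s ω ∂leb)

/-- Counting processes `N l` on a filtered probability space with intensities `r l * u l`, where
`0 ≤ u l ≤ 1`; the intensities are encoded by the exponential martingales with constant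
integrands. -/
structure ExpSystem (F : Filtration ℝ≥0 mΩ) (P : Measure Ω) (N : L → ℝ≥0 → Ω → ℕ)
    (u : L → ℝ≥0 → Ω → ℝ) (r : L → ℝ≥0) : Prop where
  path : ∀ l ω, IsCountingPath fun s => N l s ω
  count_zero : ∀ l ω, N l 0 ω = 0
  measurable_count : ∀ l t, Measurable[F t] (N l t)
  nonneg : ∀ l t ω, 0 ≤ u l t ω
  le_one : ∀ l t ω, u l t ω ≤ 1
  rightCont : ∀ l ω t, ContinuousWithinAt (fun s => u l s ω) (Set.Ici t) t
  measurable_speed : ∀ l t, Measurable[F t] (u l t)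
  lintegral_exp : ∀ (c : L → ℝ) (a b : ℝ≥0), a < b → ∀ ξ : Ω → ℝ≥0∞, Measurable[F a] ξ →
    ∫⁻ ω, ξ ω * ENNReal.ofReal (Real.exp (expo N u r (fun _ _ => c) a b ω)) ∂P = ∫⁻ ω, ξ ω ∂P

namespace ExpSystem

variable {F : Filtration ℝ≥0 mΩ} {P : Measure Ω} {N : L → ℝ≥0 → Ω → ℕ} {u : L → ℝ≥0 → Ω → ℝ}
  {r : L → ℝ≥0} (S : ExpSystem F P N u r)
include S

lemma measurable_stopped (l : L) (b : ℝ≥0) :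
    @Measurable (ℝ≥0 × Ω) ℝ (@Prod.instMeasurableSpace _ _ _ (F b)) _
      fun p => u l (min p.1 b) p.2 :=
  @measurable_stopped_of_rightCont Ω (F b) (u l) b
    (fun t ht => (S.measurable_speed l t).mono (F.mono ht) le_rfl) (S.rightCont l)

lemma measurable_jumpSum {θ : ℝ≥0 → Ω → ℝ} (hθ : PredLim F θ) (l : L) {a b : ℝ≥0} (hab : a < b) :
    Measurable[F b] fun ω => jumpSum (fun s => N l s ω) (fun s => θ s ω) a b := by
  induction hθ with
  | elem G θ h =>
    refine interval_induction G (p := fun a b => Measurable[F b] fun ω =>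
      jumpSum (fun s => N l s ω) (fun s => θ s ω) a b) ?_ ?_ a b hab
    · intro a b hab hG
      have h1 := (h a b hab hG).1
      have h2 : Measurable[F b] (θ b) := (h.measurable hab hG).mono (F.mono hab.le) le_rfl
      have h3 : ∀ t ≤ b, Measurable[F b] fun ω => (N l t ω : ℝ) := fun t ht =>
        (measurable_of_countable fun k : ℕ => (k : ℝ)).comp
          ((S.measurable_count l t).mono (F.mono ht) le_rfl)
      have h4 := h2.mul ((h3 b le_rfl).sub (h3 a hab.le))
      convert h4 using 2 with ω
      exact jumpSum_of_const (S.path l ω) hab.le fun s hs => h1 s hs ω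
    · intro a g b hag hgb h1 h2
      have h3 := (h1.mono (F.mono hgb.le) le_rfl).add h2
      convert h3 using 2 with ω
      exact jumpSum_add_adjacent (S.path l ω) _ hag.le hgb.le
  | lim θn θ _ hlim ih =>
    refine @measurable_of_tendsto_metrizable _ _ (F b) _ _ _ _ _ _ ih ?_
    rw [tendsto_pi_nhds]
    exact fun ω => tendsto_jumpSum (S.path l ω) fun s _ => hlim s ω

lemma measurable_integral {θ : ℝ≥0 → Ω → ℝ} (hθ : PredLim F θ) (l : L) {φ : ℝ → ℝ}
    (hφ : Measurable φ) {a b : ℝ≥0} (hab : a < b) :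
    Measurable[F b] fun ω => ∫ s in Set.Ioc a b, φ (θ s ω) * u l s ω ∂leb := by
  have h1 := @measurable_comp_mul _ (@Prod.instMeasurableSpace _ _ _ (F b)) _ _ φ
    hφ (hθ.measurable_indicator hab) (S.measurable_stopped l b)
  have h2 := @measurable_setIntegral_prod Ω (F b) _ h1 (Set.Ioc a b)
  convert h2 using 2 with ω
  refine setIntegral_congr_fun measurableSet_Ioc fun s hs => ?_
  simp [Set.indicator_of_mem hs, min_eq_left hs.2]

lemma aestronglyMeasurable {θ : ℝ≥0 → Ω → ℝ} (hθ : PredLim F θ) (l : L) {φ : ℝ → ℝ}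
    (hφ : Measurable φ) {a b : ℝ≥0} (hab : a < b) (ω : Ω) :
    AEStronglyMeasurable (fun s => φ (θ s ω) * u l s ω) (leb.restrict (Set.Ioc a b)) := by
  have h1 := @measurable_comp_mul _ (@Prod.instMeasurableSpace _ _ _ (F b)) _ _ φ
    hφ (hθ.measurable_indicator hab) (S.measurable_stopped l b)
  have h2 := @Measurable.comp _ _ _ _ (@Prod.instMeasurableSpace _ _ _ (F b)) _ _ _ h1
    (@measurable_prodMk_right _ _ _ (F b) ω)
  refine AEStronglyMeasurable.congr h2.aestronglyMeasurable ?_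
  refine (ae_restrict_iff' measurableSet_Ioc).2 (ae_of_all _ fun s hs => ?_)
  simp [Set.indicator_of_mem hs, min_eq_left hs.2]

lemma measurable_expo {η : ℝ≥0 → Ω → L → ℝ} (hη : ∀ l, PredLim F fun s ω => η s ω l)
    {a b : ℝ≥0} (hab : a < b) : Measurable[F b] fun ω => expo N u r η a b ω := by
  unfold expo
  refine Finset.measurable_fun_sum _ fun l _ => ?_
  exact (S.measurable_jumpSum (hη l) l hab).sub
    ((S.measurable_integral (hη l) l (φ := fun x => Real.exp x - 1) (by fun_prop) hab).const_mul _)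

lemma integrableOn_of_bounded {η : ℝ≥0 → Ω → ℝ} (hη : PredLim F η) {c : ℝ}
    (hc : ∀ s ω, η s ω ≤ c) (l : L) {a b : ℝ≥0} (hab : a < b) (ω : Ω) :
    IntegrableOn (fun s => (Real.exp (η s ω) - 1) * u l s ω) (Set.Ioc a b) leb := by
  have : IsFiniteMeasure (leb.restrict (Set.Ioc a b)) := ⟨by
    rw [Measure.restrict_apply_univ, leb_Ioc]; exact ENNReal.coe_lt_top⟩
  refine Integrable.of_bound (C := Real.exp c + 1)
    (S.aestronglyMeasurable hη l (φ := fun x => Real.exp x - 1) (by fun_prop) hab ω)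
    (ae_of_all _ fun s => ?_)
  rw [norm_mul, Real.norm_eq_abs, Real.norm_eq_abs, abs_of_nonneg (S.nonneg l s ω)]
  have h1 := Real.exp_le_exp.2 (hc s ω)
  have h2 := Real.exp_pos (η s ω)
  have h3 : |Real.exp (η s ω) - 1| ≤ Real.exp c + 1 := by
    rw [abs_le]; constructor <;> linarith
  calc _ ≤ (Real.exp c + 1) * 1 :=
        mul_le_mul h3 (S.le_one l s ω) (S.nonneg l s ω) (by positivity)
    _ = _ := mul_one _

lemma expo_add {η : ℝ≥0 → Ω → L → ℝ} {a g b : ℝ≥0} (hag : a ≤ g) (hgb : g ≤ b) {ω : Ω}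
    (hint : ∀ l, IntegrableOn (fun s => (Real.exp (η s ω l) - 1) * u l s ω) (Set.Ioc a b) leb) :
    expo N u r η a b ω = expo N u r η a g ω + expo N u r η g b ω := by
  unfold expo
  rw [← Finset.sum_add_distrib]
  refine Finset.sum_congr rfl fun l _ => ?_
  rw [jumpSum_add_adjacent (S.path l ω) _ hag hgb, ← Set.Ioc_union_Ioc_eq_Ioc hag hgb,
    setIntegral_union _ measurableSet_Ioc]
  · ring
  · exact (hint l).mono_set (Set.Ioc_subset_Ioc_right hgb)
  · exact (hint l).mono_set (Set.Ioc_subset_Ioc_left hag)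
  · rw [Set.disjoint_left]
    exact fun s hs hs' => absurd hs'.1 (not_lt.2 hs.2)

/-- The exponential martingale property of an elementary integrand between neighbouring partition
points: there the integrand has finitely many values, and on the event that it equals `y`, which is
known at time `a`, the martingale with the constant parameter `y` applies. -/
lemma lintegral_exp_elementary_base {G : Finset ℝ≥0} {η : ℝ≥0 → Ω → L → ℝ}
    (h : IsElementary F G η) {a b : ℝ≥0} (hab : a < b) (hG : ∀ g ∈ G, g ≤ a ∨ b ≤ g)
    {ξ : Ω → ℝ≥0∞} (hξ : Measurable[F a] ξ) :
    ∫⁻ ω, ξ ω * ENNReal.ofReal (Real.exp (expo N u r η a b ω)) ∂P = ∫⁻ ω, ξ ω ∂P := by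
  classical
  obtain ⟨h1, h2, h3⟩ := h a b hab hG
  have key : ∀ f : Ω → ℝ≥0∞, Measurable f →
      ∫⁻ ω, f ω ∂P = ∑ y ∈ h2.toFinset, ∫⁻ ω, {ω | η b ω = y}.indicator f ω ∂P := by
    intro f hf
    rw [← lintegral_finsetSum _ fun y _ => hf.indicator (F.le a _ (h3 y))]
    refine lintegral_congr fun ω => ?_
    rw [Finset.sum_eq_single (η b ω)]
    · rw [Set.indicator_of_mem (by rfl)]
    · intro y _ hy
      exact Set.indicator_of_notMem (fun h => hy h.symm) _
    · intro h
      exact absurd (h2.mem_toFinset.2 ⟨ω, rfl⟩) h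
  have hη : ∀ l, PredLim F fun s ω => η s ω l := fun l =>
    (PredLim.elem G _ h).map (f := fun x : L → ℝ => x l) (continuous_apply l)
  have hm : Measurable fun ω => ξ ω * ENNReal.ofReal (Real.exp (expo N u r η a b ω)) :=
    (hξ.mono (F.le a) le_rfl).mul
      (((S.measurable_expo hη hab).mono (F.le b) le_rfl).exp.ennreal_ofReal)
  rw [key _ hm, key _ (hξ.mono (F.le a) le_rfl)]
  refine Finset.sum_congr rfl fun y _ => ?_
  rw [← S.lintegral_exp y a b hab _ (hξ.indicator (h3 y))]
  refine lintegral_congr fun ω => ?_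
  by_cases hω : η b ω = y
  · rw [Set.indicator_of_mem (by exact hω), Set.indicator_of_mem (by exact hω)]
    have hs : ∀ s ∈ Set.Ioc a b, η s ω = y := fun s hs => (h1 s hs ω).trans hω
    have hexpo : expo N u r η a b ω = expo N u r (fun _ _ => y) a b ω := by
      unfold expo
      refine Finset.sum_congr rfl fun l _ => ?_
      rw [jumpSum_congr (h := fun _ => y l) fun s h => by rw [hs s h]]
      congr 2
      exact setIntegral_congr_fun measurableSet_Ioc fun s h => by simp only [hs s h]
    rw [hexpo]
  · rw [Set.indicator_of_notMem (by exact hω), Set.indicator_of_notMem (by exact hω), zero_mul]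

/-- The exponential supermartingale inequality for elementary integrands. -/
lemma lintegral_exp_elementary_le {G : Finset ℝ≥0} {η : ℝ≥0 → Ω → L → ℝ}
    (h : IsElementary F G η) {c : ℝ} (hc : ∀ s ω l, η s ω l ≤ c) {a b : ℝ≥0} (hab : a < b)
    {ξ : Ω → ℝ≥0∞} (hξ : Measurable[F a] ξ) :
    ∫⁻ ω, ξ ω * ENNReal.ofReal (Real.exp (expo N u r η a b ω)) ∂P ≤ ∫⁻ ω, ξ ω ∂P := by
  have hη : ∀ l, PredLim F fun s ω => η s ω l := fun l =>
    (PredLim.elem G _ h).map (f := fun x : L → ℝ => x l) (continuous_apply l)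
  refine interval_induction G (p := fun a b => ∀ ξ : Ω → ℝ≥0∞, Measurable[F a] ξ →
    ∫⁻ ω, ξ ω * ENNReal.ofReal (Real.exp (expo N u r η a b ω)) ∂P ≤ ∫⁻ ω, ξ ω ∂P)
    (fun a b hab hG ξ hξ => (S.lintegral_exp_elementary_base h hab hG hξ).le) ?_ a b hab ξ hξ
  intro a g b hag hgb h1 h2 ξ hξ
  refine le_trans (le_of_eq ?_) ((h2 (fun ω => ξ ω * ENNReal.ofReal
    (Real.exp (expo N u r η a g ω))) ?_).trans (h1 ξ hξ))
  · refine lintegral_congr fun ω => ?_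
    rw [S.expo_add hag.le hgb.le fun l =>
      S.integrableOn_of_bounded (hη l) (fun s ω => hc s ω l) l (hag.trans hgb) ω, Real.exp_add,
      ENNReal.ofReal_mul (Real.exp_pos _).le, mul_assoc]
  · exact (hξ.mono (F.mono hag.le) le_rfl).mul ((S.measurable_expo hη hag).exp.ennreal_ofReal)

lemma tendsto_expo {ηn : ℕ → ℝ≥0 → Ω → L → ℝ} {η : ℝ≥0 → Ω → L → ℝ}
    (hη : ∀ n l, PredLim F fun s ω => ηn n s ω l) {a b : ℝ≥0} (hab : a < b) {ω : Ω}
    (hlim : ∀ s l, Tendsto (fun n => ηn n s ω l) atTop (𝓝 (η s ω l)))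
    {bound : L → ℝ≥0 → ℝ} (hb : ∀ l, IntegrableOn (bound l) (Set.Ioc a b) leb)
    (hle : ∀ n s l, Real.exp (ηn n s ω l) + 1 ≤ bound l s) :
    Tendsto (fun n => expo N u r (ηn n) a b ω) atTop (𝓝 (expo N u r η a b ω)) := by
  unfold expo
  refine tendsto_finsetSum _ fun l _ => ?_
  refine (tendsto_jumpSum (S.path l ω) fun s _ => hlim s l).sub (Tendsto.const_mul _ ?_)
  refine tendsto_integral_of_dominated_convergence (bound l) (fun n =>
    S.aestronglyMeasurable (hη n l) l (φ := fun x => Real.exp x - 1) (by fun_prop) hab ω)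
    (hb l) (fun n => ae_of_all _ fun s => ?_) (ae_of_all _ fun s => ?_)
  · refine le_trans ?_ (hle n s l)
    rw [norm_mul, Real.norm_eq_abs, Real.norm_eq_abs, abs_of_nonneg (S.nonneg l s ω)]
    have h2 := Real.exp_pos (ηn n s ω l)
    have h3 : |Real.exp (ηn n s ω l) - 1| ≤ Real.exp (ηn n s ω l) + 1 := by
      rw [abs_le]; constructor <;> linarith
    calc _ ≤ (Real.exp (ηn n s ω l) + 1) * 1 :=
          mul_le_mul h3 (S.le_one l s ω) (S.nonneg l s ω) (by positivity)
      _ = _ := mul_one _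
  · exact (((Real.continuous_exp.tendsto _).comp (hlim s l)).sub_const 1).mul_const _

lemma measurable_mul_exp_expo {η : ℝ≥0 → Ω → L → ℝ} (hη : ∀ l, PredLim F fun s ω => η s ω l)
    {a b : ℝ≥0} (hab : a < b) {ξ : Ω → ℝ≥0∞} (hξ : Measurable[F a] ξ) :
    Measurable fun ω => ξ ω * ENNReal.ofReal (Real.exp (expo N u r η a b ω)) :=
  (hξ.mono (F.le a) le_rfl).mul (((S.measurable_expo hη hab).mono (F.le b) le_rfl).exp.ennreal_ofReal)

/-- The truncation of the integrands at level `c`. -/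
def _root_.RobustQueue.clip (c : ℝ) (x : L → ℝ) : L → ℝ := fun l => max (-c) (min c (x l))

omit [Fintype L] S in
lemma _root_.RobustQueue.continuous_clip (c : ℝ) : Continuous (clip (L := L) c) := by
  unfold clip; fun_prop

/-- The exponential supermartingale inequality for bounded limits of elementary integrands, by
Fatou's lemma. -/
lemma lintegral_exp_clip_le {η : ℝ≥0 → Ω → L → ℝ} (hη : PredLim F η) {c : ℝ} (hc : 0 ≤ c)
    {a b : ℝ≥0} (hab : a < b) {ξ : Ω → ℝ≥0∞} (hξ : Measurable[F a] ξ) :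
    ∫⁻ ω, ξ ω * ENNReal.ofReal (Real.exp (expo N u r (fun s ω => clip c (η s ω)) a b ω)) ∂P ≤
      ∫⁻ ω, ξ ω ∂P := by
  have hle : ∀ x : L → ℝ, ∀ l, clip c x l ≤ c := fun x l =>
    max_le (by linarith) (min_le_left _ _)
  induction hη with
  | elem G η h =>
    exact S.lintegral_exp_elementary_le (h.map (clip c)) (fun s ω l => hle _ l) hab hξ
  | lim ηn η hn hlim ih =>
    have hp : ∀ n l, PredLim F fun s ω => clip c (ηn n s ω) l := fun n l =>
      (hn n).map ((continuous_apply l).comp (continuous_clip c))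
    refine lintegral_le_of_tendsto (fun n => S.measurable_mul_exp_expo (hp n) hab hξ)
      (ae_of_all _ fun ω => ?_) ih
    have h1 := S.tendsto_expo hp hab (η := fun s ω => clip c (η s ω)) (ω := ω)
      (fun s l => (((continuous_apply l).comp (continuous_clip c)).tendsto _).comp (hlim s ω))
      (bound := fun _ _ => Real.exp c + 1) (fun l => integrableOn_const (by simp [leb_Ioc]))
      (fun n s l => by gcongr; exact hle _ l)
    exact ENNReal.Tendsto.const_mul (ENNReal.tendsto_ofReal ((Real.continuous_exp.tendsto _).comp h1))
      (Or.inl (by simp [Real.exp_pos]))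

/-- The exponential supermartingale inequality for predictable integrands whose intensities are
integrable. -/
theorem lintegral_exp_le {η : ℝ≥0 → Ω → L → ℝ} (hη : ∀ l, PredLim F fun s ω => η s ω l)
    {b : ℝ≥0} (hb : 0 < b)
    (hint : ∀ᵐ ω ∂P, ∀ l, IntegrableOn (fun s => Real.exp (η s ω l)) (Set.Ioc 0 b) leb)
    {ξ : Ω → ℝ≥0∞} (hξ : Measurable[F 0] ξ) :
    ∫⁻ ω, ξ ω * ENNReal.ofReal (Real.exp (expo N u r η 0 b ω)) ∂P ≤ ∫⁻ ω, ξ ω ∂P := by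
  have hv : PredLim F η := PredLim.pi hη
  have hp : ∀ (n : ℕ) l, PredLim F fun s ω => clip n (η s ω) l := fun n l =>
    hv.map ((continuous_apply l).comp (continuous_clip (n : ℝ)))
  -- the integrand is clipped to `[-n, n]`; its intensities stay below `exp η + 1`
  refine lintegral_le_of_tendsto (fun n => S.measurable_mul_exp_expo (hp n) hb hξ) ?_
    (fun n => S.lintegral_exp_clip_le hv n.cast_nonneg hb hξ)
  filter_upwards [hint] with ω hω
  have h1 := S.tendsto_expo hp hb (η := η) (ω := ω)
    (fun s l => ?_) (bound := fun l s => Real.exp (η s ω l) + 2) (fun l => ?_) (fun n s l => ?_)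
  · exact ENNReal.Tendsto.const_mul
      (ENNReal.tendsto_ofReal ((Real.continuous_exp.tendsto _).comp h1))
      (Or.inl (by simp [Real.exp_pos]))
  · refine tendsto_const_nhds.congr' ?_
    filter_upwards [eventually_ge_atTop ⌈|η s ω l|⌉₊] with n hn
    have h2 := abs_le.1 (Nat.ceil_le.1 hn)
    rw [clip, min_eq_right h2.2, max_eq_right h2.1]
  · exact (hω l).add (integrableOn_const (by simp [leb_Ioc]))
  · have h3 : Real.exp (clip n (η s ω) l) ≤ Real.exp (η s ω l) + 1 := by
      rcases le_total 0 (η s ω l) with h | h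
      · have : clip n (η s ω) l ≤ η s ω l :=
          max_le (by linarith [(Nat.cast_nonneg n : (0 : ℝ) ≤ n)]) (min_le_right _ _)
        linarith [Real.exp_le_exp.2 this]
      · have : clip n (η s ω) l ≤ 0 :=
          max_le (by linarith [(Nat.cast_nonneg n : (0 : ℝ) ≤ n)]) ((min_le_right _ _).trans h)
        linarith [Real.exp_le_one_iff.2 this, Real.exp_pos (η s ω l)]
    linarith

end ExpSystem

end ExpSystem

/-! ### Mode-driven time changes of independent Poisson processes -/

section ModeDrivenExp

variable {Ω : Type*} [mΩ : MeasurableSpace Ω] {P : Measure Ω}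
variable {L : Type*} [Fintype L] {𝒵 : Type*} [MeasurableSpace 𝒵] [DiscreteMeasurableSpace 𝒵]
  [Countable 𝒵]
variable {Y : L → ℝ≥0 → Ω → ℕ} {V : L → ℝ≥0 → Ω → ℝ≥0} {Z : ℝ≥0 → Ω → 𝒵} {r : L → ℝ≥0}
  {φ : 𝒵 → L → ℝ≥0} {step : 𝒵 → (L → ℕ) → 𝒵} {z₀ : 𝒵} {u : L → ℝ≥0 → Ω → ℝ}

lemma setIntegral_Iic_eq (f : ℝ≥0 → ℝ) (t : ℝ≥0) :
    ∫ s in Set.Iic t, f s ∂leb = ∫ s in Set.Ioc 0 t, f s ∂leb := by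
  have : Set.Iic t = {0} ∪ Set.Ioc 0 t := by
    ext s
    simp only [Set.mem_Iic, Set.singleton_union, Set.mem_insert_iff, Set.mem_Ioc]
    constructor
    · intro h
      rcases eq_or_ne s 0 with h0 | h0
      · exact Or.inl h0
      · exact Or.inr ⟨pos_iff_ne_zero.2 h0, h⟩
    · rintro (h | h)
      · rw [h]; exact zero_le
      · exact h.2
  rw [this]
  refine setIntegral_congr_set ?_
  refine union_ae_eq_right.2 ?_
  exact measure_mono_null Set.sdiff_subset (measure_singleton 0)

/-- Two densities that give the same mass to the sets of a sub-σ-algebra give the same integral to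
its measurable functions. -/
lemma lintegral_mul_eq_of_setLIntegral_eq {m : MeasurableSpace Ω} (hm : m ≤ mΩ) {f g : Ω → ℝ≥0∞}
    (hf : Measurable[mΩ] f) (hg : Measurable[mΩ] g)
    (h : ∀ B, MeasurableSet[m] B → ∫⁻ ω in B, f ω ∂P = ∫⁻ ω in B, g ω ∂P)
    {ζ : Ω → ℝ≥0∞} (hζ : Measurable[m] ζ) : ∫⁻ ω, f ω * ζ ω ∂P = ∫⁻ ω, g ω * ζ ω ∂P := by
  have h1 := lintegral_withDensity_eq_lintegral_mul P hf (hζ.mono hm le_rfl)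
  have h2 := lintegral_withDensity_eq_lintegral_mul P hg (hζ.mono hm le_rfl)
  simp only [Pi.mul_apply] at h1 h2
  rw [← h1, ← h2, ← lintegral_trim hm hζ, ← lintegral_trim hm hζ]
  congr 1
  refine @Measure.ext _ m _ _ fun B hB => ?_
  rw [trim_measurableSet_eq hm hB, trim_measurableSet_eq hm hB, withDensity_apply _ (hm B hB),
    withDensity_apply _ (hm B hB), h B hB]

/-- Independent Poisson processes run on clocks that are controlled by a mode process form a system
of counting processes with the speeds of the clocks as intensities. -/
theorem expSystem_of_modeDriven [IsProbabilityMeasure P] (hY : IsPoissonFamily Y r P)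
    (h : ∀ ω, ModeDriven φ step z₀ (fun l t => Y l t ω) (fun l t => V l t ω) fun t => Z t ω)
    {F : Filtration ℝ≥0 mΩ} (hF : ∀ t, F t = observed Y V t)
    (nonneg : ∀ l t ω, 0 ≤ u l t ω) (le_one : ∀ l t ω, u l t ω ≤ 1)
    (rightCont : ∀ l ω t, ContinuousWithinAt (fun s => u l s ω) (Set.Ici t) t)
    (hu : ∀ l t, Measurable[F t] (u l t))
    (hV : ∀ l t ω, (V l t ω : ℝ) = ∫ s in Set.Iic t, u l s ω ∂leb) :
    ExpSystem F P (fun l t ω => Y l (V l t ω) ω) u r := by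
  have hN : ∀ l t, Measurable[F t] fun ω => Y l (V l t ω) ω := by
    intro l t s hs
    rw [hF t]
    exact le_iSup_of_le (f := fun l => ⨆ s : ℝ≥0, ⨆ _ : s ≤ t,
      MeasurableSpace.comap (fun ω => Y l (V l s ω) ω) ⊤) l
      (le_iSup₂_of_le (f := fun (s : ℝ≥0) (_ : s ≤ t) =>
        MeasurableSpace.comap (fun ω => Y l (V l s ω) ω) ⊤) t le_rfl le_rfl) _ ⟨s, trivial, rfl⟩
  have hjoint : ∀ l b, @Measurable (ℝ≥0 × Ω) ℝ (@Prod.instMeasurableSpace _ _ _ (F b)) _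
      fun p => u l (min p.1 b) p.2 := fun l b =>
    @measurable_stopped_of_rightCont Ω (F b) (u l) b
      (fun t ht => (hu l t).mono (F.mono ht) le_rfl) (rightCont l)
  have hVm : ∀ l t, Measurable[F t] (V l t) := by
    intro l t
    have h1 := (@measurable_setIntegral_prod Ω (F t) _ (hjoint l t) (Set.Iic t)).real_toNNReal
    convert h1 using 2 with ω
    rw [← Real.toNNReal_coe (r := V l t ω), hV l t ω]
    congr 1
    exact setIntegral_congr_fun measurableSet_Iic fun s hs => by
      simp only [min_eq_left (show s ≤ t from hs)]
  have hint : ∀ l b ω, IntegrableOn (fun s => u l s ω) (Set.Iic b) leb := by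
    intro l b ω
    have h2 := @Measurable.comp _ _ _ _ (@Prod.instMeasurableSpace _ _ _ (F b)) _ _ _ (hjoint l b)
      (@measurable_prodMk_right _ _ _ (F b) ω)
    refine Integrable.of_bound (C := 1) (AEStronglyMeasurable.congr h2.aestronglyMeasurable ?_)
      (ae_of_all _ fun s => ?_)
    · refine (ae_restrict_iff' measurableSet_Iic).2 (ae_of_all _ fun s hs => ?_)
      simp [min_eq_left (show s ≤ b from hs)]
    · rw [Real.norm_eq_abs, abs_of_nonneg (nonneg l s ω)]
      exact le_one l s ω
  have hVle : ∀ l t ω, V l t ω ≤ t := by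
    intro l t ω
    rw [← NNReal.coe_le_coe, hV]
    calc ∫ s in Set.Iic t, u l s ω ∂leb ≤ ∫ s in Set.Iic t, (1 : ℝ) ∂leb :=
          setIntegral_mono (hint l t ω) (integrableOn_const (by simp [leb_Iic]))
            fun s => le_one l s ω
      _ = t := by simp [Measure.real, leb_Iic]
  have hVsub : ∀ l ω a b, a ≤ b → (V l b ω : ℝ) - V l a ω = ∫ s in Set.Ioc a b, u l s ω ∂leb := by
    intro l ω a b hab
    rw [hV, hV, ← Set.Iic_union_Ioc_eq_Iic hab, setIntegral_union _ measurableSet_Ioc]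
    · ring
    · exact hint l a ω
    · exact (hint l b ω).mono_set Set.Ioc_subset_Iic_self
    · rw [Set.disjoint_left]
      exact fun s hs hs' => absurd hs'.1 (not_lt.2 hs)
  refine ⟨fun l ω => (h ω).count l, fun l ω => ?_, hN, nonneg, le_one, rightCont, hu, ?_⟩
  · have := (h ω).clock_zero l
    rw [this, (hY.poisson l).zero]
  intro c a b hab ξ hξ
  -- the weights at the clock readings of time `t`
  let W : ℝ≥0 → Ω → ℝ≥0∞ := fun t ω => multiWeight Y r c (fun l => V l t ω) ω
  have hWexp : ∀ t ω, W t ω = ENNReal.ofReal (Real.exp (∑ l, (c l * (Y l (V l t ω) ω : ℝ) -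
      (Real.exp (c l) - 1) * (r l * V l t ω)))) := by
    intro t ω
    simp only [W, multiWeight, expWeight]
    rw [← ENNReal.ofReal_prod_of_nonneg fun l _ => (Real.exp_pos _).le, Real.exp_sum]
  have hWm : ∀ t, Measurable[F t] (W t) := by
    intro t
    have hsum : Measurable[F t] fun ω => ∑ l, (c l * (Y l (V l t ω) ω : ℝ) -
        (Real.exp (c l) - 1) * (r l * V l t ω)) := by
      refine Finset.measurable_fun_sum _ fun l _ => ?_
      have h1 : Measurable[F t] fun ω => (Y l (V l t ω) ω : ℝ) :=
        (measurable_of_countable fun k : ℕ => (k : ℝ)).comp (hN l t)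
      have h2 : Measurable[F t] fun ω => (V l t ω : ℝ) :=
        measurable_coe_nnreal_real.comp (hVm l t)
      exact (h1.const_mul _).sub ((h2.const_mul _).const_mul _)
    have := hsum.exp.ennreal_ofReal
    convert this using 2 with ω
    exact hWexp t ω
  -- optional stopping at the clock readings, which form a multi-parameter stopping time
  have hset : ∀ t ≤ b, ∀ B, MeasurableSet[F t] B → ∫⁻ ω in B, W t ω ∂P =
      ∫⁻ ω in B, multiWeight Y r c (fun _ => b + 1) ω ∂P := by
    intro t ht B hB
    refine setLIntegral_multiWeight_stopped hY c (fun l => (hVm l t).mono (F.le t) le_rfl)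
      (fun l ω => (hVle l t ω).trans ht) fun w => ?_
    rw [hF t] at hB
    exact measurableSet_observed_inter_clock_le h w hB
  have hsplit : ∀ ω, W b ω = W a ω * ENNReal.ofReal (Real.exp
      (expo (fun l t ω => Y l (V l t ω) ω) u r (fun _ _ => c) a b ω)) := by
    intro ω
    rw [hWexp, hWexp, ← ENNReal.ofReal_mul (Real.exp_pos _).le, ← Real.exp_add]
    congr 2
    unfold expo
    rw [← Finset.sum_add_distrib]
    refine Finset.sum_congr rfl fun l _ => ?_
    rw [jumpSum_of_const ((h ω).count l) hab.le fun _ _ => rfl, integral_const_mul,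
      ← hVsub l ω a b hab.le]
    ring
  have hW0 : ∀ t ω, W t ω ≠ 0 := fun t ω => by
    rw [hWexp]; simp [Real.exp_pos]
  have hWtop : ∀ t ω, W t ω ≠ ∞ := fun t ω => by
    rw [hWexp]; exact ENNReal.ofReal_ne_top
  -- dividing by the weight at time `a` leaves the exponential of the increment
  have hkey := lintegral_mul_eq_of_setLIntegral_eq (P := P) (F.le a) ((hWm b).mono (F.le b) le_rfl)
    ((hWm a).mono (F.le a) le_rfl) (fun B hB => by
      rw [hset b le_rfl B (F.mono hab.le B hB), hset a hab.le B hB])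
    (ζ := fun ω => (W a ω)⁻¹ * ξ ω) ((hWm a).inv.mul hξ)
  have e1 : ∀ ω, W b ω * ((W a ω)⁻¹ * ξ ω) = ξ ω * ENNReal.ofReal (Real.exp
      (expo (fun l t ω => Y l (V l t ω) ω) u r (fun _ _ => c) a b ω)) := by
    intro ω
    rw [hsplit, mul_right_comm, ← mul_assoc, ENNReal.mul_inv_cancel (hW0 a ω) (hWtop a ω), one_mul]
  have e2 : ∀ ω, W a ω * ((W a ω)⁻¹ * ξ ω) = ξ ω := by
    intro ω
    rw [← mul_assoc, ENNReal.mul_inv_cancel (hW0 a ω) (hWtop a ω), one_mul]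
  simpa only [e1, e2] using hkey

end ModeDrivenExp

/-! ### The queue under the generalized cμ rule as a mode-driven system -/

instance : Fintype Kind :=
  Fintype.ofEquiv Bool
    ⟨fun b => cond b Kind.A Kind.S, fun j => match j with
      | Kind.A => true
      | Kind.S => false, by rintro (_ | _) <;> rfl, by rintro (_ | _) <;> rfl⟩

lemma sum_streams {I : ℕ} {M : Type*} [AddCommMonoid M] (f : Kind × Fin I → M) :
    ∑ l, f l = ∑ i, f (Kind.A, i) + ∑ i, f (Kind.S, i) := by
  rw [Fintype.sum_prod_type]
  have h : ∀ g : Kind → M, ∑ j, g j = g Kind.A + g Kind.S := by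
    intro g
    have := Fintype.sum_equiv (⟨fun b => cond b Kind.A Kind.S, fun j => match j with
      | Kind.A => true
      | Kind.S => false, by rintro (_ | _) <;> rfl, by rintro (_ | _) <;> rfl⟩ : Bool ≃ Kind)
      (fun b => g (cond b Kind.A Kind.S)) g (fun _ => rfl)
    rw [← this, Fintype.sum_bool]
    rfl
  exact h _

namespace Queue

variable {I : ℕ} {D : Data I} {n : ℕ} {Ω : Type*} [mΩ : MeasurableSpace Ω] {P : Measure Ω}
  (q : Queue D n P)

/-- The driving Poisson processes, indexed by the streams. -/
def driving (l : Kind × Fin I) (t : ℝ≥0) (ω : Ω) : ℕ :=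
  match l.1 with
  | Kind.A => q.A l.2 t ω
  | Kind.S => q.S l.2 t ω

/-- The clocks of the streams: time for arrivals, busy time for services. -/
def clockTime (l : Kind × Fin I) (t : ℝ≥0) (ω : Ω) : ℝ≥0 :=
  match l.1 with
  | Kind.A => t
  | Kind.S => busyTime (q.U l.2) t ω

/-- The clock densities, indexed by the streams. -/
abbrev speed (l : Kind × Fin I) (t : ℝ≥0) (ω : Ω) : ℝ := q.clock l.1 l.2 t ω

/-- The observed counting processes, indexed by the streams. -/
abbrev counts (l : Kind × Fin I) (t : ℝ≥0) (ω : Ω) : ℕ := q.count l.1 l.2 t ω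

lemma driving_clockTime (l : Kind × Fin I) (t : ℝ≥0) (ω : Ω) :
    q.driving l (q.clockTime l t ω) ω = q.counts l t ω := by
  obtain ⟨j, i⟩ := l
  cases j <;> rfl

lemma isPoissonFamily : IsPoissonFamily q.driving (fun l => D.rate n l.1 l.2) P where
  poisson := by
    rintro ⟨j, i⟩
    cases j
    · exact q.poisson_A i
    · exact q.poisson_S i
  indep := q.indep

lemma filtration_eq_observed (t : ℝ≥0) : q.filtration t = observed q.driving q.clockTime t := by
  have : ∀ l s, (fun ω => q.driving l (q.clockTime l s ω) ω) = q.counts l s :=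
    fun l s => funext fun ω => q.driving_clockTime l s ω
  simp only [observed, this]
  rw [iSup_prod]
  rfl

section Paths

variable {q} (hq : q.Admissible)
include hq

lemma Admissible.effort_le_one (i : Fin I) (t : ℝ≥0) (ω : Ω) : q.U i t ω ≤ 1 :=
  (Finset.single_le_sum (f := fun i => q.U i t ω) (fun j _ => hq.nonneg j t ω)
    (Finset.mem_univ i)).trans (hq.sum_le_one t ω)

lemma Admissible.speed_nonneg (l : Kind × Fin I) (t : ℝ≥0) (ω : Ω) : 0 ≤ q.speed l t ω := by
  obtain ⟨j, i⟩ := l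
  cases j
  · exact zero_le_one
  · exact hq.nonneg i t ω

lemma Admissible.speed_le_one (l : Kind × Fin I) (t : ℝ≥0) (ω : Ω) : q.speed l t ω ≤ 1 := by
  obtain ⟨j, i⟩ := l
  cases j
  · exact le_rfl
  · exact hq.effort_le_one i t ω

lemma Admissible.speed_rightCont (l : Kind × Fin I) (ω : Ω) (t : ℝ≥0) :
    ContinuousWithinAt (fun s => q.speed l s ω) (Set.Ici t) t := by
  obtain ⟨j, i⟩ := l
  cases j
  · exact continuousWithinAt_const
  · exact hq.rightCont i ω t

lemma Admissible.measurable_speed (l : Kind × Fin I) (t : ℝ≥0) :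
    Measurable[q.filtration t] (q.speed l t) := by
  obtain ⟨j, i⟩ := l
  cases j
  · exact measurable_const
  · exact hq.adapted i t

lemma Admissible.measurable_speed_path (l : Kind × Fin I) (ω : Ω) :
    Measurable fun s => q.speed l s ω :=
  measurable_eval_of_rightCont (Ω := ℝ≥0) (f := fun t _ => q.speed l t ω)
    (fun _ => measurable_const) (fun _ t => hq.speed_rightCont l ω t) measurable_id'

lemma Admissible.integrableOn_speed (l : Kind × Fin I) (ω : Ω) (t : ℝ≥0) :
    IntegrableOn (fun s => q.speed l s ω) (Set.Iic t) leb :=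
  Integrable.of_bound (C := 1) (hq.measurable_speed_path l ω).aestronglyMeasurable
    (ae_of_all _ fun s => by
      rw [Real.norm_eq_abs, abs_of_nonneg (hq.speed_nonneg l s ω)]
      exact hq.speed_le_one l s ω)

lemma Admissible.clockTime_eq (l : Kind × Fin I) (t : ℝ≥0) (ω : Ω) :
    (q.clockTime l t ω : ℝ) = ∫ s in Set.Iic t, q.speed l s ω ∂leb := by
  obtain ⟨j, i⟩ := l
  cases j
  · change (t : ℝ) = ∫ s in Set.Iic t, (1 : ℝ) ∂leb
    simp [Measure.real, leb_Iic]
  · exact Real.coe_toNNReal _ (integral_nonneg fun s => hq.nonneg i s ω)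

lemma Admissible.clockTime_sub (l : Kind × Fin I) {a b : ℝ≥0} (hab : a ≤ b) (ω : Ω) :
    (q.clockTime l b ω : ℝ) - q.clockTime l a ω = ∫ s in Set.Ioc a b, q.speed l s ω ∂leb := by
  rw [hq.clockTime_eq, hq.clockTime_eq, ← Set.Iic_union_Ioc_eq_Iic hab,
    setIntegral_union _ measurableSet_Ioc]
  · ring
  · exact hq.integrableOn_speed l ω a
  · exact (hq.integrableOn_speed l ω b).mono_set Set.Ioc_subset_Iic_self
  · rw [Set.disjoint_left]
    exact fun s hs hs' => absurd hs'.1 (not_lt.2 hs)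

lemma Admissible.clockTime_mono (l : Kind × Fin I) (ω : Ω) : Monotone fun t => q.clockTime l t ω := by
  intro a b hab
  have := hq.clockTime_sub l hab ω
  have h2 : 0 ≤ ∫ s in Set.Ioc a b, q.speed l s ω ∂leb :=
    integral_nonneg fun s => hq.speed_nonneg l s ω
  exact NNReal.coe_le_coe.1 (by linarith)

lemma Admissible.clockTime_sub_le (l : Kind × Fin I) {a b : ℝ≥0} (hab : a ≤ b) (ω : Ω) :
    (q.clockTime l b ω : ℝ) - q.clockTime l a ω ≤ b - a := by
  rw [hq.clockTime_sub l hab ω]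
  calc ∫ s in Set.Ioc a b, q.speed l s ω ∂leb ≤ ∫ s in Set.Ioc a b, (1 : ℝ) ∂leb :=
        setIntegral_mono ((hq.integrableOn_speed l ω b).mono_set Set.Ioc_subset_Iic_self)
          (integrableOn_const (by simp [leb_Ioc])) fun s => hq.speed_le_one l s ω
    _ = b - a := by
        rw [setIntegral_const, Measure.real, leb_Ioc, ENNReal.coe_toReal, NNReal.coe_sub hab,
          smul_eq_mul, mul_one]

lemma Admissible.clockTime_zero (l : Kind × Fin I) (ω : Ω) : q.clockTime l 0 ω = 0 := by
  have h1 := hq.clockTime_eq l 0 ω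
  rw [setIntegral_Iic_eq] at h1
  simpa using h1

lemma Admissible.clockTime_le (l : Kind × Fin I) (t : ℝ≥0) (ω : Ω) : q.clockTime l t ω ≤ t := by
  have := hq.clockTime_sub_le l (zero_le : 0 ≤ t) ω
  rw [hq.clockTime_zero] at this
  exact NNReal.coe_le_coe.1 (by simpa using this)

lemma Admissible.continuous_clockTime (l : Kind × Fin I) (ω : Ω) :
    Continuous fun t => q.clockTime l t ω := by
  have : LipschitzWith 1 fun t => q.clockTime l t ω := by
    refine LipschitzWith.of_dist_le' (K := 1) (fun a b => ?_) |>.weaken (by simp)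
    rw [one_mul, NNReal.dist_eq, NNReal.dist_eq]
    rcases le_total a b with h | h
    · have h1 := hq.clockTime_sub_le l h ω
      have h2 := NNReal.coe_le_coe.2 (hq.clockTime_mono l ω h)
      have h3 := NNReal.coe_le_coe.2 h
      rw [abs_sub_comm, abs_of_nonneg (by linarith), abs_sub_comm, abs_of_nonneg (by linarith)]
      exact h1
    · have h1 := hq.clockTime_sub_le l h ω
      have h2 := NNReal.coe_le_coe.2 (hq.clockTime_mono l ω h)
      have h3 := NNReal.coe_le_coe.2 h
      rw [abs_of_nonneg (by linarith), abs_of_nonneg (by linarith)]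
      exact h1
  exact this.continuous

lemma Admissible.isCountingPath (l : Kind × Fin I) (ω : Ω) :
    IsCountingPath fun t => q.counts l t ω := by
  have hy := (q.isPoissonFamily.poisson l).isCountingPath ω
  refine ⟨fun a b hab => ?_, fun t => ?_⟩
  · simp only [← driving_clockTime]
    exact hy.mono (hq.clockTime_mono l ω hab)
  · simp only [← driving_clockTime]
    exact ContinuousWithinAt.comp (f := fun s => q.clockTime l s ω)
      (g := fun v => q.driving l v ω) (t := Set.Ici (q.clockTime l t ω)) (hy.rightCont _)
      (hq.continuous_clockTime l ω).continuousWithinAt fun s hs => hq.clockTime_mono l ω hs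

end Paths

/-- The queue lengths as a function of the counts. -/
def stateOf (D : Data I) (n : ℕ) (m : Kind × Fin I → ℕ) (i : Fin I) : ℝ :=
  ((D.init n i : ℝ) + m (Kind.A, i) - m (Kind.S, i)) / √(n : ℝ)

open Classical in
/-- The classes selected by the rule as a function of the counts. -/
def selectOf (D : Data I) (n : ℕ) (m : Kind × Fin I → ℕ) (i : Fin I) : Bool :=
  decide (stateOf D n m ∈ D.region i)

lemma scaledX_eq (t : ℝ≥0) (ω : Ω) :
    (fun i => q.scaledX i t ω) = stateOf D n fun l => q.counts l t ω := by
  ext i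
  have h : (q.X i t ω : ℝ) + q.count Kind.S i t ω = D.init n i + q.count Kind.A i t ω := by
    exact_mod_cast q.balance i t ω
  unfold scaledX stateOf counts
  rw [← h, add_sub_cancel_right]

lemma selected_eq (i : Fin I) (t : ℝ≥0) (ω : Ω) :
    q.selected i t ω = if selectOf D n (fun l => q.counts l t ω) i then 1 else 0 := by
  classical
  unfold selected selectOf
  rw [scaledX_eq, Set.indicator_apply]
  simp

/-- The classes that are currently served. -/
def served (t : ℝ≥0) (ω : Ω) (i : Fin I) : Bool := by
  classical exact decide (q.U i t ω = 1)

/-- The mode of the queue: the counts together with the classes in service. -/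
def mode (t : ℝ≥0) (ω : Ω) : (Kind × Fin I → ℕ) × (Fin I → Bool) :=
  (fun l => q.counts l t ω, q.served t ω)

/-- The clock speeds as a function of the mode. -/
def modeSpeed (z : (Kind × Fin I → ℕ) × (Fin I → Bool)) (l : Kind × Fin I) : ℝ≥0 :=
  match l.1 with
  | Kind.A => 1
  | Kind.S => if z.2 l.2 then 1 else 0

lemma speed_eq_modeSpeed {t : ℝ≥0} {ω : Ω} (h : ∀ i, q.U i t ω = 0 ∨ q.U i t ω = 1)
    (l : Kind × Fin I) : q.speed l t ω = modeSpeed (q.mode t ω) l := by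
  obtain ⟨j, i⟩ := l
  cases j
  · change (1 : ℝ) = _
    simp [modeSpeed]
  · change q.U i t ω = _
    rcases h i with h | h <;> simp [modeSpeed, mode, served, h]

/-- A criterion for the queue to be mode-driven. The mode consists of the counts and of the classes
in service; the service must be constant between jumps and follow a fixed rule at jumps. -/
lemma modeDriven_of {q : Queue D n P} (hq : q.Admissible)
    (h01 : ∀ i t ω, q.U i t ω = 0 ∨ q.U i t ω = 1)
    {step : (Kind × Fin I → ℕ) × (Fin I → Bool) → (Kind × Fin I → ℕ) → (Fin I → Bool)}
    {m₀ : Fin I → Bool} (h0 : ∀ ω, q.served 0 ω = m₀)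
    (hconst : ∀ ω a b, a ≤ b → (∀ l, q.counts l b ω = q.counts l a ω) →
      q.served b ω = q.served a ω)
    (hjump : ∀ ω a b, a < b → (∀ s, a ≤ s → s < b → ∀ l, q.counts l s ω = q.counts l a ω) →
      q.served b ω = step (q.mode a ω) fun l => q.counts l b ω) (ω : Ω) :
    ModeDriven modeSpeed (fun z m => (m, step z m)) (0, m₀) (fun l t => q.driving l t ω)
      (fun l t => q.clockTime l t ω) fun t => q.mode t ω where
  path l := (q.isPoissonFamily.poisson l).isCountingPath ω
  count l := by
    simp only [driving_clockTime]
    exact hq.isCountingPath l ω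
  clock_zero l := hq.clockTime_zero l ω
  mode_zero := by
    refine Prod.ext (funext fun l => ?_) (h0 ω)
    change q.counts l 0 ω = 0
    rw [← driving_clockTime, hq.clockTime_zero, (q.isPoissonFamily.poisson l).zero]
  clock_mono l := hq.clockTime_mono l ω
  clock_linear a b hab h l := by
    have h1 := hq.clockTime_sub l hab ω
    have h2 : ∫ s in Set.Ioc a b, q.speed l s ω ∂leb = (b - a) * modeSpeed (q.mode a ω) l := by
      rw [← setIntegral_congr_set (Ioo_ae_eq_Ioc (μ := leb) (a := a) (b := b)),
        setIntegral_congr_fun (g := fun _ => (modeSpeed (q.mode a ω) l : ℝ)) measurableSet_Ioo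
          fun s hs => ?_, setIntegral_congr_set (Ioo_ae_eq_Ioc (μ := leb) (a := a) (b := b)),
        setIntegral_const, Measure.real, leb_Ioc, ENNReal.coe_toReal, NNReal.coe_sub hab,
        smul_eq_mul]
      dsimp only
      rw [q.speed_eq_modeSpeed (fun i => h01 i s ω), h s hs.1.le hs.2]
    rw [← NNReal.coe_inj]
    push_cast [NNReal.coe_sub hab]
    linarith
  mode_const a b hab h := by
    simp only [driving_clockTime] at h
    exact Prod.ext (funext h) (hconst ω a b hab h)
  mode_jump a b hab h _ := by
    simp only [driving_clockTime] at h ⊢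
    exact Prod.ext rfl (hjump ω a b hab h)

lemma effort_zero_or_one_of_selected {i : Fin I} {t s : ℝ≥0} {ω : Ω}
    (h : q.U i t ω = q.selected i s ω) : q.U i t ω = 0 ∨ q.U i t ω = 1 := by
  rw [h, selected_eq]
  split_ifs
  · exact Or.inr rfl
  · exact Or.inl rfl

lemma served_of_selected {t s : ℝ≥0} {ω : Ω} (h : ∀ i, q.U i t ω = q.selected i s ω) :
    q.served t ω = selectOf D n fun l => q.counts l s ω := by
  ext i
  rw [served, h i, selected_eq]
  split_ifs with h' <;> simp [h']

/-- The speeds of an admissible queue whose mode is driven by the counts are the intensities of the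
counts. -/
lemma expSystem_of [IsProbabilityMeasure P] {q : Queue D n P} (hq : q.Admissible)
    (h01 : ∀ i t ω, q.U i t ω = 0 ∨ q.U i t ω = 1)
    {step : (Kind × Fin I → ℕ) × (Fin I → Bool) → (Kind × Fin I → ℕ) → (Fin I → Bool)}
    {m₀ : Fin I → Bool} (h0 : ∀ ω, q.served 0 ω = m₀)
    (hconst : ∀ ω a b, a ≤ b → (∀ l, q.counts l b ω = q.counts l a ω) →
      q.served b ω = q.served a ω)
    (hjump : ∀ ω a b, a < b → (∀ s, a ≤ s → s < b → ∀ l, q.counts l s ω = q.counts l a ω) →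
      q.served b ω = step (q.mode a ω) fun l => q.counts l b ω) :
    ExpSystem q.filtration P q.counts q.speed fun l => D.rate n l.1 l.2 := by
  have h := expSystem_of_modeDriven q.isPoissonFamily (modeDriven_of hq h01 h0 hconst hjump)
    q.filtration_eq_observed hq.speed_nonneg hq.speed_le_one hq.speed_rightCont
    hq.measurable_speed hq.clockTime_eq
  simpa only [driving_clockTime] using h

lemma count_zero {q : Queue D n P} (hq : q.Admissible) (l : Kind × Fin I) (ω : Ω) :
    q.counts l 0 ω = 0 := by
  rw [← driving_clockTime, hq.clockTime_zero, (q.isPoissonFamily.poisson l).zero]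

/-- Under the preemptive rule the classes in service are a function of the counts. -/
lemma IsPreemptive.expSystem [IsProbabilityMeasure P] {q : Queue D n P} (hq : q.Admissible)
    (hp : q.IsPreemptive) :
    ExpSystem q.filtration P q.counts q.speed fun l => D.rate n l.1 l.2 := by
  have hserved : ∀ t ω, q.served t ω = selectOf D n fun l => q.counts l t ω := fun t ω =>
    q.served_of_selected fun i => hp i t ω
  refine expSystem_of hq (fun i t ω => q.effort_zero_or_one_of_selected (hp i t ω))
    (m₀ := selectOf D n 0) (step := fun _ m => selectOf D n m) (fun ω => ?_)
    (fun ω a b _ h => ?_) (fun ω a b _ _ => hserved b ω)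
  · rw [hserved]
    congr 1
    exact funext fun l => count_zero hq l ω
  · rw [hserved, hserved]
    congr 1
    exact funext h

lemma queue_congr {q : Queue D n P} {s t : ℝ≥0} {ω : Ω}
    (h : ∀ l, q.counts l s ω = q.counts l t ω) (i : Fin I) : q.X i s ω = q.X i t ω := by
  have h1 := q.balance i s ω
  have h2 := q.balance i t ω
  have h3 : q.A i s ω = q.A i t ω := h (Kind.A, i)
  have h4 : q.S i (busyTime (q.U i) s ω) ω = q.S i (busyTime (q.U i) t ω) ω := h (Kind.S, i)
  omega

section NonPreemptive

variable {q : Queue D n P} (hq : q.Admissible) (hp : q.IsNonPreemptive)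
include hq

/-- While the counts do not change in a nonempty system there is no decision time. -/
lemma not_isDecisionTime {ω : Ω} {a b s : ℝ≥0} (has : a < s) (hsb : s ≤ b)
    (hN : ∀ r, a ≤ r → r < b → ∀ l, q.counts l r ω = q.counts l a ω)
    (hS : ∀ i, q.counts (Kind.S, i) b ω = q.counts (Kind.S, i) a ω)
    (hX : ¬ ∀ i, q.X i a ω = 0) : ¬ q.IsDecisionTime ω s := by
  rintro (h | ⟨i, hi⟩ | h)
  · rw [h] at has
    exact not_lt_zero has
  · refine hi ?_
    exact (hq.isCountingPath (Kind.S, i) ω).pathJump_eq_zero (hS i).symm has hsb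
  · have := nhdsLT_neBot has
    obtain ⟨r, h1, h2⟩ := (h.and (Ioo_mem_nhdsLT has)).exists
    exact hX fun i => by
      rw [← queue_congr (fun l => hN r h2.1.le (h2.2.trans_le hsb) l) i]
      exact h1 i

include hp

omit hq in
lemma IsNonPreemptive.effort_eq {ω : Ω} {a b : ℝ≥0} (hab : a ≤ b)
    (h : ∀ s, a < s → s ≤ b → ¬ q.IsDecisionTime ω s) (i : Fin I) : q.U i b ω = q.U i a ω := by
  obtain ⟨s, hs, hsd, hlast, hU⟩ := hp b ω
  obtain ⟨s', hs', hsd', hlast', hU'⟩ := hp a ω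
  have hsa : s ≤ a := by
    by_contra hcon
    exact h s (not_le.1 hcon) hs hsd
  have : s = s' := by
    rcases lt_trichotomy s s' with h1 | h1 | h1
    · exact absurd hsd' (hlast s' h1 (hs'.trans hab))
    · exact h1
    · exact absurd hsd (hlast' s h1 hsa)
  rw [hU, hU', this]

omit hq in
lemma IsNonPreemptive.effort_of_isDecisionTime {ω : Ω} {t : ℝ≥0} (h : q.IsDecisionTime ω t)
    (i : Fin I) : q.U i t ω = q.selected i t ω := by
  obtain ⟨s, hs, hsd, hlast, hU⟩ := hp t ω
  rcases hs.eq_or_lt with h1 | h1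
  · rw [hU, h1]
  · exact absurd h (hlast t h1 le_rfl)

/-- Under the non-preemptive rule the classes in service change only when the counts do, in a way
determined by the previous mode and the new counts. -/
lemma IsNonPreemptive.expSystem [IsProbabilityMeasure P] :
    ExpSystem q.filtration P q.counts q.speed fun l => D.rate n l.1 l.2 := by
  classical
  -- a service completion, or an event in an empty system, leads to a new selection;
  -- an arrival to a busy system does not change the class in service
  refine expSystem_of hq (fun i t ω => ?_) (m₀ := selectOf D n 0)
    (step := fun z m => if (∃ i, m (Kind.S, i) ≠ z.1 (Kind.S, i)) ∨
      (∀ i, D.init n i + z.1 (Kind.A, i) = z.1 (Kind.S, i)) then selectOf D n m else z.2)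
    (fun ω => ?_) (fun ω a b hab h => ?_) (fun ω a b hab h => ?_)
  · obtain ⟨s, -, -, -, hU⟩ := hp t ω
    exact q.effort_zero_or_one_of_selected (hU i)
  · rw [q.served_of_selected (hp.effort_of_isDecisionTime (Or.inl rfl))]
    congr 1
    exact funext fun l => count_zero hq l ω
  · have hN : ∀ r, a ≤ r → r ≤ b → ∀ l, q.counts l r ω = q.counts l a ω := fun r h1 h2 l =>
      le_antisymm (((hq.isCountingPath l ω).mono h2).trans (h l).le)
        ((hq.isCountingPath l ω).mono h1)
    by_cases hX : ∀ i, q.X i a ω = 0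
    · have hXb : ∀ i, q.X i b ω = 0 := fun i => by rw [queue_congr h i]; exact hX i
      ext i
      rw [served, served, hq.idle_on_empty i a ω (hX i), hq.idle_on_empty i b ω (hXb i)]
    · have := hp.effort_eq hab fun s h1 h2 => not_isDecisionTime hq h1 h2
        (fun r h3 h4 l => hN r h3 h4.le l) (fun i => h _) hX
      ext i
      rw [served, served, this i]
  · have hXa : (∀ i, D.init n i + (q.mode a ω).1 (Kind.A, i) = (q.mode a ω).1 (Kind.S, i)) ↔
        ∀ i, q.X i a ω = 0 := by
      refine forall_congr' fun i => ?_
      have h1 := q.balance i a ω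
      change D.init n i + q.A i a ω = q.S i (busyTime (q.U i) a ω) ω ↔ _
      omega
    simp only [hXa]
    split_ifs with hcase
    · refine q.served_of_selected (hp.effort_of_isDecisionTime ?_)
      rcases hcase with ⟨i, hi⟩ | hX
      · refine Or.inr (Or.inl ⟨i, ?_⟩)
        have h1 : jump (q.count Kind.S i) b ω = pathJump (fun s => q.counts (Kind.S, i) s ω) b := rfl
        rw [h1, pathJump_of_const hab fun s h2 h3 => h s h2 h3 _, sub_ne_zero]
        exact_mod_cast hi
      · refine Or.inr (Or.inr ?_)
        filter_upwards [Ioo_mem_nhdsLT hab] with s hs i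
        rw [queue_congr (h s hs.1.le hs.2) i]
        exact hX i
    · push Not at hcase
      have := hp.effort_eq hab.le fun s h1 h2 => not_isDecisionTime hq h1 h2 h
        (fun i => hcase.1 i) (by push Not; exact hcase.2)
      ext i
      change q.served b ω i = q.served a ω i
      rw [served, served, this i]

end NonPreemptive

end Queue

/-! ### Predictable real processes -/

section IsPred

variable {Ω : Type*} {mΩ : MeasurableSpace Ω} {F : Filtration ℝ≥0 mΩ}

/-- Real predictable processes. -/
def IsPred (F : Filtration ℝ≥0 mΩ) (θ : ℝ≥0 → Ω → ℝ) : Prop :=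
  Measurable[F.predictable] fun p : ℝ≥0 × Ω => θ p.1 p.2

lemma predictable_le_prod : F.predictable ≤ Prod.instMeasurableSpace := by
  apply measurableSpace_le_predictable_of_measurableSet
  · exact fun A hA => (measurableSet_singleton _).prod (F.le _ _ hA)
  · exact fun i A hA => measurableSet_Ioi.prod (F.le _ _ hA)

lemma measurable_indicator_one {S : Set Ω} (hS : MeasurableSet S) :
    Measurable (S.indicator fun _ => (1 : ℝ)) :=
  measurable_const.indicator hS

namespace IsPred

variable {θ η : ℝ≥0 → Ω → ℝ}

lemma predLim (h : IsPred F θ) : PredLim F θ := PredLim.of_predictable h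

lemma comp (h : IsPred F θ) {φ : ℝ → ℝ} (hφ : Measurable φ) : IsPred F fun s ω => φ (θ s ω) :=
  hφ.comp h

lemma mul (h : IsPred F θ) (h' : IsPred F η) : IsPred F fun s ω => θ s ω * η s ω :=
  @measurable_comp_mul _ F.predictable _ _ _ measurable_id' h h'

lemma add (h : IsPred F θ) (h' : IsPred F η) : IsPred F fun s ω => θ s ω + η s ω :=
  @measurable_add_real _ F.predictable _ _ h h'

lemma indicator {S : Set (ℝ≥0 × Ω)} (hS : MeasurableSet[F.predictable] S) :
    IsPred F fun s ω => S.indicator (fun _ => (1 : ℝ)) (s, ω) :=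
  @measurable_indicator_one _ F.predictable _ hS

lemma measurable (h : IsPred F θ) : Measurable fun p : ℝ≥0 × Ω => θ p.1 p.2 :=
  h.mono predictable_le_prod le_rfl

lemma measurable_section (h : IsPred F θ) (ω : Ω) : Measurable fun s => θ s ω :=
  h.measurable.comp measurable_prodMk_right

end IsPred

/-- The times at which an increasing continuous adapted process exceeds a level form a predictable
set. -/
lemma measurableSet_predictable_level {A : ℝ≥0 → Ω → ℝ} (hA : ∀ t, Measurable[F t] (A t))
    (hmono : ∀ ω, Monotone fun t => A t ω) (hcont : ∀ ω, Continuous fun t => A t ω) {a : ℝ}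
    (h0 : ∀ ω, A 0 ω ≤ a) : MeasurableSet[F.predictable] {p : ℝ≥0 × Ω | a < A p.1 p.2} := by
  obtain ⟨d, hdc, hdd⟩ := TopologicalSpace.exists_countable_dense ℝ≥0
  have : {p : ℝ≥0 × Ω | a < A p.1 p.2} = ⋃ q ∈ d, Set.Ioi q ×ˢ {ω | a < A q ω} := by
    ext ⟨s, ω⟩
    simp only [Set.mem_ofPred_eq, Set.mem_iUnion, Set.mem_prod, Set.mem_Ioi, exists_prop]
    constructor
    · intro hs
      have hs0 : 0 < s := pos_iff_ne_zero.2 fun h => by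
        rw [h] at hs; exact absurd (h0 ω) (not_le.2 hs)
      have hopen : IsOpen (Set.Iio s ∩ {r | a < A r ω}) :=
        isOpen_Iio.inter (isOpen_lt continuous_const (hcont ω))
      have := nhdsLT_neBot hs0
      have hne : (Set.Iio s ∩ {r | a < A r ω}).Nonempty := by
        have h1 : ∀ᶠ r in 𝓝[<] s, a < A r ω :=
          ((hcont ω).tendsto s).mono_left nhdsWithin_le_nhds |>.eventually (lt_mem_nhds hs)
        obtain ⟨r, h2, h3⟩ := (h1.and self_mem_nhdsWithin).exists
        exact ⟨r, h3, h2⟩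
      obtain ⟨q, hq1, hq2⟩ := hdd.exists_mem_open hopen hne
      exact ⟨q, hq1, hq2.1, hq2.2⟩
    · rintro ⟨q, -, hqs, hq⟩
      exact hq.trans_le (hmono ω hqs.le)
  rw [this]
  exact MeasurableSet.biUnion hdc fun q _ =>
    measurableSet_predictable_Ioi_prod (hA q measurableSet_Ioi)

end IsPred

/-- The part of an increasing integral above a level `a` is at most the integral over the times at
which the level is exceeded. -/
lemma sub_le_setIntegral_level {f A : ℝ≥0 → ℝ} {t : ℝ≥0} {a : ℝ} (ha : 0 ≤ a)
    (hf : IntegrableOn f (Set.Ioc 0 t) leb) (hf0 : ∀ s, 0 ≤ f s)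
    (hA : ∀ s, A s = ∫ r in Set.Ioc 0 s, f r ∂leb) (hcont : Continuous A) :
    A t - a ≤ ∫ s in Set.Ioc 0 t, {s | a < A s}.indicator f s ∂leb := by
  have hcomp : IsCompact (Set.Icc 0 t ∩ {s | A s ≤ a}) :=
    isCompact_Icc.inter_right (isClosed_le hcont continuous_const)
  have hne : (Set.Icc 0 t ∩ {s | A s ≤ a}).Nonempty := ⟨0, ⟨le_rfl, zero_le⟩, by simp [hA, ha]⟩
  obtain ⟨σ, ⟨⟨-, hσt⟩, hσa⟩, hσ⟩ := hcomp.exists_isGreatest hne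
  have hmeas : MeasurableSet {s | a < A s} :=
    measurableSet_lt measurable_const hcont.measurable
  have h1 : A t - A σ = ∫ s in Set.Ioc σ t, f s ∂leb := by
    rw [hA, hA, ← Set.Ioc_union_Ioc_eq_Ioc (zero_le : 0 ≤ σ) hσt,
      setIntegral_union _ measurableSet_Ioc]
    · ring
    · exact hf.mono_set (Set.Ioc_subset_Ioc_right hσt)
    · exact hf.mono_set (Set.Ioc_subset_Ioc_left zero_le)
    · rw [Set.disjoint_left]
      exact fun s hs hs' => absurd hs'.1 (not_lt.2 hs.2)
  have h2 : ∫ s in Set.Ioc σ t, f s ∂leb = ∫ s in Set.Ioc σ t, {s | a < A s}.indicator f s ∂leb := by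
    refine setIntegral_congr_fun measurableSet_Ioc fun s hs => ?_
    have : s ∈ {s | a < A s} := by
      by_contra hcon
      exact absurd (hσ ⟨⟨zero_le, hs.2⟩, (not_lt.1 hcon : A s ≤ a)⟩) (not_le.2 hs.1)
    rw [Set.indicator_of_mem this]
  have h3 : ∫ s in Set.Ioc σ t, {s | a < A s}.indicator f s ∂leb ≤
      ∫ s in Set.Ioc 0 t, {s | a < A s}.indicator f s ∂leb :=
    setIntegral_mono_set (hf.indicator hmeas)
      (ae_of_all _ fun s => Set.indicator_nonneg (fun s _ => hf0 s) s)
      (Set.Ioc_subset_Ioc_left zero_le).eventuallyLE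
  have h4 : A σ ≤ a := hσa
  linarith

/-! ### Change of measure -/

section Tilted

variable {Ω : Type*} {mΩ : MeasurableSpace Ω} {L : Type*} [Fintype L]

/-- The logarithm of the exponential process of a single stream with integrand `ζ`. -/
def logExp (f : ℝ≥0 → ℕ) (v : ℝ≥0 → ℝ) (r : ℝ≥0) (ζ : ℝ≥0 → ℝ) (t : ℝ≥0) : ℝ :=
  jumpSum f ζ 0 t - r * ∫ s in Set.Ioc 0 t, (Real.exp (ζ s) - 1) * v s ∂leb

/-- A probability measure `Q` whose density with respect to `P` at time `t` is the exponential
process with the predictable integrands `θ l`: under `Q` the count `N l` has intensity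
`r l * exp (θ l) * u l`. -/
structure Tilted (F : Filtration ℝ≥0 mΩ) (P : Measure Ω) (N : L → ℝ≥0 → Ω → ℕ)
    (u : L → ℝ≥0 → Ω → ℝ) (r : L → ℝ≥0) (θ : L → ℝ≥0 → Ω → ℝ) (Q : Measure Ω) : Prop where
  sys : ExpSystem F P N u r
  prob : IsProbabilityMeasure Q
  pred : ∀ l, IsPred F (θ l)
  integrable : ∀ᵐ ω ∂P, ∀ l t, IntegrableOn (fun s => Real.exp (θ l s ω)) (Set.Ioc 0 t) leb
  density : ∀ t B, MeasurableSet[F t] B →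
    Q B = ∫⁻ ω in B, ENNReal.ofReal (Real.exp (expo N u r (fun s ω l => θ l s ω) 0 t ω)) ∂P

namespace Tilted

variable {F : Filtration ℝ≥0 mΩ} {P : Measure Ω}
  {N : L → ℝ≥0 → Ω → ℕ} {u : L → ℝ≥0 → Ω → ℝ} {r : L → ℝ≥0} {θ : L → ℝ≥0 → Ω → ℝ} {Q : Measure Ω} (T : Tilted F P N u r θ Q)
include T

lemma measurable_density {t : ℝ≥0} (ht : 0 < t) :
    Measurable[F t] fun ω => expo N u r (fun s ω l => θ l s ω) 0 t ω :=
  T.sys.measurable_expo (fun l => (T.pred l).predLim) ht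

lemma lintegral_eq {t : ℝ≥0} (ht : 0 < t) {R : Ω → ℝ≥0∞} (hR : Measurable[F t] R) :
    ∫⁻ ω, R ω ∂Q =
      ∫⁻ ω, ENNReal.ofReal (Real.exp (expo N u r (fun s ω l => θ l s ω) 0 t ω)) * R ω ∂P := by
  have hm := (((T.measurable_density ht).mono (F.le t) le_rfl).exp.ennreal_ofReal)
  have h1 := lintegral_withDensity_eq_lintegral_mul P hm (hR.mono (F.le t) le_rfl)
  simp only [Pi.mul_apply] at h1
  rw [← h1, ← lintegral_trim (F.le t) hR, ← lintegral_trim (F.le t) hR]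
  congr 1
  refine @Measure.ext _ (F t) _ _ fun B hB => ?_
  rw [trim_measurableSet_eq (F.le t) hB, trim_measurableSet_eq (F.le t) hB,
    withDensity_apply _ (F.le t B hB), T.density t B hB]

lemma integrableOn_mul {ζ : ℝ≥0 → Ω → ℝ} (hζ : IsPred F ζ) (l : L) {t : ℝ≥0} {ω : Ω} {g : ℝ≥0 → ℝ}
    (hg : IntegrableOn g (Set.Ioc 0 t) leb) (hle : ∀ s, |ζ s ω| ≤ g s) :
    IntegrableOn (fun s => ζ s ω * u l s ω) (Set.Ioc 0 t) leb := by
  rcases (zero_le : 0 ≤ t).eq_or_lt with h0 | ht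
  · rw [← h0]; simp
  refine Integrable.mono' hg
    (T.sys.aestronglyMeasurable hζ.predLim l (φ := fun x => x) measurable_id' ht ω)
    (ae_of_all _ fun s => ?_)
  rw [norm_mul, Real.norm_eq_abs, Real.norm_eq_abs, abs_of_nonneg (T.sys.nonneg l s ω)]
  exact (mul_le_of_le_one_right (abs_nonneg _) (T.sys.le_one l s ω)).trans (hle s)

/-- Exponential inequality under the tilted measure: changing the integrand of one stream. -/
lemma lintegral_exp_le [IsProbabilityMeasure P] {t : ℝ≥0} (ht : 0 < t) (l : L) {ζ : ℝ≥0 → Ω → ℝ} (hζ : IsPred F ζ) {C : ℝ}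
    (hC : ∀ s ω, Real.exp (ζ s ω) ≤ C * (Real.exp (θ l s ω) + 1)) {R : Ω → ℝ} {K : ℝ}
    (hR : Measurable[F t] R)
    (h : ∀ ω, IntegrableOn (fun s => Real.exp (θ l s ω)) (Set.Ioc 0 t) leb →
      R ω + logExp (fun s => N l s ω) (fun s => u l s ω) (r l) (fun s => θ l s ω) t ≤
        K + logExp (fun s => N l s ω) (fun s => u l s ω) (r l) (fun s => ζ s ω) t) :
    ∫⁻ ω, ENNReal.ofReal (Real.exp (R ω)) ∂Q ≤ ENNReal.ofReal (Real.exp K) := by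
  classical
  -- replace the tilt of stream `l` by `ζ` and keep the tilts of the other streams
  let η : ℝ≥0 → Ω → L → ℝ := fun s ω l' => if l' = l then ζ s ω else θ l' s ω
  have hη : ∀ l', IsPred F fun s ω => η s ω l' := by
    intro l'
    by_cases hl : l' = l
    · simpa only [η, if_pos hl] using hζ
    · simpa only [η, if_neg hl] using T.pred l'
  have hint : ∀ᵐ ω ∂P, ∀ l', IntegrableOn (fun s => Real.exp (η s ω l')) (Set.Ioc 0 t) leb := by
    filter_upwards [T.integrable] with ω hω l'
    by_cases hl : l' = l
    · simp only [η, if_pos hl]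
      refine Integrable.mono' (((hω l t).add (integrableOn_const (C := (1 : ℝ)) ?_)).const_mul C)
        (hζ.measurable_section ω).exp.aestronglyMeasurable (ae_of_all _ fun s => ?_)
      · simp [leb_Ioc]
      · rw [Real.norm_eq_abs, abs_of_pos (Real.exp_pos _)]
        exact hC s ω
    · simpa only [η, if_neg hl] using hω l' t
  rw [T.lintegral_eq ht hR.exp.ennreal_ofReal]
  have h1 := T.sys.lintegral_exp_le (fun l' => (hη l').predLim) ht hint
    (ξ := fun _ => ENNReal.ofReal (Real.exp K)) (@measurable_const _ _ _ (F 0) _)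
  simp only [lintegral_const, measure_univ, mul_one] at h1
  refine le_trans (lintegral_mono_ae ?_) h1
  filter_upwards [T.integrable] with ω hω
  rw [← ENNReal.ofReal_mul (Real.exp_pos _).le, ← ENNReal.ofReal_mul (Real.exp_pos _).le,
    ← Real.exp_add, ← Real.exp_add]
  refine ENNReal.ofReal_le_ofReal (Real.exp_le_exp.2 ?_)
  have h2 := h ω (hω l t)
  have h3 : expo N u r (fun s ω l => θ l s ω) 0 t ω -
      logExp (fun s => N l s ω) (fun s => u l s ω) (r l) (fun s => θ l s ω) t =
      expo N u r η 0 t ω -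
        logExp (fun s => N l s ω) (fun s => u l s ω) (r l) (fun s => ζ s ω) t := by
    have e1 : logExp (fun s => N l s ω) (fun s => u l s ω) (r l) (fun s => ζ s ω) t =
        logExp (fun s => N l s ω) (fun s => u l s ω) (r l) (fun s => η s ω l) t := by
      simp only [η, if_pos]
    rw [e1]
    unfold expo
    rw [← Finset.add_sum_erase _ _ (Finset.mem_univ l),
      ← Finset.add_sum_erase _ _ (Finset.mem_univ l)]
    unfold logExp
    rw [add_sub_cancel_left, add_sub_cancel_left]
    refine Finset.sum_congr rfl fun l' hl' => ?_
    have : l' ≠ l := (Finset.mem_erase.1 hl').1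
    simp only [η, if_neg this]
  linarith

lemma measurable_logExp {ζ : ℝ≥0 → Ω → ℝ} (hζ : IsPred F ζ) (l : L) {t : ℝ≥0} (ht : 0 < t) :
    Measurable[F t] fun ω =>
      logExp (fun s => N l s ω) (fun s => u l s ω) (r l) (fun s => ζ s ω) t :=
  (T.sys.measurable_jumpSum hζ.predLim l ht).sub
    ((T.sys.measurable_integral hζ.predLim l (φ := fun x => Real.exp x - 1)
      (by fun_prop) ht).const_mul _)

omit T in
lemma _root_.RobustQueue.measurableSet_integrableOn_exp {ζ : ℝ≥0 → Ω → ℝ} (hζ : IsPred F ζ)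
    {t : ℝ≥0} (ht : 0 < t) :
    MeasurableSet[F t] {ω | IntegrableOn (fun s => Real.exp (ζ s ω)) (Set.Ioc 0 t) leb} := by
  have h1 := @Measurable.lintegral_prod_left' _ _ _ (F t) (leb.restrict (Set.Ioc 0 t)) _ _
    (hζ.predLim.measurable_indicator ht).exp.ennreal_ofReal
  have h2 : {ω | IntegrableOn (fun s => Real.exp (ζ s ω)) (Set.Ioc 0 t) leb} =
      {ω | ∫⁻ s in Set.Ioc 0 t, ENNReal.ofReal
        (Real.exp ((Set.Ioc 0 t).indicator (fun s => ζ s ω) s)) ∂leb < ∞} := by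
    ext ω
    have h3 : ∫⁻ s in Set.Ioc 0 t, ENNReal.ofReal
        (Real.exp ((Set.Ioc 0 t).indicator (fun s => ζ s ω) s)) ∂leb =
        ∫⁻ s in Set.Ioc 0 t, ENNReal.ofReal (Real.exp (ζ s ω)) ∂leb :=
      setLIntegral_congr_fun measurableSet_Ioc fun s hs => by rw [Set.indicator_of_mem hs]
    rw [Set.mem_ofPred_eq, Set.mem_ofPred_eq, h3]
    unfold IntegrableOn
    rw [← lintegral_ofReal_ne_top_iff_integrable
      (hζ.measurable_section ω).exp.aestronglyMeasurable
      (ae_of_all _ fun s => (Real.exp_pos _).le), lt_top_iff_ne_top]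
  rw [h2]
  exact h1 measurableSet_Iio

lemma ae_integrable {t : ℝ≥0} (ht : 0 < t) (l : L) :
    ∀ᵐ ω ∂Q, IntegrableOn (fun s => Real.exp (θ l s ω)) (Set.Ioc 0 t) leb := by
  have hm := measurableSet_integrableOn_exp (T.pred l) ht
  refine mem_ae_iff.2 ?_
  rw [T.density t _ (@MeasurableSet.compl _ _ (F t) hm)]
  exact setLIntegral_measure_zero _ _ (mem_ae_iff.1 (T.integrable.mono fun ω h => h l t))

omit T in
lemma _root_.RobustQueue.logExp_add {f : ℝ≥0 → ℕ} (hf : IsCountingPath f) {v : ℝ≥0 → ℝ} {r : ℝ≥0}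
    {ζ ζ' ζ'' : ℝ≥0 → ℝ} {t : ℝ≥0} (h : ∀ s, ζ'' s = ζ s + ζ' s)
    (h' : ∀ s, Real.exp (ζ'' s) - 1 = (Real.exp (ζ s) - 1) + (Real.exp (ζ' s) - 1))
    (hi : IntegrableOn (fun s => (Real.exp (ζ s) - 1) * v s) (Set.Ioc 0 t) leb)
    (hi' : IntegrableOn (fun s => (Real.exp (ζ' s) - 1) * v s) (Set.Ioc 0 t) leb) :
    logExp f v r ζ'' t = logExp f v r ζ t + logExp f v r ζ' t := by
  unfold logExp
  simp only [h', add_mul]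
  rw [funext h, jumpSum_add hf, integral_add hi hi']
  ring

/-- The integrand restricted to a predictable set and the integrand restricted to its complement
split the exponential process. -/
lemma logExp_split (l : L) {S : Set (ℝ≥0 × Ω)} (hS : MeasurableSet[F.predictable] S) {t : ℝ≥0}
    {ω : Ω} (hω : IntegrableOn (fun s => Real.exp (θ l s ω)) (Set.Ioc 0 t) leb) :
    logExp (fun s => N l s ω) (fun s => u l s ω) (r l) (fun s => θ l s ω) t =
      logExp (fun s => N l s ω) (fun s => u l s ω) (r l)
        (fun s => θ l s ω * S.indicator (fun _ => (1 : ℝ)) (s, ω)) t +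
      logExp (fun s => N l s ω) (fun s => u l s ω) (r l)
        (fun s => θ l s ω * Sᶜ.indicator (fun _ => (1 : ℝ)) (s, ω)) t := by
  have hcase : ∀ (B : Set (ℝ≥0 × Ω)) (p : ℝ≥0 × Ω), B.indicator (fun _ => (1 : ℝ)) p = 0 ∨
      B.indicator (fun _ => (1 : ℝ)) p = 1 := fun B p => by
    by_cases h : p ∈ B <;> simp [h]
  have hint : ∀ B : Set (ℝ≥0 × Ω), MeasurableSet[F.predictable] B → IntegrableOn
      (fun s => (Real.exp (θ l s ω * B.indicator (fun _ => (1 : ℝ)) (s, ω)) - 1) * u l s ω)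
      (Set.Ioc 0 t) leb := by
    intro B hB
    refine T.integrableOn_mul (ζ := fun s ω =>
      Real.exp (θ l s ω * B.indicator (fun _ => (1 : ℝ)) (s, ω)) - 1)
      (((T.pred l).mul (IsPred.indicator hB)).comp (φ := fun x => Real.exp x - 1) (by fun_prop)) l
      (g := fun s => Real.exp (θ l s ω) + 1) (hω.add (integrableOn_const (by simp [leb_Ioc])))
      fun s => ?_
    have := Real.exp_pos (θ l s ω)
    rcases hcase B (s, ω) with h | h <;> rw [h]
    · simp; positivity
    · rw [mul_one, abs_le]; constructor <;> linarith
  refine logExp_add (T.sys.path l ω) (fun s => ?_) (fun s => ?_) (hint S hS)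
    (hint Sᶜ (@MeasurableSet.compl _ _ F.predictable hS))
  · by_cases h : (s, ω) ∈ S <;> simp [h]
  · by_cases h : (s, ω) ∈ S <;> simp [h]

/-- The exponential inequality for the negative of the logarithmic density on a predictable set. -/
lemma lintegral_exp_neg_logExp_le [IsProbabilityMeasure P] {t : ℝ≥0} (ht : 0 < t) (l : L)
    {S : Set (ℝ≥0 × Ω)} (hS : MeasurableSet[F.predictable] S) :
    ∫⁻ ω, ENNReal.ofReal (Real.exp (-logExp (fun s => N l s ω) (fun s => u l s ω) (r l)
      (fun s => θ l s ω * S.indicator (fun _ => (1 : ℝ)) (s, ω)) t)) ∂Q ≤ 1 := by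
  have hSc : MeasurableSet[F.predictable] Sᶜ := @MeasurableSet.compl _ _ F.predictable hS
  have := T.lintegral_exp_le ht l ((T.pred l).mul (IsPred.indicator hSc)) (C := 1) (K := 0)
    (R := fun ω => -logExp (fun s => N l s ω) (fun s => u l s ω) (r l)
      (fun s => θ l s ω * S.indicator (fun _ => (1 : ℝ)) (s, ω)) t) (fun s ω => ?_)
    (T.measurable_logExp ((T.pred l).mul (IsPred.indicator hS)) l ht).neg (fun ω hω => ?_)
  · simpa using this
  · have := Real.exp_pos (θ l s ω)
    by_cases h : (s, ω) ∈ S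
    · simp [h]; positivity
    · simp [h]
  · rw [T.logExp_split l hS hω]
    linarith

/-- Exponential moments of the compensated integral of a bounded predictable process that vanishes
where the tilt is large. -/
lemma lintegral_exp_neg_compensated_le [IsProbabilityMeasure P] {t : ℝ≥0} (ht : 0 < t) (l : L)
    {H : ℝ≥0 → Ω → ℝ} (hH : IsPred F H) {m : ℝ} (hm : ∀ s ω, |H s ω| ≤ m)
    (hHθ : ∀ s ω, H s ω ≠ 0 → θ l s ω ≤ m) {ε : ℝ} (hε : 0 ≤ ε) (hεm : ε * m ≤ 1) :
    ∫⁻ ω, ENNReal.ofReal (Real.exp (-ε * (jumpSum (fun s => N l s ω) (fun s => H s ω) 0 t -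
        r l * ∫ s in Set.Ioc 0 t, H s ω * Real.exp (θ l s ω) * u l s ω ∂leb))) ∂Q ≤
      ENNReal.ofReal (Real.exp (r l * t * Real.exp m * m ^ 2 * ε ^ 2)) := by
  have hε1 : ∀ s ω, |-(ε * H s ω)| ≤ 1 := fun s ω => by
    rw [abs_neg, abs_mul, abs_of_nonneg hε]
    exact (mul_le_mul_of_nonneg_left (hm s ω) hε).trans hεm
  have hHe : IsPred F fun s ω => H s ω * Real.exp (θ l s ω) :=
    hH.mul ((T.pred l).comp Real.measurable_exp)
  have hζ : IsPred F fun s ω => θ l s ω + -(ε * H s ω) :=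
    (T.pred l).add (hH.comp (φ := fun x => -(ε * x)) (by fun_prop))
  -- the tilt `θ l` is lowered by `ε H`
  refine T.lintegral_exp_le ht l hζ (C := Real.exp 1) (fun s ω => ?_)
    (((T.sys.measurable_jumpSum hH.predLim l ht).sub
      ((T.sys.measurable_integral hHe.predLim l (φ := fun x => x) measurable_id' ht).const_mul
        _)).const_mul _) (fun ω hω => ?_)
  · rw [Real.exp_add, mul_comm]
    refine mul_le_mul (Real.exp_le_exp.2 (abs_le.1 (hε1 s ω)).2) (by linarith)
      (Real.exp_pos _).le (Real.exp_pos _).le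
  · have hm0 : 0 ≤ m := (abs_nonneg _).trans (hm 0 ω)
    have hi1 : IntegrableOn (fun s => (Real.exp (θ l s ω) - 1) * u l s ω) (Set.Ioc 0 t) leb := by
      refine T.integrableOn_mul (ζ := fun s ω => Real.exp (θ l s ω) - 1)
        ((T.pred l).comp (φ := fun x => Real.exp x - 1) (by fun_prop)) l
        (g := fun s => Real.exp (θ l s ω) + 1) (hω.add (integrableOn_const (by simp [leb_Ioc])))
        fun s => ?_
      have := Real.exp_pos (θ l s ω)
      rw [abs_le]; constructor <;> linarith
    have hi2 : IntegrableOn (fun s => H s ω * Real.exp (θ l s ω) * u l s ω) (Set.Ioc 0 t) leb := by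
      refine T.integrableOn_mul hHe l (g := fun s => m * Real.exp (θ l s ω)) (hω.const_mul m)
        fun s => ?_
      rw [abs_mul, abs_of_pos (Real.exp_pos _)]
      exact mul_le_mul_of_nonneg_right (hm s ω) (Real.exp_pos _).le
    have hi3 : IntegrableOn (fun s => (Real.exp (θ l s ω + -(ε * H s ω)) - 1) * u l s ω)
        (Set.Ioc 0 t) leb := by
      refine T.integrableOn_mul (ζ := fun s ω => Real.exp (θ l s ω + -(ε * H s ω)) - 1)
        (hζ.comp (φ := fun x => Real.exp x - 1) (by fun_prop)) l
        (g := fun s => Real.exp 1 * Real.exp (θ l s ω) + 1)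
        ((hω.const_mul _).add (integrableOn_const (by simp [leb_Ioc]))) fun s => ?_
      have h1 := Real.exp_pos (θ l s ω + -(ε * H s ω))
      have h2 : Real.exp (θ l s ω + -(ε * H s ω)) ≤ Real.exp 1 * Real.exp (θ l s ω) := by
        rw [Real.exp_add, mul_comm]
        exact mul_le_mul_of_nonneg_right (Real.exp_le_exp.2 (abs_le.1 (hε1 s ω)).2)
          (Real.exp_pos _).le
      rw [abs_le]; constructor <;> nlinarith [Real.exp_pos 1, Real.exp_pos (θ l s ω)]
    have hi4 : IntegrableOn (fun s => (Real.exp (θ l s ω + -(ε * H s ω)) - 1) * u l s ω +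
        ε * (H s ω * Real.exp (θ l s ω) * u l s ω)) (Set.Ioc 0 t) leb := hi3.add (hi2.const_mul ε)
    -- the second order remainder of the exponential
    have hrem : ∫ s in Set.Ioc 0 t, ((Real.exp (θ l s ω + -(ε * H s ω)) - 1) * u l s ω +
        ε * (H s ω * Real.exp (θ l s ω) * u l s ω) - (Real.exp (θ l s ω) - 1) * u l s ω) ∂leb ≤
        ∫ s in Set.Ioc 0 t, Real.exp m * (m ^ 2 * ε ^ 2) ∂leb := by
      refine setIntegral_mono (hi4.sub hi1)
        (integrableOn_const (by simp [leb_Ioc])) fun s => ?_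
      have e1 : (Real.exp (θ l s ω + -(ε * H s ω)) - 1) * u l s ω +
          ε * (H s ω * Real.exp (θ l s ω) * u l s ω) - (Real.exp (θ l s ω) - 1) * u l s ω =
          Real.exp (θ l s ω) * (Real.exp (-(ε * H s ω)) - 1 - -(ε * H s ω)) * u l s ω := by
        rw [Real.exp_add]; ring
      dsimp only
      rw [e1]
      by_cases h0 : H s ω = 0
      · simp [h0]; positivity
      have h2 := abs_le.1 (Real.abs_exp_sub_one_sub_id_le (hε1 s ω))
      have h3 : (-(ε * H s ω)) ^ 2 ≤ m ^ 2 * ε ^ 2 := by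
        rw [neg_sq, mul_pow, mul_comm]
        exact mul_le_mul_of_nonneg_right (sq_le_sq' (abs_le.1 (hm s ω)).1 (abs_le.1 (hm s ω)).2)
          (sq_nonneg _)
      have h4 : 0 ≤ Real.exp (-(ε * H s ω)) - 1 - -(ε * H s ω) := by
        linarith [Real.add_one_le_exp (-(ε * H s ω))]
      calc _ ≤ Real.exp (θ l s ω) * (Real.exp (-(ε * H s ω)) - 1 - -(ε * H s ω)) :=
            mul_le_of_le_one_right (mul_nonneg (Real.exp_pos _).le h4) (T.sys.le_one l s ω)
        _ ≤ _ := mul_le_mul (Real.exp_le_exp.2 (hHθ s ω h0)) (h2.2.trans h3) h4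
            (Real.exp_pos _).le
    rw [setIntegral_const, Measure.real, leb_Ioc, ENNReal.coe_toReal, tsub_zero, smul_eq_mul,
      integral_sub hi4 hi1, integral_add hi3 (hi2.const_mul ε),
      integral_const_mul] at hrem
    have hrem' := mul_le_mul_of_nonneg_left hrem (r l).2
    have hj : jumpSum (fun s => N l s ω) (fun s => θ l s ω + -(ε * H s ω)) 0 t =
        jumpSum (fun s => N l s ω) (fun s => θ l s ω) 0 t -
          ε * jumpSum (fun s => N l s ω) (fun s => H s ω) 0 t := by
      rw [jumpSum_add (T.sys.path l ω), jumpSum_neg (T.sys.path l ω),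
        jumpSum_const_mul (T.sys.path l ω), sub_eq_add_neg]
    unfold logExp
    rw [hj]
    simp only [NNReal.val_eq_coe] at hrem'
    nlinarith [hrem']

end Tilted

end Tilted

/-! ### The truncated entropy process and its level inequalities -/

section BoundedIntegral

variable {f : ℝ≥0 → ℝ} {C : ℝ}

lemma integrableOn_Ioc_of_bounded (hf : Measurable f) (h0 : ∀ s, 0 ≤ f s) (hC : ∀ s, f s ≤ C)
    (a b : ℝ≥0) : IntegrableOn f (Set.Ioc a b) leb :=
  Integrable.mono' (g := fun _ => C) (integrableOn_const (by simp [leb_Ioc]))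
    hf.aestronglyMeasurable (ae_of_all _ fun s => by
      rw [Real.norm_eq_abs, abs_of_nonneg (h0 s)]; exact hC s)

lemma setIntegral_Ioc_sub (hf : Measurable f) (h0 : ∀ s, 0 ≤ f s) (hC : ∀ s, f s ≤ C)
    {a b : ℝ≥0} (hab : a ≤ b) :
    ∫ s in Set.Ioc 0 b, f s ∂leb - ∫ s in Set.Ioc 0 a, f s ∂leb = ∫ s in Set.Ioc a b, f s ∂leb := by
  rw [← Set.Ioc_union_Ioc_eq_Ioc (zero_le : 0 ≤ a) hab, setIntegral_union _ measurableSet_Ioc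
    (integrableOn_Ioc_of_bounded hf h0 hC _ _) (integrableOn_Ioc_of_bounded hf h0 hC _ _)]
  · ring
  · rw [Set.disjoint_left]
    exact fun s hs hs' => absurd hs'.1 (not_lt.2 hs.2)

lemma setIntegral_Ioc_le (hf : Measurable f) (h0 : ∀ s, 0 ≤ f s) (hC : ∀ s, f s ≤ C)
    {a b : ℝ≥0} (hab : a ≤ b) : ∫ s in Set.Ioc a b, f s ∂leb ≤ C * (b - a) := by
  calc ∫ s in Set.Ioc a b, f s ∂leb ≤ ∫ s in Set.Ioc a b, C ∂leb :=
        setIntegral_mono (integrableOn_Ioc_of_bounded hf h0 hC _ _)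
          (integrableOn_const (by simp [leb_Ioc])) hC
    _ = C * (b - a) := by
        rw [setIntegral_const, Measure.real, leb_Ioc, ENNReal.coe_toReal, NNReal.coe_sub hab,
          smul_eq_mul, mul_comm]

lemma monotone_setIntegral_Ioc (hf : Measurable f) (h0 : ∀ s, 0 ≤ f s) (hC : ∀ s, f s ≤ C) :
    Monotone fun t => ∫ s in Set.Ioc 0 t, f s ∂leb := by
  intro a b hab
  have := setIntegral_Ioc_sub hf h0 hC hab
  have h2 : 0 ≤ ∫ s in Set.Ioc a b, f s ∂leb := integral_nonneg h0
  dsimp only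
  linarith

lemma continuous_setIntegral_Ioc (hf : Measurable f) (h0 : ∀ s, 0 ≤ f s) (hC : ∀ s, f s ≤ C) :
    Continuous fun t => ∫ s in Set.Ioc 0 t, f s ∂leb := by
  have key : ∀ a b : ℝ≥0, a ≤ b →
      |∫ s in Set.Ioc 0 b, f s ∂leb - ∫ s in Set.Ioc 0 a, f s ∂leb| ≤ C * |(b : ℝ) - a| := by
    intro a b hab
    rw [setIntegral_Ioc_sub hf h0 hC hab, abs_of_nonneg (integral_nonneg h0),
      abs_of_nonneg (sub_nonneg.2 (NNReal.coe_le_coe.2 hab))]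
    exact setIntegral_Ioc_le hf h0 hC hab
  refine (LipschitzWith.of_dist_le' (K := C) fun a b => ?_).continuous
  rw [Real.dist_eq, NNReal.dist_eq]
  rcases le_total a b with h | h
  · rw [abs_sub_comm, abs_sub_comm (a : ℝ)]
    exact key a b h
  · exact key b a h

end BoundedIntegral

/-- The relative entropy rate `exp x * x - exp x + 1` of a Poisson intensity `exp x` with respect to
the intensity one. -/
def entropyFun (x : ℝ) : ℝ := Real.exp x * x - Real.exp x + 1

lemma entropyFun_nonneg (x : ℝ) : 0 ≤ entropyFun x := by
  have h1 := Real.add_one_le_exp (-x)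
  have h2 : Real.exp x * Real.exp (-x) = 1 := by rw [← Real.exp_add]; simp
  unfold entropyFun
  nlinarith [Real.exp_pos x]

lemma measurable_entropyFun : Measurable entropyFun := by
  unfold entropyFun; fun_prop

/-- The entropy rate set to zero outside `[-m, m]`. -/
def truncEntropy (m : ℝ) (x : ℝ) : ℝ := (Set.Icc (-m) m).indicator entropyFun x

lemma truncEntropy_nonneg (m x : ℝ) : 0 ≤ truncEntropy m x :=
  Set.indicator_nonneg (fun x _ => entropyFun_nonneg x) x

lemma measurable_truncEntropy (m : ℝ) : Measurable (truncEntropy m) :=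
  measurable_entropyFun.indicator measurableSet_Icc

lemma truncEntropy_le {m : ℝ} (hm : 0 ≤ m) (x : ℝ) : truncEntropy m x ≤ Real.exp m * m + 1 := by
  unfold truncEntropy
  refine Set.indicator_apply_le' (fun hx => ?_) fun _ => by positivity
  unfold entropyFun
  have h1 := Real.exp_pos x
  have h2 : Real.exp x * x ≤ Real.exp m * m :=
    (mul_le_mul_of_nonneg_left hx.2 h1.le).trans
      (mul_le_mul_of_nonneg_right (Real.exp_le_exp.2 hx.2) hm)
  linarith

namespace Tilted

variable {Ω : Type*} {mΩ : MeasurableSpace Ω} {L : Type*} [Fintype L]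
  {F : Filtration ℝ≥0 mΩ} {P : Measure Ω}
  {N : L → ℝ≥0 → Ω → ℕ} {u : L → ℝ≥0 → Ω → ℝ} {r : L → ℝ≥0} {θ : L → ℝ≥0 → Ω → ℝ}
  {Q : Measure Ω}

/-- The integrated entropy rate of stream `l`, truncated to the times where the logarithmic tilt is
at most `m` in absolute value. -/
def _root_.RobustQueue.truncEntropyInt (u : L → ℝ≥0 → Ω → ℝ) (r : L → ℝ≥0) (θ : L → ℝ≥0 → Ω → ℝ)
    (l : L) (m : ℝ) (t : ℝ≥0) (ω : Ω) : ℝ :=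
  ∫ s in Set.Ioc 0 t, r l * truncEntropy m (θ l s ω) * u l s ω ∂leb

variable (T : Tilted F P N u r θ Q)
include T

lemma measurable_speed_path (l : L) (ω : Ω) : Measurable fun s => u l s ω :=
  measurable_eval_of_rightCont (Ω := ℝ≥0) (f := fun t _ => u l t ω)
    (fun _ => measurable_const) (fun _ t => T.sys.rightCont l ω t) measurable_id'

lemma measurable_truncRate (l : L) (m : ℝ) (ω : Ω) :
    Measurable fun s => r l * truncEntropy m (θ l s ω) * u l s ω :=
  (((measurable_truncEntropy m).comp ((T.pred l).measurable_section ω)).const_mul _).mul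
    (T.measurable_speed_path l ω)

lemma truncRate_nonneg (l : L) (m : ℝ) (ω : Ω) (s : ℝ≥0) :
    0 ≤ r l * truncEntropy m (θ l s ω) * u l s ω :=
  mul_nonneg (mul_nonneg (r l).2 (truncEntropy_nonneg _ _)) (T.sys.nonneg l s ω)

lemma truncRate_le (l : L) {m : ℝ} (hm : 0 ≤ m) (ω : Ω) (s : ℝ≥0) :
    r l * truncEntropy m (θ l s ω) * u l s ω ≤ r l * (Real.exp m * m + 1) :=
  (mul_le_of_le_one_right (mul_nonneg (r l).2 (truncEntropy_nonneg _ _)) (T.sys.le_one l s ω)).trans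
    (mul_le_mul_of_nonneg_left (truncEntropy_le hm _) (r l).2)

lemma measurable_truncEntropyInt (l : L) (m : ℝ) (t : ℝ≥0) :
    Measurable[F t] (truncEntropyInt u r θ l m t) := by
  rcases (zero_le : 0 ≤ t).eq_or_lt with h | h
  · have : truncEntropyInt u r θ l m t = fun _ => 0 := by
      ext ω; simp [truncEntropyInt, ← h]
    rw [this]
    exact measurable_const
  · exact T.sys.measurable_integral (T.pred l).predLim l (φ := fun x => r l * truncEntropy m x)
      ((measurable_truncEntropy m).const_mul _) h

lemma truncEntropyInt_nonneg (l : L) (m : ℝ) (t : ℝ≥0) (ω : Ω) :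
    0 ≤ truncEntropyInt u r θ l m t ω :=
  integral_nonneg (T.truncRate_nonneg l m ω)

lemma truncEntropyInt_le (l : L) {m : ℝ} (hm : 0 ≤ m) (t : ℝ≥0) (ω : Ω) :
    truncEntropyInt u r θ l m t ω ≤ r l * (Real.exp m * m + 1) * t := by
  have := setIntegral_Ioc_le (T.measurable_truncRate l m ω) (T.truncRate_nonneg l m ω)
    (T.truncRate_le l hm ω) (zero_le : 0 ≤ t)
  simpa [truncEntropyInt] using this

lemma measurableSet_level (l : L) {m : ℝ} (hm : 0 ≤ m) {a : ℝ} (ha : 0 ≤ a) :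
    MeasurableSet[F.predictable] ({p : ℝ≥0 × Ω | a < truncEntropyInt u r θ l m p.1 p.2} ∩
      {p | θ l p.1 p.2 ∈ Set.Icc (-m) m}) := by
  refine @MeasurableSet.inter _ F.predictable _ _ ?_ ((T.pred l) measurableSet_Icc)
  refine measurableSet_predictable_level (T.measurable_truncEntropyInt l m) (fun ω => ?_)
    (fun ω => ?_) fun ω => ?_
  · exact monotone_setIntegral_Ioc (T.measurable_truncRate l m ω) (T.truncRate_nonneg l m ω)
      (T.truncRate_le l hm ω)
  · exact continuous_setIntegral_Ioc (T.measurable_truncRate l m ω) (T.truncRate_nonneg l m ω)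
      (T.truncRate_le l hm ω)
  · simpa [truncEntropyInt] using ha

/-- The expected excess of the truncated entropy over a level is at most the expectation of the
positive part of the logarithmic density collected while the level is exceeded. -/
lemma lintegral_sub_level_le [IsProbabilityMeasure P] {t : ℝ≥0} (ht : 0 < t) (l : L) {m : ℝ}
    (hm : 1 ≤ m) {a : ℝ} (ha : 0 ≤ a) :
    ∫⁻ ω, ENNReal.ofReal (truncEntropyInt u r θ l m t ω - a) ∂Q ≤
      ∫⁻ ω, ENNReal.ofReal (logExp (fun s => N l s ω) (fun s => u l s ω) (r l)
        (fun s => θ l s ω * ({p : ℝ≥0 × Ω | a < truncEntropyInt u r θ l m p.1 p.2} ∩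
          {p | θ l p.1 p.2 ∈ Set.Icc (-m) m}).indicator (fun _ => (1 : ℝ)) (s, ω)) t) ∂Q := by
  have hm0 : 0 ≤ m := zero_le_one.trans hm
  have hprob := T.prob
  set S := {p : ℝ≥0 × Ω | a < truncEntropyInt u r θ l m p.1 p.2} ∩
    {p | θ l p.1 p.2 ∈ Set.Icc (-m) m} with hS
  have hSm : MeasurableSet[F.predictable] S := T.measurableSet_level l hm0 ha
  let H : ℝ≥0 → Ω → ℝ := fun s ω => θ l s ω * S.indicator (fun _ => (1 : ℝ)) (s, ω)
  have hH : IsPred F H := (T.pred l).mul (IsPred.indicator hSm)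
  have hHm : ∀ s ω, |H s ω| ≤ m := fun s ω => by
    by_cases h : (s, ω) ∈ S
    · simp only [H, Set.indicator_of_mem h, mul_one]
      exact abs_le.2 h.2
    · simp [H, Set.indicator_of_notMem h, hm0]
  have hHθ : ∀ s ω, H s ω ≠ 0 → θ l s ω ≤ m := fun s ω h0 => by
    by_cases h : (s, ω) ∈ S
    · exact h.2.2
    · exact absurd (by simp [H, Set.indicator_of_notMem h]) h0
  set y : Ω → ℝ := fun ω => logExp (fun s => N l s ω) (fun s => u l s ω) (r l)
    (fun s => H s ω) t with hy
  have hym : Measurable y := (T.measurable_logExp hH l ht).mono (F.le t) le_rfl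
  have hAm : Measurable (truncEntropyInt u r θ l m t) :=
    (T.measurable_truncEntropyInt l m t).mono (F.le t) le_rfl
  set Z : Ω → ℝ := fun ω => jumpSum (fun s => N l s ω) (fun s => H s ω) 0 t -
    r l * ∫ s in Set.Ioc 0 t, H s ω * Real.exp (θ l s ω) * u l s ω ∂leb with hZ
  -- the compensator of the logarithmic density on `S` is the entropy collected on `S`
  have hAZ : ∀ ω, max (truncEntropyInt u r θ l m t ω - a) 0 ≤ y ω - Z ω := by
    intro ω
    have h1 := sub_le_setIntegral_level (A := fun s => truncEntropyInt u r θ l m s ω) ha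
      (integrableOn_Ioc_of_bounded (T.measurable_truncRate l m ω) (T.truncRate_nonneg l m ω)
        (T.truncRate_le l hm0 ω) 0 t) (T.truncRate_nonneg l m ω) (fun _ => rfl)
      (continuous_setIntegral_Ioc (T.measurable_truncRate l m ω) (T.truncRate_nonneg l m ω)
        (T.truncRate_le l hm0 ω))
    refine (max_le h1 (integral_nonneg fun s => Set.indicator_nonneg
      (fun s _ => T.truncRate_nonneg l m ω s) s)).trans (le_of_eq ?_)
    have hi1 : IntegrableOn (fun s => H s ω * Real.exp (θ l s ω) * u l s ω) (Set.Ioc 0 t) leb := by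
      refine T.integrableOn_mul (hH.mul ((T.pred l).comp Real.measurable_exp)) l
        (g := fun _ => m * Real.exp m) (integrableOn_const (by simp [leb_Ioc])) fun s => ?_
      rw [abs_mul, abs_of_pos (Real.exp_pos _)]
      by_cases h : H s ω = 0
      · rw [h, abs_zero, zero_mul]; positivity
      · exact mul_le_mul (hHm s ω) (Real.exp_le_exp.2 (hHθ s ω h)) (Real.exp_pos _).le hm0
    have hi2 : IntegrableOn (fun s => (Real.exp (H s ω) - 1) * u l s ω) (Set.Ioc 0 t) leb := by
      refine T.integrableOn_mul (ζ := fun s ω => Real.exp (H s ω) - 1)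
        (hH.comp (φ := fun x => Real.exp x - 1) (by fun_prop)) l
        (g := fun _ => Real.exp m + 1) (integrableOn_const (by simp [leb_Ioc])) fun s => ?_
      have h2 := Real.exp_le_exp.2 (abs_le.1 (hHm s ω)).2
      have h3 := Real.exp_pos (H s ω)
      rw [abs_le]; constructor <;> linarith
    have h4 : y ω - Z ω = r l * (∫ s in Set.Ioc 0 t, H s ω * Real.exp (θ l s ω) * u l s ω ∂leb -
        ∫ s in Set.Ioc 0 t, (Real.exp (H s ω) - 1) * u l s ω ∂leb) := by
      simp only [hy, hZ, logExp]; ring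
    rw [h4, ← integral_sub hi1 hi2, ← integral_const_mul]
    refine setIntegral_congr_fun measurableSet_Ioc fun s _ => ?_
    by_cases h5 : a < truncEntropyInt u r θ l m s ω
    · rw [Set.indicator_of_mem (by exact h5)]
      by_cases h6 : θ l s ω ∈ Set.Icc (-m) m
      · have h7 : (s, ω) ∈ S := ⟨h5, h6⟩
        simp only [H, Set.indicator_of_mem h7, truncEntropy, Set.indicator_of_mem h6, entropyFun]
        ring_nf
      · have h7 : (s, ω) ∉ S := fun h => h6 h.2
        simp [H, Set.indicator_of_notMem h7, truncEntropy, Set.indicator_of_notMem h6]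
    · have h7 : (s, ω) ∉ S := fun h => h5 h.1
      rw [Set.indicator_of_notMem (by exact h5)]
      simp [H, Set.indicator_of_notMem h7]
  set C : ℝ := r l * t * Real.exp m * m ^ 2 with hC
  -- the inequality with an error of order `ε`, from `1 - ε Z ≤ exp (-ε Z)`
  have hε : ∀ ε : ℝ, 0 < ε → ε * m ≤ 1 →
      ∫⁻ ω, ENNReal.ofReal (truncEntropyInt u r θ l m t ω - a) ∂Q ≤
        ENNReal.ofReal ((Real.exp (C * ε ^ 2) - 1) / ε) + ∫⁻ ω, ENNReal.ofReal (y ω) ∂Q := by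
    intro ε hε0 hεm
    have h1 := T.lintegral_exp_neg_compensated_le ht l hH hHm hHθ hε0.le hεm
    have h2 : ∀ ω, 1 + ENNReal.ofReal ε * ENNReal.ofReal (truncEntropyInt u r θ l m t ω - a) ≤
        ENNReal.ofReal (Real.exp (-ε * Z ω)) + ENNReal.ofReal ε * ENNReal.ofReal (y ω) := by
      intro ω
      have hmax : ∀ x : ℝ, ENNReal.ofReal x = ENNReal.ofReal (max x 0) := fun x => by
        rcases le_total x 0 with h | h
        · rw [max_eq_right h, ENNReal.ofReal_of_nonpos h, ENNReal.ofReal_zero]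
        · rw [max_eq_left h]
      rw [hmax (_ - a), hmax (y ω), ← ENNReal.ofReal_mul hε0.le, ← ENNReal.ofReal_mul hε0.le,
        ← ENNReal.ofReal_one, ← ENNReal.ofReal_add zero_le_one (by positivity),
        ← ENNReal.ofReal_add (Real.exp_pos _).le (by positivity)]
      refine ENNReal.ofReal_le_ofReal ?_
      have h3 := mul_le_mul_of_nonneg_left ((hAZ ω).trans
        (sub_le_sub_right (le_max_left (y ω) 0) _)) hε0.le
      have h4 := Real.add_one_le_exp (-ε * Z ω)
      linarith
    have h3 := lintegral_mono (μ := Q) h2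
    rw [lintegral_add_right _ ((hAm.sub_const a).ennreal_ofReal.const_mul _),
      lintegral_add_right _ (hym.ennreal_ofReal.const_mul _),
      lintegral_const_mul _ (hAm.sub_const a).ennreal_ofReal,
      lintegral_const_mul _ hym.ennreal_ofReal] at h3
    simp only [lintegral_const, measure_univ, mul_one] at h3
    have hC0 : 0 ≤ C := by positivity
    have h4 : ENNReal.ofReal (Real.exp (C * ε ^ 2)) =
        1 + ENNReal.ofReal ε * ENNReal.ofReal ((Real.exp (C * ε ^ 2) - 1) / ε) := by
      have h5 : 0 ≤ Real.exp (C * ε ^ 2) - 1 := by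
        have := Real.add_one_le_exp (C * ε ^ 2)
        have : 0 ≤ C * ε ^ 2 := by positivity
        linarith
      rw [← ENNReal.ofReal_mul hε0.le, mul_div_cancel₀ _ hε0.ne', ← ENNReal.ofReal_one,
        ← ENNReal.ofReal_add zero_le_one h5, add_sub_cancel]
    have h5 := h3.trans (add_le_add_left h1 _)
    rw [h4, add_assoc, ← mul_add, ENNReal.add_le_add_iff_left ENNReal.one_ne_top,
      ENNReal.mul_le_mul_iff_right (by simpa using hε0) ENNReal.ofReal_ne_top] at h5
    exact h5
  refine ENNReal.le_of_forall_pos_le_add fun δ hδ _ => ?_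
  have hC0 : 0 ≤ C := by positivity
  -- this `ε` meets the constraint `ε m ≤ 1` and makes the error at most `δ`
  set ε : ℝ := min (1 / m) (min (1 / (C + 1)) (δ / (2 * (C + 1)))) with hεdef
  have hδ' : (0 : ℝ) < δ := hδ
  have hε0 : 0 < ε := by positivity
  have hε1 : ε ≤ 1 / m := min_le_left _ _
  have hε2 : ε ≤ 1 / (C + 1) := (min_le_right _ _).trans (min_le_left _ _)
  have hε3 : ε ≤ δ / (2 * (C + 1)) := (min_le_right _ _).trans (min_le_right _ _)
  rw [le_div_iff₀ (by positivity)] at hε1 hε2 hε3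
  have hε4 : ε ≤ 1 := by nlinarith
  have h6 : C * ε ^ 2 ≤ 1 := by nlinarith [mul_nonneg hC0 hε0.le]
  have h7 : (Real.exp (C * ε ^ 2) - 1) / ε ≤ δ := by
    rw [div_le_iff₀ hε0]
    have h8 := Real.abs_exp_sub_one_le (x := C * ε ^ 2) (by
      rw [abs_of_nonneg (by positivity)]; exact h6)
    rw [abs_of_nonneg (a := C * ε ^ 2) (by positivity)] at h8
    have h9 := le_abs_self (Real.exp (C * ε ^ 2) - 1)
    nlinarith
  refine (hε ε hε0 hε1).trans ?_
  rw [add_comm]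
  refine add_le_add_right ?_ _
  rw [← ENNReal.ofReal_coe_nnreal]
  exact ENNReal.ofReal_le_ofReal h7

/-- The level inequality in the form needed for moment bounds: the contribution of the times at
which the truncated entropy is below the level is an error term with exponential moments. -/
lemma exists_level_error [IsProbabilityMeasure P] {t : ℝ≥0} (ht : 0 < t) (l : L) {m : ℝ}
    (hm : 1 ≤ m) {a : ℝ} (ha : 0 ≤ a) :
    ∃ ξ : Ω → ℝ, Measurable ξ ∧ (∀ ω, 0 ≤ ξ ω) ∧ ∫⁻ ω, ENNReal.ofReal (Real.exp (ξ ω)) ∂Q ≤ 2 ∧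
      ∫⁻ ω, ENNReal.ofReal (truncEntropyInt u r θ l m t ω - a) ∂Q ≤
        ∫⁻ ω, {ω | a < truncEntropyInt u r θ l m t ω}.indicator (fun ω => ENNReal.ofReal
          (max (logExp (fun s => N l s ω) (fun s => u l s ω) (r l) (fun s => θ l s ω) t) 0 + ξ ω))
          ω ∂Q := by
  have hm0 : 0 ≤ m := zero_le_one.trans hm
  have hprob := T.prob
  set S := {p : ℝ≥0 × Ω | a < truncEntropyInt u r θ l m p.1 p.2} ∩
    {p | θ l p.1 p.2 ∈ Set.Icc (-m) m} with hS
  have hSm : MeasurableSet[F.predictable] S := T.measurableSet_level l hm0 ha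
  have hSc : MeasurableSet[F.predictable] Sᶜ := @MeasurableSet.compl _ _ F.predictable hSm
  set y' : Ω → ℝ := fun ω => logExp (fun s => N l s ω) (fun s => u l s ω) (r l)
    (fun s => θ l s ω * Sᶜ.indicator (fun _ => (1 : ℝ)) (s, ω)) t with hy'
  have hym : Measurable y' :=
    (T.measurable_logExp ((T.pred l).mul (IsPred.indicator hSc)) l ht).mono (F.le t) le_rfl
  refine ⟨fun ω => max (-y' ω) 0, hym.neg.max measurable_const, fun ω => le_max_right _ _, ?_, ?_⟩
  · calc ∫⁻ ω, ENNReal.ofReal (Real.exp (max (-y' ω) 0)) ∂Q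
        ≤ ∫⁻ ω, (ENNReal.ofReal (Real.exp (-y' ω)) + 1) ∂Q := lintegral_mono fun ω => by
          rcases le_total (-y' ω) 0 with h | h
          · rw [max_eq_right h, Real.exp_zero, ENNReal.ofReal_one]
            exact le_add_self
          · rw [max_eq_left h]
            exact le_self_add
      _ ≤ 1 + 1 := by
          rw [lintegral_add_right _ measurable_const, lintegral_const, measure_univ, mul_one]
          exact add_le_add_left (T.lintegral_exp_neg_logExp_le ht l hSc) 1
      _ = 2 := one_add_one_eq_two
  · refine (T.lintegral_sub_level_le ht l hm ha).trans (lintegral_mono_ae ?_)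
    filter_upwards [T.ae_integrable ht l] with ω hω
    by_cases h : a < truncEntropyInt u r θ l m t ω
    · rw [Set.indicator_of_mem (by exact h)]
      refine ENNReal.ofReal_le_ofReal ?_
      have h1 := T.logExp_split l hSm hω
      have h2 := le_max_left (-y' ω) 0
      have h3 := le_max_left (logExp (fun s => N l s ω) (fun s => u l s ω) (r l)
        (fun s => θ l s ω) t) 0
      simp only [hy'] at h2 ⊢
      linarith
    · -- below the level nothing is collected
      have h1 : ∀ s ∈ Set.Ioc 0 t,
          θ l s ω * S.indicator (fun _ => (1 : ℝ)) (s, ω) = 0 := fun s hs => by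
        have : (s, ω) ∉ S := fun hs' => h (lt_of_lt_of_le hs'.1
          (monotone_setIntegral_Ioc (T.measurable_truncRate l m ω) (T.truncRate_nonneg l m ω)
            (T.truncRate_le l hm0 ω) hs.2))
        rw [Set.indicator_of_notMem this, mul_zero]
      have h2 : logExp (fun s => N l s ω) (fun s => u l s ω) (r l)
          (fun s => θ l s ω * S.indicator (fun _ => (1 : ℝ)) (s, ω)) t = 0 := by
        unfold logExp
        rw [jumpSum_of_const (T.sys.path l ω) zero_le h1,
          setIntegral_congr_fun (g := fun _ => (0 : ℝ)) measurableSet_Ioc fun s hs => by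
            simp only [h1 s hs, Real.exp_zero, sub_self, zero_mul]]
        simp
      rw [h2]
      simp

end Tilted

/-! ### Moments from level inequalities -/

section Moments

/-- `k ^ (p - 1)`, set to zero at `k = 0`. -/
def levelSum (p : ℝ) (k : ℕ) : ℝ := if k = 0 then 0 else (k : ℝ) ^ (p - 1)

/-- The increments of `k ^ (p - 1)`, used as weights of the integer levels: the sum of the excesses
over all levels with these weights is of the order of the `p`-th power. -/
def levelWeight (p : ℝ) (j : ℕ) : ℝ := levelSum p (j + 1) - levelSum p j

variable {p : ℝ}

lemma sum_levelWeight (p : ℝ) (k : ℕ) : ∑ j ∈ Finset.range k, levelWeight p j = levelSum p k := by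
  unfold levelWeight
  rw [Finset.sum_range_sub]
  simp [levelSum]

lemma levelWeight_nonneg (hp : 1 ≤ p) (j : ℕ) : 0 ≤ levelWeight p j := by
  unfold levelWeight levelSum
  rw [if_neg (Nat.succ_ne_zero j), sub_nonneg]
  split_ifs
  · positivity
  · exact Real.rpow_le_rpow (Nat.cast_nonneg j) (by simp) (by linarith)

lemma levelWeight_le (j : ℕ) : levelWeight p j ≤ ((j : ℝ) + 1) ^ (p - 1) := by
  unfold levelWeight levelSum
  rw [if_neg (Nat.succ_ne_zero j)]
  have : (0 : ℝ) ≤ if j = 0 then 0 else (j : ℝ) ^ (p - 1) := by split_ifs <;> positivity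
  push_cast
  linarith

lemma rpow_le_sum_levels (hp : 1 ≤ p) {a : ℝ} (ha : 0 ≤ a) {J : ℕ} (haJ : a ≤ J) :
    (a / 2) ^ p ≤ ∑ j ∈ Finset.range J, levelWeight p j * max (a - j) 0 := by
  rcases ha.eq_or_lt with h0 | h0
  · rw [← h0, zero_div, Real.zero_rpow (by linarith)]
    exact Finset.sum_nonneg fun j _ => mul_nonneg (levelWeight_nonneg hp j) (le_max_right _ _)
  have hk : ⌈a / 2⌉₊ ≠ 0 := (Nat.ceil_pos.2 (by positivity)).ne'
  have hkJ : ⌈a / 2⌉₊ ≤ J := Nat.ceil_le.2 (by linarith)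
  calc (a / 2) ^ p = (a / 2) ^ (p - 1) * (a / 2) := by
        rw [← Real.rpow_add_one (by positivity)]; congr 1; ring
    _ ≤ (⌈a / 2⌉₊ : ℝ) ^ (p - 1) * (a / 2) := by
        refine mul_le_mul_of_nonneg_right ?_ (by positivity)
        exact Real.rpow_le_rpow (by positivity) (Nat.le_ceil _) (by linarith)
    _ = ∑ j ∈ Finset.range ⌈a / 2⌉₊, levelWeight p j * (a / 2) := by
        rw [← Finset.sum_mul, sum_levelWeight, levelSum, if_neg hk]
    _ ≤ ∑ j ∈ Finset.range ⌈a / 2⌉₊, levelWeight p j * max (a - j) 0 := by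
        refine Finset.sum_le_sum fun j hj => ?_
        refine mul_le_mul_of_nonneg_left (le_max_of_le_left ?_) (levelWeight_nonneg hp j)
        have := Nat.lt_ceil.1 (Finset.mem_range.1 hj)
        linarith
    _ ≤ _ := Finset.sum_le_sum_of_subset_of_nonneg (Finset.range_mono hkJ) fun j _ _ =>
        mul_nonneg (levelWeight_nonneg hp j) (le_max_right _ _)

lemma sum_levels_lt_le (hp : 1 ≤ p) {a : ℝ} (ha : 0 ≤ a) (J : ℕ) :
    ∑ j ∈ Finset.range J, (if (j : ℝ) < a then levelWeight p j else 0) ≤ (a + 1) ^ (p - 1) := by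
  rw [← Finset.sum_filter]
  calc _ ≤ ∑ j ∈ Finset.range ⌈a⌉₊, levelWeight p j := by
        refine Finset.sum_le_sum_of_subset_of_nonneg (fun j hj => ?_) fun j _ _ =>
          levelWeight_nonneg hp j
        exact Finset.mem_range.2 (Nat.lt_ceil.2 (Finset.mem_filter.1 hj).2)
    _ = levelSum p ⌈a⌉₊ := sum_levelWeight _ _
    _ ≤ (a + 1) ^ (p - 1) := by
        unfold levelSum
        split_ifs
        · positivity
        · exact Real.rpow_le_rpow (by positivity) (Nat.ceil_lt_add_one ha).le (by linarith)

lemma le_add_exp_div {δ ξ : ℝ} (hδ : 0 < δ) (hξ : 0 ≤ ξ) (q : ℕ) :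
    ξ ≤ δ + (q + 1).factorial / δ ^ q * Real.exp ξ := by
  rcases le_total ξ δ with h | h
  · have : 0 ≤ (q + 1).factorial / δ ^ q * Real.exp ξ := by positivity
    linarith
  · have h1 := Real.pow_div_factorial_le_exp ξ hξ (q + 1)
    rw [div_le_iff₀ (by positivity)] at h1
    have h2 : δ ^ q * ξ ≤ ξ ^ (q + 1) := by
      rw [pow_succ]
      exact mul_le_mul_of_nonneg_right (pow_le_pow_left₀ hδ.le h q) hξ
    have h3 : ξ ≤ (q + 1).factorial / δ ^ q * Real.exp ξ := by
      rw [div_mul_eq_mul_div, le_div_iff₀ (by positivity)]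
      linarith
    linarith

lemma rpow_mul_le (hp : 1 ≤ p) {δ a x : ℝ} (hδ : 0 < δ) (ha : 0 < a) (hx : 0 ≤ x) :
    a ^ (p - 1) * x ≤ δ * a ^ p + δ ^ (1 - p) * x ^ p := by
  have hap : a ^ p = a ^ (p - 1) * a := by
    rw [← Real.rpow_add_one ha.ne']; congr 1; ring
  rcases le_total x (δ * a) with h | h
  · have h1 : 0 ≤ δ ^ (1 - p) * x ^ p := by positivity
    have h2 := mul_le_mul_of_nonneg_left h (Real.rpow_nonneg ha.le (p - 1))
    rw [hap]
    linarith
  · have hx0 : 0 < x := (by positivity : 0 < δ * a).trans_le h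
    have h1 : 0 ≤ δ * a ^ p := by positivity
    have h2 : a ^ (p - 1) ≤ δ ^ (1 - p) * x ^ (p - 1) := by
      have h3 : a ≤ x / δ := by rw [le_div_iff₀ hδ]; linarith
      calc a ^ (p - 1) ≤ (x / δ) ^ (p - 1) := Real.rpow_le_rpow ha.le h3 (by linarith)
        _ = δ ^ (1 - p) * x ^ (p - 1) := by
          rw [Real.div_rpow hx hδ.le, div_eq_mul_inv, ← Real.rpow_neg hδ.le, mul_comm]
          congr 2; ring
    have h4 : x ^ p = x ^ (p - 1) * x := by
      rw [← Real.rpow_add_one hx0.ne']; congr 1; ring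
    have h5 := mul_le_mul_of_nonneg_right h2 hx
    rw [h4]
    linarith

lemma add_rpow_le (hp : 0 ≤ p) {a b : ℝ} (ha : 0 ≤ a) (hb : 0 ≤ b) :
    (a + b) ^ p ≤ 2 ^ p * (a ^ p + b ^ p) := by
  have h1 : a + b ≤ 2 * max a b := by linarith [le_max_left a b, le_max_right a b]
  calc (a + b) ^ p ≤ (2 * max a b) ^ p := Real.rpow_le_rpow (by positivity) h1 hp
    _ = 2 ^ p * max a b ^ p := Real.mul_rpow (by norm_num) (by positivity)
    _ ≤ 2 ^ p * (a ^ p + b ^ p) := by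
        refine mul_le_mul_of_nonneg_left ?_ (by positivity)
        have := Real.rpow_nonneg ha p
        have := Real.rpow_nonneg hb p
        rcases max_choice a b with h | h <;> rw [h] <;> linarith

/-- The constant in the estimate of the error terms of the level inequalities. -/
def levelErrorConst (p δ : ℝ) : ℝ :=
  4 * ((⌈p⌉₊ + 2).factorial / δ ^ (⌈p⌉₊ + 1))

/-- The level weights grow like `(j + 1) ^ (p - 1)`, so that the error terms, which decay with the
power `⌈p⌉₊ + 1` of `j + 1`, are summable. -/
lemma sum_levelWeight_mul_le {δ : ℝ} (hδ : 0 < δ) (J : ℕ) :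
    ∑ j ∈ Finset.range J, levelWeight p j *
      ((⌈p⌉₊ + 1 + 1).factorial / (δ * (j + 1)) ^ (⌈p⌉₊ + 1) * 2) ≤ levelErrorConst p δ := by
  have hsum : ∑ j ∈ Finset.range J, (1 : ℝ) / ((j : ℝ) + 1) ^ 2 ≤ 2 := by
    calc ∑ j ∈ Finset.range J, (1 : ℝ) / ((j : ℝ) + 1) ^ 2
        ≤ ∑ j ∈ Finset.range J, (2 * (1 / ((j : ℝ) + 1)) - 2 * (1 / (((j + 1 : ℕ) : ℝ) + 1))) := by
          refine Finset.sum_le_sum fun j _ => ?_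
          have h1 : (0 : ℝ) < (j : ℝ) + 1 := by positivity
          have h2 : 2 * (1 / ((j : ℝ) + 1)) - 2 * (1 / (((j + 1 : ℕ) : ℝ) + 1)) =
              2 / (((j : ℝ) + 1) * (j + 2)) := by
            push_cast
            have : (j : ℝ) + 1 + 1 ≠ 0 := by positivity
            have : (j : ℝ) + 2 ≠ 0 := by positivity
            field_simp
            ring
          rw [h2, div_le_div_iff₀ (by positivity) (by positivity)]
          nlinarith
      _ = 2 - 2 * (1 / ((J : ℝ) + 1)) := by
          rw [Finset.sum_range_sub' fun j : ℕ => 2 * (1 / ((j : ℝ) + 1))]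
          simp
      _ ≤ 2 := by
          have : (0 : ℝ) ≤ 2 * (1 / ((J : ℝ) + 1)) := by positivity
          linarith
  set K : ℝ := (⌈p⌉₊ + 1 + 1).factorial / δ ^ (⌈p⌉₊ + 1) with hK
  have hK0 : 0 ≤ K := by positivity
  calc _ ≤ ∑ j ∈ Finset.range J, 2 * K * (1 / ((j : ℝ) + 1) ^ 2) := by
        refine Finset.sum_le_sum fun j _ => ?_
        have h1 : (1 : ℝ) ≤ (j : ℝ) + 1 := by simp
        have h0 : (0 : ℝ) < (j : ℝ) + 1 := by positivity
        have h2 : levelWeight p j * ((j : ℝ) + 1) ^ 2 ≤ ((j : ℝ) + 1) ^ (⌈p⌉₊ + 1) := by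
          calc levelWeight p j * ((j : ℝ) + 1) ^ 2
              ≤ ((j : ℝ) + 1) ^ (p - 1) * ((j : ℝ) + 1) ^ 2 :=
                mul_le_mul_of_nonneg_right (levelWeight_le j) (by positivity)
            _ = ((j : ℝ) + 1) ^ (p + 1) := by
                rw [← Real.rpow_natCast _ 2, ← Real.rpow_add h0]; congr 1; push_cast; ring
            _ ≤ ((j : ℝ) + 1) ^ ((⌈p⌉₊ + 1 : ℕ) : ℝ) :=
                Real.rpow_le_rpow_of_exponent_le h1 (by
                  push_cast; linarith [Nat.le_ceil p])
            _ = _ := Real.rpow_natCast _ _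
        rw [mul_pow, ← div_div, ← hK, mul_one_div, le_div_iff₀ (by positivity)]
        calc _ = (2 * K) * (levelWeight p j * ((j : ℝ) + 1) ^ 2) / ((j : ℝ) + 1) ^ (⌈p⌉₊ + 1) := by
              ring
          _ ≤ 2 * K := by
              rw [div_le_iff₀ (by positivity)]
              exact mul_le_mul_of_nonneg_left h2 (by positivity)
    _ = 2 * K * ∑ j ∈ Finset.range J, (1 : ℝ) / ((j : ℝ) + 1) ^ 2 := by rw [Finset.mul_sum]
    _ ≤ 2 * K * 2 := mul_le_mul_of_nonneg_left hsum (by positivity)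
    _ = levelErrorConst p δ := by rw [levelErrorConst, hK]; ring

variable {Ω : Type*} [MeasurableSpace Ω] {Q : Measure Ω}

/-- The intermediate moment estimate with a free parameter `δ`. -/
lemma lintegral_half_rpow_le [IsProbabilityMeasure Q] (hp : 1 ≤ p) {δ : ℝ} (hδ : 0 < δ)
    {A x : Ω → ℝ} {ξ : ℕ → Ω → ℝ} (hA : Measurable A) (hx : Measurable x)
    (hξ : ∀ j, Measurable (ξ j)) (hA0 : ∀ ω, 0 ≤ A ω) {J : ℕ} (hAJ : ∀ ω, A ω ≤ J)
    (hx0 : ∀ ω, 0 ≤ x ω) (hξ0 : ∀ j ω, 0 ≤ ξ j ω)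
    (hexp : ∀ j, ∫⁻ ω, ENNReal.ofReal (Real.exp (ξ j ω)) ∂Q ≤ 2)
    (hlevel : ∀ j : ℕ, ∫⁻ ω, ENNReal.ofReal (A ω - j) ∂Q ≤
      ∫⁻ ω, {ω | (j : ℝ) < A ω}.indicator (fun ω => ENNReal.ofReal (x ω + ξ j ω)) ω ∂Q) :
    ∫⁻ ω, ENNReal.ofReal ((A ω / 2) ^ p) ∂Q ≤
      ∫⁻ ω, ENNReal.ofReal (2 * δ * (A ω + 1) ^ p + δ ^ (1 - p) * x ω ^ p) ∂Q +
        ENNReal.ofReal (levelErrorConst p δ) := by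
  have hmax : ∀ y : ℝ, ENNReal.ofReal (max y 0) = ENNReal.ofReal y := fun y => by
    rcases le_total y 0 with h | h
    · rw [max_eq_right h, ENNReal.ofReal_of_nonpos h, ENNReal.ofReal_zero]
    · rw [max_eq_left h]
  have hset : ∀ j : ℕ, MeasurableSet {ω | (j : ℝ) < A ω} := fun j =>
    measurableSet_lt measurable_const hA
  set c : ℕ → ℝ := fun j => (⌈p⌉₊ + 1 + 1).factorial / (δ * (j + 1)) ^ (⌈p⌉₊ + 1) with hc
  have hc0 : ∀ j, 0 ≤ c j := fun j => by positivity
  have hw := levelWeight_nonneg hp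
  -- write the power as a weighted sum of excesses over levels, use the level inequalities, and
  -- estimate the error at level `j` by `δ (j + 1)` plus a small multiple of its exponential
  calc ∫⁻ ω, ENNReal.ofReal ((A ω / 2) ^ p) ∂Q
      ≤ ∫⁻ ω, ∑ j ∈ Finset.range J,
          ENNReal.ofReal (levelWeight p j) * ENNReal.ofReal (A ω - j) ∂Q := by
        refine lintegral_mono fun ω => ?_
        refine (ENNReal.ofReal_le_ofReal (rpow_le_sum_levels hp (hA0 ω) (hAJ ω))).trans ?_
        rw [ENNReal.ofReal_sum_of_nonneg fun j _ => mul_nonneg (hw j) (le_max_right _ _)]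
        refine Finset.sum_le_sum fun j _ => ?_
        rw [ENNReal.ofReal_mul (hw j), hmax]
    _ = ∑ j ∈ Finset.range J,
          ENNReal.ofReal (levelWeight p j) * ∫⁻ ω, ENNReal.ofReal (A ω - j) ∂Q := by
        rw [lintegral_finsetSum _ fun j _ => (hA.sub_const _).ennreal_ofReal.const_mul _]
        refine Finset.sum_congr rfl fun j _ => ?_
        rw [lintegral_const_mul _ (hA.sub_const _).ennreal_ofReal]
    _ ≤ ∑ j ∈ Finset.range J, ENNReal.ofReal (levelWeight p j) *
          ∫⁻ ω, ({ω | (j : ℝ) < A ω}.indicator (fun ω => ENNReal.ofReal (x ω + δ * (j + 1))) ω +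
            ENNReal.ofReal (c j) * ENNReal.ofReal (Real.exp (ξ j ω))) ∂Q := by
        refine Finset.sum_le_sum fun j _ => mul_le_mul_right ((hlevel j).trans
          (lintegral_mono fun ω => ?_)) _
        by_cases h : (j : ℝ) < A ω
        · rw [Set.indicator_of_mem (by exact h), Set.indicator_of_mem (by exact h),
            ← ENNReal.ofReal_mul (hc0 j), ← ENNReal.ofReal_add
              (add_nonneg (hx0 ω) (by positivity)) (mul_nonneg (hc0 j) (Real.exp_pos _).le)]
          refine ENNReal.ofReal_le_ofReal ?_
          have := le_add_exp_div (δ := δ * (j + 1)) (by positivity) (hξ0 j ω) (⌈p⌉₊ + 1)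
          simp only [hc]
          linarith
        · rw [Set.indicator_of_notMem (by exact h)]
          exact zero_le
    _ ≤ ∑ j ∈ Finset.range J, (∫⁻ ω, ENNReal.ofReal (levelWeight p j) *
          {ω | (j : ℝ) < A ω}.indicator (fun ω => ENNReal.ofReal (x ω + δ * (j + 1))) ω ∂Q +
            ENNReal.ofReal (levelWeight p j * (c j * 2))) := by
        refine Finset.sum_le_sum fun j _ => ?_
        rw [lintegral_add_right _ ((hξ j).exp.ennreal_ofReal.const_mul _), mul_add,
          lintegral_const_mul _ (hξ j).exp.ennreal_ofReal,
          lintegral_const_mul _ (((hx.add_const _).ennreal_ofReal).indicator (hset j))]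
        refine add_le_add_right ?_ _
        rw [ENNReal.ofReal_mul (hw j), ENNReal.ofReal_mul (hc0 j), ENNReal.ofReal_ofNat]
        exact mul_le_mul_right (mul_le_mul_right (hexp j) _) _
    _ = ∫⁻ ω, ∑ j ∈ Finset.range J, ENNReal.ofReal (levelWeight p j) *
          {ω | (j : ℝ) < A ω}.indicator (fun ω => ENNReal.ofReal (x ω + δ * (j + 1))) ω ∂Q +
        ENNReal.ofReal (∑ j ∈ Finset.range J, levelWeight p j * (c j * 2)) := by
        rw [Finset.sum_add_distrib, lintegral_finsetSum _ fun j _ =>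
          ((((hx.add_const _).ennreal_ofReal).indicator (hset j))).const_mul _,
          ENNReal.ofReal_sum_of_nonneg fun j _ =>
            mul_nonneg (hw j) (mul_nonneg (hc0 j) (by norm_num))]
    _ ≤ _ := by
        refine add_le_add (lintegral_mono fun ω => ?_)
          (ENNReal.ofReal_le_ofReal (sum_levelWeight_mul_le hδ J))
        have hA1 : 0 < A ω + 1 := by linarith [hA0 ω]
        have hy : 0 ≤ x ω + δ * (A ω + 1) := add_nonneg (hx0 ω) (by positivity)
        calc _ ≤ ∑ j ∈ Finset.range J, ENNReal.ofReal
                ((if (j : ℝ) < A ω then levelWeight p j else 0) * (x ω + δ * (A ω + 1))) := by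
              refine Finset.sum_le_sum fun j _ => ?_
              by_cases h : (j : ℝ) < A ω
              · rw [Set.indicator_of_mem (by exact h), if_pos h, ← ENNReal.ofReal_mul (hw j)]
                refine ENNReal.ofReal_le_ofReal (mul_le_mul_of_nonneg_left ?_ (hw j))
                have : δ * ((j : ℝ) + 1) ≤ δ * (A ω + 1) :=
                  mul_le_mul_of_nonneg_left (by linarith) hδ.le
                linarith
              · rw [Set.indicator_of_notMem (by exact h), if_neg h]
                simp
          _ = ENNReal.ofReal ((∑ j ∈ Finset.range J, if (j : ℝ) < A ω then levelWeight p j else 0) *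
                (x ω + δ * (A ω + 1))) := by
              rw [Finset.sum_mul, ENNReal.ofReal_sum_of_nonneg]
              intro j _
              refine mul_nonneg ?_ hy
              split_ifs
              · exact hw j
              · exact le_rfl
          _ ≤ _ := by
              refine ENNReal.ofReal_le_ofReal ?_
              refine (mul_le_mul_of_nonneg_right (sum_levels_lt_le hp (hA0 ω) J) hy).trans ?_
              have h1 := rpow_mul_le hp hδ hA1 (hx0 ω)
              have h2 : (A ω + 1) ^ p = (A ω + 1) ^ (p - 1) * (A ω + 1) := by
                rw [← Real.rpow_add_one hA1.ne']; congr 1; ring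
              rw [h2] at h1 ⊢
              linarith

/-- If the expected excess of a bounded variable `A` over every integer level is controlled by
`x` and errors with exponential moments on the event that the level is exceeded, then the moments
of `A` are controlled by those of `x`. -/
theorem exists_moment_const (hp : 1 ≤ p) : ∃ C : ℝ≥0, ∀ {Ω : Type*} [MeasurableSpace Ω]
    (Q : Measure Ω) [IsProbabilityMeasure Q] (A x : Ω → ℝ) (ξ : ℕ → Ω → ℝ), Measurable A →
    Measurable x → (∀ j, Measurable (ξ j)) → (∀ ω, 0 ≤ A ω) → (∃ B, ∀ ω, A ω ≤ B) →
    (∀ ω, 0 ≤ x ω) → (∀ j ω, 0 ≤ ξ j ω) →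
    (∀ j, ∫⁻ ω, ENNReal.ofReal (Real.exp (ξ j ω)) ∂Q ≤ 2) →
    (∀ j : ℕ, ∫⁻ ω, ENNReal.ofReal (A ω - j) ∂Q ≤
      ∫⁻ ω, {ω | (j : ℝ) < A ω}.indicator (fun ω => ENNReal.ofReal (x ω + ξ j ω)) ω ∂Q) →
    ∫⁻ ω, ENNReal.ofReal (A ω ^ p) ∂Q ≤ C * (1 + ∫⁻ ω, ENNReal.ofReal (x ω ^ p) ∂Q) := by
  have hp0 : 0 ≤ p := by linarith
  -- with this `δ` the `A`-term on the right is half of the left-hand side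
  set δ : ℝ := 4⁻¹ * (2 ^ p * 2 ^ p)⁻¹ with hδdef
  have hδ : 0 < δ := by positivity
  have hδ2 : 2 ^ p * (2 * δ * 2 ^ p) = 1 / 2 := by
    rw [hδdef]
    have : (2 : ℝ) ^ p ≠ 0 := by positivity
    field_simp
    norm_num
  set C : ℝ := 1 + 2 * 2 ^ p * (δ ^ (1 - p) + levelErrorConst p δ) with hC
  have hE0 : 0 ≤ levelErrorConst p δ := by unfold levelErrorConst; positivity
  refine ⟨C.toNNReal, fun {Ω} _ Q _ A x ξ hA hx hξ hA0 ⟨B, hB⟩ hx0 hξ0 hexp hlevel => ?_⟩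
  have hmain := lintegral_half_rpow_le hp hδ hA hx hξ hA0 (J := ⌈B⌉₊)
    (fun ω => (hB ω).trans (Nat.le_ceil B)) hx0 hξ0 hexp hlevel
  set a := ∫⁻ ω, ENNReal.ofReal (A ω ^ p) ∂Q with ha
  set X := ∫⁻ ω, ENNReal.ofReal (x ω ^ p) ∂Q with hX
  have hC1 : 1 ≤ C := by
    have : 0 ≤ 2 * 2 ^ p * (δ ^ (1 - p) + levelErrorConst p δ) := by positivity
    linarith
  by_cases hXtop : X = ∞
  · rw [hXtop, add_top, ENNReal.mul_top]
    · exact le_top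
    · simpa using by linarith
  have hatop : a ≠ ∞ := by
    refine ne_top_of_le_ne_top (b := ENNReal.ofReal (B ^ p)) ENNReal.ofReal_ne_top ?_
    calc a ≤ ∫⁻ _, ENNReal.ofReal (B ^ p) ∂Q := lintegral_mono fun ω =>
          ENNReal.ofReal_le_ofReal (Real.rpow_le_rpow (hA0 ω) (hB ω) hp0)
      _ = _ := by simp
  have hAp : Measurable fun ω => ENNReal.ofReal (A ω ^ p) := (hA.pow_const p).ennreal_ofReal
  have hxp : Measurable fun ω => ENNReal.ofReal (x ω ^ p) := (hx.pow_const p).ennreal_ofReal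
  have hl : ∫⁻ ω, ENNReal.ofReal ((A ω / 2) ^ p) ∂Q = ENNReal.ofReal (2 ^ p)⁻¹ * a := by
    rw [ha, ← lintegral_const_mul _ hAp]
    refine lintegral_congr fun ω => ?_
    rw [← ENNReal.ofReal_mul (by positivity), Real.div_rpow (hA0 ω) (by norm_num), div_eq_inv_mul]
  have hr : ∫⁻ ω, ENNReal.ofReal (2 * δ * (A ω + 1) ^ p + δ ^ (1 - p) * x ω ^ p) ∂Q ≤
      ENNReal.ofReal (2 * δ * 2 ^ p) * (a + 1) + ENNReal.ofReal (δ ^ (1 - p)) * X := by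
    calc _ ≤ ∫⁻ ω, (ENNReal.ofReal (2 * δ * 2 ^ p) * (ENNReal.ofReal (A ω ^ p) + 1) +
          ENNReal.ofReal (δ ^ (1 - p)) * ENNReal.ofReal (x ω ^ p)) ∂Q := by
          refine lintegral_mono fun ω => ?_
          have h1 := Real.rpow_nonneg (hA0 ω) p
          have h2 := Real.rpow_nonneg (hx0 ω) p
          rw [← ENNReal.ofReal_one, ← ENNReal.ofReal_add h1 zero_le_one,
            ← ENNReal.ofReal_mul (by positivity), ← ENNReal.ofReal_mul (by positivity),
            ← ENNReal.ofReal_add (by positivity) (by positivity)]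
          refine ENNReal.ofReal_le_ofReal (add_le_add_left ?_ _)
          have h3 := add_rpow_le hp0 (hA0 ω) zero_le_one
          rw [Real.one_rpow] at h3
          rw [mul_assoc _ (2 ^ p)]
          exact mul_le_mul_of_nonneg_left h3 (by positivity)
      _ = _ := by
          rw [lintegral_add_right _ (hxp.const_mul _), lintegral_const_mul _ (hAp.add_const 1),
            lintegral_add_right _ measurable_const, lintegral_const_mul _ hxp]
          simp [ha, hX]
  rw [hl] at hmain
  have hfin := hmain.trans (add_le_add_left hr _)
  obtain ⟨a', ha'⟩ : ∃ a' : ℝ, a = ENNReal.ofReal a' ∧ 0 ≤ a' :=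
    ⟨a.toReal, (ENNReal.ofReal_toReal hatop).symm, ENNReal.toReal_nonneg⟩
  obtain ⟨X', hX'⟩ : ∃ X' : ℝ, X = ENNReal.ofReal X' ∧ 0 ≤ X' :=
    ⟨X.toReal, (ENNReal.ofReal_toReal hXtop).symm, ENNReal.toReal_nonneg⟩
  have ha0 := ha'.2
  have hX0 := hX'.2
  have hd0 : 0 ≤ δ ^ (1 - p) := by positivity
  rw [ha'.1, hX'.1, ← ENNReal.ofReal_one, ← ENNReal.ofReal_add ha0 zero_le_one,
    ← ENNReal.ofReal_mul (by positivity), ← ENNReal.ofReal_mul (by positivity),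
    ← ENNReal.ofReal_mul (by positivity), ← ENNReal.ofReal_add (by positivity) (by positivity),
    ← ENNReal.ofReal_add (by positivity) hE0, ENNReal.ofReal_le_ofReal_iff (by positivity)] at hfin
  rw [ha'.1, hX'.1, ← ENNReal.ofReal_one, ← ENNReal.ofReal_add zero_le_one hX0]
  change _ ≤ ENNReal.ofReal C * _
  rw [← ENNReal.ofReal_mul (by linarith)]
  refine ENNReal.ofReal_le_ofReal ?_
  have h1 := mul_le_mul_of_nonneg_left hfin (show (0 : ℝ) ≤ 2 ^ p by positivity)
  rw [← mul_assoc, mul_inv_cancel₀ (by positivity), one_mul, mul_add, mul_add, ← mul_assoc _ _ (a' + 1),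
    hδ2] at h1
  have h2 : C * (1 + X') = (1 + X') + 2 * (2 ^ p * δ ^ (1 - p) + 2 ^ p * levelErrorConst p δ) +
      2 * (2 ^ p * (δ ^ (1 - p) * X') + 2 ^ p * levelErrorConst p δ * X') := by rw [hC]; ring
  rw [h2]
  have h3 : 0 ≤ (2 : ℝ) ^ p * δ ^ (1 - p) := by positivity
  have h4 : 0 ≤ 2 ^ p * levelErrorConst p δ * X' := by positivity
  linarith

end Moments

/-! ### Moments of the integrated entropy -/

namespace Tilted

variable {Ω : Type*} {mΩ : MeasurableSpace Ω} {L : Type*} [Fintype L]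
  {F : Filtration ℝ≥0 mΩ} {P : Measure Ω}
  {N : L → ℝ≥0 → Ω → ℕ} {u : L → ℝ≥0 → Ω → ℝ} {r : L → ℝ≥0} {θ : L → ℝ≥0 → Ω → ℝ}
  {Q : Measure Ω}

lemma tendsto_truncEntropyInt (T : Tilted F P N u r θ Q) (l : L) (t : ℝ≥0) (ω : Ω) :
    Tendsto (fun m : ℕ => ENNReal.ofReal (truncEntropyInt u r θ l ((m : ℝ) + 1) t ω)) atTop
      (𝓝 (∫⁻ s in Set.Ioc 0 t, ENNReal.ofReal (r l * entropyFun (θ l s ω) * u l s ω) ∂leb)) := by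
  have h1 : ∀ m : ℕ, ENNReal.ofReal (truncEntropyInt u r θ l ((m : ℝ) + 1) t ω) =
      ∫⁻ s in Set.Ioc 0 t,
        ENNReal.ofReal (r l * truncEntropy ((m : ℝ) + 1) (θ l s ω) * u l s ω) ∂leb := fun m =>
    ofReal_integral_eq_lintegral_ofReal
      (integrableOn_Ioc_of_bounded (T.measurable_truncRate l _ ω) (T.truncRate_nonneg l _ ω)
        (T.truncRate_le l (by positivity) ω) 0 t)
      (ae_of_all _ (T.truncRate_nonneg l _ ω))
  simp only [h1]
  refine lintegral_tendsto_of_tendsto_of_monotone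
    (fun m => (T.measurable_truncRate l _ ω).ennreal_ofReal.aemeasurable)
    (ae_of_all _ fun s m m' hmm => ?_) (ae_of_all _ fun s => ?_)
  · refine ENNReal.ofReal_le_ofReal (mul_le_mul_of_nonneg_right
      (mul_le_mul_of_nonneg_left ?_ (r l).2) (T.sys.nonneg l s ω))
    have hmm' : (m : ℝ) ≤ m' := Nat.cast_le.2 hmm
    exact Set.indicator_le_indicator_of_subset (Set.Icc_subset_Icc (by linarith) (by linarith))
      entropyFun_nonneg _
  · refine tendsto_const_nhds.congr' ?_
    filter_upwards [eventually_ge_atTop ⌈|θ l s ω|⌉₊] with m hm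
    have h2 := abs_le.1 (Nat.ceil_le.1 hm)
    rw [truncEntropy, Set.indicator_of_mem]
    constructor <;> linarith

/-- The moments of the integrated entropy of a stream under the tilted measure are controlled by
those of the positive part of its logarithmic density, with a constant that depends only on the
exponent. -/
theorem exists_entropy_const {p : ℝ} (hp : 1 ≤ p) : ∃ C : ℝ≥0,
    ∀ {Ω : Type*} {mΩ : MeasurableSpace Ω} {L : Type*} [Fintype L] {F : Filtration ℝ≥0 mΩ}
      {P : Measure Ω} [IsProbabilityMeasure P] {N : L → ℝ≥0 → Ω → ℕ} {u : L → ℝ≥0 → Ω → ℝ}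
      {r : L → ℝ≥0} {θ : L → ℝ≥0 → Ω → ℝ} {Q : Measure Ω}, Tilted F P N u r θ Q →
      ∀ (t : ℝ≥0), 0 < t → ∀ l,
      ∫⁻ ω, (∫⁻ s in Set.Ioc 0 t,
          ENNReal.ofReal (r l * entropyFun (θ l s ω) * u l s ω) ∂leb) ^ p ∂Q ≤
        C * (1 + ∫⁻ ω, ENNReal.ofReal (max (logExp (fun s => N l s ω) (fun s => u l s ω) (r l)
          (fun s => θ l s ω) t) 0 ^ p) ∂Q) := by
  obtain ⟨C, hC⟩ := exists_moment_const hp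
  refine ⟨C, fun {Ω mΩ L _ F P _ N u r θ Q} T t ht l => ?_⟩
  have hprob := T.prob
  refine lintegral_le_of_tendsto
    (f := fun (m : ℕ) ω => ENNReal.ofReal (truncEntropyInt u r θ l ((m : ℝ) + 1) t ω) ^ p)
    (fun m => ?_) (ae_of_all _ fun ω => ?_) fun m => ?_
  · exact (((T.measurable_truncEntropyInt l _ t).mono (F.le t) le_rfl).ennreal_ofReal).pow_const p
  · exact (ENNReal.continuous_rpow_const.tendsto _).comp (T.tendsto_truncEntropyInt l t ω)
  · have hm : (1 : ℝ) ≤ (m : ℝ) + 1 := by simp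
    have hlev := fun j : ℕ => T.exists_level_error ht l hm (a := j) j.cast_nonneg
    choose ξ hξ hξ0 hexp hle using hlev
    have := hC Q (truncEntropyInt u r θ l ((m : ℝ) + 1) t) (fun ω => max (logExp (fun s => N l s ω)
        (fun s => u l s ω) (r l) (fun s => θ l s ω) t) 0) ξ
      ((T.measurable_truncEntropyInt l _ t).mono (F.le t) le_rfl)
      (((T.measurable_logExp (T.pred l) l ht).mono (F.le t) le_rfl).max measurable_const) hξ
      (T.truncEntropyInt_nonneg l _ t) ⟨_, T.truncEntropyInt_le l (by linarith) t⟩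
      (fun ω => le_max_right _ _) hξ0 hexp hle
    refine le_trans (le_of_eq (lintegral_congr fun ω => ?_)) this
    exact ENNReal.ofReal_rpow_of_nonneg (T.truncEntropyInt_nonneg l _ t ω) (by linarith)

end Tilted

/-! ### Maximal inequalities -/

namespace ExpSystem

variable {Ω : Type*} {mΩ : MeasurableSpace Ω} {L : Type*} [Fintype L]
  {F : Filtration ℝ≥0 mΩ} {P : Measure Ω} {N : L → ℝ≥0 → Ω → ℕ} {u : L → ℝ≥0 → Ω → ℝ}
  {r : L → ℝ≥0} (S : ExpSystem F P N u r)

omit [Fintype L] in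
lemma integrableOn_speed_Ioc [Fintype L] (S : ExpSystem F P N u r) (l : L) (a b : ℝ≥0) (ω : Ω) :
    IntegrableOn (fun s => u l s ω) (Set.Ioc a b) leb :=
  integrableOn_Ioc_of_bounded
    (measurable_eval_of_rightCont (Ω := ℝ≥0) (f := fun t _ => u l t ω)
      (fun _ => measurable_const) (fun _ t => S.rightCont l ω t) measurable_id')
    (fun s => S.nonneg l s ω) (fun s => S.le_one l s ω) a b

include S

lemma expo_const (c : L → ℝ) (t : ℝ≥0) (ω : Ω) : expo N u r (fun _ _ => c) 0 t ω =
    ∑ l, (c l * N l t ω - (Real.exp (c l) - 1) * (r l * ∫ s in Set.Ioc 0 t, u l s ω ∂leb)) := by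
  unfold expo
  refine Finset.sum_congr rfl fun l _ => ?_
  rw [jumpSum_of_const (S.path l ω) zero_le fun _ _ => rfl, integral_const_mul, S.count_zero]
  push_cast
  ring

lemma measurable_expo_const (c : L → ℝ) (t : ℝ≥0) :
    Measurable[F t] fun ω => expo N u r (fun _ _ => c) 0 t ω := by
  rcases (zero_le : 0 ≤ t).eq_or_lt with h | h
  · have : (fun ω => expo N u r (fun _ _ => c) 0 t ω) = fun _ => 0 := by
      ext ω
      rw [S.expo_const, ← h]
      simp [S.count_zero]
    rw [this]
    exact measurable_const
  · exact S.measurable_expo (η := fun _ _ => c) (fun l => predLim_const (c l)) h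

lemma setLIntegral_exp_const (c : L → ℝ) {a b : ℝ≥0} (hab : a ≤ b) {B : Set Ω}
    (hB : MeasurableSet[F a] B) :
    ∫⁻ ω in B, ENNReal.ofReal (Real.exp (expo N u r (fun _ _ => c) 0 b ω)) ∂P =
      ∫⁻ ω in B, ENNReal.ofReal (Real.exp (expo N u r (fun _ _ => c) 0 a ω)) ∂P := by
  rcases hab.eq_or_lt with h | h
  · rw [h]
  have h1 := S.lintegral_exp c a b h (B.indicator fun ω =>
    ENNReal.ofReal (Real.exp (expo N u r (fun _ _ => c) 0 a ω)))
    ((S.measurable_expo_const c a).exp.ennreal_ofReal.indicator hB)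
  rw [lintegral_indicator (F.le a B hB)] at h1
  rw [← h1, ← lintegral_indicator (F.le a B hB)]
  refine lintegral_congr fun ω => ?_
  by_cases hω : ω ∈ B
  · rw [Set.indicator_of_mem hω, Set.indicator_of_mem hω, ← ENNReal.ofReal_mul (Real.exp_pos _).le,
      ← Real.exp_add, ← S.expo_add zero_le hab fun l => ?_]
    exact (S.integrableOn_speed_Ioc l 0 b ω).const_mul _
  · rw [Set.indicator_of_notMem hω, Set.indicator_of_notMem hω, zero_mul]

lemma lintegral_exp_const [IsProbabilityMeasure P] (c : L → ℝ) (t : ℝ≥0) :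
    ∫⁻ ω, ENNReal.ofReal (Real.exp (expo N u r (fun _ _ => c) 0 t ω)) ∂P = 1 := by
  have h1 := S.setLIntegral_exp_const c (zero_le : 0 ≤ t) (B := Set.univ) (by simp)
  simp only [Measure.restrict_univ] at h1
  rw [h1]
  simp [S.expo_const, S.count_zero]

/-- Doob's maximal inequality for an exponential martingale along finitely many times. -/
lemma mul_measure_exists_finset_le [IsProbabilityMeasure P] (c : L → ℝ) (t : ℝ≥0)
    (s : Finset ℝ≥0) (hs : ∀ i ∈ s, i ≤ t) (x : ℝ) :
    ENNReal.ofReal x * P {ω | ∃ i ∈ s, x ≤ Real.exp (expo N u r (fun _ _ => c) 0 i ω)} ≤ 1 := by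
  classical
  let M : ℝ≥0 → Ω → ℝ := fun i ω => Real.exp (expo N u r (fun _ _ => c) 0 i ω)
  have hM : ∀ i, Measurable[F i] (M i) := fun i => (S.measurable_expo_const c i).exp
  -- `E i` is the event that `i` is the first time in `s` at which the level is exceeded
  let E : ℝ≥0 → Set Ω := fun i => {ω | x ≤ M i ω} ∩ ⋂ j ∈ s.filter (· < i), {ω | M j ω < x}
  have hE : ∀ i, MeasurableSet[F i] (E i) := fun i => by
    refine @MeasurableSet.inter _ (F i) _ _ (hM i measurableSet_Ici) ?_
    refine Finset.measurableSet_biInter _ fun j hj => ?_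
    exact F.mono (Finset.mem_filter.1 hj).2.le _ (hM j measurableSet_Iio)
  have hdisj : Set.PairwiseDisjoint (s : Set ℝ≥0) E := by
    intro i hi j hj hij
    have key : ∀ i ∈ s, ∀ j, i < j → Disjoint (E i) (E j) := fun i hi j hlt => by
      rw [Set.disjoint_left]
      intro ω h1 h2
      have h3 := Set.mem_iInter₂.1 h2.2 i (Finset.mem_filter.2 ⟨hi, hlt⟩)
      exact absurd (show x ≤ M i ω from h1.1) (not_le.2 h3)
    rcases lt_or_gt_of_ne hij with h | h
    · exact key i hi j h
    · exact (key j hj i h).symm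
  have hunion : {ω | ∃ i ∈ s, x ≤ Real.exp (expo N u r (fun _ _ => c) 0 i ω)} = ⋃ i ∈ s, E i := by
    ext ω
    simp only [Set.mem_ofPred_eq, Set.mem_iUnion, exists_prop]
    constructor
    · rintro ⟨i, hi, hx⟩
      have hne : (s.filter fun i => x ≤ M i ω).Nonempty := ⟨i, Finset.mem_filter.2 ⟨hi, hx⟩⟩
      obtain ⟨i₀, hi₀, hmin⟩ := Finset.exists_min_image _ (fun i : ℝ≥0 => i) hne
      rw [Finset.mem_filter] at hi₀
      refine ⟨i₀, hi₀.1, hi₀.2, Set.mem_iInter₂.2 fun j hj => ?_⟩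
      rw [Finset.mem_filter] at hj
      by_contra hcon
      exact absurd (hmin j (Finset.mem_filter.2 ⟨hj.1, not_lt.1 hcon⟩)) (not_le.2 hj.2)
    · rintro ⟨i, hi, hx⟩
      exact ⟨i, hi, hx.1⟩
  rw [hunion, measure_biUnion_finset hdisj fun i _ => F.le i _ (hE i), Finset.mul_sum]
  calc ∑ i ∈ s, ENNReal.ofReal x * P (E i)
      ≤ ∑ i ∈ s, ∫⁻ ω in E i, ENNReal.ofReal (M t ω) ∂P := by
        refine Finset.sum_le_sum fun i hi => ?_
        have h1 := S.setLIntegral_exp_const c (hs i hi) (hE i)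
        rw [show ∫⁻ ω in E i, ENNReal.ofReal (M t ω) ∂P =
          ∫⁻ ω in E i, ENNReal.ofReal (M i ω) ∂P from h1, ← setLIntegral_const]
        exact setLIntegral_mono' (F.le i _ (hE i)) fun ω hω => ENNReal.ofReal_le_ofReal hω.1
    _ = ∫⁻ ω in ⋃ i ∈ s, E i, ENNReal.ofReal (M t ω) ∂P :=
        (lintegral_biUnion_finset hdisj (fun i _ => F.le i _ (hE i)) _).symm
    _ ≤ ∫⁻ ω, ENNReal.ofReal (M t ω) ∂P := setLIntegral_le_lintegral _ _
    _ = 1 := S.lintegral_exp_const c t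

lemma mul_measure_exists_le [IsProbabilityMeasure P] (c : L → ℝ) (t : ℝ≥0) (d : ℕ → ℝ≥0)
    (hd : ∀ k, d k ≤ t) (x : ℝ) :
    ENNReal.ofReal x * P {ω | ∃ k, x ≤ Real.exp (expo N u r (fun _ _ => c) 0 (d k) ω)} ≤ 1 := by
  classical
  have hU : {ω | ∃ k, x ≤ Real.exp (expo N u r (fun _ _ => c) 0 (d k) ω)} =
      ⋃ K : ℕ, {ω | ∃ i ∈ (Finset.range K).image d,
        x ≤ Real.exp (expo N u r (fun _ _ => c) 0 i ω)} := by
    ext ω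
    simp only [Set.mem_ofPred_eq, Set.mem_iUnion, Finset.mem_image, Finset.mem_range,
      exists_exists_and_eq_and]
    exact ⟨fun ⟨k, hk⟩ => ⟨k + 1, k, by simp, hk⟩, fun ⟨_, k, _, hk⟩ => ⟨k, hk⟩⟩
  have hmono : Monotone fun K : ℕ => {ω | ∃ i ∈ (Finset.range K).image d,
      x ≤ Real.exp (expo N u r (fun _ _ => c) 0 i ω)} := fun K K' hK ω ⟨i, hi, hx⟩ =>
    ⟨i, Finset.image_subset_image (Finset.range_mono hK) hi, hx⟩
  rw [hU, hmono.measure_iUnion, ENNReal.mul_iSup]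
  refine iSup_le fun K => S.mul_measure_exists_finset_le c t _ (fun i hi => ?_) x
  obtain ⟨k, -, rfl⟩ := Finset.mem_image.1 hi
  exact hd k

lemma speedIntegral_le (l : L) (t : ℝ≥0) (ω : Ω) : ∫ s in Set.Ioc 0 t, u l s ω ∂leb ≤ t := by
  have := setIntegral_Ioc_le (measurable_eval_of_rightCont (Ω := ℝ≥0) (f := fun t _ => u l t ω)
    (fun _ => measurable_const) (fun _ t => S.rightCont l ω t) measurable_id')
    (fun s => S.nonneg l s ω) (fun s => S.le_one l s ω) (zero_le : 0 ≤ t)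
  simpa using this

lemma expo_const_le (c : L → ℝ) {s t : ℝ≥0} (hst : s ≤ t) (ω : Ω) :
    expo N u r (fun _ _ => c) 0 s ω ≤ ∑ l, (|c l| * N l t ω + r l * t) := by
  rw [S.expo_const]
  refine Finset.sum_le_sum fun l _ => ?_
  have h1 : c l * N l s ω ≤ |c l| * N l t ω :=
    (mul_le_mul_of_nonneg_right (le_abs_self _) (Nat.cast_nonneg _)).trans
      (mul_le_mul_of_nonneg_left (Nat.cast_le.2 ((S.path l ω).mono hst)) (abs_nonneg _))
  have h2 : 0 ≤ ∫ s in Set.Ioc 0 s, u l s ω ∂leb := integral_nonneg fun s => S.nonneg l s ω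
  have h3 : r l * ∫ s in Set.Ioc 0 s, u l s ω ∂leb ≤ r l * t :=
    mul_le_mul_of_nonneg_left ((S.speedIntegral_le l s ω).trans (NNReal.coe_le_coe.2 hst)) (r l).2
  have h4 : 0 ≤ r l * ∫ s in Set.Ioc 0 s, u l s ω ∂leb := mul_nonneg (r l).2 h2
  nlinarith [Real.exp_pos (c l)]

lemma expo_const_rightCont (c : L → ℝ) (ω : Ω) (t : ℝ≥0) :
    ContinuousWithinAt (fun s => expo N u r (fun _ _ => c) 0 s ω) (Set.Ici t) t := by
  simp only [S.expo_const]
  refine tendsto_finsetSum _ fun l _ => ?_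
  have h1 : Continuous fun t => ∫ s in Set.Ioc 0 t, u l s ω ∂leb :=
    continuous_setIntegral_Ioc (measurable_eval_of_rightCont (Ω := ℝ≥0) (f := fun t _ => u l t ω)
      (fun _ => measurable_const) (fun _ t => S.rightCont l ω t) measurable_id')
      (fun s => S.nonneg l s ω) (fun s => S.le_one l s ω)
  have h2 : ContinuousWithinAt (fun s => (N l s ω : ℝ)) (Set.Ici t) t :=
    (continuous_of_discreteTopology (f := fun k : ℕ => (k : ℝ))).continuousAt.comp_continuousWithinAt
      ((S.path l ω).rightCont t)
  exact (h2.const_mul _).sub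
    ((continuous_const.mul (continuous_const.mul h1)).continuousWithinAt)

/-- The running maximum of the logarithm of an exponential martingale has an exponential moment of
order `1 / 2`. -/
lemma exists_running_max [IsProbabilityMeasure P] (c : L → ℝ) (t : ℝ≥0) :
    ∃ Y : Ω → ℝ, Measurable[F t] Y ∧
      (∀ ω, ∀ s ≤ t, expo N u r (fun _ _ => c) 0 s ω ≤ Y ω) ∧
      ∫⁻ ω, ENNReal.ofReal (Real.exp (Y ω / 2)) ∂P ≤ 9 := by
  let d : ℕ → ℝ≥0 := fun k => min (TopologicalSpace.denseSeq ℝ≥0 k) t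
  have hd : ∀ k, d k ≤ t := fun k => min_le_right _ _
  let y : ℝ≥0 → Ω → ℝ := fun s ω => expo N u r (fun _ _ => c) 0 s ω
  have hbdd : ∀ ω, BddAbove (Set.range fun k => y (d k) ω) := fun ω =>
    ⟨_, by rintro _ ⟨k, rfl⟩; exact S.expo_const_le c (hd k) ω⟩
  let Y : Ω → ℝ := fun ω => ⨆ k, y (d k) ω
  have hYm : Measurable[F t] Y := Measurable.iSup fun k =>
    (S.measurable_expo_const c (d k)).mono (F.mono (hd k)) le_rfl
  have hle : ∀ ω k, y (d k) ω ≤ Y ω := fun ω k => le_ciSup (hbdd ω) k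
  refine ⟨Y, hYm, fun ω s hs => ?_, ?_⟩
  · rcases hs.eq_or_lt with h | h
    · obtain ⟨k, hk⟩ := (TopologicalSpace.denseRange_denseSeq ℝ≥0).exists_mem_open
        (isOpen_Ioi (a := t)) ⟨t + 1, by simp⟩
      have : d k = t := min_eq_right (le_of_lt hk)
      have h1 := hle ω k
      rw [this] at h1
      rw [h]
      exact h1
    · by_contra hcon
      have h1 := (S.expo_const_rightCont c ω s).eventually (lt_mem_nhds (not_le.1 hcon))
      obtain ⟨v, hv, hsub⟩ := (mem_nhdsGE_iff_exists_Ico_subset' h).1 h1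
      have hsv : s < min v t := lt_min hv h
      obtain ⟨k, hk⟩ := (TopologicalSpace.denseRange_denseSeq ℝ≥0).exists_mem_open
        (isOpen_Ioo (a := s) (b := min v t)) (Set.nonempty_Ioo.2 hsv)
      have hdk : d k = TopologicalSpace.denseSeq ℝ≥0 k :=
        min_eq_left (hk.2.le.trans (min_le_right _ _))
      have h2 : Y ω < y (TopologicalSpace.denseSeq ℝ≥0 k) ω :=
        hsub ⟨hk.1.le, hk.2.trans_le (min_le_left _ _)⟩
      have h3 := hle ω k
      rw [hdk] at h3
      exact absurd h3 (not_le.2 h2)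
  · have hYm' : Measurable Y := hYm.mono (F.le t) le_rfl
    have hset : ∀ k : ℕ, MeasurableSet {ω | (4 : ℝ) ^ k ≤ Real.exp (Y ω)} := fun k =>
      measurableSet_le measurable_const hYm'.exp
    -- the supremum need not be attained, whence the factor `2`
    have hP : ∀ k : ℕ, P {ω | (4 : ℝ) ^ k ≤ Real.exp (Y ω)} ≤ ENNReal.ofReal (2 * (1 / 4) ^ k) := by
      intro k
      have h1 := S.mul_measure_exists_le c t d hd ((4 : ℝ) ^ k / 2)
      have h2 : {ω | (4 : ℝ) ^ k ≤ Real.exp (Y ω)} ⊆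
          {ω | ∃ j, (4 : ℝ) ^ k / 2 ≤ Real.exp (expo N u r (fun _ _ => c) 0 (d j) ω)} := by
        intro ω hω
        obtain ⟨j, hj⟩ := exists_lt_of_lt_ciSup
          (show Y ω - Real.log 2 < Y ω by linarith [Real.log_pos one_lt_two])
        refine ⟨j, ?_⟩
        have h3 := Real.exp_le_exp.2 hj.le
        rw [Real.exp_sub, Real.exp_log two_pos] at h3
        have h4 : (4 : ℝ) ^ k ≤ Real.exp (Y ω) := hω
        exact (div_le_div_of_nonneg_right h4 two_pos.le).trans h3
      have h5 := (mul_le_mul_right (measure_mono h2) (ENNReal.ofReal ((4 : ℝ) ^ k / 2))).trans h1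
      have h6 : ENNReal.ofReal (2 * (1 / 4) ^ k) = (ENNReal.ofReal ((4 : ℝ) ^ k / 2))⁻¹ := by
        rw [← ENNReal.ofReal_inv_of_pos (by positivity)]
        congr 1
        rw [one_div, inv_pow, inv_div, div_eq_mul_inv]
      rw [h6]
      exact ENNReal.le_inv_iff_mul_le.2 (by rwa [mul_comm])
    -- if `4 ^ k ≤ exp Y < 4 ^ (k + 1)`, then `exp (Y / 2) ≤ 2 * 2 ^ k`
    have hpt : ∀ ω, ENNReal.ofReal (Real.exp (Y ω / 2)) ≤ 1 + ∑' k : ℕ,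
        {ω | (4 : ℝ) ^ k ≤ Real.exp (Y ω)}.indicator (fun _ => ENNReal.ofReal (2 * 2 ^ k)) ω := by
      intro ω
      rcases le_total (Y ω) 0 with h | h
      · refine le_trans ?_ le_self_add
        rw [← ENNReal.ofReal_one]
        exact ENNReal.ofReal_le_ofReal (Real.exp_le_one_iff.2 (by linarith))
      · obtain ⟨k, hk1, hk2⟩ := exists_nat_pow_near (Real.one_le_exp h) (y := (4 : ℝ)) (by norm_num)
        refine le_trans ?_ ((ENNReal.le_tsum k).trans le_add_self)
        rw [Set.indicator_of_mem (by exact hk1)]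
        refine ENNReal.ofReal_le_ofReal ?_
        have h1 : Real.exp (Y ω / 2) ^ 2 ≤ (2 * 2 ^ k) ^ 2 := by
          rw [← Real.exp_nat_mul]
          have h2 : ((2 : ℕ) : ℝ) * (Y ω / 2) = Y ω := by push_cast; ring
          have h3 : ((2 : ℝ) * 2 ^ k) ^ 2 = 4 ^ (k + 1) := by
            rw [← pow_succ', ← pow_mul, mul_comm, pow_mul]; norm_num
          rw [h2, h3]
          exact hk2.le
        exact le_of_sq_le_sq h1 (by positivity)
    calc ∫⁻ ω, ENNReal.ofReal (Real.exp (Y ω / 2)) ∂P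
        ≤ ∫⁻ ω, (1 + ∑' k : ℕ, {ω | (4 : ℝ) ^ k ≤ Real.exp (Y ω)}.indicator
            (fun _ => ENNReal.ofReal (2 * 2 ^ k)) ω) ∂P := lintegral_mono hpt
      _ = 1 + ∑' k : ℕ, ENNReal.ofReal (2 * 2 ^ k) * P {ω | (4 : ℝ) ^ k ≤ Real.exp (Y ω)} := by
          rw [lintegral_add_left measurable_const, lintegral_tsum fun k =>
            (measurable_const.indicator (hset k)).aemeasurable]
          simp only [lintegral_const, measure_univ, mul_one, lintegral_indicator_const (hset _)]
      _ ≤ 1 + ∑' k : ℕ, ENNReal.ofReal (4 * (1 / 2) ^ k) := by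
          refine add_le_add_right (ENNReal.tsum_le_tsum fun k => ?_) _
          refine (mul_le_mul_right (hP k) _).trans (le_of_eq ?_)
          rw [← ENNReal.ofReal_mul (by positivity)]
          congr 1
          have : ((1 : ℝ) / 2) ^ k = 2 ^ k * (1 / 4) ^ k := by rw [← mul_pow]; norm_num
          rw [this]; ring
      _ = 9 := by
          rw [← ENNReal.ofReal_tsum_of_nonneg (fun k => by positivity)
            (summable_geometric_two.mul_left 4), tsum_mul_left, tsum_geometric_two]
          norm_num

end ExpSystem

namespace Tilted

variable {Ω : Type*} {mΩ : MeasurableSpace Ω} {L : Type*} [Fintype L]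
  {F : Filtration ℝ≥0 mΩ} {P : Measure Ω}
  {N : L → ℝ≥0 → Ω → ℕ} {u : L → ℝ≥0 → Ω → ℝ} {r : L → ℝ≥0} {θ : L → ℝ≥0 → Ω → ℝ}
  {Q : Measure Ω}

/-- Under the tilted measure the exponential martingales of the reference measure are controlled by
the logarithmic density up to an error with exponential moments. -/
lemma exists_sup_error [IsProbabilityMeasure P] (T : Tilted F P N u r θ Q) {t : ℝ≥0} (ht : 0 < t)
    (c : L → ℝ) :
    ∃ ξ : Ω → ℝ, Measurable ξ ∧ (∀ ω, 0 ≤ ξ ω) ∧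
      ∫⁻ ω, ENNReal.ofReal (Real.exp (ξ ω)) ∂Q ≤ 10 ∧ ∀ ω, ∀ s ≤ t,
        expo N u r (fun _ _ => c) 0 s ω ≤
          2 * (expo N u r (fun s ω l => θ l s ω) 0 t ω + ξ ω) := by
  have hprob := T.prob
  obtain ⟨Y, hYm, hle, hY⟩ := T.sys.exists_running_max c t
  set X : Ω → ℝ := fun ω => expo N u r (fun s ω l => θ l s ω) 0 t ω with hX
  have hXm : Measurable[F t] X := T.measurable_density ht
  -- `Q` has the density `exp X` at time `t`, so that `exp (Y / 2 - X)` has the `Q`-mean of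
  -- `exp (Y / 2)` under `P`
  refine ⟨fun ω => max (Y ω / 2 - X ω) 0, ?_, fun ω => le_max_right _ _, ?_, fun ω s hs => ?_⟩
  · exact (((hYm.div_const 2).sub hXm).mono (F.le t) le_rfl).max measurable_const
  · calc ∫⁻ ω, ENNReal.ofReal (Real.exp (max (Y ω / 2 - X ω) 0)) ∂Q
        ≤ ∫⁻ ω, (ENNReal.ofReal (Real.exp (Y ω / 2 - X ω)) + 1) ∂Q := lintegral_mono fun ω => by
          rcases le_total (Y ω / 2 - X ω) 0 with h | h
          · rw [max_eq_right h, Real.exp_zero, ENNReal.ofReal_one]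
            exact le_add_self
          · rw [max_eq_left h]
            exact le_self_add
      _ ≤ 9 + 1 := by
          rw [lintegral_add_right _ measurable_const, lintegral_const, measure_univ, mul_one]
          refine add_le_add_left (le_trans (le_of_eq ?_) hY) 1
          rw [T.lintegral_eq ht (R := fun ω => ENNReal.ofReal (Real.exp (Y ω / 2 - X ω)))
            ((hYm.div_const 2).sub hXm).exp.ennreal_ofReal]
          refine lintegral_congr fun ω => ?_
          rw [← ENNReal.ofReal_mul (Real.exp_pos _).le, ← Real.exp_add]
          congr 2
          simp only [hX]
          ring
      _ = 10 := by norm_num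
  · have h1 := hle ω s hs
    have h2 := le_max_left (Y ω / 2 - X ω) 0
    simp only [hX] at h2 ⊢
    linarith

end Tilted

/-! ### Work conservation and the pathwise bound on the queue lengths -/

lemma Data.exists_mem_region {I : ℕ} (D : Data I) {x : Fin I → ℝ} (hx : ∀ j, 0 ≤ x j)
    (hx0 : x ≠ 0) : ∃ i, x ∈ D.region i := by
  classical
  have hne : (Finset.univ : Finset (Fin I)).Nonempty := by
    obtain ⟨j, -⟩ := Function.ne_iff.1 hx0
    exact ⟨j, Finset.mem_univ j⟩
  obtain ⟨m, -, hm⟩ := Finset.exists_max_image Finset.univ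
    (fun j => D.base Kind.S j * D.cost' j (x j)) hne
  obtain ⟨i, hi, hmin⟩ := Finset.exists_min_image (Finset.univ.filter fun i =>
    ∀ j, D.base Kind.S j * D.cost' j (x j) ≤ D.base Kind.S i * D.cost' i (x i)) (fun i => i)
    ⟨m, Finset.mem_filter.2 ⟨Finset.mem_univ m, fun j => hm j (Finset.mem_univ j)⟩⟩
  have hi' := (Finset.mem_filter.1 hi).2
  refine ⟨i, hx, hx0, hi', fun j hj => ?_⟩
  by_contra hcon
  have := hmin j (Finset.mem_filter.2 ⟨Finset.mem_univ j, fun k => (hi' k).trans (not_lt.1 hcon)⟩)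
  exact absurd this (not_le.2 hj)

namespace Queue

variable {I : ℕ} {D : Data I} {n : ℕ} {Ω : Type*} [mΩ : MeasurableSpace Ω] {P : Measure Ω}
  {q : Queue D n P}

lemma exists_selected (hn : 1 ≤ n) {t : ℝ≥0} {ω : Ω} (h : ∃ i, q.X i t ω ≠ 0) :
    ∃ i, q.selected i t ω = 1 := by
  obtain ⟨j, hj⟩ := h
  have hn' : (0 : ℝ) < √(n : ℝ) := Real.sqrt_pos.2 (by exact_mod_cast hn)
  obtain ⟨i, hi⟩ := D.exists_mem_region (x := fun j => q.scaledX j t ω)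
    (fun j => by unfold scaledX; positivity) (Function.ne_iff.2 ⟨j, by
      unfold scaledX
      have : (q.X j t ω : ℝ) ≠ 0 := by exact_mod_cast hj
      simp [this, hn'.ne']⟩)
  exact ⟨i, Set.indicator_of_mem hi _⟩

/-- Both rules are work conserving. -/
lemma Admissible.sum_effort_eq_one (hn : 1 ≤ n) (hq : q.Admissible)
    (hr : q.IsPreemptive ∨ q.IsNonPreemptive) {t : ℝ≥0} {ω : Ω} (h : ∃ i, q.X i t ω ≠ 0) :
    ∑ i, q.U i t ω = 1 := by
  have key : ∀ s, (∀ i, q.U i t ω = q.selected i s ω) → (∃ i, q.X i s ω ≠ 0) →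
      ∑ i, q.U i t ω = 1 := by
    intro s hU hX
    obtain ⟨i, hi⟩ := exists_selected hn hX
    refine le_antisymm (hq.sum_le_one t ω) ?_
    rw [← hi, ← hU i]
    exact Finset.single_le_sum (f := fun i => q.U i t ω) (fun j _ => hq.nonneg j t ω)
      (Finset.mem_univ i)
  rcases hr with hp | hp
  · exact key t (fun i => hp i t ω) h
  · obtain ⟨s, hst, hsd, hlast, hU⟩ := hp t ω
    refine key s hU ?_
    by_contra hempty
    push Not at hempty
    -- the first arrival after an empty decision time would be a later decision time
    have hpath := fun l => hq.isCountingPath l ω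
    have hne : ∑ l, q.counts l s ω ≠ ∑ l, q.counts l t ω := fun heq => by
      obtain ⟨i, hi⟩ := h
      have h1 := (sum_eq_iff_of_mono hpath hst).1 heq.symm
      exact hi (by rw [queue_congr h1 i]; exact hempty i)
    obtain ⟨s', hss', hs't, hbefore, -⟩ := (IsCountingPath.sum hpath).exists_first_jump hst hne
    refine hlast s' hss' hs't (Or.inr (Or.inr ?_))
    filter_upwards [Ioo_mem_nhdsLT hss'] with v hv i
    have h1 := (sum_eq_iff_of_mono hpath hv.1.le).1 (hbefore v hv.1.le hv.2)
    rw [queue_congr h1 i]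
    exact hempty i

/-- The centered counts. -/
def centered (q : Queue D n P) (l : Kind × Fin I) (t : ℝ≥0) (ω : Ω) : ℝ :=
  q.counts l t ω - D.rate n l.1 l.2 * q.clockTime l t ω

/-- The workload: the time needed to serve all present customers at the mean rates. -/
def workload (q : Queue D n P) (t : ℝ≥0) (ω : Ω) : ℝ := ∑ i, q.X i t ω / (D.rate n Kind.S i : ℝ)

/-- The fluctuations of the workload. -/
def workloadNoise (q : Queue D n P) (t : ℝ≥0) (ω : Ω) : ℝ :=
  ∑ i, (q.centered (Kind.A, i) t ω - q.centered (Kind.S, i) t ω) / (D.rate n Kind.S i : ℝ)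

lemma workload_eq (hS : ∀ i, 0 < D.rate n Kind.S i) (t : ℝ≥0) (ω : Ω) :
    q.workload t ω = ∑ i, (D.init n i : ℝ) / (D.rate n Kind.S i : ℝ) +
      (∑ i, (D.rate n Kind.A i : ℝ) / (D.rate n Kind.S i : ℝ)) * t -
        ∑ i, (q.clockTime (Kind.S, i) t ω : ℝ) + q.workloadNoise t ω := by
  unfold workload workloadNoise
  rw [Finset.sum_mul, ← Finset.sum_add_distrib, ← Finset.sum_sub_distrib, ← Finset.sum_add_distrib]
  refine Finset.sum_congr rfl fun i _ => ?_
  have h1 : (q.X i t ω : ℝ) + q.counts (Kind.S, i) t ω =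
      D.init n i + q.counts (Kind.A, i) t ω := by exact_mod_cast q.balance i t ω
  have h2 : (q.X i t ω : ℝ) = D.init n i + q.counts (Kind.A, i) t ω - q.counts (Kind.S, i) t ω := by
    linarith
  have h3 : (D.rate n Kind.S i : ℝ) ≠ 0 := (NNReal.coe_pos.2 (hS i)).ne'
  have h4 : q.clockTime (Kind.A, i) t ω = t := rfl
  rw [h2]
  unfold centered
  rw [h4]
  field_simp
  ring

lemma Admissible.sum_clockTime_le (hq : q.Admissible) {a b : ℝ≥0} (hab : a ≤ b) (ω : Ω) :
    ∑ i, (q.clockTime (Kind.S, i) b ω : ℝ) - ∑ i, (q.clockTime (Kind.S, i) a ω : ℝ) ≤ b - a ∧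
      ((∀ s ∈ Set.Ioc a b, ∃ i, q.X i s ω ≠ 0) → (1 ≤ n) → (q.IsPreemptive ∨ q.IsNonPreemptive) →
        ∑ i, (q.clockTime (Kind.S, i) b ω : ℝ) - ∑ i, (q.clockTime (Kind.S, i) a ω : ℝ) = b - a) := by
  have h1 : ∑ i, (q.clockTime (Kind.S, i) b ω : ℝ) - ∑ i, (q.clockTime (Kind.S, i) a ω : ℝ) =
      ∫ s in Set.Ioc a b, ∑ i, q.U i s ω ∂leb := by
    change _ = ∫ s in Set.Ioc a b, ∑ i, q.speed (Kind.S, i) s ω ∂leb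
    rw [integral_finsetSum _ fun i _ => (hq.integrableOn_speed (Kind.S, i) ω b).mono_set
      Set.Ioc_subset_Iic_self, ← Finset.sum_sub_distrib]
    exact Finset.sum_congr rfl fun i _ => hq.clockTime_sub (Kind.S, i) hab ω
  have h2 : ∫ s in Set.Ioc a b, (1 : ℝ) ∂leb = b - a := by
    rw [setIntegral_const, Measure.real, leb_Ioc, ENNReal.coe_toReal, NNReal.coe_sub hab,
      smul_eq_mul, mul_one]
  rw [h1, ← h2]
  refine ⟨setIntegral_mono (integrable_finsetSum _ fun i _ =>
      (hq.integrableOn_speed (Kind.S, i) ω b).mono_set Set.Ioc_subset_Iic_self)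
      (integrableOn_const (by simp [leb_Ioc])) fun s => hq.sum_le_one s ω, fun h hn hr => ?_⟩
  exact setIntegral_congr_fun measurableSet_Ioc fun s hs => hq.sum_effort_eq_one hn hr (h s hs)

/-- The workload of a work conserving system is controlled by the initial workload, the drift and
the fluctuations. -/
lemma Admissible.workload_le (hn : 1 ≤ n) (hq : q.Admissible)
    (hr : q.IsPreemptive ∨ q.IsNonPreemptive) (hS : ∀ i, 0 < D.rate n Kind.S i) {t : ℝ≥0} {ω : Ω}
    {B : ℝ} (hB : ∀ s ≤ t, |q.workloadNoise s ω| ≤ B) :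
    q.workload t ω ≤ ∑ i, (D.init n i : ℝ) / (D.rate n Kind.S i : ℝ) +
      |∑ i, (D.rate n Kind.A i : ℝ) / (D.rate n Kind.S i : ℝ) - 1| * t + 2 * B := by
  set w₀ : ℝ := ∑ i, (D.init n i : ℝ) / (D.rate n Kind.S i : ℝ) with hw₀
  set ρ : ℝ := ∑ i, (D.rate n Kind.A i : ℝ) / (D.rate n Kind.S i : ℝ) with hρ
  have hw₀0 : 0 ≤ w₀ := Finset.sum_nonneg fun i _ => by positivity
  -- the set of the times at which a busy period can begin
  set Z : Set ℝ≥0 := {s | s ≤ t ∧ (s = 0 ∨ ∀ i, q.X i s ω = 0)} with hZ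
  have hZ0 : (0 : ℝ≥0) ∈ Z := ⟨zero_le, Or.inl rfl⟩
  have hbdd : BddAbove Z := ⟨t, fun s hs => hs.1⟩
  have hσt : sSup Z ≤ t := csSup_le ⟨0, hZ0⟩ fun s hs => hs.1
  refine le_of_forall_pos_le_add fun ε hε => ?_
  obtain ⟨s, hs, hsε⟩ : ∃ s ∈ Z, ((sSup Z : ℝ≥0) : ℝ) - ε < s := by
    by_contra hcon
    push Not at hcon
    have h1 : sSup Z ≤ (sSup Z : ℝ≥0) - ε.toNNReal := csSup_le ⟨0, hZ0⟩ fun s hs => by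
      rw [← NNReal.coe_le_coe]
      have h2 := hcon s hs
      have h3 : (ε.toNNReal : ℝ) = ε := Real.coe_toNNReal _ hε.le
      have h4 : ε.toNNReal ≤ sSup Z := by
        rw [← NNReal.coe_le_coe, h3]
        have := hcon 0 hZ0
        rw [NNReal.coe_zero] at this
        linarith
      rw [NNReal.coe_sub h4, h3]
      exact h2
    have h2 : sSup Z = 0 ∨ sSup Z - ε.toNNReal < sSup Z := by
      rcases eq_or_ne (sSup Z) 0 with h | h
      · exact Or.inl h
      · exact Or.inr (tsub_lt_self (pos_iff_ne_zero.2 h) (Real.toNNReal_pos.2 hε))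
    rcases h2 with h2 | h2
    · have := hcon 0 hZ0
      rw [h2, NNReal.coe_zero] at this
      linarith
    · exact absurd h1 (not_le.2 h2)
  have hsσ : s ≤ sSup Z := le_csSup hbdd hs
  have hidle := (hq.sum_clockTime_le hσt ω).2 (fun v hv => by
    by_contra hcon
    push Not at hcon
    exact absurd (le_csSup hbdd (show v ∈ Z from ⟨hv.2, Or.inr hcon⟩)) (not_le.2 hv.1)) hn hr
  have hmono : ∑ i, (q.clockTime (Kind.S, i) s ω : ℝ) ≤
      ∑ i, (q.clockTime (Kind.S, i) (sSup Z) ω : ℝ) := Finset.sum_le_sum fun i _ =>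
    NNReal.coe_le_coe.2 (hq.clockTime_mono (Kind.S, i) ω hsσ)
  have hws : q.workload s ω ≤ w₀ := by
    rcases hs.2 with h | h
    · have h1 : q.workload s ω = w₀ := by
        unfold workload
        rw [hw₀]
        refine Finset.sum_congr rfl fun i _ => ?_
        have h2 := q.balance i 0 ω
        have h3 : q.A i 0 ω = 0 := count_zero hq (Kind.A, i) ω
        have h4 : q.S i (busyTime (q.U i) 0 ω) ω = 0 := count_zero hq (Kind.S, i) ω
        rw [h3, h4] at h2
        rw [h]
        have h5 : q.X i 0 ω = D.init n i := h2
        rw [h5]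
      exact h1.le
    · have : q.workload s ω = 0 := Finset.sum_eq_zero fun i _ => by rw [h i]; simp
      rw [this]; exact hw₀0
  have e1 := workload_eq (q := q) hS t ω
  have e2 := workload_eq (q := q) hS s ω
  have hst : (s : ℝ) ≤ t := NNReal.coe_le_coe.2 hs.1
  have hs0 : (0 : ℝ) ≤ s := s.2
  have hdrift : (ρ - 1) * (t - s) ≤ |ρ - 1| * t :=
    (mul_le_mul_of_nonneg_right (le_abs_self _) (by linarith)).trans
      (mul_le_mul_of_nonneg_left (by linarith) (abs_nonneg _))
  have hb1 := (abs_le.1 (hB t le_rfl)).2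
  have hb2 := (abs_le.1 (hB s hs.1)).1
  rw [← hw₀, ← hρ] at e1 e2
  nlinarith

/-- The queue lengths in terms of bounds for the centered counts. -/
lemma Admissible.queue_le (hn : 1 ≤ n) (hq : q.Admissible)
    (hr : q.IsPreemptive ∨ q.IsNonPreemptive) (hS : ∀ i, 0 < D.rate n Kind.S i) {t : ℝ≥0} {ω : Ω}
    {b : Kind × Fin I → ℝ} (hb : ∀ s ≤ t, ∀ l, |q.centered l s ω| ≤ b l) (i : Fin I) :
    q.X i t ω ≤ D.rate n Kind.S i * (∑ j, (D.init n j : ℝ) / (D.rate n Kind.S j : ℝ) +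
      |∑ j, (D.rate n Kind.A j : ℝ) / (D.rate n Kind.S j : ℝ) - 1| * t +
        2 * ∑ j, (b (Kind.A, j) + b (Kind.S, j)) / (D.rate n Kind.S j : ℝ)) := by
  have h1 := hq.workload_le hn hr hS (t := t) (ω := ω)
    (B := ∑ j, (b (Kind.A, j) + b (Kind.S, j)) / (D.rate n Kind.S j : ℝ)) (fun s hs => by
      unfold workloadNoise
      refine (Finset.abs_sum_le_sum_abs _ _).trans (Finset.sum_le_sum fun j _ => ?_)
      rw [abs_div, abs_of_nonneg (NNReal.coe_nonneg (D.rate n Kind.S j))]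
      refine div_le_div_of_nonneg_right ?_ (D.rate n Kind.S j).2
      exact (abs_sub _ _).trans (add_le_add (hb s hs _) (hb s hs _)))
  have h2 : (q.X i t ω : ℝ) / D.rate n Kind.S i ≤ q.workload t ω :=
    Finset.single_le_sum (f := fun i => (q.X i t ω : ℝ) / (D.rate n Kind.S i : ℝ))
      (fun j _ => by positivity) (Finset.mem_univ i)
  rw [← div_le_iff₀' (NNReal.coe_pos.2 (hS i))]
  exact h2.trans h1

end Queue

/-! ### Bounds on the parameters, uniform in the scaling parameter -/

lemma _root_.Filter.Tendsto.exists_forall_abs_le {f : ℕ → ℝ} {x : ℝ}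
    (h : Tendsto f atTop (𝓝 x)) : ∃ K, ∀ n, |f n| ≤ K := by
  obtain ⟨K, hK⟩ := h.abs.bddAbove_range
  exact ⟨K, fun n => hK ⟨n, rfl⟩⟩

namespace Data.CriticallyLoaded

variable {I : ℕ} {D : Data I} (hD : D.CriticallyLoaded)
include hD

lemma tendsto_sqrt_mul_sub (j : Kind) (i : Fin I) :
    Tendsto (fun n : ℕ => √(n : ℝ) * ((D.rate n j i : ℝ) / n - D.base j i)) atTop
      (𝓝 (D.second j i)) := by
  have h1 := (hD.rate_expansion j i).tendsto_div_nhds_zero.add_const (D.second j i)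
  rw [zero_add] at h1
  refine h1.congr' ?_
  filter_upwards [eventually_gt_atTop 0] with n hn
  have h2 : (0 : ℝ) < √(n : ℝ) := Real.sqrt_pos.2 (by exact_mod_cast hn)
  have h3 : (n : ℝ) = √(n : ℝ) * √(n : ℝ) := (Real.mul_self_sqrt (Nat.cast_nonneg n)).symm
  have h4 : √(n : ℝ) * ((D.rate n j i : ℝ) / n - D.base j i) =
      ((D.rate n j i : ℝ) - D.base j i * n) / √(n : ℝ) := by
    have : (n : ℝ) ≠ 0 := by positivity
    rw [eq_div_iff h2.ne', mul_comm, ← mul_assoc, ← h3]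
    field_simp
  rw [h4]
  field_simp
  ring

lemma tendsto_rate_div (j : Kind) (i : Fin I) :
    Tendsto (fun n : ℕ => (D.rate n j i : ℝ) / n) atTop (𝓝 (D.base j i)) := by
  have h0 : Tendsto (fun n : ℕ => (√(n : ℝ))⁻¹) atTop (𝓝 0) :=
    (Real.tendsto_sqrt_atTop.comp tendsto_natCast_atTop_atTop).inv_tendsto_atTop
  have h1 := ((hD.tendsto_sqrt_mul_sub j i).mul h0).add_const (D.base j i)
  rw [mul_zero, zero_add] at h1
  refine h1.congr' ?_
  filter_upwards [eventually_gt_atTop 0] with n hn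
  have h2 : (0 : ℝ) < √(n : ℝ) := Real.sqrt_pos.2 (by exact_mod_cast hn)
  field_simp
  ring

lemma exists_load_bound : ∃ K : ℝ, ∀ n : ℕ, 1 ≤ n →
    √(n : ℝ) * |∑ i, (D.rate n Kind.A i : ℝ) / (D.rate n Kind.S i : ℝ) - 1| ≤ K := by
  have h1 : ∀ i, Tendsto (fun n : ℕ => (√(n : ℝ) * ((D.rate n Kind.A i : ℝ) / n - D.base Kind.A i) -
      D.base Kind.A i / D.base Kind.S i *
        (√(n : ℝ) * ((D.rate n Kind.S i : ℝ) / n - D.base Kind.S i))) /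
          ((D.rate n Kind.S i : ℝ) / n)) atTop
      (𝓝 ((D.second Kind.A i - D.base Kind.A i / D.base Kind.S i * D.second Kind.S i) /
        D.base Kind.S i)) := fun i =>
    ((hD.tendsto_sqrt_mul_sub _ i).sub ((hD.tendsto_sqrt_mul_sub _ i).const_mul _)).div
      (hD.tendsto_rate_div _ i) (hD.base_pos _ i).ne'
  obtain ⟨K, hK⟩ := (tendsto_finsetSum Finset.univ fun i _ => h1 i).exists_forall_abs_le
  refine ⟨K, fun n hn => ?_⟩
  have h2 : (0 : ℝ) < n := by exact_mod_cast hn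
  have h3 := hK n
  rw [← abs_of_nonneg (Real.sqrt_nonneg (n : ℝ)), ← abs_mul, ← hD.load, ← Finset.sum_sub_distrib,
    Finset.mul_sum]
  refine (congrArg _ (Finset.sum_congr rfl fun i _ => ?_)).trans_le h3
  have h4 := (NNReal.coe_pos.2 (hD.rate_pos n hn Kind.S i)).ne'
  have h5 := (hD.base_pos Kind.S i).ne'
  field_simp
  ring

/-- All parameters are of the order prescribed by the heavy traffic regime, uniformly in `n`. -/
lemma exists_bounds : ∃ K : ℝ, 1 ≤ K ∧
    (∀ j i, D.base j i ≤ K ∧ 1 ≤ K * D.base j i) ∧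
    ∀ n : ℕ, 1 ≤ n →
      (∀ j i, (D.rate n j i : ℝ) ≤ K * n ∧ (n : ℝ) ≤ K * D.rate n j i) ∧
      √(n : ℝ) * |∑ i, (D.rate n Kind.A i : ℝ) / (D.rate n Kind.S i : ℝ) - 1| ≤ K ∧
      ∀ i, (D.init n i : ℝ) ≤ K * √(n : ℝ) := by
  obtain ⟨K₁, h₁⟩ := hD.exists_load_bound
  obtain ⟨x₀, hx₀⟩ := hD.init_tendsto
  choose K₂ h₂ using fun i => (tendsto_pi_nhds.1 hx₀ i).exists_forall_abs_le
  choose K₃ h₃ using fun j i => (hD.tendsto_rate_div j i).exists_forall_abs_le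
  choose K₄ h₄ using fun j i =>
    ((hD.tendsto_rate_div j i).inv₀ (hD.base_pos j i).ne').exists_forall_abs_le
  -- convergent sequences are bounded; `κ` collects the bounds
  let κ : ℝ := ∑ j, ∑ i, (|K₂ i| + |K₃ j i| + |K₄ j i| + D.base j i + (D.base j i)⁻¹)
  have hκ : ∀ j i, |K₂ i| + |K₃ j i| + |K₄ j i| + D.base j i + (D.base j i)⁻¹ ≤ κ := fun j i => by
    have h0 : ∀ j i, 0 ≤ |K₂ i| + |K₃ j i| + |K₄ j i| + D.base j i + (D.base j i)⁻¹ := fun j i => by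
      have := hD.base_pos j i
      positivity
    refine le_trans ?_ (Finset.single_le_sum (f := fun j => ∑ i, (|K₂ i| + |K₃ j i| + |K₄ j i| +
      D.base j i + (D.base j i)⁻¹)) (fun j _ => Finset.sum_nonneg fun i _ => h0 j i)
      (Finset.mem_univ j))
    exact Finset.single_le_sum (f := fun i => |K₂ i| + |K₃ j i| + |K₄ j i| +
      D.base j i + (D.base j i)⁻¹) (fun i _ => h0 j i) (Finset.mem_univ i)
  have hκ0 : 0 ≤ κ := Finset.sum_nonneg fun j _ => Finset.sum_nonneg fun i _ => by
    have := hD.base_pos j i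
    positivity
  have hb : ∀ j i, 0 < D.base j i ∧ 0 < (D.base j i)⁻¹ := fun j i =>
    ⟨hD.base_pos j i, inv_pos.2 (hD.base_pos j i)⟩
  refine ⟨1 + κ + |K₁|, by have := abs_nonneg K₁; linarith, fun j i => ?_, fun n hn => ?_⟩
  · have e1 := abs_nonneg (K₂ i)
    have e2 := abs_nonneg (K₃ j i)
    have e3 := abs_nonneg (K₄ j i)
    have e4 := abs_nonneg K₁
    have e5 := hκ j i
    obtain ⟨b1, b2⟩ := hb j i
    refine ⟨by linarith, ?_⟩
    rw [← div_le_iff₀ b1, one_div]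
    linarith
  have hn' : (0 : ℝ) < n := by exact_mod_cast hn
  refine ⟨fun j i => ?_, ?_, fun i => ?_⟩
  · have e1 := abs_nonneg (K₂ i)
    have e2 := le_abs_self (K₃ j i)
    have e3 := le_abs_self (K₄ j i)
    have e2' := abs_nonneg (K₃ j i)
    have e3' := abs_nonneg (K₄ j i)
    have e4 := abs_nonneg K₁
    have e5 := hκ j i
    obtain ⟨b1, b2⟩ := hb j i
    have hr := NNReal.coe_pos.2 (hD.rate_pos n hn j i)
    have f1 := (le_abs_self _).trans (h₃ j i n)
    have f2 := (le_abs_self _).trans (h₄ j i n)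
    rw [div_le_iff₀ hn'] at f1
    rw [inv_div, div_le_iff₀ hr] at f2
    exact ⟨f1.trans (mul_le_mul_of_nonneg_right (by linarith) hn'.le),
      f2.trans (mul_le_mul_of_nonneg_right (by linarith) hr.le)⟩
  · have := le_abs_self K₁
    exact (h₁ n hn).trans (by linarith)
  · have e1 := le_abs_self (K₂ i)
    have e2 := abs_nonneg (K₃ Kind.A i)
    have e3 := abs_nonneg (K₄ Kind.A i)
    have e4 := abs_nonneg K₁
    have e5 := hκ Kind.A i
    obtain ⟨b1, b2⟩ := hb Kind.A i
    have f1 := (le_abs_self _).trans (h₂ i n)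
    rw [div_le_iff₀ (Real.sqrt_pos.2 hn')] at f1
    exact f1.trans (mul_le_mul_of_nonneg_right (by linarith) (Real.sqrt_nonneg _))

end Data.CriticallyLoaded

namespace Queue

variable {I : ℕ} {D : Data I} {n : ℕ} {Ω : Type*} [mΩ : MeasurableSpace Ω] {P : Measure Ω}
  {q : Queue D n P}

/-- The bound on the queue lengths in the diffusion scaling. -/
lemma Admissible.scaledX_le (hn : 1 ≤ n) (hq : q.Admissible)
    (hr : q.IsPreemptive ∨ q.IsNonPreemptive) {K : ℝ} (hK : 1 ≤ K)
    (hrate : ∀ j i, 0 < D.rate n j i ∧ (D.rate n j i : ℝ) ≤ K * n ∧ (n : ℝ) ≤ K * D.rate n j i)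
    (hload : √(n : ℝ) * |∑ i, (D.rate n Kind.A i : ℝ) / (D.rate n Kind.S i : ℝ) - 1| ≤ K)
    (hinit : ∀ i, (D.init n i : ℝ) ≤ K * √(n : ℝ)) {t : ℝ≥0} {ω : Ω} {b : Kind × Fin I → ℝ}
    (hb : ∀ s ≤ t, ∀ l, |q.centered l s ω| ≤ √(n : ℝ) * b l) (i : Fin I) :
    q.scaledX i t ω ≤ K ^ 3 * (I + 2) * (1 + t + ∑ l, b l) := by
  have hn' : (0 : ℝ) < n := by exact_mod_cast hn
  have hs : (0 : ℝ) < √(n : ℝ) := Real.sqrt_pos.2 hn'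
  have hss : √(n : ℝ) * √(n : ℝ) = n := Real.mul_self_sqrt hn'.le
  have hK0 : 0 < K := by linarith
  have hb0 : ∀ l, 0 ≤ b l := fun l => by
    have := (abs_nonneg _).trans (hb t le_rfl l)
    exact nonneg_of_mul_nonneg_right this hs
  have hinv : ∀ j, ((D.rate n Kind.S j : ℝ))⁻¹ ≤ K / n := fun j => by
    rw [inv_le_comm₀ (NNReal.coe_pos.2 (hrate Kind.S j).1) (by positivity), inv_div,
      div_le_iff₀' hK0]
    exact (hrate Kind.S j).2.2
  have h1 := hq.queue_le hn hr (fun i => (hrate Kind.S i).1) hb i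
  have e1 : ∑ j, (D.init n j : ℝ) / (D.rate n Kind.S j : ℝ) ≤ I * (K * √(n : ℝ) * (K / n)) := by
    refine (Finset.sum_le_sum (g := fun _ => K * √(n : ℝ) * (K / n)) fun j _ => ?_).trans_eq (by simp)
    rw [div_eq_mul_inv]
    exact mul_le_mul (hinit j) (hinv j) (by positivity) (by positivity)
  have e2 : ∑ j, (√(n : ℝ) * b (Kind.A, j) + √(n : ℝ) * b (Kind.S, j)) /
      (D.rate n Kind.S j : ℝ) ≤ √(n : ℝ) * (K / n) * ∑ l, b l := by
    rw [sum_streams, ← Finset.sum_add_distrib, Finset.mul_sum]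
    refine Finset.sum_le_sum fun j _ => ?_
    rw [div_eq_mul_inv, ← mul_add]
    refine (mul_le_mul_of_nonneg_left (hinv j)
      (mul_nonneg hs.le (add_nonneg (hb0 _) (hb0 _)))).trans_eq (by ring)
  have e3 : |∑ i, (D.rate n Kind.A i : ℝ) / (D.rate n Kind.S i : ℝ) - 1| ≤ K / √(n : ℝ) := by
    rw [le_div_iff₀' hs]
    exact hload
  have hsum : 0 ≤ ∑ l, b l := Finset.sum_nonneg fun l _ => hb0 l
  have ht : (0 : ℝ) ≤ t := t.2
  unfold scaledX
  rw [div_le_iff₀ hs]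
  have e4 : (q.X i t ω : ℝ) ≤ K * n * (I * (K * √(n : ℝ) * (K / n)) + K / √(n : ℝ) * t +
      2 * (√(n : ℝ) * (K / n) * ∑ l, b l)) := by
    refine h1.trans (mul_le_mul (hrate Kind.S i).2.1 ?_ ?_ (by positivity))
    · exact add_le_add (add_le_add e1 (mul_le_mul_of_nonneg_right e3 ht))
        (mul_le_mul_of_nonneg_left e2 (by norm_num))
    · refine add_nonneg (add_nonneg (Finset.sum_nonneg fun j _ => by positivity) (by positivity))
        (mul_nonneg (by norm_num) (Finset.sum_nonneg fun j _ => ?_))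
      exact div_nonneg (add_nonneg (mul_nonneg hs.le (hb0 _)) (mul_nonneg hs.le (hb0 _))) (by positivity)
  refine e4.trans ?_
  have e5 : K * n * (I * (K * √(n : ℝ) * (K / n)) + K / √(n : ℝ) * t +
      2 * (√(n : ℝ) * (K / n) * ∑ l, b l)) =
      (K ^ 3 * I + K ^ 2 * t + 2 * K ^ 2 * ∑ l, b l) * √(n : ℝ) := by
    have e6 : (n : ℝ) / √(n : ℝ) = √(n : ℝ) := by rw [div_eq_iff hs.ne', hss]
    have e7 : K / √(n : ℝ) = K * √(n : ℝ) / n := by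
      rw [div_eq_div_iff hs.ne' hn'.ne', mul_assoc, hss]
    rw [e7]
    field_simp
  rw [e5]
  refine mul_le_mul_of_nonneg_right ?_ hs.le
  have e8 : K ^ 2 ≤ K ^ 3 := pow_le_pow_right₀ hK (by norm_num)
  have e9 : (0 : ℝ) ≤ I := Nat.cast_nonneg I
  have e10 : (0 : ℝ) ≤ K ^ 3 := by positivity
  have m1 : K ^ 2 * (t : ℝ) ≤ K ^ 3 * t := mul_le_mul_of_nonneg_right e8 ht
  have m2 : K ^ 2 * ∑ l, b l ≤ K ^ 3 * ∑ l, b l := mul_le_mul_of_nonneg_right e8 hsum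
  have m3 : 0 ≤ K ^ 3 * I * (t : ℝ) := by positivity
  have m4 : 0 ≤ K ^ 3 * I * ∑ l, b l := by positivity
  have m5 : 0 ≤ K ^ 3 * (t : ℝ) := by positivity
  nlinarith

end Queue

/-! ### Moments of the queue lengths -/

lemma exp_sub_one_sub_le (x : ℝ) : Real.exp x - 1 - x ≤ x ^ 2 * Real.exp |x| := by
  have h1 : Real.exp x - 1 ≤ x * Real.exp x := by
    have h2 := mul_le_mul_of_nonneg_left (Real.add_one_le_exp (-x)) (Real.exp_pos x).le
    rw [← Real.exp_add, add_neg_cancel, Real.exp_zero] at h2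
    linarith
  have h3 := Real.add_one_le_exp x
  rcases le_total 0 x with h | h
  · rw [abs_of_nonneg h]
    nlinarith [mul_le_mul_of_nonneg_left h1 h]
  · have h4 : 1 ≤ Real.exp |x| := Real.one_le_exp (abs_nonneg x)
    nlinarith [mul_le_mul_of_nonneg_left h4 (sq_nonneg x),
      mul_le_mul_of_nonneg_left h3 (neg_nonneg.2 h)]

lemma rpow_le_mul_exp {p : ℝ} (hp : 0 < p) {x : ℝ} (hx : 0 ≤ x) : x ^ p ≤ p ^ p * Real.exp x := by
  have h1 : x / p ≤ Real.exp (x / p) := by linarith [Real.add_one_le_exp (x / p)]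
  calc x ^ p = p ^ p * (x / p) ^ p := by
        rw [← Real.mul_rpow hp.le (by positivity), mul_div_cancel₀ _ hp.ne']
    _ ≤ p ^ p * Real.exp (x / p) ^ p :=
        mul_le_mul_of_nonneg_left (Real.rpow_le_rpow (by positivity) h1 hp.le) (by positivity)
    _ = p ^ p * Real.exp x := by rw [← Real.exp_mul, div_mul_cancel₀ _ hp.ne']

namespace Queue

variable {I : ℕ} {D : Data I} {n : ℕ} {Ω : Type*} [mΩ : MeasurableSpace Ω] {P : Measure Ω}
  {q : Queue D n P} {Q : Measure Ω} {θ : Kind × Fin I → ℝ≥0 → Ω → ℝ}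

/-- The logarithmic density of one stream. -/
def streamLog (q : Queue D n P) (θ : Kind × Fin I → ℝ≥0 → Ω → ℝ) (l : Kind × Fin I) (t : ℝ≥0)
    (ω : Ω) : ℝ :=
  logExp (fun s => q.counts l s ω) (fun s => q.speed l s ω) (D.rate n l.1 l.2)
    (fun s => θ l s ω) t

/-- The maximal inequality, applied to the tilts by `± a / √n` of a single stream, bounds the
centered counts by the logarithmic densities up to an error with an exponential moment. -/
lemma exists_centered_bound [IsProbabilityMeasure P] (hn : 1 ≤ n) (hq : q.Admissible)
    (T : Tilted q.filtration P q.counts q.speed (fun l => D.rate n l.1 l.2) θ Q) {K : ℝ}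
    (hrate : ∀ j i, (D.rate n j i : ℝ) ≤ K * n) {a : ℝ} (ha : 0 < a) {t : ℝ≥0} (ht : 0 < t)
    (l : Kind × Fin I) :
    ∃ ξ : Bool → Ω → ℝ, (∀ k, Measurable (ξ k)) ∧ (∀ k ω, 0 ≤ ξ k ω) ∧
      (∀ k, ∫⁻ ω, ENNReal.ofReal (Real.exp (ξ k ω)) ∂Q ≤ 10) ∧ ∀ ω, ∀ s ≤ t,
        |q.centered l s ω| ≤ √(n : ℝ) *
          (2 / a * (∑ l, max (q.streamLog θ l t ω) 0 + ∑ k, ξ k ω) + a * Real.exp a * K * t) := by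
  classical
  have hn' : (1 : ℝ) ≤ n := by exact_mod_cast hn
  have hs : (1 : ℝ) ≤ √(n : ℝ) := Real.one_le_sqrt.2 hn'
  have hss : √(n : ℝ) * √(n : ℝ) = n := Real.mul_self_sqrt (by linarith)
  let ε : Bool → ℝ := fun k => if k then a / √(n : ℝ) else -(a / √(n : ℝ))
  choose ξ hξm hξ0 hξe hξ using fun k => T.exists_sup_error ht (Pi.single l (ε k))
  refine ⟨ξ, hξm, hξ0, hξe, fun ω s hst => ?_⟩
  have hX : expo q.counts q.speed (fun l => D.rate n l.1 l.2) (fun s ω l => θ l s ω) 0 t ω ≤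
      ∑ l, max (q.streamLog θ l t ω) 0 := Finset.sum_le_sum fun l _ => le_max_left _ _
  have key : ∀ k, ε k * q.centered l s ω ≤
      2 * (∑ l, max (q.streamLog θ l t ω) 0 + ∑ k, ξ k ω) + a ^ 2 * Real.exp a * K * t := by
    intro k
    have h1 := hξ k ω s hst
    rw [T.sys.expo_const, Finset.sum_eq_single l (fun l' _ hl' => by simp [Pi.single_eq_of_ne hl'])
      (fun h => absurd (Finset.mem_univ l) h), Pi.single_eq_same] at h1
    have h2 : ∫ v in Set.Ioc 0 s, q.speed l v ω ∂leb = q.clockTime l s ω := by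
      rw [hq.clockTime_eq, setIntegral_Iic_eq]
    rw [h2] at h1
    have h3 : (q.clockTime l s ω : ℝ) ≤ t := NNReal.coe_le_coe.2 ((hq.clockTime_le l s ω).trans hst)
    -- the second order remainder is of order `1 / n`, and the rates are of order `n`
    have h4 : Real.exp (ε k) - 1 - ε k ≤ a ^ 2 / n * Real.exp a := by
      have h5 : |ε k| = a / √(n : ℝ) := by
        have : 0 ≤ a / √(n : ℝ) := by positivity
        cases k <;> simp [ε, abs_of_nonneg this]
      refine (exp_sub_one_sub_le (ε k)).trans ?_
      rw [← sq_abs, h5, div_pow, Real.sq_sqrt (by linarith)]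
      exact mul_le_mul_of_nonneg_left (Real.exp_le_exp.2 (div_le_self ha.le hs)) (by positivity)
    have h6 : ξ k ω ≤ ∑ k, ξ k ω :=
      Finset.single_le_sum (fun k _ => hξ0 k ω) (Finset.mem_univ k)
    have h7 : (D.rate n l.1 l.2 : ℝ) * q.clockTime l s ω ≤ K * n * t :=
      mul_le_mul (hrate _ _) h3 (NNReal.coe_nonneg _) ((NNReal.coe_nonneg _).trans (hrate l.1 l.2))
    have h8 : (Real.exp (ε k) - 1 - ε k) * (D.rate n l.1 l.2 * q.clockTime l s ω) ≤
        a ^ 2 * Real.exp a * K * t := by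
      calc _ ≤ a ^ 2 / n * Real.exp a * (D.rate n l.1 l.2 * q.clockTime l s ω) :=
            mul_le_mul_of_nonneg_right h4 (by positivity)
        _ ≤ a ^ 2 / n * Real.exp a * (K * n * t) := mul_le_mul_of_nonneg_left h7 (by positivity)
        _ = _ := by field_simp
    unfold centered
    nlinarith
  have h1 := key true
  have h2 := key false
  simp only [ε, if_true, Bool.false_eq_true, if_false] at h1 h2
  set Z := ∑ l, max (q.streamLog θ l t ω) 0 + ∑ k, ξ k ω with hZ
  have h3 : a / √(n : ℝ) * |q.centered l s ω| ≤ 2 * Z + a ^ 2 * Real.exp a * K * t := by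
    rcases abs_cases (q.centered l s ω) with ⟨h, -⟩ | ⟨h, -⟩ <;> rw [h] <;> linarith
  have h4 : √(n : ℝ) * (2 / a * Z + a * Real.exp a * K * t) =
      (2 * Z + a ^ 2 * Real.exp a * K * t) / (a / √(n : ℝ)) := by
    field_simp
  rw [h4, le_div_iff₀ (by positivity)]
  linarith

/-- The moments of the queue lengths are controlled by those of the positive parts of the
logarithmic densities, with a factor that is as small as desired. -/
lemma exists_scaledX_moment_const (I : ℕ) {p K : ℝ} (hp : 1 ≤ p) (hK : 1 ≤ K) :
    ∃ K₁ : ℝ, 0 ≤ K₁ ∧ ∀ a : ℝ, 0 < a → ∃ K₂ : ℝ, 0 ≤ K₂ ∧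
      ∀ {D : Data I} {n : ℕ} {Ω : Type*} [MeasurableSpace Ω] {P : Measure Ω}
        [IsProbabilityMeasure P] {q : Queue D n P} {Q : Measure Ω}
        {θ : Kind × Fin I → ℝ≥0 → Ω → ℝ}, 1 ≤ n → q.Admissible →
        (q.IsPreemptive ∨ q.IsNonPreemptive) →
        (∀ j i, 0 < D.rate n j i ∧ (D.rate n j i : ℝ) ≤ K * n ∧ (n : ℝ) ≤ K * D.rate n j i) →
        √(n : ℝ) * |∑ i, (D.rate n Kind.A i : ℝ) / (D.rate n Kind.S i : ℝ) - 1| ≤ K →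
        (∀ i, (D.init n i : ℝ) ≤ K * √(n : ℝ)) →
        Tilted q.filtration P q.counts q.speed (fun l => D.rate n l.1 l.2) θ Q →
        ∀ t : ℝ≥0, 0 < t → ∀ i,
          ∫⁻ ω, ENNReal.ofReal (q.scaledX i t ω ^ p) ∂Q ≤
            ENNReal.ofReal (K₂ * (1 + t) ^ p) + ENNReal.ofReal (K₁ / a ^ p) *
              ∑ l, ∫⁻ ω, ENNReal.ofReal (max (q.streamLog θ l t ω) 0 ^ p) ∂Q := by
  classical
  set m : ℝ := (Fintype.card (Kind × Fin I) : ℝ) with hm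
  set B : ℝ := K ^ 3 * (I + 2) with hB
  have hB0 : 0 ≤ B := by positivity
  have hm0 : 0 ≤ m := Nat.cast_nonneg _
  have hp0 : 0 ≤ p := by linarith
  set m₂ : ℝ := (Fintype.card ((Kind × Fin I) × Bool) : ℝ) with hm₂
  have hm₂0 : 0 ≤ m₂ := Nat.cast_nonneg _
  refine ⟨2 ^ p * (2 * m * B) ^ p * 2 ^ p * m ^ (p - 1), by positivity, fun a ha => ?_⟩
  -- `α` belongs to the deterministic part, `β` to the logarithmic densities `S` and the errors `Ξ`
  set α : ℝ := 2 ^ p * (B * (1 + m * a * Real.exp a * K)) ^ p with hα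
  set β : ℝ := 2 ^ p * (2 * m * B / a) ^ p * 2 ^ p with hβ
  have hα0 : 0 ≤ α := by positivity
  have hβ0 : 0 ≤ β := by positivity
  set γ : ℝ := β * (m₂ ^ (p - 1) * (m₂ * (p ^ p * 10))) with hγ
  have hγ0 : 0 ≤ γ := by positivity
  refine ⟨α + γ, by positivity, ?_⟩
  intro D n Ω _ P _ q Q θ hn hq hr hrate hload hinit T t ht i
  have hprob := T.prob
  choose ξ hξm hξ0 hξe hξ using fun l =>
    exists_centered_bound hn hq T (fun j i => (hrate j i).2.1) ha ht l
  set S : Ω → ℝ := fun ω => ∑ l, max (q.streamLog θ l t ω) 0 with hS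
  set Ξ : Ω → ℝ := fun ω => ∑ k : (Kind × Fin I) × Bool, ξ k.1 k.2 ω with hΞ
  have hS0 : ∀ ω, 0 ≤ S ω := fun ω => Finset.sum_nonneg fun l _ => le_max_right _ _
  have hΞ0 : ∀ ω, 0 ≤ Ξ ω := fun ω => Finset.sum_nonneg fun k _ => hξ0 k.1 k.2 ω
  have ht0 : (0 : ℝ) ≤ t := t.2
  have hX0 : ∀ ω, 0 ≤ q.scaledX i t ω := fun ω => by unfold scaledX; positivity
  have hpt : ∀ ω, q.scaledX i t ω ≤
      B * (1 + m * a * Real.exp a * K) * (1 + t) + 2 * m * B / a * (S ω + Ξ ω) := fun ω => by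
    have h1 := hq.scaledX_le hn hr hK hrate hload hinit (t := t) (ω := ω)
      (b := fun _ => 2 / a * (S ω + Ξ ω) + a * Real.exp a * K * t) (fun s hst l => by
        refine (hξ l ω s hst).trans ?_
        have h2 : ∑ k, ξ l k ω ≤ Ξ ω := by
          rw [hΞ]
          simp only
          rw [Fintype.sum_prod_type]
          exact Finset.single_le_sum (f := fun l => ∑ k, ξ l k ω)
            (fun l _ => Finset.sum_nonneg fun k _ => hξ0 l k ω) (Finset.mem_univ l)
        gcongr) i
    rw [Finset.sum_const, Finset.card_univ, nsmul_eq_mul, ← hm, ← hB] at h1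
    refine h1.trans ?_
    have h3 : 0 ≤ B * (m * a * Real.exp a * K) := by positivity
    have h4 : 2 * m * B / a * (S ω + Ξ ω) = B * (m * (2 / a * (S ω + Ξ ω))) := by ring
    rw [h4]
    nlinarith
  have hpow : ∀ ω, q.scaledX i t ω ^ p ≤ α * (1 + t) ^ p + β * (m ^ (p - 1) *
      ∑ l, max (q.streamLog θ l t ω) 0 ^ p) + β * Ξ ω ^ p := fun ω => by
    have e1 := Real.rpow_le_rpow (hX0 ω) (hpt ω) hp0
    have e2 := add_rpow_le hp0 (a := B * (1 + m * a * Real.exp a * K) * (1 + t))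
      (b := 2 * m * B / a * (S ω + Ξ ω)) (by positivity)
      (mul_nonneg (by positivity) (add_nonneg (hS0 ω) (hΞ0 ω)))
    have e3 := add_rpow_le hp0 (hS0 ω) (hΞ0 ω)
    have e4 : S ω ^ p ≤ m ^ (p - 1) * ∑ l, max (q.streamLog θ l t ω) 0 ^ p := by
      have := Real.rpow_sum_le_const_mul_sum_rpow_of_nonneg Finset.univ
        (f := fun l => max (q.streamLog θ l t ω) 0) hp (fun l _ => le_max_right _ _)
      rwa [Finset.card_univ] at this
    rw [Real.mul_rpow (by positivity) (by positivity),
      Real.mul_rpow (by positivity) (add_nonneg (hS0 ω) (hΞ0 ω))] at e2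
    have e5 : 0 ≤ (2 * m * B / a) ^ p := by positivity
    calc _ ≤ _ := e1
      _ ≤ _ := e2
      _ ≤ 2 ^ p * ((B * (1 + m * a * Real.exp a * K)) ^ p * (1 + t) ^ p + (2 * m * B / a) ^ p *
          (2 ^ p * (m ^ (p - 1) * ∑ l, max (q.streamLog θ l t ω) 0 ^ p + Ξ ω ^ p))) := by
        gcongr
        exact e3.trans (by gcongr)
      _ = _ := by rw [hα, hβ]; ring
  have hΞp : ∫⁻ ω, ENNReal.ofReal (Ξ ω ^ p) ∂Q ≤ ENNReal.ofReal (m₂ ^ (p - 1) * (m₂ * (p ^ p * 10))) := by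
    calc _ ≤ ∫⁻ ω, ENNReal.ofReal (m₂ ^ (p - 1)) * ∑ k : (Kind × Fin I) × Bool,
          ENNReal.ofReal (p ^ p) * ENNReal.ofReal (Real.exp (ξ k.1 k.2 ω)) ∂Q := by
          refine lintegral_mono fun ω => ?_
          simp only [← ENNReal.ofReal_mul (show 0 ≤ p ^ p by positivity)]
          rw [← ENNReal.ofReal_sum_of_nonneg fun k _ => by positivity,
            ← ENNReal.ofReal_mul (by positivity)]
          refine ENNReal.ofReal_le_ofReal ?_
          have := Real.rpow_sum_le_const_mul_sum_rpow_of_nonneg Finset.univ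
            (f := fun k : (Kind × Fin I) × Bool => ξ k.1 k.2 ω) hp (fun k _ => hξ0 k.1 k.2 ω)
          rw [Finset.card_univ, ← hm₂] at this
          refine this.trans (mul_le_mul_of_nonneg_left (Finset.sum_le_sum fun k _ => ?_)
            (by positivity))
          exact rpow_le_mul_exp (by linarith) (hξ0 k.1 k.2 ω)
      _ = ENNReal.ofReal (m₂ ^ (p - 1)) * ∑ k : (Kind × Fin I) × Bool,
          ENNReal.ofReal (p ^ p) * ∫⁻ ω, ENNReal.ofReal (Real.exp (ξ k.1 k.2 ω)) ∂Q := by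
          have hmeas : ∀ k : (Kind × Fin I) × Bool,
              Measurable fun ω => ENNReal.ofReal (Real.exp (ξ k.1 k.2 ω)) := fun k =>
            (hξm k.1 k.2).exp.ennreal_ofReal
          rw [lintegral_const_mul _ (Finset.measurable_fun_sum _ fun k _ =>
            (hmeas k).const_mul _), lintegral_finsetSum _ fun k _ => (hmeas k).const_mul _]
          congr 1
          exact Finset.sum_congr rfl fun k _ => lintegral_const_mul _ (hmeas k)
      _ ≤ ENNReal.ofReal (m₂ ^ (p - 1)) * ∑ k : (Kind × Fin I) × Bool,
          ENNReal.ofReal (p ^ p) * ENNReal.ofReal 10 := by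
          gcongr with k
          rw [ENNReal.ofReal_ofNat]
          exact hξe k.1 k.2
      _ = _ := by
          rw [Finset.sum_const, Finset.card_univ, nsmul_eq_mul, ← ENNReal.ofReal_mul (by positivity),
            ← ENNReal.ofReal_natCast, ← hm₂, ← ENNReal.ofReal_mul hm₂0,
            ← ENNReal.ofReal_mul (by positivity)]
  have hXm : ∀ l, Measurable fun ω => ENNReal.ofReal (max (q.streamLog θ l t ω) 0 ^ p) := fun l =>
    (((T.measurable_logExp (T.pred l) l ht).mono (q.filtration.le t) le_rfl).max
      measurable_const).pow_const p |>.ennreal_ofReal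
  have hΞm : Measurable fun ω => ENNReal.ofReal (Ξ ω ^ p) :=
    ((Finset.measurable_fun_sum _ fun k _ => hξm k.1 k.2).pow_const p).ennreal_ofReal
  have h1t : 1 ≤ (1 + (t : ℝ)) ^ p := Real.one_le_rpow (by linarith) hp0
  calc _ ≤ ∫⁻ ω, (ENNReal.ofReal (α * (1 + t) ^ p) + ENNReal.ofReal (β * m ^ (p - 1)) *
        (∑ l, ENNReal.ofReal (max (q.streamLog θ l t ω) 0 ^ p)) +
        ENNReal.ofReal β * ENNReal.ofReal (Ξ ω ^ p)) ∂Q := lintegral_mono fun ω => by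
        have hsum0 : 0 ≤ ∑ l, max (q.streamLog θ l t ω) 0 ^ p :=
          Finset.sum_nonneg fun l _ => Real.rpow_nonneg (le_max_right _ _) _
        have hΞp0 : 0 ≤ Ξ ω ^ p := Real.rpow_nonneg (hΞ0 ω) _
        rw [← ENNReal.ofReal_sum_of_nonneg fun l _ => Real.rpow_nonneg (le_max_right _ _) _,
          ← ENNReal.ofReal_mul (by positivity), ← ENNReal.ofReal_mul hβ0,
          ← ENNReal.ofReal_add (by positivity) (by positivity),
          ← ENNReal.ofReal_add (by positivity) (by positivity)]
        refine ENNReal.ofReal_le_ofReal ((hpow ω).trans_eq (by ring))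
    _ = ENNReal.ofReal (α * (1 + t) ^ p) + ENNReal.ofReal (β * m ^ (p - 1)) *
        (∑ l, ∫⁻ ω, ENNReal.ofReal (max (q.streamLog θ l t ω) 0 ^ p) ∂Q) +
        ENNReal.ofReal β * ∫⁻ ω, ENNReal.ofReal (Ξ ω ^ p) ∂Q := by
        rw [lintegral_add_right _ (hΞm.const_mul _), lintegral_const_mul _ hΞm,
          lintegral_add_left measurable_const, lintegral_const, measure_univ, mul_one,
          lintegral_const_mul _ (Finset.measurable_fun_sum _ fun l _ => hXm l),
          lintegral_finsetSum _ fun l _ => hXm l]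
    _ ≤ ENNReal.ofReal (α * (1 + t) ^ p) + ENNReal.ofReal (β * m ^ (p - 1)) *
        (∑ l, ∫⁻ ω, ENNReal.ofReal (max (q.streamLog θ l t ω) 0 ^ p) ∂Q) +
        ENNReal.ofReal (γ * (1 + t) ^ p) := by
        gcongr
        refine (mul_le_mul_right hΞp _).trans ?_
        rw [← ENNReal.ofReal_mul hβ0]
        exact ENNReal.ofReal_le_ofReal (le_mul_of_one_le_right hγ0 h1t)
    _ = _ := by
        rw [add_right_comm, ← ENNReal.ofReal_add (by positivity) (by positivity), ← add_mul]
        congr 3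
        rw [hβ, Real.div_rpow (by positivity) ha.le]
        ring

end Queue

/-! ### Admissible measures as tilted measures -/

lemma restrict_leb_Iic_eq (t : ℝ≥0) : leb.restrict (Set.Iic t) = leb.restrict (Set.Ioc 0 t) := by
  have h : Set.Icc 0 t = Set.Iic t := Set.Icc_bot
  rw [← h]
  exact (Measure.restrict_congr_set Ioc_ae_eq_Icc).symm

/-- The Fenchel inequality for the relative entropy. -/
lemma mul_sub_le_entropyFun (c x : ℝ) :
    c * (Real.exp x - 1) - (Real.exp c - 1 - c) ≤ entropyFun x := by
  have h1 := mul_nonneg (Real.exp_pos c).le (entropyFun_nonneg (x - c))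
  have h2 : Real.exp c * Real.exp (x - c) = Real.exp x := by rw [← Real.exp_add]; ring_nf
  unfold entropyFun at h1 ⊢
  have h3 : Real.exp c * (Real.exp (x - c) * (x - c) - Real.exp (x - c) + 1) =
      Real.exp x * (x - c) - Real.exp x + Real.exp c := by rw [← h2]; ring
  linarith

/-- Fenchel's inequality for the entropy at the slopes `± c`. -/
lemma abs_exp_sub_one_le {c : ℝ} (hc : 0 ≤ c) (x : ℝ) :
    c * |Real.exp x - 1| ≤ entropyFun x + c ^ 2 * Real.exp c := by
  have h1 := mul_sub_le_entropyFun c x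
  have h2 := mul_sub_le_entropyFun (-c) x
  have h3 := exp_sub_one_sub_le c
  have h4 := exp_sub_one_sub_le (-c)
  rw [abs_neg, neg_sq] at h4
  rw [abs_of_nonneg hc] at h3 h4
  rcases abs_cases (Real.exp x - 1) with ⟨h, -⟩ | ⟨h, -⟩ <;> rw [h] <;> linarith

namespace Queue

variable {I : ℕ} {D : Data I} {n : ℕ} {Ω : Type*} [mΩ : MeasurableSpace Ω] {P : Measure Ω}
  {q : Queue D n P} {Q : Measure Ω} {ψ : Kind → Fin I → ℝ≥0 → Ω → ℝ}

/-- The logarithm of the intensity relative to the reference rate. -/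
def logRatio (D : Data I) (n : ℕ) (ψ : Kind → Fin I → ℝ≥0 → Ω → ℝ) (l : Kind × Fin I) (t : ℝ≥0)
    (ω : Ω) : ℝ :=
  Real.log (ψ l.1 l.2 t ω / D.rate n l.1 l.2)

omit mΩ in
lemma exp_logRatio (hrate : ∀ j i, 0 < D.rate n j i) (hψ : ∀ j i t ω, 0 < ψ j i t ω)
    (l : Kind × Fin I) (t : ℝ≥0) (ω : Ω) :
    Real.exp (logRatio D n ψ l t ω) = ψ l.1 l.2 t ω / D.rate n l.1 l.2 :=
  Real.exp_log (div_pos (hψ _ _ _ _) (NNReal.coe_pos.2 (hrate _ _)))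

omit mΩ in
lemma rate_mul_exp_logRatio (hrate : ∀ j i, 0 < D.rate n j i) (hψ : ∀ j i t ω, 0 < ψ j i t ω)
    (l : Kind × Fin I) (t : ℝ≥0) (ω : Ω) :
    D.rate n l.1 l.2 * (Real.exp (logRatio D n ψ l t ω) - 1) =
      ψ l.1 l.2 t ω - D.rate n l.1 l.2 := by
  have := (NNReal.coe_pos.2 (hrate l.1 l.2)).ne'
  rw [exp_logRatio hrate hψ]
  field_simp

lemma logDensity_eq (hrate : ∀ j i, 0 < D.rate n j i) (hψ : ∀ j i t ω, 0 < ψ j i t ω)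
    (l : Kind × Fin I) (t : ℝ≥0) (ω : Ω) :
    q.logDensity l.1 l.2 (ψ l.1 l.2) t ω = q.streamLog (logRatio D n ψ) l t ω := by
  unfold logDensity streamLog logExp
  congr 1
  · exact finsum_Iic_eq_jumpSum (fun s => logRatio D n ψ l s ω) t
  · rw [setIntegral_Iic_eq, ← integral_const_mul]
    refine setIntegral_congr_fun measurableSet_Ioc fun s _ => ?_
    simp only
    rw [← mul_assoc, rate_mul_exp_logRatio hrate hψ]

lemma IsMaximizer.tilted [IsProbabilityMeasure P] (hQ : q.IsMaximizer ψ Q) (hq : q.Admissible)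
    (hr : q.IsPreemptive ∨ q.IsNonPreemptive) (hrate : ∀ j i, 0 < D.rate n j i) :
    Tilted q.filtration P q.counts q.speed (fun l => D.rate n l.1 l.2) (logRatio D n ψ) Q where
  sys := hr.elim (fun h => h.expSystem hq) fun h => h.expSystem hq
  prob := hQ.isProbability
  pred l := by
    have h1 : IsPred q.filtration (ψ l.1 l.2) := (hQ.predictable l.1 l.2).measurable
    exact h1.comp (φ := fun x => Real.log (x / D.rate n l.1 l.2)) (by fun_prop)
  integrable := by
    have h1 : ∀ᵐ ω ∂P, ∀ j i, ∀ t : ℝ≥0, IntegrableOn (fun s => ψ j i s ω) (Set.Iic t) leb :=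
      ae_all_iff.2 fun j => ae_all_iff.2 fun i => hQ.integrable j i
    filter_upwards [h1] with ω hω l t
    simp only [exp_logRatio hrate hQ.pos]
    exact ((hω l.1 l.2 t).mono_set fun s hs => hs.2).div_const _
  density t B hB := by
    rw [hQ.density t B hB]
    refine lintegral_congr fun ω => ?_
    have h1 : expo q.counts q.speed (fun l => D.rate n l.1 l.2)
        (fun s ω l => logRatio D n ψ l s ω) 0 t ω =
        ∑ l : Kind × Fin I, q.logDensity l.1 l.2 (ψ l.1 l.2) t ω :=
      Finset.sum_congr rfl fun l _ => (logDensity_eq hrate hQ.pos l t ω).symm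
    rw [h1, sum_streams fun l : Kind × Fin I => q.logDensity l.1 l.2 (ψ l.1 l.2) t ω, ← Finset.sum_add_distrib,
      Real.exp_sum]
    simp only [Real.exp_add]

omit mΩ in
lemma entropyRate_scaledPsi (hb : ∀ j i, 0 < D.base j i) (hn : 1 ≤ n)
    (hrate : ∀ j i, 0 < D.rate n j i) (hψ : ∀ j i t ω, 0 < ψ j i t ω)
    (l : Kind × Fin I) (t : ℝ≥0) (ω : Ω) :
    D.entropyRate n l.1 l.2 (D.scaledPsi n l.1 l.2 (ψ l.1 l.2) t ω) =
      D.rate n l.1 l.2 * entropyFun (logRatio D n ψ l t ω) := by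
  have h1 := (NNReal.coe_pos.2 (hrate l.1 l.2)).ne'
  have h2 : √(D.base l.1 l.2 * n) ≠ 0 := by
    have : (0 : ℝ) < n := by exact_mod_cast hn
    have := hb l.1 l.2
    positivity
  have h3 : √(D.base l.1 l.2 * n) / D.rate n l.1 l.2 * D.scaledPsi n l.1 l.2 (ψ l.1 l.2) t ω =
      Real.exp (logRatio D n ψ l t ω) - 1 := by
    rw [exp_logRatio hrate hψ]
    unfold Data.scaledPsi
    field_simp
  unfold Data.entropyRate entropyFun
  rw [h3, add_sub_cancel, Real.log_exp]
  ring

lemma integratedEntropy_eq (hb : ∀ j i, 0 < D.base j i) (hn : 1 ≤ n)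
    (hrate : ∀ j i, 0 < D.rate n j i) (hψ : ∀ j i t ω, 0 < ψ j i t ω)
    (l : Kind × Fin I) (t : ℝ≥0) (ω : Ω) :
    q.integratedEntropy l.1 l.2 (ψ l.1 l.2) t ω = ∫⁻ s in Set.Ioc 0 t,
      ENNReal.ofReal (D.rate n l.1 l.2 * entropyFun (logRatio D n ψ l s ω) * q.speed l s ω) ∂leb := by
  unfold integratedEntropy
  rw [restrict_leb_Iic_eq]
  simp only [entropyRate_scaledPsi hb hn hrate hψ]

/-- The integrated perturbation is controlled by the integrated entropy. -/
lemma enorm_integratedPsi_le (hn : 1 ≤ n) (hq : q.Admissible) {K : ℝ} (hK : 1 ≤ K)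
    (hb : ∀ j i, 0 < D.base j i ∧ 1 ≤ K * D.base j i)
    (hrate : ∀ j i, 0 < D.rate n j i ∧ (D.rate n j i : ℝ) ≤ K * n)
    (hψ : ∀ j i t ω, 0 < ψ j i t ω) (l : Kind × Fin I) (t : ℝ≥0) (ω : Ω) :
    ‖q.integratedPsi l.1 l.2 (ψ l.1 l.2) t ω‖ₑ ≤
      ENNReal.ofReal K * q.integratedEntropy l.1 l.2 (ψ l.1 l.2) t ω +
        ENNReal.ofReal (K ^ 2 * Real.exp 1) * t := by
  have hK0 : 0 ≤ K := by linarith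
  have hn' : (1 : ℝ) ≤ n := by exact_mod_cast hn
  have hs : (1 : ℝ) ≤ √(n : ℝ) := Real.one_le_sqrt.2 hn'
  have hpt : ∀ s, ‖D.scaledPsi n l.1 l.2 (ψ l.1 l.2) s ω * q.clock l.1 l.2 s ω‖ₑ ≤
      ENNReal.ofReal K * ENNReal.ofReal (D.rate n l.1 l.2 *
        entropyFun (logRatio D n ψ l s ω) * q.speed l s ω) +
        ENNReal.ofReal (K ^ 2 * Real.exp 1) := fun s => by
    have hu0 : 0 ≤ q.clock l.1 l.2 s ω := hq.speed_nonneg l s ω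
    have hu1 : q.clock l.1 l.2 s ω ≤ 1 := hq.speed_le_one l s ω
    have hr0 : (0 : ℝ) ≤ D.rate n l.1 l.2 := NNReal.coe_nonneg _
    have hE := entropyFun_nonneg (logRatio D n ψ l s ω)
    -- `|exp x - 1| / √n` is at most the entropy of `x` plus a term of order `1 / n`, by Fenchel's
    -- inequality
    have h1 := abs_exp_sub_one_le (c := (√(n : ℝ))⁻¹) (by positivity) (logRatio D n ψ l s ω)
    have h2 : Real.exp (√(n : ℝ))⁻¹ ≤ Real.exp 1 := Real.exp_le_exp.2 (inv_le_one_of_one_le₀ hs)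
    have h3 : (√(n : ℝ))⁻¹ ^ 2 = (n : ℝ)⁻¹ := by rw [inv_pow, Real.sq_sqrt (by linarith)]
    rw [h3] at h1
    have h4 : |D.scaledPsi n l.1 l.2 (ψ l.1 l.2) s ω| =
        D.rate n l.1 l.2 * ((√(n : ℝ))⁻¹ * |Real.exp (logRatio D n ψ l s ω) - 1|) *
          (√(D.base l.1 l.2))⁻¹ := by
      unfold Data.scaledPsi
      rw [← rate_mul_exp_logRatio (fun j i => (hrate j i).1) hψ, abs_div, abs_mul, abs_of_nonneg hr0,
        abs_of_nonneg (Real.sqrt_nonneg _), Real.sqrt_mul (hb _ _).1.le]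
      field_simp
    have h5 : (√(D.base l.1 l.2))⁻¹ ≤ K := by
      rw [inv_le_comm₀ (Real.sqrt_pos.2 (hb _ _).1) (by linarith)]
      refine Real.le_sqrt_of_sq_le ?_
      have h6 : K⁻¹ ≤ D.base l.1 l.2 := by
        rw [inv_le_iff_one_le_mul₀' (by linarith)]
        exact (hb _ _).2
      have h7 : K⁻¹ ≤ 1 := inv_le_one_of_one_le₀ hK
      have h8 : 0 ≤ K⁻¹ := by positivity
      nlinarith
    have h6 : (D.rate n l.1 l.2 : ℝ) * ((n : ℝ)⁻¹ * Real.exp (√(n : ℝ))⁻¹) ≤ K * Real.exp 1 := by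
      rw [← mul_assoc]
      refine mul_le_mul ?_ h2 (Real.exp_pos _).le hK0
      rw [← div_eq_mul_inv, div_le_iff₀ (by linarith)]
      exact (hrate _ _).2
    have h7 : |D.scaledPsi n l.1 l.2 (ψ l.1 l.2) s ω| ≤
        (D.rate n l.1 l.2 * entropyFun (logRatio D n ψ l s ω) + K * Real.exp 1) * K := by
      rw [h4]
      refine mul_le_mul ?_ h5 (by positivity) (by positivity)
      have := mul_le_mul_of_nonneg_left h1 hr0
      linarith
    rw [Real.enorm_eq_ofReal_abs, ← ENNReal.ofReal_mul hK0, ← ENNReal.ofReal_add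
      (mul_nonneg hK0 (mul_nonneg (mul_nonneg hr0 hE) hu0)) (by positivity), abs_mul,
      abs_of_nonneg hu0]
    refine ENNReal.ofReal_le_ofReal ?_
    change _ ≤ K * (D.rate n l.1 l.2 * entropyFun (logRatio D n ψ l s ω) *
      q.clock l.1 l.2 s ω) + K ^ 2 * Real.exp 1
    have h8 := mul_le_mul_of_nonneg_right h7 hu0
    have h9 : K ^ 2 * Real.exp 1 * q.clock l.1 l.2 s ω ≤ K ^ 2 * Real.exp 1 :=
      mul_le_of_le_one_right (by positivity) hu1
    nlinarith
  unfold integratedPsi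
  refine (enorm_integral_le_lintegral_enorm _).trans ((lintegral_mono hpt).trans ?_)
  rw [lintegral_add_right _ measurable_const, lintegral_const_mul' _ _ ENNReal.ofReal_ne_top,
    lintegral_const, Measure.restrict_apply_univ, leb_Iic, integratedEntropy_eq
      (fun j i => (hb j i).1) hn (fun j i => (hrate j i).1) hψ, restrict_leb_Iic_eq]

end Queue

/-! ### Joint measurability in time and randomness -/

lemma IsCountingPath.jumpSum_rightCont {f : ℝ≥0 → ℕ} (hf : IsCountingPath f) (g : ℝ≥0 → ℝ)
    (t : ℝ≥0) : ContinuousWithinAt (fun s => jumpSum f g 0 s) (Set.Ici t) t := by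
  obtain ⟨u, htu, hu⟩ := hf.exists_const t
  refine (continuousWithinAt_const (b := jumpSum f g 0 t)).congr_of_eventuallyEq ?_ rfl
  filter_upwards [Ico_mem_nhdsGE htu] with s hs
  rw [jumpSum_add_adjacent hf g zero_le hs.1]
  have h : jumpSum f g t s = 0 := finsum_mem_eq_zero_of_forall_eq_zero fun r hr => by
    rw [hf.pathJump_eq_zero (hu s hs.1 hs.2).symm hr.1 hr.2, mul_zero]
  rw [h, add_zero]

section
variable {Ω : Type*} {mΩ : MeasurableSpace Ω}

lemma measurable_eval_prod {β : Type*} [TopologicalSpace β] [MeasurableSpace β]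
    [TopologicalSpace.PseudoMetrizableSpace β] [BorelSpace β] {f : ℝ≥0 → Ω → β}
    (hf : ∀ t, Measurable (f t))
    (hr : ∀ ω t, ContinuousWithinAt (fun s => f s ω) (Set.Ici t) t) :
    Measurable fun x : Ω × ℝ≥0 => f x.2 x.1 :=
  measurable_eval_of_rightCont (Ω := Ω × ℝ≥0) (f := fun t x => f t x.1)
    (fun t => (hf t).comp measurable_fst) (fun x t => hr x.1 t) (R := fun x => x.2) measurable_snd

lemma measurable_indicator_Ioc_prod {f : ℝ≥0 × Ω → ℝ} (hf : Measurable f) :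
    Measurable fun y : ℝ≥0 × (Ω × ℝ≥0) =>
      (Set.Ioc 0 y.2.2).indicator (fun s => f (s, y.2.1)) y.1 := by
  have h1 : MeasurableSet {y : ℝ≥0 × (Ω × ℝ≥0) | y.1 ∈ Set.Ioc 0 y.2.2} :=
    (measurableSet_lt (f := fun _ : ℝ≥0 × (Ω × ℝ≥0) => (0 : ℝ≥0)) measurable_const
      measurable_fst).inter (measurableSet_le (g := fun y : ℝ≥0 × (Ω × ℝ≥0) => y.2.2)
        measurable_fst (measurable_snd.comp measurable_snd))
  exact (hf.comp (measurable_fst.prodMk (measurable_fst.comp measurable_snd))).indicator h1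

lemma measurable_integral_Ioc {f : ℝ≥0 × Ω → ℝ} (hf : Measurable f) :
    Measurable fun x : Ω × ℝ≥0 => ∫ s in Set.Ioc 0 x.2, f (s, x.1) ∂leb := by
  have h1 := measurable_setIntegral_prod (measurable_indicator_Ioc_prod hf) Set.univ
  simpa only [Measure.restrict_univ, integral_indicator measurableSet_Ioc] using h1

lemma measurable_lintegral_Ioc {f : ℝ≥0 × Ω → ℝ} (hf : Measurable f) :
    Measurable fun x : Ω × ℝ≥0 => ∫⁻ s in Set.Ioc 0 x.2, ENNReal.ofReal (f (s, x.1)) ∂leb := by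
  have h1 := (measurable_indicator_Ioc_prod hf).ennreal_ofReal.lintegral_prod_left' (μ := leb)
  have h2 : ∀ x : Ω × ℝ≥0, ∫⁻ s, ENNReal.ofReal
      ((Set.Ioc 0 x.2).indicator (fun s => f (s, x.1)) s) ∂leb =
      ∫⁻ s in Set.Ioc 0 x.2, ENNReal.ofReal (f (s, x.1)) ∂leb := fun x => by
    rw [← lintegral_indicator measurableSet_Ioc]
    refine lintegral_congr fun s => ?_
    by_cases hs : s ∈ Set.Ioc 0 x.2 <;> simp [hs]
  simpa only [h2] using h1

end

namespace Queue

variable {I : ℕ} {D : Data I} {n : ℕ} {Ω : Type*} [mΩ : MeasurableSpace Ω] {P : Measure Ω}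
  {q : Queue D n P} {Q : Measure Ω} {θ : Kind × Fin I → ℝ≥0 → Ω → ℝ}

lemma Admissible.measurable_speed_prod (hq : q.Admissible) (l : Kind × Fin I) :
    Measurable fun x : ℝ≥0 × Ω => q.speed l x.1 x.2 :=
  (measurable_eval_prod (fun t => (hq.measurable_speed l t).mono (q.filtration.le t) le_rfl)
    (hq.speed_rightCont l)).comp measurable_swap

lemma measurable_streamLog (hq : q.Admissible)
    (T : Tilted q.filtration P q.counts q.speed (fun l => D.rate n l.1 l.2) θ Q)
    (l : Kind × Fin I) : Measurable fun x : Ω × ℝ≥0 => q.streamLog θ l x.2 x.1 := by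
  unfold streamLog logExp
  refine Measurable.sub ?_ (Measurable.const_mul ?_ _)
  · refine measurable_eval_prod (f := fun t ω =>
      jumpSum (fun s => q.counts l s ω) (fun s => θ l s ω) 0 t) (fun t => ?_)
      fun ω t => (hq.isCountingPath l ω).jumpSum_rightCont _ t
    rcases (zero_le : 0 ≤ t).eq_or_lt with h | h
    · simp only [← h, jumpSum, Set.Ioc_self]
      simp
    · exact (T.sys.measurable_jumpSum (T.pred l).predLim l h).mono (q.filtration.le t) le_rfl
  · exact measurable_integral_Ioc (f := fun x => (Real.exp (θ l x.1 x.2) - 1) * q.speed l x.1 x.2)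
      (((T.pred l).measurable.exp.sub_const 1).mul (hq.measurable_speed_prod l))

lemma measurable_entropy (hq : q.Admissible)
    (T : Tilted q.filtration P q.counts q.speed (fun l => D.rate n l.1 l.2) θ Q)
    (l : Kind × Fin I) : Measurable fun x : Ω × ℝ≥0 => ∫⁻ s in Set.Ioc 0 x.2,
      ENNReal.ofReal (D.rate n l.1 l.2 * entropyFun (θ l s x.1) * q.speed l s x.1) ∂leb :=
  measurable_lintegral_Ioc (f := fun x => D.rate n l.1 l.2 * entropyFun (θ l x.1 x.2) *
    q.speed l x.1 x.2)
    (((measurable_entropyFun.comp (T.pred l).measurable).const_mul _).mul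
      (hq.measurable_speed_prod l))

lemma Admissible.measurable_scaledX (hq : q.Admissible) (i : Fin I) :
    Measurable fun x : Ω × ℝ≥0 => q.scaledX i x.2 x.1 := by
  have h1 : ∀ l : Kind × Fin I, Measurable fun x : Ω × ℝ≥0 => (q.counts l x.2 x.1 : ℝ) := fun l =>
    measurable_from_nat.comp (measurable_eval_prod
      (fun t => q.measurable_count l.1 l.2 t) fun ω t => (hq.isCountingPath l ω).rightCont t)
  have h2 : ∀ t ω, q.scaledX i t ω =
      (D.init n i + q.counts (Kind.A, i) t ω - q.counts (Kind.S, i) t ω) / √(n : ℝ) := fun t ω => by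
    have h3 : (q.X i t ω : ℝ) + q.counts (Kind.S, i) t ω =
      D.init n i + q.counts (Kind.A, i) t ω := by exact_mod_cast q.balance i t ω
    unfold scaledX
    rw [← h3, add_sub_cancel_right]
  simp only [h2]
  exact (((h1 (Kind.A, i)).const_add _).sub (h1 (Kind.S, i))).div_const _

end Queue

/-! ### Discounted expectations -/

section discounted

variable {I : ℕ} {Ω : Type*} {mΩ : MeasurableSpace Ω}

/-- The expected discounted integral of a nonnegative process. -/
def discounted (D : Data I) (Q : Measure Ω) (f : ℝ≥0 → Ω → ℝ≥0∞) : ℝ≥0∞ :=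
  ∫⁻ ω, ∫⁻ t, (D.disc t : ℝ≥0∞) * f t ω ∂leb ∂Q

variable {D : Data I} {Q : Measure Ω} {f g : ℝ≥0 → Ω → ℝ≥0∞}

lemma discounted_mono (h : ∀ t ω, f t ω ≤ g t ω) : discounted D Q f ≤ discounted D Q g :=
  lintegral_mono fun ω => lintegral_mono fun t => mul_le_mul_right (h t ω) _

lemma discounted_add (hd : Measurable D.disc) (hf : Measurable fun x : Ω × ℝ≥0 => f x.2 x.1) :
    discounted D Q (fun t ω => f t ω + g t ω) = discounted D Q f + discounted D Q g := by
  have h1 : Measurable fun x : Ω × ℝ≥0 => (D.disc x.2 : ℝ≥0∞) * f x.2 x.1 :=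
    (hd.coe_nnreal_ennreal.comp measurable_snd).mul hf
  unfold discounted
  rw [← lintegral_add_left h1.lintegral_prod_right']
  refine lintegral_congr fun ω => ?_
  have h2 : Measurable fun t => (D.disc t : ℝ≥0∞) * f t ω := h1.comp measurable_prodMk_left
  simp only [mul_add]
  exact lintegral_add_left h2 _

lemma discounted_const_mul {c : ℝ≥0∞} (hc : c ≠ ∞) :
    discounted D Q (fun t ω => c * f t ω) = c * discounted D Q f := by
  unfold discounted
  rw [← lintegral_const_mul' _ _ hc]
  refine lintegral_congr fun ω => ?_
  rw [← lintegral_const_mul' _ _ hc]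
  simp only [mul_left_comm]

lemma discounted_deterministic [IsProbabilityMeasure Q] (c : ℝ≥0 → ℝ≥0∞) :
    discounted D Q (fun t _ => c t) = ∫⁻ t, (D.disc t : ℝ≥0∞) * c t ∂leb := by
  unfold discounted
  rw [lintegral_const, measure_univ, mul_one]

lemma discounted_swap [SFinite Q] (hd : Measurable D.disc)
    (hf : Measurable fun x : Ω × ℝ≥0 => f x.2 x.1) :
    discounted D Q f = ∫⁻ t, (D.disc t : ℝ≥0∞) * ∫⁻ ω, f t ω ∂Q ∂leb := by
  have h1 : Measurable fun x : Ω × ℝ≥0 => (D.disc x.2 : ℝ≥0∞) * f x.2 x.1 :=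
    (hd.coe_nnreal_ennreal.comp measurable_snd).mul hf
  unfold discounted
  rw [lintegral_lintegral_swap h1.aemeasurable]
  refine lintegral_congr fun t => ?_
  rw [lintegral_const_mul' _ _ ENNReal.coe_ne_top]

/-- A bound for the expectations at positive times yields one for discounted expectations. -/
lemma discounted_le {L : Type*} [Fintype L] [IsProbabilityMeasure Q] (hd : Measurable D.disc)
    (hf : Measurable fun x : Ω × ℝ≥0 => f x.2 x.1) {h : L → ℝ≥0 → Ω → ℝ≥0∞}
    (hh : ∀ l, Measurable fun x : Ω × ℝ≥0 => h l x.2 x.1) {c : ℝ≥0 → ℝ≥0∞} {k : ℝ≥0∞} (hk : k ≠ ∞)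
    (hle : ∀ t, 0 < t → ∫⁻ ω, f t ω ∂Q ≤ c t + k * ∑ l, ∫⁻ ω, h l t ω ∂Q) :
    discounted D Q f ≤ ∫⁻ t, (D.disc t : ℝ≥0∞) * c t ∂leb + k * ∑ l, discounted D Q (h l) := by
  have hm : ∀ l, Measurable fun t => (D.disc t : ℝ≥0∞) * ∫⁻ ω, h l t ω ∂Q := fun l =>
    hd.coe_nnreal_ennreal.mul (hh l).lintegral_prod_left'
  have h1 : k * ∑ l, discounted D Q (h l) =
      ∫⁻ t, k * ∑ l, (D.disc t : ℝ≥0∞) * ∫⁻ ω, h l t ω ∂Q ∂leb := by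
    rw [lintegral_const_mul' _ _ hk, lintegral_finsetSum _ fun l _ => hm l]
    simp only [discounted_swap hd (hh _)]
  rw [h1, discounted_swap hd hf, ← lintegral_add_right _
    ((Finset.measurable_fun_sum _ fun l _ => hm l).const_mul k)]
  refine lintegral_mono_ae ?_
  have h2 : ∀ᵐ t ∂leb, t ≠ 0 := by
    rw [ae_iff]
    simp
  filter_upwards [h2] with t ht
  refine (mul_le_mul_right (hle t (pos_iff_ne_zero.2 ht)) _).trans_eq ?_
  rw [mul_add, mul_left_comm, Finset.mul_sum]

/-- The moment of the discount function that enters all estimates. -/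
def Data.discMoment (D : Data I) (pbar : ℝ) : ℝ≥0∞ :=
  ∫⁻ t : ℝ≥0, (D.disc t : ℝ≥0∞) * ENNReal.ofReal ((1 + (t : ℝ)) ^ pbar) ∂leb

lemma lintegral_disc_le {pbar : ℝ} (hp : 0 ≤ pbar) :
    ∫⁻ t, (D.disc t : ℝ≥0∞) ∂leb ≤ D.discMoment pbar := by
  refine lintegral_mono fun t => le_mul_of_one_le_right zero_le ?_
  have ht : (0 : ℝ) ≤ t := t.2
  rw [← ENNReal.ofReal_one]
  exact ENNReal.ofReal_le_ofReal (Real.one_le_rpow (by linarith) hp)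

/-- The weight `(1 + t) ^ pbar` has a finite discounted integral: up to time `1` the discount
function is at most its initial value, and afterwards `1 + t` is comparable to `t`. -/
lemma Data.Regular.discMoment_ne_top {p pbar : ℝ} (hreg : D.Regular p pbar) :
    D.discMoment pbar ≠ ∞ := by
  have hp : 0 ≤ pbar := by linarith [hreg.one_le_p, hreg.p_le_pbar]
  have hm := hreg.disc_moment
  have h1 : ∀ t : ℝ≥0, (D.disc t : ℝ≥0∞) * ENNReal.ofReal ((1 + (t : ℝ)) ^ pbar) ≤
      ENNReal.ofReal (2 ^ pbar) * ((Set.Iic 1).indicator (fun _ => 2 * (D.disc 0 : ℝ≥0∞)) t +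
        2 * ((D.disc t : ℝ≥0∞) * (t : ℝ≥0∞) ^ pbar)) := fun t => by
    have ht : (0 : ℝ) ≤ t := t.2
    have e1 : ENNReal.ofReal ((1 + (t : ℝ)) ^ pbar) ≤
        ENNReal.ofReal (2 ^ pbar) * (1 + (t : ℝ≥0∞) ^ pbar) := by
      refine (ENNReal.ofReal_le_ofReal (add_rpow_le hp zero_le_one ht)).trans_eq ?_
      rw [ENNReal.ofReal_mul (by positivity), Real.one_rpow, ENNReal.ofReal_add zero_le_one
        (by positivity), ENNReal.ofReal_one, ← ENNReal.ofReal_rpow_of_nonneg ht hp,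
        ENNReal.ofReal_coe_nnreal]
    refine (mul_le_mul_right e1 _).trans ?_
    rw [mul_left_comm]
    refine mul_le_mul_right ?_ _
    rcases le_total t 1 with h | h
    · rw [Set.indicator_of_mem (show t ∈ Set.Iic 1 from h)]
      have e2 : (t : ℝ≥0∞) ^ pbar ≤ 1 := ENNReal.rpow_le_one (by exact_mod_cast h) hp
      refine le_add_right ?_
      rw [mul_comm]
      refine mul_le_mul' ?_ (ENNReal.coe_le_coe.2 (hreg.disc_anti zero_le))
      calc (1 : ℝ≥0∞) + (t : ℝ≥0∞) ^ pbar ≤ 1 + 1 := by gcongr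
        _ = 2 := one_add_one_eq_two
    · have e2 : 1 ≤ (t : ℝ≥0∞) ^ pbar := ENNReal.one_le_rpow (by exact_mod_cast h) (by
        linarith [hreg.one_le_p, hreg.p_le_pbar])
      refine le_add_left ?_
      rw [mul_left_comm]
      refine mul_le_mul_right ?_ _
      rw [two_mul]
      gcongr
  refine ne_top_of_le_ne_top ?_ (lintegral_mono h1)
  rw [lintegral_const_mul' _ _ ENNReal.ofReal_ne_top,
    lintegral_add_left (measurable_const.indicator measurableSet_Iic),
    lintegral_const_mul' _ _ (by simp), lintegral_indicator measurableSet_Iic, lintegral_const,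
    Measure.restrict_apply_univ, leb_Iic]
  exact ENNReal.mul_ne_top ENNReal.ofReal_ne_top (ENNReal.add_ne_top.2
    ⟨ENNReal.mul_ne_top (ENNReal.mul_ne_top (by simp) (by simp)) (by simp),
      ENNReal.mul_ne_top (by simp) hm.ne⟩)

end discounted

/-! ### Extended real arithmetic of the payoff -/

lemma EReal.sub_add_sub_coe_ennreal {a b c d : ℝ≥0∞} (hb : b ≠ ∞) (hd : d ≠ ∞) :
    ((a : EReal) - b) + ((c : EReal) - d) = ((a + c : ℝ≥0∞) : EReal) - ((b + d : ℝ≥0∞) : EReal) := by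
  lift b to ℝ≥0 using hb
  lift d to ℝ≥0 using hd
  have hreal : ∀ x : ℝ≥0, (((x : ℝ≥0∞) : EReal)) = ((x : ℝ) : EReal) := fun _ => rfl
  rw [← ENNReal.coe_add, hreal, hreal, hreal]
  induction a with
  | top =>
    rw [top_add, EReal.coe_ennreal_top, EReal.top_sub_coe, EReal.top_sub_coe]
    refine EReal.top_add_of_ne_bot ?_
    induction c with
    | top => rw [EReal.coe_ennreal_top, EReal.top_sub_coe]; simp
    | coe c => rw [hreal, ← EReal.coe_sub]; exact EReal.coe_ne_bot _
  | coe a =>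
    induction c with
    | top =>
      rw [add_top, EReal.coe_ennreal_top, EReal.top_sub_coe, EReal.top_sub_coe, hreal,
        ← EReal.coe_sub, EReal.coe_add_top]
    | coe c =>
      rw [← ENNReal.coe_add, hreal, hreal, hreal, ← EReal.coe_sub, ← EReal.coe_sub, ← EReal.coe_sub,
        ← EReal.coe_add]
      congr 1
      push_cast
      ring

lemma EReal.sum_sub_coe_ennreal {L : Type*} (s : Finset L) {a b : L → ℝ≥0∞} (hb : ∀ l, b l ≠ ∞) :
    ∑ l ∈ s, ((a l : EReal) - b l) = ((∑ l ∈ s, a l : ℝ≥0∞) : EReal) - ((∑ l ∈ s, b l : ℝ≥0∞) : EReal) := by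
  classical
  induction s using Finset.induction_on with
  | empty => simp
  | insert l s hl ih =>
    rw [Finset.sum_insert hl, Finset.sum_insert hl, Finset.sum_insert hl, ih,
      EReal.sub_add_sub_coe_ennreal (hb l) (ENNReal.sum_ne_top.2 fun l _ => hb l)]

lemma EReal.le_of_le_sub_coe_ennreal {v : ℝ} {H a b : ℝ≥0∞} (hb : b ≠ ∞)
    (h : (v : EReal) ≤ (H : EReal) - ((a : EReal) - b)) :
    a ≠ ∞ ∧ a ≤ H + b + ENNReal.ofReal |v| := by
  lift b to ℝ≥0 using hb
  have hreal : ∀ x : ℝ≥0, (((x : ℝ≥0∞) : EReal)) = ((x : ℝ) : EReal) := fun _ => rfl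
  rw [hreal] at h
  induction a with
  | top =>
    rw [EReal.coe_ennreal_top, EReal.top_sub_coe, EReal.sub_top] at h
    exact absurd h (not_le.2 (EReal.bot_lt_coe v))
  | coe a =>
    refine ⟨ENNReal.coe_ne_top, ?_⟩
    induction H with
    | top => simp
    | coe H =>
      rw [hreal, hreal, ← EReal.coe_sub, ← EReal.coe_sub, EReal.coe_le_coe_iff] at h
      have h1 : (a : ℝ) ≤ H + b + |v| := by linarith [neg_abs_le v]
      rw [← ENNReal.ofReal_coe_nnreal (p := a), ← ENNReal.ofReal_coe_nnreal (p := H),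
        ← ENNReal.ofReal_coe_nnreal (p := b), ← ENNReal.ofReal_add (NNReal.coe_nonneg H) (NNReal.coe_nonneg b),
        ← ENNReal.ofReal_add (by positivity) (abs_nonneg v)]
      exact ENNReal.ofReal_le_ofReal h1

/-! ### The payoff bounds the moments of the logarithmic densities -/

section growth

variable {I : ℕ} {D : Data I} {p pbar : ℝ}

lemma Data.Regular.cost_le (hreg : D.Regular p pbar) {c₀ : ℝ} (hc₀ : 0 < c₀)
    (h : ∀ i, ∀ x : ℝ, 0 ≤ x → D.cost i x ≤ c₀ * (1 + x ^ p)) (i : Fin I) {x : ℝ} (hx : 0 ≤ x) :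
    D.cost i x ≤ c₀ * (2 + x ^ pbar) := by
  have h1 : x ^ p ≤ 1 + x ^ pbar := by
    rcases le_total x 1 with h1 | h1
    · have := Real.rpow_le_one hx h1 (zero_le_one.trans hreg.one_le_p)
      have := Real.rpow_nonneg hx pbar
      linarith
    · have := Real.rpow_le_rpow_of_exponent_le h1 hreg.p_le_pbar
      linarith
  exact (h i x hx).trans (mul_le_mul_of_nonneg_left (by linarith) hc₀.le)

/-- The negative part of a divergence function is dominated by an exponential. -/
lemma neg_g_le {g : ℝ → ℝ} {c₁ c₂ c₃ : ℝ} (hp : 0 < pbar) (hc₂ : 0 < c₂) (hc₃ : 0 < c₃)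
    (h1 : ∀ x : ℝ, |g x| ≤ c₃ * (1 + |x| ^ pbar))
    (h2 : ∀ x : ℝ, 0 ≤ x → c₁ + c₂ * x ^ pbar ≤ g x) (x : ℝ) :
    -g x ≤ |c₁| + c₃ + c₃ * pbar ^ pbar * Real.exp (-x) := by
  have h3 : 0 ≤ c₃ * pbar ^ pbar * Real.exp (-x) := by positivity
  have h4 := abs_nonneg c₁
  rcases le_total 0 x with hx | hx
  · have h5 := h2 x hx
    have h6 : 0 ≤ c₂ * x ^ pbar := by positivity
    linarith [neg_abs_le c₁]
  · have h5 := (neg_le_abs (g x)).trans (h1 x)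
    have h6 := rpow_le_mul_exp hp (neg_nonneg.2 hx)
    rw [abs_of_nonpos hx] at h5
    have := mul_le_mul_of_nonneg_left h6 hc₃.le
    linarith

/-- The positive part of a divergence function dominates the power of the positive part. -/
lemma mul_posPart_rpow_le {g : ℝ → ℝ} {c₁ c₂ : ℝ} (hp : 0 < pbar) (hc₂ : 0 < c₂)
    (h2 : ∀ x : ℝ, 0 ≤ x → c₁ + c₂ * x ^ pbar ≤ g x) (x : ℝ) :
    ENNReal.ofReal c₂ * ENNReal.ofReal (max x 0 ^ pbar) ≤
      ENNReal.ofReal (g x) + ENNReal.ofReal |c₁| := by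
  rcases le_total 0 x with hx | hx
  · rw [max_eq_left hx, ← ENNReal.ofReal_mul hc₂.le]
    refine le_trans (ENNReal.ofReal_le_ofReal ?_) ENNReal.ofReal_add_le
    linarith [h2 x hx, neg_abs_le c₁]
  · rw [max_eq_right hx, Real.zero_rpow hp.ne', ENNReal.ofReal_zero, mul_zero]
    exact zero_le

end growth

namespace Queue

section moments

variable {I : ℕ} {D : Data I} {n : ℕ} {Ω : Type*} [mΩ : MeasurableSpace Ω] {P : Measure Ω}
  {q : Queue D n P} {Q : Measure Ω} {θ : Kind × Fin I → ℝ≥0 → Ω → ℝ} {p pbar : ℝ}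

/-- The discounted moment of the positive part of the logarithmic density of a stream. -/
def logMoment (q : Queue D n P) (Q : Measure Ω) (θ : Kind × Fin I → ℝ≥0 → Ω → ℝ) (pbar : ℝ)
    (l : Kind × Fin I) : ℝ≥0∞ :=
  discounted D Q fun t ω => ENNReal.ofReal (max (q.streamLog θ l t ω) 0 ^ pbar)

lemma measurable_posPart_streamLog (hq : q.Admissible)
    (T : Tilted q.filtration P q.counts q.speed (fun l => D.rate n l.1 l.2) θ Q)
    (l : Kind × Fin I) :
    Measurable fun x : Ω × ℝ≥0 => ENNReal.ofReal (max (q.streamLog θ l x.2 x.1) 0 ^ pbar) :=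
  (((measurable_streamLog hq T l).max measurable_const).pow_const pbar).ennreal_ofReal

/-- The reciprocal of the density of a stream has mean at most one under the tilted measure. -/
lemma lintegral_exp_neg_streamLog_le [IsProbabilityMeasure P]
    (T : Tilted q.filtration P q.counts q.speed (fun l => D.rate n l.1 l.2) θ Q)
    (l : Kind × Fin I) {t : ℝ≥0} (ht : 0 < t) :
    ∫⁻ ω, ENNReal.ofReal (Real.exp (-q.streamLog θ l t ω)) ∂Q ≤ 1 := by
  simpa [streamLog] using T.lintegral_exp_neg_logExp_le ht l (S := Set.univ) MeasurableSet.univ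

/-- The discounted negative part of a divergence is bounded, because the reciprocal of the density
of a stream has mean at most one. -/
lemma discounted_neg_g_le [IsProbabilityMeasure P] (hreg : D.Regular p pbar) (hq : q.Admissible)
    (T : Tilted q.filtration P q.counts q.speed (fun l => D.rate n l.1 l.2) θ Q) {C C' : ℝ}
    (hC : 0 ≤ C) (hC' : 0 ≤ C') (l : Kind × Fin I)
    (h : ∀ x, -D.g l.1 l.2 x ≤ C + C' * Real.exp (-x)) :
    discounted D Q (fun t ω => ENNReal.ofReal (-D.g l.1 l.2 (q.streamLog θ l t ω))) ≤
      ENNReal.ofReal (C + C') * D.discMoment pbar := by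
  have hprob := T.prob
  have hm : Measurable fun x : Ω × ℝ≥0 =>
      ENNReal.ofReal (-D.g l.1 l.2 (q.streamLog θ l x.2 x.1)) :=
    (((hreg.g_mono l.1 l.2).measurable.comp (measurable_streamLog hq T l)).neg).ennreal_ofReal
  have h1 := discounted_le (L := Empty) (D := D) (Q := Q)
    (f := fun t ω => ENNReal.ofReal (-D.g l.1 l.2 (q.streamLog θ l t ω))) hreg.disc_anti.measurable hm
    (h := fun l => l.elim) (fun l => l.elim) (c := fun _ => ENNReal.ofReal (C + C')) (k := 0)
    (by simp) (fun t ht => by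
      rw [zero_mul, add_zero]
      calc _ ≤ ∫⁻ ω, (ENNReal.ofReal C + ENNReal.ofReal C' *
            ENNReal.ofReal (Real.exp (-q.streamLog θ l t ω))) ∂Q := lintegral_mono fun ω => by
            rw [← ENNReal.ofReal_mul hC', ← ENNReal.ofReal_add hC (by positivity)]
            exact ENNReal.ofReal_le_ofReal (h _)
        _ ≤ ENNReal.ofReal C + ENNReal.ofReal C' * 1 := by
            rw [lintegral_add_left measurable_const, lintegral_const, measure_univ, mul_one,
              lintegral_const_mul' _ _ ENNReal.ofReal_ne_top]
            gcongr
            exact lintegral_exp_neg_streamLog_le T l ht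
        _ = _ := by rw [mul_one, ENNReal.ofReal_add hC hC'])
  refine h1.trans ?_
  rw [zero_mul, add_zero]
  simp only [mul_comm _ (ENNReal.ofReal (C + C'))]
  rw [lintegral_const_mul' _ _ ENNReal.ofReal_ne_top]
  exact mul_le_mul_right (lintegral_disc_le (by linarith [hreg.one_le_p, hreg.p_le_pbar])) _

/-- The positive part of the divergence of a stream dominates its logarithmic moment. -/
lemma mul_logMoment_le [IsProbabilityMeasure Q] (hreg : D.Regular p pbar) {c₁ c₂ : ℝ}
    (hc₂ : 0 < c₂) (l : Kind × Fin I)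
    (h : ∀ x : ℝ, 0 ≤ x → c₁ + c₂ * x ^ pbar ≤ D.g l.1 l.2 x) :
    ENNReal.ofReal c₂ * q.logMoment Q θ pbar l ≤
      discounted D Q (fun t ω => ENNReal.ofReal (D.g l.1 l.2 (q.streamLog θ l t ω))) +
        ENNReal.ofReal |c₁| * D.discMoment pbar := by
  have hp : 0 < pbar := by linarith [hreg.one_le_p, hreg.p_le_pbar]
  unfold logMoment
  rw [← discounted_const_mul ENNReal.ofReal_ne_top]
  refine (discounted_mono fun t ω => mul_posPart_rpow_le hp hc₂ h _).trans ?_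
  simp only [add_comm _ (ENNReal.ofReal |c₁|)]
  rw [discounted_add hreg.disc_anti.measurable measurable_const, discounted_deterministic, add_comm]
  refine add_le_add_right ?_ _
  simp only [mul_comm _ (ENNReal.ofReal |c₁|)]
  rw [lintegral_const_mul' _ _ ENNReal.ofReal_ne_top]
  exact mul_le_mul_right (lintegral_disc_le hp.le) _

/-- The holding cost is bounded by moments of the queue lengths. -/
lemma holdingCost_le [IsProbabilityMeasure Q] (hreg : D.Regular p pbar) (hq : q.Admissible)
    {c₀ : ℝ} (hc₀ : 0 < c₀) (h : ∀ i, ∀ x : ℝ, 0 ≤ x → D.cost i x ≤ c₀ * (1 + x ^ p)) :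
    q.holdingCost Q ≤ ENNReal.ofReal c₀ * (I * (2 * D.discMoment pbar) +
      ∑ i, discounted D Q fun t ω => ENNReal.ofReal (q.scaledX i t ω ^ pbar)) := by
  have hp : 0 < pbar := by linarith [hreg.one_le_p, hreg.p_le_pbar]
  have hX0 : ∀ i t ω, 0 ≤ q.scaledX i t ω := fun i t ω => by unfold scaledX; positivity
  have hm : ∀ i, Measurable fun x : Ω × ℝ≥0 => ENNReal.ofReal (q.scaledX i x.2 x.1 ^ pbar) :=
    fun i => ((hq.measurable_scaledX i).pow_const pbar).ennreal_ofReal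
  have h1 : ∀ t ω, ENNReal.ofReal (∑ i, D.cost i (q.scaledX i t ω)) ≤
      ENNReal.ofReal c₀ * ∑ i, (2 + ENNReal.ofReal (q.scaledX i t ω ^ pbar)) := fun t ω => by
    have h2 : ∀ i, (2 : ℝ≥0∞) + ENNReal.ofReal (q.scaledX i t ω ^ pbar) =
        ENNReal.ofReal (2 + q.scaledX i t ω ^ pbar) := fun i => by
      rw [ENNReal.ofReal_add (by norm_num) (Real.rpow_nonneg (hX0 i t ω) _), ENNReal.ofReal_ofNat]
    simp only [h2]
    rw [← ENNReal.ofReal_sum_of_nonneg fun i _ => by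
      have := Real.rpow_nonneg (hX0 i t ω) pbar
      positivity, ← ENNReal.ofReal_mul hc₀.le, Finset.mul_sum]
    exact ENNReal.ofReal_le_ofReal (Finset.sum_le_sum fun i _ => hreg.cost_le hc₀ h i (hX0 i t ω))
  have h3 : ∀ s : Finset (Fin I), discounted D Q (fun t ω =>
      ∑ i ∈ s, (2 + ENNReal.ofReal (q.scaledX i t ω ^ pbar))) ≤
      s.card * (2 * D.discMoment pbar) +
        ∑ i ∈ s, discounted D Q fun t ω => ENNReal.ofReal (q.scaledX i t ω ^ pbar) := by
    classical
    intro s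
    induction s using Finset.induction_on with
    | empty => simp [discounted]
    | insert i s hi ih =>
      simp only [Finset.sum_insert hi, Finset.card_insert_of_notMem hi]
      rw [discounted_add hreg.disc_anti.measurable ((hm i).const_add 2),
        discounted_add hreg.disc_anti.measurable measurable_const, discounted_deterministic]
      have h4 : ∫⁻ t, (D.disc t : ℝ≥0∞) * 2 ∂leb ≤ 2 * D.discMoment pbar := by
        simp only [mul_comm _ (2 : ℝ≥0∞)]
        rw [lintegral_const_mul' _ _ (by simp)]
        exact mul_le_mul_right (lintegral_disc_le hp.le) _
      refine (add_le_add (add_le_add_left h4 _) ih).trans_eq ?_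
      push_cast
      ring
  refine (discounted_mono (D := D) (Q := Q) h1).trans ?_
  rw [discounted_const_mul ENNReal.ofReal_ne_top]
  refine mul_le_mul_right ((h3 Finset.univ).trans_eq ?_) _
  rw [Finset.card_univ, Fintype.card_fin]

end moments

/-- A lower bound for the payoffs bounds the logarithmic moments, and hence those of the queue
lengths, uniformly in the scaling parameter. -/
theorem exists_logMoment_bound {I : ℕ} {D : Data I} (hD : D.CriticallyLoaded) {p pbar : ℝ}
    (hreg : D.Regular p pbar) (v : ℝ) :
    ∃ W : ℝ≥0∞, W ≠ ∞ ∧ ∀ {n : ℕ} {Ω : Type*} [MeasurableSpace Ω] {P : Measure Ω}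
      [IsProbabilityMeasure P] {q : Queue D n P} {Q : Measure Ω}
      {ψ : Kind → Fin I → ℝ≥0 → Ω → ℝ}, 1 ≤ n → q.Admissible →
      (q.IsPreemptive ∨ q.IsNonPreemptive) → q.IsMaximizer ψ Q → (v : EReal) ≤ q.payoff ψ Q →
      ∑ l, q.logMoment Q (logRatio D n ψ) pbar l ≤ W ∧
      ∀ i, discounted D Q (fun t ω => ENNReal.ofReal (q.scaledX i t ω ^ pbar)) ≤ W := by
  have hp : 1 ≤ pbar := hreg.one_le_p.trans hreg.p_le_pbar
  obtain ⟨K, hK, -, hbounds⟩ := hD.exists_bounds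
  obtain ⟨c₀, hc₀, hcost⟩ := hreg.cost_growth
  obtain ⟨c₁, c₂, c₃, hc₂, hc₃, hg⟩ := hreg.g_growth
  obtain ⟨K₁, hK₁, hmom⟩ := exists_scaledX_moment_const I hp hK
  -- with this tilt at most half of the divergence is needed to absorb the holding cost
  set a : ℝ := 1 + 2 * I * c₀ * K₁ / c₂ with ha
  have ha1 : 1 ≤ a := by
    have : 0 ≤ 2 * I * c₀ * K₁ / c₂ := by positivity
    linarith
  obtain ⟨K₂, hK₂, hmom⟩ := hmom a (by linarith)
  set κ := D.discMoment pbar with hκ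
  have hκt : κ ≠ ∞ := hreg.discMoment_ne_top
  set G : ℝ := |c₁| + c₃ + c₃ * pbar ^ pbar with hG
  set k : ℝ≥0∞ := ENNReal.ofReal (K₁ / a ^ pbar) with hk
  set R : ℝ≥0∞ := ENNReal.ofReal c₀ * (I * (2 * κ) + I * (ENNReal.ofReal K₂ * κ)) +
    Fintype.card (Kind × Fin I) * (ENNReal.ofReal G * κ) + ENNReal.ofReal |v| +
      Fintype.card (Kind × Fin I) * (ENNReal.ofReal |c₁| * κ) with hR
  have hRt : R ≠ ∞ := by
    have h1 : ∀ x : ℝ, ENNReal.ofReal x * κ ≠ ∞ := fun x =>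
      ENNReal.mul_ne_top ENNReal.ofReal_ne_top hκt
    have h2 : ∀ (m : ℕ) {y : ℝ≥0∞}, y ≠ ∞ → (m : ℝ≥0∞) * y ≠ ∞ := fun m y hy =>
      ENNReal.mul_ne_top (ENNReal.natCast_ne_top m) hy
    refine ENNReal.add_ne_top.2 ⟨ENNReal.add_ne_top.2 ⟨ENNReal.add_ne_top.2 ⟨?_, ?_⟩, ?_⟩, ?_⟩
    · exact ENNReal.mul_ne_top ENNReal.ofReal_ne_top (ENNReal.add_ne_top.2
        ⟨h2 _ (ENNReal.mul_ne_top (by simp) hκt), h2 _ (h1 _)⟩)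
    · exact h2 _ (h1 _)
    · exact ENNReal.ofReal_ne_top
    · exact h2 _ (h1 _)
  set W : ℝ≥0∞ := R / ENNReal.ofReal (c₂ / 2) with hW
  have hWt : W ≠ ∞ := ENNReal.div_ne_top hRt (by simpa using hc₂)
  refine ⟨W + (ENNReal.ofReal K₂ * κ + k * W), ENNReal.add_ne_top.2 ⟨hWt, ENNReal.add_ne_top.2
    ⟨ENNReal.mul_ne_top ENNReal.ofReal_ne_top hκt, ENNReal.mul_ne_top ENNReal.ofReal_ne_top hWt⟩⟩, ?_⟩
  intro n Ω _ P _ q Q ψ hn hq hr hQ hv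
  have hprob := hQ.isProbability
  have hrate := hD.rate_pos n hn
  have T := hQ.tilted hq hr hrate
  obtain ⟨hb1, hb2, hb3⟩ := hbounds n hn
  set Y := fun l => q.logMoment Q (logRatio D n ψ) pbar l with hY
  -- the moment bound at positive times, integrated against the discount function
  have hZ : ∀ i, discounted D Q (fun t ω => ENNReal.ofReal (q.scaledX i t ω ^ pbar)) ≤
      ENNReal.ofReal K₂ * κ + k * ∑ l, Y l := fun i => by
    refine (discounted_le hreg.disc_anti.measurable
      (((hq.measurable_scaledX i).pow_const pbar).ennreal_ofReal)
      (fun l => measurable_posPart_streamLog (pbar := pbar) hq T l)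
      (c := fun t => ENNReal.ofReal (K₂ * (1 + t) ^ pbar)) (k := k) ENNReal.ofReal_ne_top
      fun t ht => hmom hn hq hr (fun j i => ⟨hrate j i, hb1 j i⟩) hb2 hb3 T t ht i).trans ?_
    refine add_le_add_left ?_ _
    simp only [ENNReal.ofReal_mul hK₂, mul_left_comm _ (ENNReal.ofReal K₂)]
    rw [lintegral_const_mul' _ _ ENNReal.ofReal_ne_top]
    exact le_rfl
  -- split every penalty into its positive and its negative part; the latter are finite, so that the
  -- bound on the payoff makes the former finite as well
  set Gp : Kind × Fin I → ℝ≥0∞ := fun l => discounted D Q fun t ω =>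
    ENNReal.ofReal (D.g l.1 l.2 (q.logDensity l.1 l.2 (ψ l.1 l.2) t ω)) with hGp
  set Gm : Kind × Fin I → ℝ≥0∞ := fun l => discounted D Q fun t ω =>
    ENNReal.ofReal (-D.g l.1 l.2 (q.logDensity l.1 l.2 (ψ l.1 l.2) t ω)) with hGm
  have hGmle : ∀ l, Gm l ≤ ENNReal.ofReal G * κ := fun l => by
    rw [hGm]
    simp only [logDensity_eq hrate hQ.pos]
    exact discounted_neg_g_le hreg hq T (C := |c₁| + c₃) (by positivity) (by positivity) l
      (neg_g_le (by linarith) hc₂ hc₃ (hg l.1 l.2).1 (hg l.1 l.2).2)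
  have hGmt : ∀ l, Gm l ≠ ∞ := fun l =>
    ne_top_of_le_ne_top (ENNReal.mul_ne_top ENNReal.ofReal_ne_top hκt) (hGmle l)
  have hYle : ∀ l, ENNReal.ofReal c₂ * Y l ≤ Gp l + ENNReal.ofReal |c₁| * κ := fun l => by
    rw [hGp]
    simp only [logDensity_eq hrate hQ.pos]
    exact mul_logMoment_le hreg hc₂ l (hg l.1 l.2).2
  have hpay : q.payoff ψ Q = (q.holdingCost Q : EReal) -
      (((∑ l, Gp l : ℝ≥0∞) : EReal) - ((∑ l, Gm l : ℝ≥0∞) : EReal)) := by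
    rw [← EReal.sum_sub_coe_ennreal Finset.univ hGmt, sum_streams]
    rfl
  rw [hpay] at hv
  obtain ⟨hGpt, hGple⟩ := EReal.le_of_le_sub_coe_ennreal
    (ENNReal.sum_ne_top.2 fun l _ => hGmt l) hv
  have hsumY : ENNReal.ofReal c₂ * ∑ l, Y l ≤
      ∑ l, Gp l + Fintype.card (Kind × Fin I) * (ENNReal.ofReal |c₁| * κ) := by
    rw [Finset.mul_sum]
    refine (Finset.sum_le_sum fun l _ => hYle l).trans_eq ?_
    rw [Finset.sum_add_distrib, Finset.sum_const, Finset.card_univ, nsmul_eq_mul]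
  have hc₂' : ENNReal.ofReal c₂ ≠ 0 := by simpa using hc₂
  have hYt : ∑ l, Y l ≠ ∞ := fun h => by
    rw [h, ENNReal.mul_top hc₂'] at hsumY
    exact ENNReal.add_ne_top.2 ⟨hGpt, ENNReal.mul_ne_top (ENNReal.natCast_ne_top _)
      (ENNReal.mul_ne_top ENNReal.ofReal_ne_top hκt)⟩ (top_le_iff.1 hsumY)
  have hH : q.holdingCost Q ≤ ENNReal.ofReal c₀ * (I * (2 * κ) + I * (ENNReal.ofReal K₂ * κ)) +
      ENNReal.ofReal c₀ * (I * k) * ∑ l, Y l := by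
    refine (holdingCost_le hreg hq hc₀ hcost).trans ?_
    refine (mul_le_mul_right (add_le_add_right (Finset.sum_le_sum fun i _ => hZ i) _) _).trans_eq ?_
    rw [Finset.sum_const, Finset.card_univ, Fintype.card_fin, nsmul_eq_mul]
    ring
  have hsmall : ENNReal.ofReal c₀ * (I * k) ≤ ENNReal.ofReal (c₂ / 2) := by
    rw [hk, ← ENNReal.ofReal_natCast, ← ENNReal.ofReal_mul (Nat.cast_nonneg _),
      ← ENNReal.ofReal_mul hc₀.le]
    refine ENNReal.ofReal_le_ofReal ?_
    have h1 : a ≤ a ^ pbar := Real.self_le_rpow_of_one_le ha1 hp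
    have h2 : c₀ * (I * (K₁ / a ^ pbar)) = c₀ * I * K₁ / a ^ pbar := by ring
    rw [h2, div_le_iff₀ (by linarith)]
    have h3 : c₂ / 2 * a = c₂ / 2 + I * c₀ * K₁ := by
      rw [ha]
      field_simp
    nlinarith
  have hfin : ENNReal.ofReal (c₂ / 2) * ∑ l, Y l ≤ R := by
    have h1 : ENNReal.ofReal c₂ = ENNReal.ofReal (c₂ / 2) + ENNReal.ofReal (c₂ / 2) := by
      rw [← ENNReal.ofReal_add (by positivity) (by positivity), add_halves]
    have h2 : ENNReal.ofReal (c₂ / 2) * ∑ l, Y l ≠ ∞ := ENNReal.mul_ne_top ENNReal.ofReal_ne_top hYt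
    have h3 : ∑ l, Gm l ≤ Fintype.card (Kind × Fin I) * (ENNReal.ofReal G * κ) := by
      refine (Finset.sum_le_sum fun l _ => hGmle l).trans_eq ?_
      rw [Finset.sum_const, Finset.card_univ, nsmul_eq_mul]
    have h4 : ENNReal.ofReal (c₂ / 2) * ∑ l, Y l + ENNReal.ofReal (c₂ / 2) * ∑ l, Y l ≤
        R + ENNReal.ofReal (c₂ / 2) * ∑ l, Y l := by
      rw [← add_mul, ← h1]
      refine hsumY.trans ((add_le_add_left (hGple.trans (add_le_add_left (add_le_add
        (hH.trans (add_le_add_right (mul_le_mul_left hsmall _) _)) h3) _)) _).trans_eq ?_)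
      rw [hR]
      ring
    exact (ENNReal.add_le_add_iff_right h2).1 h4
  have hYW : ∑ l, Y l ≤ W := by
    rw [hW, ENNReal.le_div_iff_mul_le (Or.inl (by simpa using hc₂)) (Or.inl ENNReal.ofReal_ne_top),
      mul_comm]
    exact hfin
  refine ⟨hYW.trans le_self_add, fun i => (hZ i).trans (le_trans ?_ le_add_self)⟩
  gcongr

end Queue

/-! ### Moments of the integrated perturbations -/

namespace Queue

variable {I : ℕ} {D : Data I} {n : ℕ} {Ω : Type*} [mΩ : MeasurableSpace Ω] {P : Measure Ω}
  {q : Queue D n P} {Q : Measure Ω} {ψ : Kind → Fin I → ℝ≥0 → Ω → ℝ}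

lemma IsMaximizer.measurable_integratedEntropy [IsProbabilityMeasure P] (hD : D.CriticallyLoaded)
    (hn : 1 ≤ n) (hq : q.Admissible) (hr : q.IsPreemptive ∨ q.IsNonPreemptive)
    (hQ : q.IsMaximizer ψ Q) (pbar : ℝ) (l : Kind × Fin I) :
    Measurable fun x : Ω × ℝ≥0 => q.integratedEntropy l.1 l.2 (ψ l.1 l.2) x.2 x.1 ^ pbar := by
  have hrate := hD.rate_pos n hn
  simp only [integratedEntropy_eq hD.base_pos hn hrate hQ.pos]
  exact (measurable_entropy hq (hQ.tilted hq hr hrate) l).pow_const pbar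

/-- The moment bound for the integrated entropy at fixed times, integrated against the discount
function. -/
lemma IsMaximizer.discounted_entropy_le [IsProbabilityMeasure P] (hD : D.CriticallyLoaded)
    {p pbar : ℝ} (hreg : D.Regular p pbar) (hn : 1 ≤ n) (hq : q.Admissible)
    (hr : q.IsPreemptive ∨ q.IsNonPreemptive) (hQ : q.IsMaximizer ψ Q) {C : ℝ≥0}
    (l : Kind × Fin I)
    (hC : ∀ t : ℝ≥0, 0 < t → ∫⁻ ω, (∫⁻ s in Set.Ioc 0 t, ENNReal.ofReal (D.rate n l.1 l.2 *
          entropyFun (logRatio D n ψ l s ω) * q.speed l s ω) ∂leb) ^ pbar ∂Q ≤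
        C * (1 + ∫⁻ ω, ENNReal.ofReal (max (q.streamLog (logRatio D n ψ) l t ω) 0 ^ pbar) ∂Q)) :
    discounted D Q (fun t ω => q.integratedEntropy l.1 l.2 (ψ l.1 l.2) t ω ^ pbar) ≤
      C * (D.discMoment pbar + q.logMoment Q (logRatio D n ψ) pbar l) := by
  have hprob := hQ.isProbability
  have hrate := hD.rate_pos n hn
  have hp : 0 ≤ pbar := by linarith [hreg.one_le_p, hreg.p_le_pbar]
  have h1 := discounted_le (L := Unit) (D := D) (Q := Q)
    (f := fun t ω => q.integratedEntropy l.1 l.2 (ψ l.1 l.2) t ω ^ pbar)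
    (h := fun _ t ω => ENNReal.ofReal (max (q.streamLog (logRatio D n ψ) l t ω) 0 ^ pbar))
    hreg.disc_anti.measurable (hQ.measurable_integratedEntropy hD hn hq hr pbar l)
    (fun _ => measurable_posPart_streamLog hq (hQ.tilted hq hr hrate) l)
    (c := fun _ => C) (k := C) ENNReal.coe_ne_top (fun t ht => by
      simp only [integratedEntropy_eq hD.base_pos hn hrate hQ.pos]
      refine (hC t ht).trans_eq ?_
      rw [Finset.univ_unique, Finset.sum_singleton, mul_add, mul_one])
  refine h1.trans ?_
  rw [Finset.univ_unique, Finset.sum_singleton, mul_add]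
  refine add_le_add_left ?_ _
  simp only [mul_comm _ (C : ℝ≥0∞)]
  rw [lintegral_const_mul' _ _ ENNReal.coe_ne_top]
  exact mul_le_mul_right (lintegral_disc_le hp) _

/-- The integrated perturbation of a stream, in terms of its integrated entropy. -/
lemma enorm_integratedPsi_rpow_le {pbar : ℝ} (hp : 1 ≤ pbar) (hD : D.CriticallyLoaded) (hn : 1 ≤ n)
    (hq : q.Admissible) (hψ : ∀ j i t ω, 0 < ψ j i t ω) {K : ℝ} (hK : 1 ≤ K)
    (hb : ∀ j i, 1 ≤ K * D.base j i) (hrate : ∀ j i, (D.rate n j i : ℝ) ≤ K * n)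
    (l : Kind × Fin I) (t : ℝ≥0) (ω : Ω) :
    ‖q.integratedPsi l.1 l.2 (ψ l.1 l.2) t ω‖ₑ ^ pbar ≤
      2 ^ (pbar - 1) * ENNReal.ofReal K ^ pbar *
          q.integratedEntropy l.1 l.2 (ψ l.1 l.2) t ω ^ pbar +
        2 ^ (pbar - 1) * ENNReal.ofReal (K ^ 2 * Real.exp 1) ^ pbar *
          ENNReal.ofReal ((1 + (t : ℝ)) ^ pbar) := by
  have hp0 : 0 ≤ pbar := by linarith
  have h1 := enorm_integratedPsi_le hn hq hK (fun j i => ⟨hD.base_pos j i, hb j i⟩)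
    (fun j i => ⟨hD.rate_pos n hn j i, hrate j i⟩) hψ l t ω
  refine (ENNReal.rpow_le_rpow h1 hp0).trans ((ENNReal.rpow_add_le_mul_rpow_add_rpow _ _ hp).trans ?_)
  rw [ENNReal.mul_rpow_of_nonneg _ _ hp0, ENNReal.mul_rpow_of_nonneg _ _ hp0, mul_add, mul_assoc,
    mul_assoc]
  gcongr
  rw [← ENNReal.ofReal_rpow_of_nonneg (by positivity) hp0]
  refine ENNReal.rpow_le_rpow ?_ hp0
  rw [← ENNReal.ofReal_coe_nnreal]
  exact ENNReal.ofReal_le_ofReal (by linarith)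

/-- The discounted moments of the integrated perturbations of a class are controlled by those of its
integrated entropies. -/
lemma IsMaximizer.discounted_psi_le [IsProbabilityMeasure P] (hD : D.CriticallyLoaded)
    {p pbar : ℝ} (hreg : D.Regular p pbar) (hn : 1 ≤ n) (hq : q.Admissible)
    (hr : q.IsPreemptive ∨ q.IsNonPreemptive) (hQ : q.IsMaximizer ψ Q) {K : ℝ} (hK : 1 ≤ K)
    (hb : ∀ j i, 1 ≤ K * D.base j i) (hrate : ∀ j i, (D.rate n j i : ℝ) ≤ K * n) (i : Fin I) :
    discounted D Q (fun t ω => ‖q.integratedPsi Kind.A i (ψ Kind.A i) t ω‖ₑ ^ pbar +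
        ‖q.integratedPsi Kind.S i (ψ Kind.S i) t ω‖ₑ ^ pbar) ≤
      2 ^ (pbar - 1) * ENNReal.ofReal K ^ pbar *
        (discounted D Q (fun t ω => q.integratedEntropy Kind.A i (ψ Kind.A i) t ω ^ pbar) +
          discounted D Q (fun t ω => q.integratedEntropy Kind.S i (ψ Kind.S i) t ω ^ pbar)) +
      2 * (2 ^ (pbar - 1) * ENNReal.ofReal (K ^ 2 * Real.exp 1) ^ pbar) * D.discMoment pbar := by
  have hprob := hQ.isProbability
  have hp : 1 ≤ pbar := hreg.one_le_p.trans hreg.p_le_pbar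
  have hd := hreg.disc_anti.measurable
  set C₁ : ℝ≥0∞ := 2 ^ (pbar - 1) * ENNReal.ofReal K ^ pbar with hC₁
  set C₂ : ℝ≥0∞ := 2 ^ (pbar - 1) * ENNReal.ofReal (K ^ 2 * Real.exp 1) ^ pbar with hC₂
  have hC : ∀ x : ℝ, (2 : ℝ≥0∞) ^ (pbar - 1) * ENNReal.ofReal x ^ pbar ≠ ∞ := fun x =>
    ENNReal.mul_ne_top (ENNReal.rpow_ne_top_of_nonneg (by linarith) (by simp))
      (ENNReal.rpow_ne_top_of_nonneg (by linarith) ENNReal.ofReal_ne_top)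
  have hm := hQ.measurable_integratedEntropy hD hn hq hr pbar
  have hpt := enorm_integratedPsi_rpow_le hp hD hn hq hQ.pos hK hb hrate
  calc _ ≤ discounted D Q (fun t ω =>
        C₁ * (q.integratedEntropy Kind.A i (ψ Kind.A i) t ω ^ pbar +
          q.integratedEntropy Kind.S i (ψ Kind.S i) t ω ^ pbar) +
        2 * C₂ * ENNReal.ofReal ((1 + (t : ℝ)) ^ pbar)) := discounted_mono fun t ω => by
        refine (add_le_add (hpt (Kind.A, i) t ω) (hpt (Kind.S, i) t ω)).trans_eq ?_
        rw [← hC₁, ← hC₂]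
        ring
    _ = _ := by
        rw [discounted_add hd (((hm (Kind.A, i)).add (hm (Kind.S, i))).const_mul C₁),
          discounted_const_mul (hC K), discounted_add hd (hm (Kind.A, i)),
          discounted_deterministic]
        simp only [mul_left_comm _ (2 * C₂)]
        rw [lintegral_const_mul' _ _ (ENNReal.mul_ne_top (by simp) (hC _))]
        rfl

end Queue

end RobustQueue

end

theorem proposition4p2 {I : ℕ} (D : RobustQueue.Data I) (hD : D.CriticallyLoaded)
    (p pbar : ℝ) (hreg : D.Regular p pbar)
    {Ω : ℕ → Type*} [∀ n, MeasurableSpace (Ω n)]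
    (P : ∀ n, Measure (Ω n)) [∀ n, IsProbabilityMeasure (P n)]
    (q : ∀ n, RobustQueue.Queue D n (P n))
    (hadm : ∀ n, 1 ≤ n → (q n).Admissible)
    (hrule : ∀ n, 1 ≤ n → (q n).IsPreemptive ∨ (q n).IsNonPreemptive)
    (ψ : ∀ n, RobustQueue.Kind → Fin I → ℝ≥0 → Ω n → ℝ)
    (Q : ∀ n, Measure (Ω n))
    (hQ : ∀ n, 1 ≤ n → (q n).IsMaximizer (ψ n) (Q n))
    (v : ℝ) (hv : ∀ n, 1 ≤ n → (v : EReal) ≤ (q n).payoff (ψ n) (Q n)) :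
    ∃ M : ℝ, 0 < M ∧ ∀ n, 1 ≤ n → ∀ i : Fin I,
      (∫⁻ ω, ∫⁻ t, (D.disc t : ℝ≥0∞) *
          (‖(q n).integratedPsi RobustQueue.Kind.A i (ψ n RobustQueue.Kind.A i) t ω‖ₑ ^ pbar +
            ‖(q n).integratedPsi RobustQueue.Kind.S i (ψ n RobustQueue.Kind.S i) t ω‖ₑ ^ pbar)
          ∂(RobustQueue.leb) ∂(Q n) ≤ ENNReal.ofReal M) ∧
      (∫⁻ ω, ∫⁻ t, (D.disc t : ℝ≥0∞) *
          ((q n).integratedEntropy RobustQueue.Kind.A i (ψ n RobustQueue.Kind.A i) t ω ^ pbar +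
            (q n).integratedEntropy RobustQueue.Kind.S i (ψ n RobustQueue.Kind.S i) t ω ^ pbar)
          ∂(RobustQueue.leb) ∂(Q n) ≤ ENNReal.ofReal M) ∧
      (∫⁻ ω, ∫⁻ t, (D.disc t : ℝ≥0∞) *
          ENNReal.ofReal ((q n).scaledX i t ω ^ pbar) ∂(RobustQueue.leb) ∂(Q n) ≤ ENNReal.ofReal M) := by
  obtain ⟨K, hK, hbase, hbounds⟩ := hD.exists_bounds
  obtain ⟨W, hW, hmom⟩ := RobustQueue.Queue.exists_logMoment_bound hD hreg v
  have hp : 1 ≤ pbar := hreg.one_le_p.trans hreg.p_le_pbar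
  obtain ⟨C, hC⟩ := RobustQueue.Tilted.exists_entropy_const hp
  have hκ := hreg.discMoment_ne_top
  set κ := D.discMoment pbar with hκdef
  set E : ℝ≥0∞ := C * (κ + W) + C * (κ + W) with hE
  set B : ℝ≥0∞ := 2 ^ (pbar - 1) * ENNReal.ofReal K ^ pbar * E +
    2 * (2 ^ (pbar - 1) * ENNReal.ofReal (K ^ 2 * Real.exp 1) ^ pbar) * κ with hB
  have hEt : E ≠ ∞ := ENNReal.add_ne_top.2
    ⟨ENNReal.mul_ne_top ENNReal.coe_ne_top (ENNReal.add_ne_top.2 ⟨hκ, hW⟩),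
      ENNReal.mul_ne_top ENNReal.coe_ne_top (ENNReal.add_ne_top.2 ⟨hκ, hW⟩)⟩
  have hpow : ∀ x : ℝ, (2 : ℝ≥0∞) ^ (pbar - 1) * ENNReal.ofReal x ^ pbar ≠ ∞ := fun x =>
    ENNReal.mul_ne_top (ENNReal.rpow_ne_top_of_nonneg (by linarith) (by simp))
      (ENNReal.rpow_ne_top_of_nonneg (by linarith) ENNReal.ofReal_ne_top)
  have hBt : B ≠ ∞ := ENNReal.add_ne_top.2 ⟨ENNReal.mul_ne_top (hpow K) hEt,
    ENNReal.mul_ne_top (ENNReal.mul_ne_top (by simp) (hpow _)) hκ⟩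
  have hle : ∀ {x : ℝ≥0∞}, x ≤ B + E + W → x ≤ ENNReal.ofReal ((B + E + W).toReal + 1) :=
    fun {x} hx => hx.trans ((ENNReal.le_ofReal_iff_toReal_le
      (ENNReal.add_ne_top.2 ⟨ENNReal.add_ne_top.2 ⟨hBt, hEt⟩, hW⟩) (by positivity)).2 (by linarith))
  refine ⟨(B + E + W).toReal + 1, by positivity, fun n hn i => ?_⟩
  have hq := hadm n hn
  have hr := hrule n hn
  have hM := hQ n hn
  obtain ⟨h1, h2⟩ := hmom hn hq hr hM (hv n hn)
  have hent : ∀ l : RobustQueue.Kind × Fin I, RobustQueue.discounted D (Q n)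
      (fun t ω => (q n).integratedEntropy l.1 l.2 (ψ n l.1 l.2) t ω ^ pbar) ≤ C * (κ + W) :=
    fun l => (hM.discounted_entropy_le hD hreg hn hq hr l fun t ht =>
      hC (hM.tilted hq hr (hD.rate_pos n hn)) t ht l).trans (mul_le_mul_right (add_le_add_right
        ((Finset.single_le_sum (fun _ _ => zero_le) (Finset.mem_univ l)).trans h1) _) _)
  refine ⟨hle ?_, hle ?_, hle ((h2 i).trans le_add_self)⟩
  · refine (hM.discounted_psi_le hD hreg hn hq hr hK (fun j i => (hbase j i).2)
      (fun j i => ((hbounds n hn).1 j i).1) i).trans (le_trans ?_ (le_self_add.trans le_self_add))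
    exact add_le_add_left (mul_le_mul_right
      (add_le_add (hent (RobustQueue.Kind.A, i)) (hent (RobustQueue.Kind.S, i))) _) _
  · refine le_trans ?_ (le_add_self.trans le_self_add)
    refine (RobustQueue.discounted_add hreg.disc_anti.measurable
      (hM.measurable_integratedEntropy hD hn hq hr pbar (RobustQueue.Kind.A, i))).trans_le ?_
    exact add_le_add (hent (RobustQueue.Kind.A, i)) (hent (RobustQueue.Kind.S, i))
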